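/- **Notation.** Let $\tau\in\mathbb H$, $q^s=e^{2\pi i s\tau}$, $y_x^s=e^{2\pi i s x}$, $\tau_2=\operatorname{Im}\tau$, let $\eta$ be the Dedekind eta function, and for an integer $k\ge 2$ put $$\theta_{11}(\tau;z)=\sum_{n\in\mathbb Z}q^{(n+1/2)^2/2}e^{2\pi i(z+1/2)(n+1/2)},\quad \vartheta_{k,r}(\tau;z)=\sum_{n\equiv r\,(2k)}q^{n^2/4k}y_z^{n},\quad S_{k,r}(\tau)=\sum_{n\equiv r\,(2k)}n\,q^{n^2/4k}.$$ Let $\chi^{(k-2)}_{l}(\tau;z)$ be the affine $SU(2)$ character, i.e. the entire function of $z$ equal to $\dfrac{\vartheta_{k,l+1}(\tau;z/2)-\vartheta_{k,-l-1}(\tau;z/2)}{\vartheta_{2,1}(\tau;z/2)-\vartheta_{2,-1}(\tau;z/2)}$. For $k\ge3$ let the string functions $c^{(k-2)}_{l,r}(\tau)$ be the coefficients in $\chi^{(k-2)}_l(\tau;z)=\sum_{r\in\mathbb Z_{2(k-2)}}c^{(k-2)}_{l,r}(\tau)\,\vartheta_{k-2,r}(\tau;z/2)$, and let $$\chi^{l,s,k}_r(\tau;z)=\sum_{n\in\mathbb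 Z_{k-2}}c^{(k-2)}_{l,r-s+4n}(\tau)\,\vartheta_{2k(k-2),\,2r+k(4n-s)}(\tau;z/2k);$$ for $k=2$ and $l=0$ let $\chi^{0,s,2}_r=1$ if $r\equiv s \pmod 4$ and $0$ otherwise. Put $C^{l,k}_r(\tau;z)=i\big(\chi^{l,1,k}_r(\tau;z)-\chi^{l,3,k}_r(\tau;z)\big)$ and, for $u,v\notin\mathbb Z\tau+\mathbb Z$, $$\mu^{k,j,j'}(\tau;v,u,w)=\frac{y_v^{j'/k}}{\theta_{11}(\tau;u)}\sum_{n\in\mathbb Z}\frac{q^{n^2/k}q^{j'n/k}}{1-y_vq^n}\,e^{2\pi i n(u+(1-2/k)(w-v))}\,C^{j-1,k}_{2n+j'}(\tau;w-v).$$ With $E(x)=2\int_0^xe^{-\pi t^2}dt$ let $$R_{k,r}(\tau;u)=\sum_{n\equiv r\,(2k)}\Big[\operatorname{sgn}(n+\tfrac12)-E\big((n+2k\tfrac{\operatorname{Im}u}{\tau_2})\sqrt{\tau_2/k}\big)\Big]e^{-\pi i n^2\tau/2k-2\pi i n u},$$ $\widehat R_{k,r}(\tau;u)=R_{k,r}(\tau;u/2)-R_{k,-r}(\tau;u/2)$,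 and, with $x=u-v+w$, $x'=u-v+w(1-2/k)$ and $\delta=1$ if $j\equiv j' \pmod 2$, $\delta=0$ otherwise, $$\tilde\mu^{k,j,j'}(\tau;v,u,w)=\tfrac12\big(\mu^{k,j,j'}+\mu^{k,k-j,k-j'}\big)(\tau;v,u,w)-\tfrac{\delta}{4}\big[\chi^{(k-2)}_{j-1}(\tau;x)\widehat R_{k,j'}(\tau;x')+\chi^{(k-2)}_{k-j-1}(\tau;x)\widehat R_{k,k-j'}(\tau;x')\big].$$ For $d\mid k$ and $r,r'\in\mathbb Z_{2k}$ let $\Omega^{(k,d)}_{r,r'}=1$ if $r+r'\equiv0\pmod{2d}$ and $r-r'\equiv0\pmod{2k/d}$, and $0$ otherwise. For an ADE root system $Y$ with Coxeter number $k$ let $\Omega^Y$ be $\Omega^{(k,1)}$ for $A_{k-1}$ ($k\ge2$); $\Omega^{(k,1)}+\Omega^{(k,k/2)}$ for $D_{k/2+1}$ ($k\ge6$ even); $\Omega^{(12,1)}+\Omega^{(12,4)}+\Omega^{(12,6)}$ for $E_6$; $\Omega^{(18,1)}+\Omega^{(18,6)}+\Omega^{(18,9)}$ for $E_7$; $\Omega^{(30,1)}+\Omega^{(30,6)}+\Omega^{(30,10)}+\Omega^{(30,15)}$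 for $E_8$. Put $\widehat\Omega^Y_{r,r'}=\Omega^Y_{r,r'}-\Omega^Y_{r,-r'}$, $\mu^Y=\sum_{j,j'=1}^{k-1}\widehat\Omega^Y_{j,j'}\mu^{k,j,j'}$ and $\tilde\mu^Y=\sum_{j,j'=1}^{k-1}\widehat\Omega^Y_{j,j'}\tilde\mu^{k,j,j'}$. For $g$ of weight $2-\kappa$ let $g^*(\tau)=\left(\frac{i}{2\pi}\right)^{\kappa-1}\int_{-\bar\tau}^{i\infty}(z+\tau)^{-\kappa}\,\overline{g(-\bar z)}\,dz$ be the non-holomorphic Eichler integral, normalised by $(4\pi\tau_2)^{\kappa}\,\partial_{\bar\tau}g^*=-2\pi i\,\overline{g}$; write $S^*_{k,r}$ for that of $S_{k,r}$ (with $\kappa=1/2$). **Statement.** Let $Y$ be an ADE root system with Coxeter number $k$. For $\tau\in\mathbb H$ and $z\in\mathbb C\setminus(\mathbb Z\tau+\mathbb Z)$, $$\tilde\mu^Y(\tau;z,z,0)=\mu^Y(\tau;z,z,0)-\frac{1}{\eta(\tau)^3\sqrt{4\pi k}}\sum_{j,j'=1}^{k-1}\widehat\Omega^Y_{j,j'}S_{k,j}(\tau)S^*_{k,j'}(\tau)=\mu^Y(\tau;z,z,0)-\frac{1}{\eta(\tau)^3\sqrt{16\pi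 k}}\sum_{j,j'\in\mathbb Z_{2k}}\Omega^Y_{j,j'}S_{k,j}(\tau)S^*_{k,j'}(\tau),$$ and (a) $\tilde\mu^Y(\tau+1;z,z,0)=e^{-\pi i/4}\,\tilde\mu^Y(\tau;z,z,0)$; (b) $\tilde\mu^Y(-\frac1\tau;\frac z\tau,\frac z\tau,0)=-\sqrt{-i\tau}\;\tilde\mu^Y(\tau;z,z,0)$; (c) $\eta(\tau+1)^3\,\tilde\mu^Y(\tau+1;z,z,0)=\eta(\tau)^3\,\tilde\mu^Y(\tau;z,z,0)$; (d) $\eta(-\frac1\tau)^3\,\tilde\mu^Y(-\frac1\tau;\frac z\tau,\frac z\tau,0)=\tau^2\,\eta(\tau)^3\,\tilde\mu^Y(\tau;z,z,0)$. Moreover $\eta(\tau)^3\mu^Y(\tau;z,z,0)$ is holomorphic in $(\tau,z)$ for $\tau\in\mathbb H$, $z\notin\mathbb Z\tau+\mathbb Z$, and its completion has the shadow $-(16\pi k)^{-1/2}\sum_{r,r'\in\mathbb Z_{2k}}\Omega^Y_{r,r'}S_{k,r}\overline{S_{k,r'}}$: for such $(\tau,z)$, $$(4\pi\tau_2)^{1/2}\,\frac{\partial}{\partial\bar\tau}\Big(\eta(\tau)^3\tilde\mu^Y(\tau;z,z,0)\Big)=-2\pi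 i\cdot\Big(-\frac{1}{\sqrt{16\pi k}}\Big)\sum_{r,r'\in\mathbb Z_{2k}}\Omega^Y_{r,r'}\,S_{k,r}(\tau)\,\overline{S_{k,r'}(\tau)} .$$ Finally, for all integers $N\ge1$ and $a,b$ not both divisible by $N$, the function $h(\tau)=\eta(\tau)^3\mu^Y(\tau;z,z,0)$ with $z=\frac{a\tau+b}{N}$ is a mixed mock modular form of weight $2$ on $\Gamma(N)$ with this shadow. That is: $h$ is holomorphic on $\mathbb H$ and of polynomial growth at the cusps; $(f_r)=(S_{k,r})_{r\in\mathbb Z_{2k}}$ and $(g_r)=\big(-(16\pi k)^{-1/2}\sum_{r'}\Omega^Y_{r,r'}S_{k,r'}\big)_{r\in\mathbb Z_{2k}}$ are vector-valued holomorphic modular forms of weight $3/2$ on $\Gamma(N)$ (of polynomial growth at the cusps, each $\gamma=\begin{pmatrix}\alpha&\beta\\ c&d\end{pmatrix}\in\Gamma(N)$ acting by the principal branch of $(c\tau+d)^{3/2}$ and a constant invertible matrix); and $\hat h=h+\sum_r f_r\,g_r^*$ satisfies $\hat h(\gamma\tau)=(c\tau+d)^2\,\hat h(\tau)$ for all $\gamma\in\Gamma(N)$.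 -/

import Mathlib

open Complex Filter Topology MeasureTheory
open scoped Real ComplexConjugate MatrixGroups

noncomputable section

namespace ADEAppell

/-! Throughout, `τ` is a complex number that is meant to lie in the upper half plane,
`q = exp (2πiτ)` and `y_x = exp (2πix)`; fractional powers of `q` and `y_x` are
`q ^ s = exp (2πi s τ)` and `y_x ^ s = exp (2πi s x)`. -/

/-! ### Theta functions -/

/-- The Jacobi theta function with odd characteristic,
`θ₁₁(τ; z) = ∑ₙ q ^ ((n + 1/2)² / 2) * exp (2πi (z + 1/2) (n + 1/2))`. -/
def theta11 (τ z : ℂ) : ℂ :=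
  ∑' n : ℤ, exp (π * I * ((n : ℂ) + 1 / 2) ^ 2 * τ
    + 2 * π * I * (z + 1 / 2) * ((n : ℂ) + 1 / 2))

/-- The Jacobi theta function of level `k`,
`ϑ_{k,r}(τ; z) = ∑ q ^ (m² / 4k) * y ^ m` over the integers `m = 2kn + r`. -/
def levelTheta (k : ℕ) (r : ℤ) (τ z : ℂ) : ℂ :=
  ∑' n : ℤ, exp (2 * π * I * (((2 * k * n + r : ℤ) : ℂ) ^ 2 / (4 * k)) * τ
    + 2 * π * I * ((2 * k * n + r : ℤ) : ℂ) * z)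

/-- The unary theta function of weight `3/2`,
`S_{k,r}(τ) = ∑ₙ (2kn + r) q ^ ((2kn + r)² / 4k)`. -/
def unaryTheta (k : ℕ) (r : ℤ) (τ : ℂ) : ℂ :=
  ∑' n : ℤ, ((2 * k * n + r : ℤ) : ℂ) *
    exp (2 * π * I * (((2 * k * n + r : ℤ) : ℂ) ^ 2 / (4 * k)) * τ)

/-! ### Characters -/

/-- The affine `SU(2)` character `χ_l^{(k-2)}(τ; z)` of level `k - 2`, as an entire function of `z`:
the quotient `(ϑ_{k,l+1} - ϑ_{k,-l-1}) / (ϑ_{2,1} - ϑ_{2,-1})` at `(τ; z/2)`, with its removable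
singularities (at the points of `ℤτ + ℤ`) filled in by the limit. -/
def affineChar (k : ℕ) (l : ℤ) (τ z : ℂ) : ℂ :=
  limUnder (𝓝[≠] z) fun x : ℂ =>
    (levelTheta k (l + 1) τ (x / 2) - levelTheta k (-(l + 1)) τ (x / 2)) /
      (levelTheta 2 1 τ (x / 2) - levelTheta 2 (-1) τ (x / 2))

/-- The string function `c_{l,r}^{(k-2)}(τ)` of level `k - 2 ≥ 1`: the coefficient of
`ϑ_{k-2,r}(τ; z/2)` in the theta decomposition
`χ_l^{(k-2)}(τ; z) = ∑_{r mod 2(k-2)} c_{l,r}^{(k-2)}(τ) ϑ_{k-2,r}(τ; z/2)`, that is,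
`q ^ (- r² / 4(k-2))` times the coefficient of `exp (πirz)` in the Fourier expansion of
the character, which is `2`-periodic in `z`. -/
def stringFn (k : ℕ) (l r : ℤ) (τ : ℂ) : ℂ :=
  exp (-(2 * π * I * ((r : ℂ) ^ 2 / (4 * ((k : ℂ) - 2))) * τ)) *
    ((1 / 2) * ∫ x in (0 : ℝ)..2, affineChar k l τ x * exp (-(π * I * r * x)))

/-- The functions `χ_r^{l,s,k}(τ; z)` of the supersymmetric coset `SU(2)_k / U(1)`,
`∑_{n mod k-2} c_{l,r-s+4n}^{(k-2)}(τ) ϑ_{2k(k-2),2r+k(4n-s)}(τ; z/2k)` for `k ≥ 3`.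
At `k = 2` the character `χ_l^{(0)}` is constant in `z` (equal to `1` for `l = 0`) and the
branching relation makes `χ_r^{l,s,2}` equal to that constant for `r = s` modulo `4`
and to `0` otherwise. -/
def cosetFn (k : ℕ) (l s r : ℤ) (τ z : ℂ) : ℂ :=
  if k = 2 then
    if (4 : ℤ) ∣ r - s then affineChar 2 l τ 0 else 0
  else
    ∑ n ∈ Finset.range (k - 2),
      stringFn k l (r - s + 4 * n) τ *
        levelTheta (2 * k * (k - 2)) (2 * r + k * (4 * n - s)) τ (z / (2 * k))

/-- The supersymmetric characters `C_r^{l,k}[a; b](τ; z)` of `SU(2)_k / U(1)`. -/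
def cosetChar (k : ℕ) (a b : ℕ) (l r : ℤ) (τ z : ℂ) : ℂ :=
  exp (π * I * a * b / 2) *
    (cosetFn k l a r τ z + (-1) ^ b * cosetFn k l (a + 2) r τ z)

/-! ### Appell-Lerch sums -/

/-- The Appell-Lerch sum `μ^{k,j,j'}(τ; v, u, w)`. -/
def mu (k : ℕ) (j j' : ℤ) (τ v u w : ℂ) : ℂ :=
  exp (2 * π * I * v * (j' / k)) / theta11 τ u *
    ∑' n : ℤ,
      exp (2 * π * I * (((n : ℂ) ^ 2 + j' * n) / k) * τ) / (1 - exp (2 * π * I * (v + n * τ))) *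
        exp (2 * π * I * n * (u + (1 - 2 / (k : ℂ)) * (w - v))) *
        cosetChar k 1 1 (j - 1) (2 * n + j') τ (w - v)

/-- The error function `E(x) = 2 ∫₀ˣ exp (-πt²) dt`. -/
def errorE (x : ℝ) : ℝ := 2 * ∫ t in (0 : ℝ)..x, Real.exp (-π * t ^ 2)

/-- Zwegers' function `R_{k,r}(τ; u)`, a sum over the integers `n` congruent to `r`
modulo `2k` (here written `n = 2km + r`). -/
def zwegersR (k : ℕ) (r : ℤ) (τ u : ℂ) : ℂ :=
  ∑' m : ℤ,
    ((Real.sign (((2 * k * m + r : ℤ) : ℝ) + 1 / 2) -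
        errorE ((((2 * k * m + r : ℤ) : ℝ) + 2 * k * u.im / τ.im) * √(τ.im / k)) : ℝ) : ℂ) *
      exp (-(π * I * ((2 * k * m + r : ℤ) : ℂ) ^ 2 * τ / (2 * k))
        - 2 * π * I * ((2 * k * m + r : ℤ) : ℂ) * u)

/-- The function `R̂_{k,r}(τ; u) = R_{k,r}(τ; u/2) - R_{k,-r}(τ; u/2)`. -/
def zwegersRHat (k : ℕ) (r : ℤ) (τ u : ℂ) : ℂ :=
  zwegersR k r τ (u / 2) - zwegersR k (-r) τ (u / 2)

/-- The completed Appell-Lerch sum `μ̃^{k,j,j'}(τ; v, u, w)`. -/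
def muTilde (k : ℕ) (j j' : ℤ) (τ v u w : ℂ) : ℂ :=
  (1 / 2) * (mu k j j' τ v u w + mu k (k - j) (k - j') τ v u w) -
    (1 / 4) * (if (2 : ℤ) ∣ j - j' then 1 else 0) *
      (affineChar k (j - 1) τ (u - v + w) *
          zwegersRHat k j' τ (u - v + w * (1 - 2 / (k : ℂ))) +
        affineChar k (k - j - 1) τ (u - v + w) *
          zwegersRHat k (k - j') τ (u - v + w * (1 - 2 / (k : ℂ))))

/-! ### ADE root systems and their invariant matrices -/

/-- The ADE (irreducible simply laced) root systems. -/
inductive ADE : Type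
  | A (n : ℕ) (hn : 1 ≤ n) : ADE
  | D (n : ℕ) (hn : 4 ≤ n) : ADE
  | E6 : ADE
  | E7 : ADE
  | E8 : ADE

/-- The matrix `Ω^{(k,d)}`, for a divisor `d` of `k`. Its index set is `ℤ/2k`; the entries are
written as a function of representatives in `ℤ`, on whose classes modulo `2k` they depend. -/
def omegaDiv (k d : ℕ) (r r' : ℤ) : ℂ :=
  if ((2 * d : ℕ) : ℤ) ∣ r + r' ∧ ((2 * k / d : ℕ) : ℤ) ∣ r - r' then 1 else 0

/-- The Coxeter number. -/
def ADE.coxeter : ADE → ℕ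
  | .A n _ => n + 1
  | .D n _ => 2 * (n - 1)
  | .E6 => 12
  | .E7 => 18
  | .E8 => 30

/-- The matrix `Ω^Y`. -/
def ADE.omega : ADE → ℤ → ℤ → ℂ
  | .A n _, r, r' => omegaDiv (n + 1) 1 r r'
  | .D n _, r, r' => omegaDiv (2 * (n - 1)) 1 r r' + omegaDiv (2 * (n - 1)) (n - 1) r r'
  | .E6, r, r' => omegaDiv 12 1 r r' + omegaDiv 12 4 r r' + omegaDiv 12 6 r r'
  | .E7, r, r' => omegaDiv 18 1 r r' + omegaDiv 18 6 r r' + omegaDiv 18 9 r r'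
  | .E8, r, r' =>
      omegaDiv 30 1 r r' + omegaDiv 30 6 r r' + omegaDiv 30 10 r r' + omegaDiv 30 15 r r'

/-- The matrix `Ω̂^Y`, with entries `Ω^Y_{r,r'} - Ω^Y_{r,-r'}`. -/
def ADE.omegaHat (Y : ADE) (r r' : ℤ) : ℂ := Y.omega r r' - Y.omega r (-r')

/-- The function `μ^Y(τ; v, u, w)`. -/
def muADE (Y : ADE) (τ v u w : ℂ) : ℂ :=
  ∑ j ∈ Finset.Icc 1 (Y.coxeter - 1), ∑ j' ∈ Finset.Icc 1 (Y.coxeter - 1),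
    Y.omegaHat j j' * mu Y.coxeter j j' τ v u w

/-- The completion `μ̃^Y(τ; v, u, w)`. -/
def muADETilde (Y : ADE) (τ v u w : ℂ) : ℂ :=
  ∑ j ∈ Finset.Icc 1 (Y.coxeter - 1), ∑ j' ∈ Finset.Icc 1 (Y.coxeter - 1),
    Y.omegaHat j j' * muTilde Y.coxeter j j' τ v u w

/-! ### Eichler integrals and mixed mock modular forms -/

/-- The non-holomorphic Eichler integral `g^*` of `g` that completes mock modular forms of weight
`κ` (so that `g` has weight `2 - κ`), namely
`g^*(τ) = (i/2π) ^ (κ-1) ∫_{-τ̄}^{i∞} (z + τ) ^ (-κ) conj (g (-z̄)) dz`,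
along the vertical half line `z = -τ̄ + it`, `t > 0`. It is normalised by
`(4π Im τ) ^ κ ∂g^*/∂τ̄ = -2πi conj (g τ)`. -/
def eichlerIntegral (κ : ℝ) (g : ℂ → ℂ) (τ : ℂ) : ℂ :=
  (I / (2 * π)) ^ ((κ : ℂ) - 1) *
    ∫ t in Set.Ioi (0 : ℝ),
      ((-conj τ + t * I) + τ) ^ (-(κ : ℂ)) * conj (g (-conj (-conj τ + t * I))) * I

/-- The non-holomorphic Eichler integral `S^*_{k,r}` of the weight `3/2` form `S_{k,r}`. -/
def unaryThetaStar (k : ℕ) (r : ℤ) (τ : ℂ) : ℂ := eichlerIntegral (1 / 2) (unaryTheta k r) τ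

/-- The Wirtinger derivative `∂F/∂τ̄`. -/
def dbar (F : ℂ → ℂ) (τ : ℂ) : ℂ := (1 / 2) * (fderiv ℝ F τ 1 + I * fderiv ℝ F τ I)

/-- The fractional linear action `τ ↦ (aτ + b) / (cτ + d)`. -/
def mobius (γ : SL(2, ℤ)) (τ : ℂ) : ℂ :=
  ((γ 0 0 : ℂ) * τ + (γ 0 1 : ℂ)) / ((γ 1 0 : ℂ) * τ + (γ 1 1 : ℂ))

/-- Polynomial growth on the upper half plane towards all cusps. -/
def PolynomialGrowth (F : ℂ → ℂ) : Prop :=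
  ∃ (C : ℝ) (N : ℕ), ∀ τ : ℂ, 0 < τ.im → ‖F τ‖ ≤ C * (τ.im + 1 / τ.im) ^ N

/-- Vector valued modular forms of real weight `κ` on `Γ`: the automorphy factor is the principal
branch of `(cτ + d) ^ κ`, and each `γ ∈ Γ` acts by an invertible matrix not depending on `τ`. -/
structure IsVectorModularForm {ι : Type} [Fintype ι] [DecidableEq ι]
    (Γ : Subgroup SL(2, ℤ)) (κ : ℝ) (F : ι → ℂ → ℂ) : Prop where
  holomorphic : ∀ i, DifferentiableOn ℂ (F i) {τ | 0 < τ.im}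
  growth : ∀ i, PolynomialGrowth (F i)
  transform : ∀ γ ∈ Γ, ∃ M : (Matrix ι ι ℂ)ˣ, ∀ τ : ℂ, 0 < τ.im → ∀ i,
    F i (mobius γ τ) =
      ((γ 1 0 : ℂ) * τ + (γ 1 1 : ℂ)) ^ (κ : ℂ) * ∑ j, (M : Matrix ι ι ℂ) i j * F j τ

/-- `h` is a mixed mock modular form of integral weight `κ` on `Γ`, with completion
`ĥ = h + ∑ⱼ fⱼ gⱼ^*` and shadow `∑ⱼ fⱼ conj (gⱼ)`: `h` is holomorphic on the upper half plane, of
polynomial growth at the cusps, the `fⱼ` are the components of a modular form of weight `ℓ`, the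
`gⱼ` those of one of weight `2 - (κ - ℓ)`, and `ĥ` transforms with weight `κ` under `Γ`. -/
structure IsMixedMockModularForm {ι : Type} [Fintype ι] [DecidableEq ι]
    (Γ : Subgroup SL(2, ℤ)) (κ : ℤ) (ℓ : ℝ) (h : ℂ → ℂ) (f g : ι → ℂ → ℂ) : Prop where
  holomorphic : DifferentiableOn ℂ h {τ | 0 < τ.im}
  growth : PolynomialGrowth h
  modular_f : IsVectorModularForm Γ ℓ f
  modular_g : IsVectorModularForm Γ (2 - (κ - ℓ)) g
  transform : ∀ γ ∈ Γ, ∀ τ : ℂ, 0 < τ.im →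
    h (mobius γ τ) + ∑ j, f j (mobius γ τ) * eichlerIntegral (κ - ℓ) (g j) (mobius γ τ) =
      ((γ 1 0 : ℂ) * τ + (γ 1 1 : ℂ)) ^ κ *
        (h τ + ∑ j, f j τ * eichlerIntegral (κ - ℓ) (g j) τ)

end ADEAppell

end

open ADEAppell

noncomputable section

namespace ADEAppell

/-! ### Preliminaries on sums over the integers -/

/-! Write `y = exp (2πiz)` and `A_n = 1 / (1 - y q ^ n)`. At `u = v = z`, `w = 0` both `η³ μ^Y` and
its completion have closed forms as double series over integers, and every assertion is read off
from these.

Closed form of `η³ μ`. The exponents quadratic in `n` cancel, so `θ₁₁(z) μ^{k,j,j'}` becomes a sum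
of `A_n` against Fourier coefficients of `χ_{j-1}(ζ) θ₁₁(ζ + z)` (`mu_eq_tsum_shiftedCoeff`). The
character times `θ₁₁(ζ)` is a difference of level `k` theta functions, and Kronecker's identity
(`exists_kronecker`, whose constant comes from Jacobi's formula for `η³`) expands `η³ θ₁₁(ζ + z) /
(θ₁₁(z) θ₁₁(ζ))` with coefficients `A_n`, up to elementary factors. Hence `η³ μ = -∑ₙ ∑ₛ c_s A_n
A_{n-s}` with Gaussian coefficients `c_s` (`eta_cube_mul_mu_eq_tsum_tsum`). As `∑ c_s = 0`, one may
replace `A_{n-s}` by `A_{n-s} - 1`; partial fractions then telescope the sum over `n` to `s / (q ^ s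
- 1)` for `s ≠ 0`, and only `s = 0` keeps a dependence on `z`, through a Weierstrass sum `W`
(`eta_cube_mul_mu`). Contracting with `Ω̂^{(k,d)}`, `k = de`, and expanding geometrically gives `-(e
- d) W` plus a series in `q ^ (ab)` (`sum_omegaHatDiv_mul_mu`).

Completion. At the origin the character is `S_{k,j} / η³` and `R̂_{k,j'}` is a multiple of
`S*_{k,j'}` (`affineChar_zero`, `zwegersRHat_zero`); the parity and reflection symmetries of `Ω^Y`
dispose of `δ` and of the symmetrisation `j ↦ k - j`. The substitution `p = da + eb`, `p' = da - eb`
unfolds the contracted product `S S*` into a second series with the same exponents `ab`. Adding the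
two series term by term and applying Poisson summation in `b` for each `a`
(`tsum_completedTerm_row`) yields, up to `1 / 4π²`, `(e - d) ℘ + e E_{d/e} - d (G₂ - π / τ₂)`, where
`E_α` is the weight two lattice sum with convergence factor depending on `α |ω|² / τ₂`
(`completedPart_eq`). Each of the three summands has weight two under all of `SL(2, ℤ)`, so `η³
μ̃^Y` has too (`eta_cube_mul_muADETilde_mobius`); division by `η³ = S_{2,1}` gives the laws for
`μ̃^Y` itself.

Shadow and mock modularity. `η³ μ^Y` is holomorphic by its closed form, so `∂/∂τ̄` only sees `S*`,
whose series is differentiated termwise. At a torsion point an element of `Γ(N)` moves `z` by a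
lattice vector, which `W` ignores. The vector of unary theta functions transforms by matrices
commuting with `Ω^Y`; this is checked on `S` and `T`, for `S` by a computation with the finite
Fourier kernel (`fourierOmega_comm`). -/

lemma tsum_residueClass {E : Type*} [AddCommMonoid E] [TopologicalSpace E] {N : ℤ} (hN : N ≠ 0)
    (r : ℤ) (f : ℤ → E) :
    ∑' n : ℤ, f (N * n + r) = ∑' p : ℤ, if N ∣ p - r then f p else 0 := by
  have hinj : Function.Injective (fun n : ℤ => N * n + r) := fun a b h => by
    simpa [hN] using h
  rw [← hinj.tsum_eq (f := fun p : ℤ => if N ∣ p - r then f p else 0)]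
  · simp
  · intro p hp
    by_cases h : N ∣ p - r
    · obtain ⟨c, hc⟩ := h
      exact ⟨c, by simp only; omega⟩
    · simp [h] at hp

lemma summable_residueClass (N r : ℤ) {f : ℤ → ℂ} (hf : Summable f) :
    Summable (fun p : ℤ => if N ∣ p - r then f p else 0) := by
  refine Summable.of_norm_bounded hf.norm fun p => ?_
  split_ifs <;> simp

lemma summable_exp_neg_mul_abs {c : ℝ} (hc : 0 < c) :
    Summable (fun n : ℤ => Real.exp (-c * |(n : ℝ)|)) := by
  have h : Summable (fun n : ℕ => Real.exp (-c * (n : ℝ))) := by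
    have := Real.summable_exp_nat_mul_iff (a := -c)
    simpa [mul_comm] using this.2 (by linarith)
  refine Summable.of_nat_of_neg ?_ ?_ <;> simpa using h

/-- Gaussian sums converge absolutely, with polynomial and exponential weights. -/
lemma summable_pow_mul_gaussian (j : ℕ) (b : ℝ) {c : ℝ} (hc : 0 < c) :
    Summable (fun n : ℤ => |(n : ℝ)| ^ j * Real.exp (-c * (n : ℝ) ^ 2 + b * |(n : ℝ)|)) := by
  have h := summable_pow_mul_jacobiTheta₂_term_bound (b / (2 * π)) (T := c / π) (by positivity) j
  refine h.congr fun n => ?_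
  push_cast
  congr 2
  field_simp
  ring

lemma norm_exp_two_pi_I_mul (w : ℂ) : ‖exp (2 * π * I * w)‖ = Real.exp (-(2 * π * w.im)) := by
  rw [Complex.norm_exp]
  congr 1
  simp [mul_re, mul_im]

lemma exp_two_pi_I_mul_int (n : ℤ) : exp (2 * π * I * n) = 1 := by
  rw [mul_comm]; exact exp_int_mul_two_pi_mul_I n

lemma exp_two_pi_I_mul_eq_one_iff (w : ℂ) : exp (2 * π * I * w) = 1 ↔ ∃ n : ℤ, w = n := by
  rw [Complex.exp_eq_one_iff]
  refine exists_congr fun n => ?_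
  have : (2 * π * I : ℂ) ≠ 0 := two_pi_I_ne_zero
  rw [mul_comm (n : ℂ), mul_right_inj' this]

/-! ### The factors `1 / (1 - y q ^ n)` -/

/-- The factor `1 / (1 - y q ^ n)` of an Appell-Lerch sum. -/
def appellFactor (τ z : ℂ) (n : ℤ) : ℂ := 1 / (1 - exp (2 * π * I * (z + n * τ)))

variable {τ z : ℂ}

lemma one_sub_exp_ne_zero (hz : ∀ m n : ℤ, z ≠ m * τ + n) (n : ℤ) :
    1 - exp (2 * π * I * (z + n * τ)) ≠ 0 := by
  rw [sub_ne_zero, ne_comm, Ne, exp_two_pi_I_mul_eq_one_iff]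
  rintro ⟨m, hm⟩
  refine hz (-n) m ?_
  push_cast
  linear_combination hm

lemma norm_exp_add_int_mul (n : ℤ) :
    ‖exp (2 * π * I * (z + n * τ))‖ =
      Real.exp (-(2 * π * z.im)) * Real.exp (-(2 * π * τ.im * n)) := by
  rw [norm_exp_two_pi_I_mul, ← Real.exp_add]
  congr 1
  simp
  ring

lemma appellFactor_sub_one (hz : ∀ m n : ℤ, z ≠ m * τ + n) (n : ℤ) :
    appellFactor τ z n - 1 = exp (2 * π * I * (z + n * τ)) * appellFactor τ z n := by
  have := one_sub_exp_ne_zero hz n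
  rw [appellFactor]
  field_simp
  ring

lemma tendsto_exp_add_int_mul_atTop (hτ : 0 < τ.im) :
    Tendsto (fun n : ℤ => exp (2 * π * I * (z + n * τ))) atTop (𝓝 0) := by
  rw [tendsto_zero_iff_norm_tendsto_zero]
  simp_rw [norm_exp_add_int_mul]
  rw [show (0 : ℝ) = Real.exp (-(2 * π * z.im)) * 0 by simp]
  refine Tendsto.const_mul _ (Real.tendsto_exp_atBot.comp ?_)
  refine tendsto_neg_atTop_atBot.comp ?_
  exact Tendsto.const_mul_atTop (by positivity) tendsto_intCast_atTop_atTop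

lemma tendsto_appellFactor_atTop (hτ : 0 < τ.im) :
    Tendsto (appellFactor τ z) atTop (𝓝 1) := by
  have := (tendsto_const_nhds (x := (1 : ℂ))).sub (tendsto_exp_add_int_mul_atTop (z := z) hτ)
  have h := (tendsto_const_nhds (x := (1 : ℂ))).div this (by simp)
  rw [sub_zero, div_one] at h
  exact h

/-- The identity `1 / (1 - x) + 1 / (1 - x⁻¹) = 1` exchanges the two ends of the index line, so
behaviour at `-∞` follows from that at `+∞`. -/
lemma appellFactor_neg (hz : ∀ m n : ℤ, z ≠ m * τ + n) (n : ℤ) :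
    appellFactor τ z (-n) = 1 - appellFactor τ (-z) n := by
  have h1 := one_sub_exp_ne_zero hz (-n)
  have h2 := one_sub_exp_ne_zero (z := -z) (τ := τ) (fun a b h => hz (-a) (-b) (by
    push_cast; linear_combination -h)) n
  have h3 : exp (2 * π * I * (z + (-n : ℤ) * τ)) * exp (2 * π * I * (-z + n * τ)) = 1 := by
    rw [← Complex.exp_add, ← Complex.exp_zero]; congr 1; push_cast; ring
  rw [appellFactor, appellFactor, eq_sub_iff_add_eq, div_add_div _ _ h1 h2,
    div_eq_one_iff_eq (mul_ne_zero h1 h2)]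
  linear_combination -h3

lemma tendsto_appellFactor_atBot (hτ : 0 < τ.im) (hz : ∀ m n : ℤ, z ≠ m * τ + n) :
    Tendsto (appellFactor τ z) atBot (𝓝 0) := by
  have h := (tendsto_const_nhds (x := (1 : ℂ))).sub
    ((tendsto_appellFactor_atTop (z := -z) hτ).comp tendsto_neg_atBot_atTop)
  rw [sub_self] at h
  refine h.congr fun n => ?_
  have := appellFactor_neg hz (-n)
  simp only [neg_neg] at this
  simp [this]

/-- The factors converge to `1` at `+∞` and to `0` at `-∞`, hence are bounded; the relation `A_n - 1
= y q ^ n A_n`, read in both directions, turns boundedness into exponential decay at the appropriate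
end. -/
lemma exists_appellFactor_bound (hτ : 0 < τ.im) (hz : ∀ m n : ℤ, z ≠ m * τ + n) :
    ∃ C : ℝ, 0 < C ∧ ∀ n : ℤ, ‖appellFactor τ z n‖ ≤ C ∧ ‖appellFactor τ z n - 1‖ ≤ C ∧
      ‖appellFactor τ z n‖ ≤ C * Real.exp (2 * π * τ.im * n) ∧
      ‖appellFactor τ z n - 1‖ ≤ C * Real.exp (-(2 * π * τ.im * n)) := by
  have hb : ∃ B : ℝ, ∀ n : ℤ, ‖appellFactor τ z n‖ ≤ B := by
    have h1 := (tendsto_appellFactor_atTop (z := z) hτ).norm.eventually_le_const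
      (show ‖(1 : ℂ)‖ < 2 by simp)
    have h2 := (tendsto_appellFactor_atBot hτ hz).norm.eventually_le_const
      (show ‖(0 : ℂ)‖ < 2 by simp)
    obtain ⟨a, ha⟩ := eventually_atTop.1 h1
    obtain ⟨b, hb⟩ := eventually_atBot.1 h2
    -- The constant `2` covers the two tails and the finite sum the indices in between.
    refine ⟨2 + ∑ i ∈ Finset.Icc b a, ‖appellFactor τ z i‖, fun n => ?_⟩
    have hs : 0 ≤ ∑ i ∈ Finset.Icc b a, ‖appellFactor τ z i‖ :=
      Finset.sum_nonneg fun _ _ => norm_nonneg _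
    rcases le_total a n with h | h
    · linarith [ha n h]
    rcases le_total n b with h' | h'
    · linarith [hb n h']
    have := Finset.single_le_sum (f := fun i => ‖appellFactor τ z i‖)
      (fun i _ => norm_nonneg _) (Finset.mem_Icc.2 ⟨h', h⟩)
    linarith
  obtain ⟨B, hB⟩ := hb
  have hB0 : 0 ≤ B := (norm_nonneg _).trans (hB 0)
  have hsub : ∀ n, ‖appellFactor τ z n - 1‖ ≤ B + 1 := fun n =>
    (norm_sub_le _ _).trans (by simpa using hB n)
  set Y := Real.exp (-(2 * π * z.im)) with hY
  have hYpos : 0 < Y := Real.exp_pos _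
  -- The factors `Y` and `Y⁻¹` pay for multiplying and dividing by `|y|` in the two decay estimates.
  refine ⟨(B + 1) * (1 + Y + Y⁻¹), by positivity, fun n => ?_⟩
  have hle : B + 1 ≤ (B + 1) * (1 + Y + Y⁻¹) :=
    le_mul_of_one_le_right (by positivity) (by linarith [inv_pos.2 hYpos])
  refine ⟨by linarith [hB n], (hsub n).trans hle, ?_, ?_⟩
  · have h := appellFactor_sub_one hz n
    have h2 : ‖appellFactor τ z n - 1‖ =
        Y * Real.exp (-(2 * π * τ.im * n)) * ‖appellFactor τ z n‖ := by
      rw [h, norm_mul, norm_exp_add_int_mul]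
    have h3 : ‖appellFactor τ z n‖ =
        Y⁻¹ * Real.exp (2 * π * τ.im * n) * ‖appellFactor τ z n - 1‖ := by
      rw [h2, Real.exp_neg]
      field_simp
    rw [h3]
    calc Y⁻¹ * Real.exp (2 * π * τ.im * n) * ‖appellFactor τ z n - 1‖
        ≤ Y⁻¹ * Real.exp (2 * π * τ.im * n) * (B + 1) := by gcongr; exact hsub n
      _ = ((B + 1) * Y⁻¹) * Real.exp (2 * π * τ.im * n) := by ring
      _ ≤ _ := by gcongr; linarith
  · rw [appellFactor_sub_one hz, norm_mul, norm_exp_add_int_mul]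
    calc Y * Real.exp (-(2 * π * τ.im * n)) * ‖appellFactor τ z n‖
        ≤ Y * Real.exp (-(2 * π * τ.im * n)) * (B + 1) := by gcongr; linarith [hB n]
      _ = ((B + 1) * Y) * Real.exp (-(2 * π * τ.im * n)) := by ring
      _ ≤ _ := by gcongr; linarith [inv_pos.2 hYpos]

/-- Differences of the factors decay exponentially in both directions. -/
lemma exists_appellFactor_sub_bound (hτ : 0 < τ.im) (hz : ∀ m n : ℤ, z ≠ m * τ + n) :
    ∃ C : ℝ, 0 < C ∧ ∀ n s : ℤ, ‖appellFactor τ z n - appellFactor τ z (n - s)‖ ≤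
      C * Real.exp (2 * π * τ.im * |(s : ℝ)|) * Real.exp (-(2 * π * τ.im) * |(n : ℝ)|) := by
  obtain ⟨C, hC, h⟩ := exists_appellFactor_bound hτ hz
  refine ⟨2 * C, by positivity, fun n s => ?_⟩
  have hc : 0 < 2 * π * τ.im := by positivity
  have hone : (1 : ℝ) ≤ Real.exp (2 * π * τ.im * |(s : ℝ)|) := Real.one_le_exp (by positivity)
  rcases le_total 0 n with hn | hn
  · have hn' : |(n : ℝ)| = n := abs_of_nonneg (by exact_mod_cast hn)
    have e1 := (h n).2.2.2
    have e2 := (h (n - s)).2.2.2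
    have e3 : Real.exp (-(2 * π * τ.im * ((n - s : ℤ) : ℝ))) ≤
        Real.exp (2 * π * τ.im * |(s : ℝ)|) * Real.exp (-(2 * π * τ.im) * n) := by
      rw [← Real.exp_add]
      refine Real.exp_le_exp.2 ?_
      push_cast
      nlinarith [le_abs_self (s : ℝ)]
    have e4 : Real.exp (-(2 * π * τ.im * n)) ≤
        Real.exp (2 * π * τ.im * |(s : ℝ)|) * Real.exp (-(2 * π * τ.im) * n) := by
      rw [neg_mul]
      exact le_mul_of_one_le_left (Real.exp_pos _).le hone
    rw [hn', show appellFactor τ z n - appellFactor τ z (n - s) =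
      (appellFactor τ z n - 1) - (appellFactor τ z (n - s) - 1) by ring]
    refine (norm_sub_le _ _).trans ?_
    nlinarith
  · have hn' : |(n : ℝ)| = -n := abs_of_nonpos (by exact_mod_cast hn)
    have e1 := (h n).2.2.1
    have e2 := (h (n - s)).2.2.1
    have e3 : Real.exp (2 * π * τ.im * ((n - s : ℤ) : ℝ)) ≤
        Real.exp (2 * π * τ.im * |(s : ℝ)|) * Real.exp (-(2 * π * τ.im) * -n) := by
      rw [← Real.exp_add]
      refine Real.exp_le_exp.2 ?_
      push_cast
      nlinarith [neg_abs_le (s : ℝ)]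
    have e4 : Real.exp (2 * π * τ.im * n) ≤
        Real.exp (2 * π * τ.im * |(s : ℝ)|) * Real.exp (-(2 * π * τ.im) * -n) := by
      rw [neg_mul_neg]
      exact le_mul_of_one_le_left (Real.exp_pos _).le hone
    rw [hn']
    refine (norm_sub_le _ _).trans ?_
    nlinarith

lemma summable_appellFactor_sub (hτ : 0 < τ.im) (hz : ∀ m n : ℤ, z ≠ m * τ + n) (s : ℤ) :
    Summable (fun n => appellFactor τ z n - appellFactor τ z (n - s)) := by
  obtain ⟨C, hC, h⟩ := exists_appellFactor_sub_bound hτ hz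
  exact Summable.of_norm_bounded
    ((summable_exp_neg_mul_abs (c := 2 * π * τ.im) (by positivity)).mul_left _) fun n => h n s

/-- The sum telescopes to the difference of the limits, `1` at `+∞` minus `0` at `-∞`; absolute
convergence allows evaluating it along symmetric intervals. -/
lemma hasSum_appellFactor_sub_one (hτ : 0 < τ.im) (hz : ∀ m n : ℤ, z ≠ m * τ + n) :
    HasSum (fun n => appellFactor τ z n - appellFactor τ z (n - 1)) 1 := by
  have hs := (summable_appellFactor_sub hτ hz 1).hasSum
  have ht : Tendsto (fun N : ℕ => Finset.Ico (-(N : ℤ)) N) atTop atTop := by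
    refine tendsto_atTop_finset_of_monotone
      (fun a b hab => Finset.Ico_subset_Ico (by omega) (by omega)) fun x => ⟨x.natAbs + 1, ?_⟩
    simp only [Finset.mem_Ico]; omega
  have h1 := hs.comp ht
  have h2 : ∀ N : ℕ, ∑ n ∈ Finset.Ico (-(N : ℤ)) N,
      (appellFactor τ z n - appellFactor τ z (n - 1)) =
      appellFactor τ z (N - 1) - appellFactor τ z (-N - 1) := by
    intro N
    induction N with
    | zero => simp
    | succ N ih =>
      have : Finset.Ico (-((N + 1 : ℕ) : ℤ)) ((N + 1 : ℕ) : ℤ) =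
          insert (N : ℤ) (insert (-(N : ℤ) - 1) (Finset.Ico (-(N : ℤ)) N)) := by
        ext x; simp only [Finset.mem_Ico, Finset.mem_insert]; push_cast; omega
      rw [this, Finset.sum_insert (by simp; omega), Finset.sum_insert (by simp), ih]
      push_cast
      ring_nf
  have h3 : Tendsto (fun N : ℕ => appellFactor τ z (N - 1) - appellFactor τ z (-N - 1)) atTop
      (𝓝 (1 - 0)) := by
    refine ((tendsto_appellFactor_atTop hτ).comp ?_).sub
      ((tendsto_appellFactor_atBot hτ hz).comp ?_)
    · exact tendsto_atTop_add_const_right _ (-1) tendsto_natCast_atTop_atTop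
    · exact tendsto_atBot_add_const_right _ (-1)
        (tendsto_neg_atTop_atBot.comp tendsto_natCast_atTop_atTop)
  have h4 := tendsto_nhds_unique (h1.congr h2) h3
  rw [sub_zero] at h4
  rwa [h4] at hs

/-- A difference at distance `s` is a sum of `s` unit differences, each contributing the total jump
`1`; for `s < 0` the jump is crossed backwards. -/
lemma hasSum_appellFactor_sub (hτ : 0 < τ.im) (hz : ∀ m n : ℤ, z ≠ m * τ + n) (s : ℤ) :
    HasSum (fun n => appellFactor τ z n - appellFactor τ z (n - s)) s := by
  have h1 := hasSum_appellFactor_sub_one hτ hz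
  induction s using Int.induction_on with
  | zero => simp
  | succ s ih =>
    have h2 := (Equiv.hasSum_iff (Equiv.subRight (s : ℤ))).2 h1
    have := ih.add h2
    refine (this.congr_fun fun n => ?_) |> fun h => by simpa using h
    simp only [Function.comp, Equiv.subRight_apply]
    ring_nf
  | pred s ih =>
    have h2 := (Equiv.hasSum_iff (Equiv.addRight ((s : ℤ) + 1))).2 h1
    have := ih.sub h2
    refine (this.congr_fun fun n => ?_) |> fun h => by simpa [sub_eq_add_neg] using h
    simp only [Function.comp, Equiv.coe_addRight]
    ring_nf

/-! ### Jacobi's identity for the cube of the eta function -/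

/-- The finite product `(1 - q) (1 - q ^ 2) ⋯ (1 - q ^ n)`. -/
def qPoch (q : ℂ) (n : ℕ) : ℂ := ∏ i ∈ Finset.range n, (1 - q ^ (i + 1))

lemma qPoch_succ (q : ℂ) (n : ℕ) : qPoch q (n + 1) = qPoch q n * (1 - q ^ (n + 1)) :=
  Finset.prod_range_succ _ _

lemma one_sub_pow_ne_zero {q : ℂ} (hq : ‖q‖ < 1) (n : ℕ) : 1 - q ^ (n + 1) ≠ 0 := by
  rw [sub_ne_zero]
  intro h
  have : ‖q ^ (n + 1)‖ < 1 := by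
    rw [norm_pow]; exact pow_lt_one₀ (norm_nonneg _) hq (by simp)
  rw [← h] at this
  simp at this

lemma qPoch_ne_zero {q : ℂ} (hq : ‖q‖ < 1) (n : ℕ) : qPoch q n ≠ 0 :=
  Finset.prod_ne_zero_iff.2 fun i _ => one_sub_pow_ne_zero hq i

/-- The `q`-binomial coefficient. -/
def qBinom (q : ℂ) (M j : ℕ) : ℂ := qPoch q M / (qPoch q j * qPoch q (M - j))

lemma qBinom_zero_right {q : ℂ} (hq : ‖q‖ < 1) (M : ℕ) : qBinom q M 0 = 1 := by
  have := qPoch_ne_zero hq M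
  simp only [qBinom, Nat.sub_zero]
  rw [show qPoch q 0 = 1 by simp [qPoch], one_mul, div_self this]

lemma qBinom_self {q : ℂ} (hq : ‖q‖ < 1) (M : ℕ) : qBinom q M M = 1 := by
  have := qPoch_ne_zero hq M
  simp only [qBinom, Nat.sub_self]
  rw [show qPoch q 0 = 1 by simp [qPoch], mul_one, div_self this]

/-- The `q`-Pascal rule. The restriction `j < M` matters because with truncated subtraction `qBinom
q M (M + 1)` is not zero. -/
lemma qBinom_succ_succ {q : ℂ} (hq : ‖q‖ < 1) {M j : ℕ} (hj : j < M) :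
    qBinom q (M + 1) (j + 1) = qBinom q M (j + 1) + q ^ (M - j) * qBinom q M j := by
  obtain ⟨l, rfl⟩ : ∃ l, M = j + 1 + l := ⟨M - j - 1, by omega⟩
  have e1 : j + 1 + l + 1 - (j + 1) = l + 1 := by omega
  have e2 : j + 1 + l - (j + 1) = l := by omega
  have e3 : j + 1 + l - j = l + 1 := by omega
  have h1 := qPoch_ne_zero hq j
  have h2 := qPoch_ne_zero hq l
  have h3 := one_sub_pow_ne_zero hq j
  have h4 := one_sub_pow_ne_zero hq l
  simp only [qBinom, e1, e2, e3, qPoch_succ]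
  field_simp
  ring

/-- The `q`-binomial theorem, by induction on `M`: multiplying by `1 + x q ^ M` realises the
`q`-Pascal rule. The two extreme coefficients are split off because that rule is only available
strictly inside. -/
lemma prod_one_add_mul_pow {q : ℂ} (hq : ‖q‖ < 1) (x : ℂ) (M : ℕ) :
    ∏ i ∈ Finset.range M, (1 + x * q ^ i) =
      ∑ j ∈ Finset.range (M + 1), q ^ (j.choose 2) * qBinom q M j * x ^ j := by
  induction M with
  | zero => simp [qBinom, qPoch]
  | succ M ih =>
    rw [Finset.prod_range_succ, ih, mul_add, mul_one, Finset.sum_range_succ' _ M,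
      Finset.sum_range_succ' _ (M + 1), Finset.sum_range_succ _ M, qBinom_self hq (M + 1),
      qBinom_zero_right hq, qBinom_zero_right hq]
    rw [show ∀ A B C : ℂ, A + B + C = A + (C + B) from fun A B C => by ring]
    have hmid : ∑ j ∈ Finset.range M, q ^ ((j + 1).choose 2) * qBinom q (M + 1) (j + 1) * x ^ (j + 1)
        = ∑ j ∈ Finset.range M, q ^ ((j + 1).choose 2) * qBinom q M (j + 1) * x ^ (j + 1) +
          (∑ j ∈ Finset.range M, q ^ (j.choose 2) * qBinom q M j * x ^ j) * (x * q ^ M) := by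
      rw [Finset.sum_mul, ← Finset.sum_add_distrib]
      refine Finset.sum_congr rfl fun j hj => ?_
      have hj' := Finset.mem_range.1 hj
      rw [qBinom_succ_succ hq hj', Nat.choose_succ_succ' j 1, Nat.choose_one_right, pow_add]
      have : q ^ M = q ^ j * q ^ (M - j) := by rw [← pow_add]; congr 1; omega
      rw [this]
      ring
    have hrel := (Finset.sum_range_succ' (fun j => q ^ (j.choose 2) * qBinom q M j * x ^ j) M).symm.trans
      (Finset.sum_range_succ (fun j => q ^ (j.choose 2) * qBinom q M j * x ^ j) M)
    rw [qBinom_self hq, qBinom_zero_right hq] at hrel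
    rw [hmid, Nat.choose_succ_succ' M 1, Nat.choose_one_right, pow_add]
    linear_combination (x * q ^ M) * hrel

lemma two_mul_choose_two (n : ℕ) : 2 * ((n + 1).choose 2) = n * (n + 1) := by
  rw [Nat.choose_two_right, Nat.mul_div_cancel']
  · simp [mul_comm]
  · simpa [mul_comm] using (Nat.even_mul_succ_self n).two_dvd

lemma choose_two_add (N l : ℕ) :
    (N + 1 + l).choose 2 + (N + 1).choose 2 = N * (N + 1 + l) + (l + 1).choose 2 := by
  have h1 := two_mul_choose_two (N + l)
  have h2 := two_mul_choose_two N
  have h3 := two_mul_choose_two l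
  rw [show N + 1 + l = N + l + 1 by ring]
  nlinarith

lemma choose_two_sub {N l : ℕ} (h : l ≤ N) :
    (N - l).choose 2 + (N + 1).choose 2 = N * (N - l) + (l + 1).choose 2 := by
  obtain ⟨m, rfl⟩ := Nat.exists_eq_add_of_le h
  rw [Nat.add_sub_cancel_left]
  have h2 := two_mul_choose_two (l + m)
  have h3 := two_mul_choose_two l
  rcases m with _ | m
  · simp
  · have h1 := two_mul_choose_two m
    nlinarith

/-- The finite form of Jacobi's identity. -/
lemma qPoch_sq {q : ℂ} (hq : ‖q‖ < 1) (hq0 : q ≠ 0) (N : ℕ) :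
    qPoch q N ^ 2 = ∑ n ∈ Finset.range (N + 1),
      (-1) ^ n * (2 * n + 1) * q ^ ((n + 1).choose 2) * qBinom q (2 * N + 1) (N - n) := by
  -- Taking `x = -y q ^ (-N)` in the `q`-binomial theorem centres the product, so that its middle
  -- factor is `1 - y`.
  set w : ℂ := (q ^ N)⁻¹ with hw
  have hwN : w * q ^ N = 1 := inv_mul_cancel₀ (pow_ne_zero _ hq0)
  have hpoly : ∀ y : ℂ, (1 - y) * ((∏ i ∈ Finset.range N, (1 - y * (w * q ^ i))) *
      ∏ i ∈ Finset.range N, (1 - y * q ^ (i + 1))) =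
      ∑ j ∈ Finset.range (2 * N + 2),
        q ^ (j.choose 2) * qBinom q (2 * N + 1) j * (-w) ^ j * y ^ j := by
    intro y
    have h := prod_one_add_mul_pow hq (-w * y) (2 * N + 1)
    simp_rw [mul_pow, ← mul_assoc] at h
    rw [← h, show 2 * N + 1 = N + (N + 1) by ring, Finset.prod_range_add, Finset.prod_range_succ',
      add_zero]
    have e1 : ∀ i, 1 + -w * y * q ^ i = 1 - y * (w * q ^ i) := fun i => by ring
    have e2 : ∀ i, 1 + -w * y * q ^ (N + (i + 1)) = 1 - y * q ^ (i + 1) := fun i => by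
      rw [pow_add]; linear_combination (-y * q ^ (i + 1)) * hwN
    have e3 : 1 + -w * y * q ^ N = 1 - y := by linear_combination -y * hwN
    simp_rw [e2, e3, e1]
    ring
  -- At `y = 1` only the vanishing factor `1 - y` needs to be differentiated; on the polynomial side
  -- the derivative produces the weights `j`.
  have hd1 : HasDerivAt (fun y : ℂ => (1 - y) * ((∏ i ∈ Finset.range N, (1 - y * (w * q ^ i))) *
      ∏ i ∈ Finset.range N, (1 - y * q ^ (i + 1))))
      (-((∏ i ∈ Finset.range N, (1 - w * q ^ i)) * qPoch q N)) 1 := by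
    have hg : DifferentiableAt ℂ (fun y : ℂ => (∏ i ∈ Finset.range N, (1 - y * (w * q ^ i))) *
      ∏ i ∈ Finset.range N, (1 - y * q ^ (i + 1))) 1 := by fun_prop
    have := ((hasDerivAt_id (1 : ℂ)).const_sub 1).mul hg.hasDerivAt
    refine this.congr_deriv ?_
    simp [qPoch]
  have hd2 : HasDerivAt (fun y : ℂ => ∑ j ∈ Finset.range (2 * N + 2),
        q ^ (j.choose 2) * qBinom q (2 * N + 1) j * (-w) ^ j * y ^ j)
      (∑ j ∈ Finset.range (2 * N + 2),
        q ^ (j.choose 2) * qBinom q (2 * N + 1) j * (-w) ^ j * j) 1 := by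
    refine HasDerivAt.fun_sum fun j _ => ?_
    simpa using (hasDerivAt_pow j (1 : ℂ)).const_mul
      (q ^ (j.choose 2) * qBinom q (2 * N + 1) j * (-w) ^ j)
  have hkey := hd1.unique (hd2.congr_of_eventuallyEq (Eventually.of_forall hpoly))
  have hprod : (∏ i ∈ Finset.range N, (1 - w * q ^ i)) * q ^ ((N + 1).choose 2) =
      (-1) ^ N * qPoch q N := by
    have hc : q ^ ((N + 1).choose 2) = ∏ i ∈ Finset.range N, q ^ (i + 1) := by
      rw [Finset.prod_pow_eq_pow_sum]
      congr 1
      have h1 := Finset.sum_range_id_mul_two (N + 1)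
      rw [Finset.sum_range_succ'] at h1
      have h2 := two_mul_choose_two N
      simp only [add_zero, Nat.add_sub_cancel] at h1
      nlinarith
    rw [hc, qPoch, ← Finset.prod_range_reflect, ← Finset.prod_mul_distrib,
      ← Finset.card_range N, ← Finset.prod_const, Finset.card_range, ← Finset.prod_mul_distrib]
    refine Finset.prod_congr rfl fun i hi => ?_
    have hi' := Finset.mem_range.1 hi
    have : w * (q ^ (N - 1 - i) * q ^ (i + 1)) = 1 := by
      rw [← pow_add, show N - 1 - i + (i + 1) = N by omega, hwN]
    linear_combination -this
  -- The indices `N - n` and `N + 1 + n` are paired: they carry the same `q`-binomial coefficient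
  -- and power of `q` with opposite signs, and their difference is the weight `2n + 1`.
  have hsplit : ∑ j ∈ Finset.range (2 * N + 2),
        q ^ (j.choose 2) * qBinom q (2 * N + 1) j * (-w) ^ j * j =
      ∑ n ∈ Finset.range (N + 1),
        (q ^ ((N - n).choose 2) * qBinom q (2 * N + 1) (N - n) * (-w) ^ (N - n) * (N - n : ℕ) +
        q ^ ((N + 1 + n).choose 2) * qBinom q (2 * N + 1) (N + 1 + n) * (-w) ^ (N + 1 + n) *
          (N + 1 + n : ℕ)) := by
    rw [show 2 * N + 2 = (N + 1) + (N + 1) by ring, Finset.sum_range_add, Finset.sum_add_distrib,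
      ← Finset.sum_range_reflect]
    simp
  rw [hsplit] at hkey
  have hq1 : (-1 : ℂ) ^ N * (-1) ^ N = 1 := by rw [← mul_pow]; simp
  have hfin : -((-1) ^ N * qPoch q N ^ 2) = ∑ n ∈ Finset.range (N + 1),
      -((-1) ^ N) * ((-1) ^ n * (2 * n + 1) * q ^ ((n + 1).choose 2) *
        qBinom q (2 * N + 1) (N - n)) := by
    calc -((-1) ^ N * qPoch q N ^ 2)
        = -((∏ i ∈ Finset.range N, (1 - w * q ^ i)) * qPoch q N) * q ^ ((N + 1).choose 2) := by
          linear_combination qPoch q N * hprod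
      _ = _ := by
          rw [hkey, Finset.sum_mul]
          refine Finset.sum_congr rfl fun n hn => ?_
          have hn' : n ≤ N := by have := Finset.mem_range.1 hn; omega
          have hsym : qBinom q (2 * N + 1) (N + 1 + n) = qBinom q (2 * N + 1) (N - n) := by
            rw [qBinom, qBinom, mul_comm (qPoch q (N + 1 + n)), show 2 * N + 1 - (N + 1 + n) = N - n by omega,
              show 2 * N + 1 - (N - n) = N + 1 + n by omega]
          have hwpow : ∀ a : ℕ, w ^ a * q ^ (N * a) = 1 := fun a => by
            rw [pow_mul, ← mul_pow, hwN, one_pow]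
          have h1 : q ^ ((N - n).choose 2) * q ^ ((N + 1).choose 2) * w ^ (N - n) =
              q ^ ((n + 1).choose 2) := by
            rw [← pow_add, choose_two_sub hn', pow_add]
            linear_combination q ^ ((n + 1).choose 2) * hwpow (N - n)
          have h2 : q ^ ((N + 1 + n).choose 2) * q ^ ((N + 1).choose 2) * w ^ (N + 1 + n) =
              q ^ ((n + 1).choose 2) := by
            rw [← pow_add, choose_two_add, pow_add]
            linear_combination q ^ ((n + 1).choose 2) * hwpow (N + 1 + n)
          have hs1 : (-1 : ℂ) ^ (N - n) = (-1) ^ N * (-1) ^ n := by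
            have : (-1 : ℂ) ^ N = (-1) ^ (N - n) * (-1) ^ n := by
              rw [← pow_add]; congr 1; omega
            rw [this, mul_assoc, ← mul_pow]; simp
          have hs2 : (-1 : ℂ) ^ (N + 1 + n) = -((-1) ^ N * (-1) ^ n) := by
            rw [pow_add, pow_add]; ring
          rw [hsym, neg_pow w, neg_pow w, hs1, hs2]
          push_cast [Nat.cast_sub hn']
          linear_combination (qBinom q (2 * N + 1) (N - n) * ((-1) ^ N * (-1) ^ n) * (N - n)) * h1 -
            (qBinom q (2 * N + 1) (N - n) * ((-1) ^ N * (-1) ^ n) * (N + 1 + n)) * h2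
  rw [← Finset.mul_sum] at hfin
  linear_combination (-(-1) ^ N) * hfin + (∑ n ∈ Finset.range (N + 1),
      ((-1) ^ n * (2 * n + 1) * q ^ ((n + 1).choose 2) *
        qBinom q (2 * N + 1) (N - n)) - qPoch q N ^ 2) * hq1

lemma tendsto_qPoch {q : ℂ} (hq : ‖q‖ < 1) :
    Tendsto (qPoch q) atTop (𝓝 (∏' n : ℕ, (1 - q ^ (n + 1)))) :=
  (ModularForm.multipliable_one_sub_pow hq).hasProd.tendsto_prod_nat

lemma tprod_one_sub_pow_ne_zero {q : ℂ} (hq : ‖q‖ < 1) : ∏' n : ℕ, (1 - q ^ (n + 1)) ≠ 0 := by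
  have := tprod_one_add_ne_zero_of_summable (f := fun n : ℕ => -q ^ (n + 1))
    (fun n => by simpa [← sub_eq_add_neg] using one_sub_pow_ne_zero hq n)
    (by simpa using (summable_nat_add_iff 1).mpr (summable_geometric_of_lt_one (norm_nonneg _) hq))
  simpa [← sub_eq_add_neg] using this

lemma summable_natCast_mul_pow_choose {r : ℝ} (hr0 : 0 ≤ r) (hr : r < 1) :
    Summable (fun n : ℕ => (2 * n + 1 : ℝ) * r ^ ((n + 1).choose 2)) := by
  have h1 : Summable (fun n : ℕ => (2 * n + 1 : ℝ) * r ^ n) := by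
    have a := summable_pow_mul_geometric_of_norm_lt_one 1 (r := r) (by simpa [abs_of_nonneg hr0])
    have b := summable_geometric_of_lt_one hr0 hr
    refine ((a.mul_left 2).add b).congr fun n => ?_
    simp; ring
  refine h1.of_nonneg_of_le (fun n => by positivity) fun n => ?_
  refine mul_le_mul_of_nonneg_left (pow_le_pow_of_le_one hr0 hr.le ?_) (by positivity)
  have := two_mul_choose_two n
  rcases n with _ | n
  · simp
  · nlinarith

/-- Jacobi's identity. -/
lemma tprod_one_sub_pow_cube {q : ℂ} (hq : ‖q‖ < 1) (hq0 : q ≠ 0) :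
    (∏' n : ℕ, (1 - q ^ (n + 1))) ^ 3 =
      ∑' n : ℕ, (-1) ^ n * (2 * n + 1) * q ^ ((n + 1).choose 2) := by
  set L := ∏' n : ℕ, (1 - q ^ (n + 1)) with hL
  have hL0 : L ≠ 0 := tprod_one_sub_pow_ne_zero hq
  have hlim := tendsto_qPoch hq
  -- The finite products converge to a nonzero limit, so they and their inverses are bounded; this
  -- bounds all `q`-binomial coefficients uniformly.
  obtain ⟨B, hB⟩ : ∃ B, ∀ n, ‖qPoch q n‖ ≤ B := by
    obtain ⟨B, hB⟩ := hlim.norm.bddAbove_range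
    exact ⟨B, fun n => hB ⟨n, rfl⟩⟩
  obtain ⟨B', hB'⟩ : ∃ B, ∀ n, ‖(qPoch q n)⁻¹‖ ≤ B := by
    obtain ⟨B, hB⟩ := (hlim.inv₀ hL0).norm.bddAbove_range
    exact ⟨B, fun n => hB ⟨n, rfl⟩⟩
  have hB0 : 0 ≤ B := (norm_nonneg _).trans (hB 0)
  have hB0' : 0 ≤ B' := (norm_nonneg _).trans (hB' 0)
  set F : ℕ → ℕ → ℂ := fun N n => if n ≤ N then
    (-1) ^ n * (2 * n + 1) * q ^ ((n + 1).choose 2) * qBinom q (2 * N + 1) (N - n) else 0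
  have h1 : ∀ N, ∑' n, F N n = qPoch q N ^ 2 := by
    intro N
    rw [qPoch_sq hq hq0, tsum_eq_sum (s := Finset.range (N + 1))]
    · refine Finset.sum_congr rfl fun n hn => ?_
      have := Finset.mem_range.1 hn
      exact if_pos (by omega)
    · intro n hn
      simp only [Finset.mem_range, not_lt] at hn
      exact if_neg (by omega)
  -- Each `q`-binomial coefficient tends to `L / L² = L⁻¹`, and dominated convergence passes this
  -- through the sum: the limit of the finite identity reads `L² = L⁻¹ ∑ …`.
  have h2 : Tendsto (fun N => ∑' n, F N n) atTop
      (𝓝 (∑' n : ℕ, (-1) ^ n * (2 * n + 1) * q ^ ((n + 1).choose 2) * L⁻¹)) := by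
    refine tendsto_tsum_of_dominated_convergence
      (bound := fun n : ℕ => ((2 * n + 1 : ℝ) * ‖q‖ ^ ((n + 1).choose 2)) * (B * (B' * B')))
      ((summable_natCast_mul_pow_choose (norm_nonneg _) hq).mul_right _) ?_ ?_
    · intro n
      have hb : Tendsto (fun N : ℕ => qBinom q (2 * N + 1) (N - n)) atTop (𝓝 L⁻¹) := by
        have e : L⁻¹ = L / (L * L) := by field_simp
        rw [e]
        refine (hlim.comp ?_).div ((hlim.comp ?_).mul (hlim.comp ?_)) (mul_ne_zero hL0 hL0)
        · exact tendsto_atTop_mono (fun N => by simp only [id]; omega) tendsto_id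
        · exact tendsto_sub_atTop_nat n
        · exact tendsto_atTop_mono (fun N => by simp only [id]; omega) tendsto_id
      refine (hb.const_mul _).congr' ?_
      filter_upwards [eventually_ge_atTop n] with N hN
      simp only [F, if_pos hN]
    · refine Eventually.of_forall fun N n => ?_
      simp only [F]
      split_ifs with h
      · have e2 : ‖(2 * (n : ℂ) + 1)‖ = 2 * n + 1 := by
          rw [show (2 * (n : ℂ) + 1) = ((2 * n + 1 : ℕ) : ℂ) by push_cast; ring, Complex.norm_natCast]
          push_cast; ring
        rw [norm_mul, norm_mul, norm_mul, norm_pow, norm_pow, e2, norm_neg, norm_one, one_pow, one_mul]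
        refine mul_le_mul_of_nonneg_left ?_ (by positivity)
        rw [qBinom, div_eq_mul_inv, mul_inv, norm_mul, norm_mul]
        gcongr
        exacts [hB _, hB' _, hB' _]
      · simp; positivity
  have h3 : Tendsto (fun N => ∑' n, F N n) atTop (𝓝 (L ^ 2)) := by
    simp_rw [h1]; exact hlim.pow 2
  have h4 := tendsto_nhds_unique h3 h2
  rw [tsum_mul_right] at h4
  rw [pow_succ, h4]
  field_simp

/-! ### Coefficients of the odd theta function, and Jacobi's identity expressed through them. -/

lemma norm_exp_two_pi_I_lt_one' {τ : ℂ} (hτ : 0 < τ.im) : ‖exp (2 * π * I * τ)‖ < 1 := by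
  rw [norm_exp_two_pi_I_mul, Real.exp_lt_one_iff]
  have : 0 < 2 * π * τ.im := by positivity
  linarith

/-- The coefficients of the odd theta function: `t m = i (-1) ^ m q ^ ((2m+1)² / 8)`. -/
def oddThetaCoeff (τ : ℂ) (m : ℤ) : ℂ :=
  I * (-1) ^ m * exp (π * I * ((m : ℂ) + 1 / 2) ^ 2 * τ)

lemma norm_neg_one_zpow (m : ℤ) : ‖(-1 : ℂ) ^ m‖ = 1 := by simp

lemma norm_oddThetaCoeff (τ : ℂ) (m : ℤ) :
    ‖oddThetaCoeff τ m‖ = Real.exp (-(π * τ.im) * ((m : ℝ) + 1 / 2) ^ 2) := by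
  rw [oddThetaCoeff, norm_mul, norm_mul, norm_I, norm_neg_one_zpow, one_mul, one_mul,
    Complex.norm_exp]
  congr 1
  have : ((m : ℂ) + 1 / 2) ^ 2 = ((((m : ℝ) + 1 / 2) ^ 2 : ℝ) : ℂ) := by push_cast; ring
  rw [this, show (π : ℂ) * I * ((((m : ℝ) + 1 / 2) ^ 2 : ℝ) : ℂ) * τ
    = ((π * ((m : ℝ) + 1 / 2) ^ 2 : ℝ) : ℂ) * (I * τ) by push_cast; ring, re_ofReal_mul]
  simp
  ring

lemma norm_oddThetaCoeff_le {τ : ℂ} (hτ : 0 < τ.im) (m : ℤ) :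
    ‖oddThetaCoeff τ m‖ ≤ Real.exp (-(π * τ.im) * (m : ℝ) ^ 2 + π * τ.im * |(m : ℝ)|) := by
  rw [norm_oddThetaCoeff]
  refine Real.exp_le_exp.2 ?_
  have : 0 < π * τ.im := by positivity
  nlinarith [neg_abs_le (m : ℝ)]

lemma summable_oddThetaCoeff_mul {τ : ℂ} (hτ : 0 < τ.im) (j : ℕ) (b : ℝ) :
    Summable (fun m : ℤ => ‖oddThetaCoeff τ m‖ * (|(m : ℝ)| ^ j * Real.exp (b * |(m : ℝ)|))) := by
  refine (summable_pow_mul_gaussian j (π * τ.im + b) (c := π * τ.im) (by positivity)).of_nonneg_of_le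
    (fun m => by positivity) fun m => ?_
  calc ‖oddThetaCoeff τ m‖ * (|(m : ℝ)| ^ j * Real.exp (b * |(m : ℝ)|))
      ≤ Real.exp (-(π * τ.im) * (m : ℝ) ^ 2 + π * τ.im * |(m : ℝ)|) *
        (|(m : ℝ)| ^ j * Real.exp (b * |(m : ℝ)|)) := by
        gcongr; exact norm_oddThetaCoeff_le hτ m
    _ = _ := by
        rw [show -(π * τ.im) * (m : ℝ) ^ 2 + (π * τ.im + b) * |(m : ℝ)| =
          (-(π * τ.im) * (m : ℝ) ^ 2 + π * τ.im * |(m : ℝ)|) + b * |(m : ℝ)| by ring,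
          Real.exp_add (-(π * τ.im) * (m : ℝ) ^ 2 + π * τ.im * |(m : ℝ)|)]
        ring

lemma summable_oddThetaCoeff {τ : ℂ} (hτ : 0 < τ.im) : Summable (oddThetaCoeff τ) := by
  refine Summable.of_norm ((summable_oddThetaCoeff_mul hτ 0 0).congr fun m => ?_)
  simp

lemma oddThetaCoeff_neg_sub_one (τ : ℂ) (m : ℤ) :
    oddThetaCoeff τ (-m - 1) = -oddThetaCoeff τ m := by
  have h : (-1 : ℂ) ^ (-m - 1) = -(-1) ^ m := by
    rw [zpow_sub₀ (by simp), zpow_neg, ← inv_zpow, zpow_one, div_neg, div_one,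
      show (-1 : ℂ)⁻¹ = -1 by norm_num]
  rw [oddThetaCoeff, oddThetaCoeff, h]
  push_cast
  rw [show (-(m : ℂ) - 1 + 1 / 2) ^ 2 = ((m : ℂ) + 1 / 2) ^ 2 by ring]
  ring

/-- The involution `m ↦ -m - 1` reverses the sign of every term. -/
lemma tsum_oddThetaCoeff (τ : ℂ) : ∑' m, oddThetaCoeff τ m = 0 := by
  have h := (Equiv.subRight (1 : ℤ)).tsum_eq (fun m => oddThetaCoeff τ m)
  have h2 := (Equiv.neg ℤ).tsum_eq (fun m => oddThetaCoeff τ (m - 1))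
  simp only [Equiv.subRight_apply, Equiv.neg_apply, oddThetaCoeff_neg_sub_one] at h h2
  rw [h, tsum_neg] at h2
  exact self_eq_neg.1 h2.symm

/-- The weight `2m + 1` is odd under `m ↦ -m - 1`, as is the coefficient, so the two half-lines
contribute equally. Since `(m + 1/2)² / 2 = 1/8 + m(m + 1)/2`, each half is Jacobi's series, and the
three factors `q ^ (1/24)` of `η³` account for the `1/8`. -/
lemma tsum_mul_oddThetaCoeff {τ : ℂ} (hτ : 0 < τ.im) :
    ∑' m : ℤ, (2 * m + 1) * oddThetaCoeff τ m = 2 * I * ModularForm.eta τ ^ 3 := by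
  have hq := norm_exp_two_pi_I_lt_one' hτ
  have hsum : Summable (fun m : ℤ => (2 * m + 1) * oddThetaCoeff τ m) := by
    have h1 := ((summable_oddThetaCoeff_mul hτ 1 0).mul_left 2).add
      (summable_oddThetaCoeff_mul hτ 0 0)
    refine Summable.of_norm_bounded h1 fun m => ?_
    rw [norm_mul]
    have : ‖(2 * (m : ℂ) + 1)‖ ≤ 2 * |(m : ℝ)| + 1 := by
      refine (norm_add_le _ _).trans ?_
      simp
    simp only [pow_one, zero_mul, Real.exp_zero, mul_one, pow_zero]
    nlinarith [norm_nonneg (oddThetaCoeff τ m)]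
  have hterm : ∀ n : ℕ, oddThetaCoeff τ n = I * exp (2 * π * I * τ / 8) *
      ((-1) ^ n * exp (2 * π * I * τ) ^ ((n + 1).choose 2)) := by
    intro n
    have hc : (((n + 1).choose 2 : ℕ) : ℂ) = n * (n + 1) / 2 := by
      have := two_mul_choose_two n
      have h2 : (2 : ℂ) * ((n + 1).choose 2 : ℕ) = n * (n + 1) := by exact_mod_cast this
      linear_combination h2 / 2
    rw [oddThetaCoeff, ← Complex.exp_nat_mul, hc]
    rw [show ∀ a b c : ℂ, I * a * (b * c) = I * b * (a * c) from fun a b c => by ring,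
      ← Complex.exp_add]
    simp only [zpow_natCast, Int.cast_natCast]
    congr 2
    ring
  have h1 : HasSum (fun n : ℕ => (2 * ((n : ℤ) : ℂ) + 1) * oddThetaCoeff τ (n : ℤ) +
      (2 * ((-((n : ℤ) + 1) : ℤ) : ℂ) + 1) * oddThetaCoeff τ (-((n : ℤ) + 1)))
      (∑' m : ℤ, (2 * m + 1) * oddThetaCoeff τ m) := by
    have := hsum.hasSum.nat_add_neg_add_one
    exact this
  have h2 : ∀ n : ℕ, (2 * ((n : ℤ) : ℂ) + 1) * oddThetaCoeff τ (n : ℤ) +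
      (2 * ((-((n : ℤ) + 1) : ℤ) : ℂ) + 1) * oddThetaCoeff τ (-((n : ℤ) + 1)) =
      2 * I * exp (2 * π * I * τ / 8) *
        ((-1) ^ n * (2 * n + 1) * exp (2 * π * I * τ) ^ ((n + 1).choose 2)) := by
    intro n
    rw [show -((n : ℤ) + 1) = -(n : ℤ) - 1 by ring, oddThetaCoeff_neg_sub_one, hterm]
    push_cast
    ring
  rw [← h1.tsum_eq, tsum_congr h2, tsum_mul_left, ← tprod_one_sub_pow_cube hq (Complex.exp_ne_zero _),
    ModularForm.eta, mul_pow]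
  simp_rw [ModularForm.eta_q_eq_pow]
  rw [Function.Periodic.qParam, ← Complex.exp_nat_mul]
  rw [show (2 * π * I * τ / 8 : ℂ) = (3 : ℕ) * (2 * π * I * τ / (24 : ℝ)) by push_cast; ring]
  ring

/-! ### The odd theta function and Kronecker's identity -/

lemma exp_pi_I_mul_int_add_half (m : ℤ) : exp (π * I * ((m : ℂ) + 1 / 2)) = I * (-1) ^ m := by
  rw [mul_add, Complex.exp_add, show (π : ℂ) * I * (1 / 2) = π / 2 * I by ring,
    Complex.exp_pi_div_two_mul_I, mul_comm (π * I : ℂ), Complex.exp_int_mul, Complex.exp_pi_mul_I]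
  ring

lemma theta11_eq_tsum (τ z : ℂ) :
    theta11 τ z = ∑' m : ℤ, oddThetaCoeff τ m * exp (2 * π * I * z * (m + 1 / 2)) := by
  refine tsum_congr fun m => ?_
  rw [oddThetaCoeff, ← exp_pi_I_mul_int_add_half, ← Complex.exp_add, ← Complex.exp_add]
  congr 1
  ring

lemma oddThetaCoeff_succ (τ : ℂ) (m : ℤ) :
    oddThetaCoeff τ (m + 1) = -exp (2 * π * I * ((m + 1) * τ)) * oddThetaCoeff τ m := by
  rw [oddThetaCoeff, oddThetaCoeff, zpow_add₀ (by norm_num), zpow_one]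
  rw [show π * I * (((m + 1 : ℤ) : ℂ) + 1 / 2) ^ 2 * τ =
    2 * π * I * ((m + 1) * τ) + π * I * ((m : ℂ) + 1 / 2) ^ 2 * τ by push_cast; ring,
    Complex.exp_add]
  ring

lemma oddThetaCoeff_ne_zero (τ : ℂ) (m : ℤ) : oddThetaCoeff τ m ≠ 0 := by
  rw [oddThetaCoeff]
  exact mul_ne_zero (mul_ne_zero I_ne_zero (zpow_ne_zero _ (by norm_num))) (Complex.exp_ne_zero _)

lemma summable_mul_appellFactor {τ z : ℂ} (hτ : 0 < τ.im) (hz : ∀ m n : ℤ, z ≠ m * τ + n)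
    {c : ℤ → ℂ} (hc : Summable c) (g : ℤ → ℤ) :
    Summable (fun m => c m * appellFactor τ z (g m)) := by
  obtain ⟨C, hC, h⟩ := exists_appellFactor_bound hτ hz
  refine Summable.of_norm_bounded (hc.norm.mul_right C) fun m => ?_
  rw [norm_mul]
  gcongr
  exact (h _).1

/-- Inserting `A_n = 1 + y q ^ n A_n`, the constant `1` drops out because the theta coefficients sum
to zero; the shift `m ↦ m + 1` then matches the power of `q` with the recursion of the coefficients.
-/
lemma tsum_oddThetaCoeff_mul_appellFactor_succ {τ z : ℂ} (hτ : 0 < τ.im)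
    (hz : ∀ m n : ℤ, z ≠ m * τ + n) (s : ℤ) :
    ∑' m, oddThetaCoeff τ m * appellFactor τ z (s + 1 - m) =
      -exp (2 * π * I * (z + (s + 1) * τ)) *
        ∑' m, oddThetaCoeff τ m * appellFactor τ z (s - m) := by
  rw [← tsum_mul_left]
  have h1 : ∀ m, oddThetaCoeff τ m * appellFactor τ z (s + 1 - m) = oddThetaCoeff τ m +
      oddThetaCoeff τ m * (exp (2 * π * I * (z + ((s + 1 - m : ℤ) : ℂ) * τ)) *
        appellFactor τ z (s + 1 - m)) := by
    intro m
    rw [← appellFactor_sub_one hz]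
    ring
  have h0 := summable_oddThetaCoeff hτ
  have hs := summable_mul_appellFactor hτ hz h0 (fun m => s + 1 - m)
  have hs' : Summable (fun m => oddThetaCoeff τ m *
      (exp (2 * π * I * (z + ((s + 1 - m : ℤ) : ℂ) * τ)) * appellFactor τ z (s + 1 - m))) := by
    refine (hs.sub h0).congr fun m => ?_
    linear_combination h1 m
  rw [tsum_congr h1, h0.tsum_add hs', tsum_oddThetaCoeff, zero_add,
    ← (Equiv.addRight (1 : ℤ)).tsum_eq]
  refine tsum_congr fun m => ?_
  rw [Equiv.coe_addRight, oddThetaCoeff_succ, show s + 1 - (m + 1) = s - m by ring]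
  rw [show 2 * π * I * (z + (s + 1) * τ) = 2 * π * I * ((m + 1) * τ) +
    2 * π * I * (z + ((s - m : ℤ) : ℂ) * τ) by push_cast; ring, Complex.exp_add]
  ring

/-- Both sides solve the same first order recursion in `s`, with nonvanishing multiplier, so they
are determined in both directions by the value at `s = 0`. -/
lemma tsum_oddThetaCoeff_mul_appellFactor {τ z : ℂ} (hτ : 0 < τ.im)
    (hz : ∀ m n : ℤ, z ≠ m * τ + n) (s : ℤ) :
    ∑' m, oddThetaCoeff τ m * appellFactor τ z (s - m) =
      ((∑' m, oddThetaCoeff τ m * appellFactor τ z (0 - m)) / oddThetaCoeff τ 0) *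
        (oddThetaCoeff τ s * exp (2 * π * I * z * s)) := by
  set K := (∑' m, oddThetaCoeff τ m * appellFactor τ z (0 - m)) / oddThetaCoeff τ 0 with hK
  have hstep : ∀ s : ℤ, oddThetaCoeff τ (s + 1) * exp (2 * π * I * z * (s + 1 : ℤ)) =
      -exp (2 * π * I * (z + (s + 1) * τ)) * (oddThetaCoeff τ s * exp (2 * π * I * z * s)) := by
    intro s
    rw [oddThetaCoeff_succ, show 2 * π * I * z * ((s + 1 : ℤ) : ℂ) = 2 * π * I * z * s +
      2 * π * I * z by push_cast; ring, show 2 * π * I * (z + (s + 1) * τ) =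
      2 * π * I * ((s + 1) * τ) + 2 * π * I * z by ring, Complex.exp_add, Complex.exp_add]
    ring
  induction s using Int.induction_on with
  | zero =>
    simp only [Int.cast_zero, mul_zero, Complex.exp_zero, mul_one]
    rw [hK, div_mul_cancel₀ _ (oddThetaCoeff_ne_zero τ 0)]
  | succ s ih =>
    rw [tsum_oddThetaCoeff_mul_appellFactor_succ hτ hz, ih, hstep]
    ring
  | pred s ih =>
    have h1 := tsum_oddThetaCoeff_mul_appellFactor_succ hτ hz (-(s : ℤ) - 1)
    have h2 := hstep (-(s : ℤ) - 1)
    rw [sub_add_cancel] at h1 h2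
    rw [h2, h1] at ih
    have h3 : -exp (2 * π * I * (z + (((-(s : ℤ) - 1 : ℤ) : ℂ) + 1) * τ)) ≠ 0 :=
      neg_ne_zero.2 (Complex.exp_ne_zero _)
    refine mul_left_cancel₀ h3 ?_
    rw [ih]
    ring

/-- The double series does not converge absolutely as it stands. Subtracting `A_s ∑ t_m = 0` from
each inner sum makes it so; after the exchange the differences `A_s - A_{s-m}` telescope to `m`, and
Jacobi's identity evaluates `∑ m t_m`. -/
lemma tsum_tsum_oddThetaCoeff_mul_appellFactor {τ z : ℂ} (hτ : 0 < τ.im)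
    (hz : ∀ m n : ℤ, z ≠ m * τ + n) :
    ∑' s, ∑' m, oddThetaCoeff τ m * appellFactor τ z (s - m) = -(I * ModularForm.eta τ ^ 3) := by
  have h0 := summable_oddThetaCoeff hτ
  have h1 : ∀ s, ∑' m, oddThetaCoeff τ m * appellFactor τ z (s - m) =
      ∑' m, -(oddThetaCoeff τ m * (appellFactor τ z s - appellFactor τ z (s - m))) := by
    intro s
    have := (summable_mul_appellFactor hτ hz h0 (fun m => s - m)).tsum_sub
      (h0.mul_right (appellFactor τ z s))
    rw [tsum_mul_right, tsum_oddThetaCoeff, zero_mul, sub_zero] at this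
    rw [← this]
    exact tsum_congr fun m => by ring
  obtain ⟨C, hC, hb⟩ := exists_appellFactor_sub_bound hτ hz
  have hsum : Summable (fun p : ℤ × ℤ =>
      -(oddThetaCoeff τ p.2 * (appellFactor τ z p.1 - appellFactor τ z (p.1 - p.2)))) := by
    have hA := summable_exp_neg_mul_abs (c := 2 * π * τ.im) (by positivity)
    have hB := summable_oddThetaCoeff_mul hτ 0 (2 * π * τ.im)
    have hAB := (hA.mul_of_nonneg hB (fun _ => by positivity) (fun _ => by positivity)).mul_left C
    refine Summable.of_norm_bounded hAB fun p => ?_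
    rw [norm_neg, norm_mul, pow_zero, one_mul]
    calc _ ≤ ‖oddThetaCoeff τ p.2‖ * _ := mul_le_mul_of_nonneg_left (hb p.1 p.2) (norm_nonneg _)
      _ = _ := by ring
  rw [tsum_congr h1, ← hsum.tsum_comm (f := fun s m =>
    -(oddThetaCoeff τ m * (appellFactor τ z s - appellFactor τ z (s - m))))]
  have h2 : ∀ m : ℤ, ∑' s, -(oddThetaCoeff τ m * (appellFactor τ z s - appellFactor τ z (s - m))) =
      -(1 / 2) * ((2 * m + 1) * oddThetaCoeff τ m) + (1 / 2) * oddThetaCoeff τ m := by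
    intro m
    rw [tsum_neg, tsum_mul_left, (hasSum_appellFactor_sub hτ hz m).tsum_eq]
    ring
  -- Convergence comes for free: a divergent series would have sum `0` by convention, whereas the
  -- sum is `2iη³ ≠ 0`.
  have h3 : Summable (fun m : ℤ => (2 * (m : ℂ) + 1) * oddThetaCoeff τ m) := by
    by_contra hns
    have := tsum_mul_oddThetaCoeff hτ
    rw [tsum_eq_zero_of_not_summable hns] at this
    have he := ModularForm.eta_ne_zero (z := τ) hτ
    exact (mul_ne_zero (mul_ne_zero two_ne_zero I_ne_zero) (pow_ne_zero 3 he)) this.symm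
  rw [tsum_congr h2, (h3.mul_left _).tsum_add (h0.mul_left _), tsum_mul_left, tsum_mul_left,
    tsum_oddThetaCoeff, tsum_mul_oddThetaCoeff hτ]
  ring

/-- Kronecker's identity, in terms of Fourier coefficients. -/
lemma exists_kronecker {τ z : ℂ} (hτ : 0 < τ.im) (hz : ∀ m n : ℤ, z ≠ m * τ + n) :
    ∃ K : ℂ, (∀ s : ℤ, ∑' m, oddThetaCoeff τ m * appellFactor τ z (s - m) =
        K * (oddThetaCoeff τ s * exp (2 * π * I * z * s))) ∧
      K * theta11 τ z = -(I * ModularForm.eta τ ^ 3) * exp (π * I * z) := by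
  refine ⟨_, tsum_oddThetaCoeff_mul_appellFactor hτ hz, ?_⟩
  rw [← tsum_tsum_oddThetaCoeff_mul_appellFactor hτ hz,
    tsum_congr (tsum_oddThetaCoeff_mul_appellFactor hτ hz), tsum_mul_left, mul_assoc,
    ← tsum_mul_right, theta11_eq_tsum]
  congr 1
  refine tsum_congr fun m => ?_
  rw [mul_assoc (oddThetaCoeff τ m), ← Complex.exp_add]
  congr 2
  ring

/-- Kronecker's identity exhibits a multiple of `θ₁₁(z)` as a nonzero multiple of `η³`, so no zero
counting by contour integration is needed. -/
lemma theta11_ne_zero {τ z : ℂ} (hτ : 0 < τ.im) (hz : ∀ m n : ℤ, z ≠ m * τ + n) :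
    theta11 τ z ≠ 0 := by
  obtain ⟨K, -, h⟩ := exists_kronecker hτ hz
  intro h0
  rw [h0, mul_zero] at h
  have he := ModularForm.eta_ne_zero (z := τ) hτ
  exact (mul_ne_zero (neg_ne_zero.2 (mul_ne_zero I_ne_zero (pow_ne_zero 3 he)))
    (Complex.exp_ne_zero _)) h.symm

lemma theta11_add_lattice (τ z : ℂ) (m n : ℤ) :
    theta11 τ (z + (m * τ + n)) =
      (-1) ^ m * (-1) ^ n * exp (-(π * I * m ^ 2 * τ) - 2 * π * I * m * z) * theta11 τ z := by
  rw [theta11_eq_tsum, theta11_eq_tsum, ← tsum_mul_left, ← (Equiv.addRight m).tsum_eq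
    (fun l : ℤ => _ * (oddThetaCoeff τ l * exp (2 * π * I * z * (l + 1 / 2))))]
  refine tsum_congr fun l => ?_
  have h1 : exp (2 * π * I * (n * (l + 1 / 2))) = (-1) ^ n := by
    rw [show 2 * π * I * (n * (l + 1 / 2)) = 2 * π * I * ((n * l : ℤ) : ℂ) + n * (π * I) by
      push_cast; ring, Complex.exp_add, exp_two_pi_I_mul_int, Complex.exp_int_mul,
      Complex.exp_pi_mul_I, one_mul]
  have h2 : (-1 : ℂ) ^ m * (-1) ^ m = 1 := by
    rw [← mul_zpow]; simp
  rw [Equiv.coe_addRight, oddThetaCoeff, oddThetaCoeff, zpow_add₀ (by norm_num)]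
  rw [show 2 * π * I * (z + (m * τ + n)) * ((l : ℂ) + 1 / 2) = 2 * π * I * (n * (l + 1 / 2)) +
    2 * π * I * (z + m * τ) * ((l : ℂ) + 1 / 2) by ring, Complex.exp_add, h1]
  have h3 : exp (π * I * ((l : ℂ) + 1 / 2) ^ 2 * τ) * exp (2 * π * I * (z + m * τ) * (l + 1 / 2)) =
      exp (-(π * I * m ^ 2 * τ) - 2 * π * I * m * z) *
        (exp (π * I * (((l + m : ℤ) : ℂ) + 1 / 2) ^ 2 * τ) *
          exp (2 * π * I * z * (((l + m : ℤ) : ℂ) + 1 / 2))) := by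
    rw [← Complex.exp_add, ← Complex.exp_add, ← Complex.exp_add]
    congr 1
    push_cast
    ring
  calc _ = I * (-1) ^ l * (-1) ^ n * (exp (π * I * ((l : ℂ) + 1 / 2) ^ 2 * τ) *
        exp (2 * π * I * (z + m * τ) * (l + 1 / 2))) := by ring
    _ = _ := by
      rw [h3]
      linear_combination -(I * (-1) ^ l * (-1) ^ n * (exp (-(π * I * m ^ 2 * τ) - 2 * π * I * m * z) *
        (exp (π * I * (((l + m : ℤ) : ℂ) + 1 / 2) ^ 2 * τ) *
          exp (2 * π * I * z * (((l + m : ℤ) : ℂ) + 1 / 2))))) * h2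

/-! ### Analytic properties of the odd theta function: derivative, zeros and their simplicity. -/

lemma theta11_eq_jacobiTheta₂ (τ z : ℂ) :
    theta11 τ z = exp (π * I * (τ / 4 + z + 1 / 2)) * jacobiTheta₂ (z + 1 / 2 + τ / 2) τ := by
  rw [theta11, jacobiTheta₂, ← tsum_mul_left]
  refine tsum_congr fun n => ?_
  rw [jacobiTheta₂_term, ← Complex.exp_add]
  congr 1
  ring

/-- Differentiating termwise attaches the weight `πi (2m + 1)` to each coefficient, so Jacobi's
identity gives `πi · 2iη³`. -/
lemma hasDerivAt_theta11_zero {τ : ℂ} (hτ : 0 < τ.im) :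
    HasDerivAt (theta11 τ) (-(2 * π) * ModularForm.eta τ ^ 3) 0 := by
  have h1 : HasDerivAt (fun z => exp (π * I * (τ / 4 + z + 1 / 2)) *
      jacobiTheta₂ (z + 1 / 2 + τ / 2) τ)
      (exp (π * I * (τ / 4 + 0 + 1 / 2)) * (π * I) * jacobiTheta₂ (0 + 1 / 2 + τ / 2) τ +
        exp (π * I * (τ / 4 + 0 + 1 / 2)) * jacobiTheta₂' (0 + 1 / 2 + τ / 2) τ) 0 := by
    refine HasDerivAt.mul (HasDerivAt.cexp ?_) ?_
    · exact ((((hasDerivAt_id (0 : ℂ)).const_add (τ / 4)).add_const (1 / 2)).const_mul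
        (π * I : ℂ)).congr_deriv (mul_one _)
    · have := hasDerivAt_jacobiTheta₂_fst (0 + 1 / 2 + τ / 2) hτ
      rw [add_assoc] at this ⊢
      simp_rw [add_assoc]
      exact this.comp_add_const 0 (1 / 2 + τ / 2)
  refine (h1.congr_of_eventuallyEq (Eventually.of_forall (theta11_eq_jacobiTheta₂ τ))).congr_deriv ?_
  have hA := (hasSum_jacobiTheta₂_term (0 + 1 / 2 + τ / 2) hτ).mul_left
    (exp (π * I * (τ / 4 + 0 + 1 / 2)) * (π * I))
  have hB := (hasSum_jacobiTheta₂'_term (0 + 1 / 2 + τ / 2) hτ).mul_left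
    (exp (π * I * (τ / 4 + 0 + 1 / 2)))
  rw [← (hA.add hB).tsum_eq]
  have : ∀ n : ℤ, exp (π * I * (τ / 4 + 0 + 1 / 2)) * (π * I) *
      jacobiTheta₂_term n (0 + 1 / 2 + τ / 2) τ + exp (π * I * (τ / 4 + 0 + 1 / 2)) *
      jacobiTheta₂'_term n (0 + 1 / 2 + τ / 2) τ =
      π * I * ((2 * n + 1) * oddThetaCoeff τ n) := by
    intro n
    rw [jacobiTheta₂'_term, jacobiTheta₂_term, oddThetaCoeff, ← exp_pi_I_mul_int_add_half,
      ← Complex.exp_add]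
    have : exp (π * I * (τ / 4 + 0 + 1 / 2)) *
        exp (2 * π * I * n * (0 + 1 / 2 + τ / 2) + π * I * n ^ 2 * τ) =
        exp (π * I * (n + 1 / 2) + π * I * (n + 1 / 2) ^ 2 * τ) := by
      rw [← Complex.exp_add]; congr 1; ring
    linear_combination (π * I * (2 * n + 1)) * this
  rw [tsum_congr this, tsum_mul_left, tsum_mul_oddThetaCoeff hτ]
  linear_combination (2 * π * ModularForm.eta τ ^ 3) * I_mul_I

lemma theta11_zero (τ : ℂ) : theta11 τ 0 = 0 := by
  rw [theta11_eq_tsum]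
  simpa using tsum_oddThetaCoeff τ

lemma theta11_lattice (τ : ℂ) (m n : ℤ) : theta11 τ (m * τ + n) = 0 := by
  have := theta11_add_lattice τ 0 m n
  rwa [zero_add, theta11_zero, mul_zero] at this

lemma theta11_eq_zero_iff {τ z : ℂ} (hτ : 0 < τ.im) :
    theta11 τ z = 0 ↔ ∃ m n : ℤ, z = m * τ + n := by
  refine ⟨fun h => ?_, ?_⟩
  · by_contra! hz
    exact theta11_ne_zero hτ hz h
  · rintro ⟨m, n, rfl⟩
    exact theta11_lattice τ m n

lemma differentiable_theta11 {τ : ℂ} (hτ : 0 < τ.im) : Differentiable ℂ (theta11 τ) := by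
  intro z
  have h : theta11 τ = fun z => exp (π * I * (τ / 4 + z + 1 / 2)) *
      jacobiTheta₂ (z + 1 / 2 + τ / 2) τ := funext (theta11_eq_jacobiTheta₂ τ)
  rw [h]
  refine DifferentiableAt.mul (by fun_prop) ?_
  exact (differentiableAt_jacobiTheta₂_fst (z + 1 / 2 + τ / 2) hτ).comp z
    (f := fun z => z + 1 / 2 + τ / 2) (by fun_prop)

/-- Quasi-periodicity carries the simple zero at the origin to every lattice point. Simplicity is
what makes the singularities of the affine characters removable. -/
lemma deriv_theta11_lattice_ne_zero {τ : ℂ} (hτ : 0 < τ.im) (m n : ℤ) :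
    deriv (theta11 τ) (m * τ + n) ≠ 0 := by
  have h1 : HasDerivAt (fun z => theta11 τ (z + (m * τ + n)))
      (deriv (theta11 τ) (m * τ + n)) 0 := by
    have := (differentiable_theta11 hτ (0 + (m * τ + n))).hasDerivAt
    simpa using this.comp_add_const (0 : ℂ) (m * τ + n)
  have h2 : HasDerivAt (fun z => (-1) ^ m * (-1) ^ n *
      exp (-(π * I * m ^ 2 * τ) - 2 * π * I * m * z) * theta11 τ z)
      ((-1) ^ m * (-1) ^ n * exp (-(π * I * m ^ 2 * τ) - 2 * π * I * m * 0) *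
        (-(2 * π) * ModularForm.eta τ ^ 3)) 0 := by
    have hd : DifferentiableAt ℂ (fun z : ℂ => (-1 : ℂ) ^ m * (-1) ^ n *
      exp (-(π * I * m ^ 2 * τ) - 2 * π * I * m * z)) 0 := by fun_prop
    refine (hd.hasDerivAt.mul (hasDerivAt_theta11_zero hτ)).congr_deriv ?_
    rw [theta11_zero]; ring
  rw [h1.unique (h2.congr_of_eventuallyEq
    (Eventually.of_forall fun z => theta11_add_lattice τ z m n))]
  have he := ModularForm.eta_ne_zero (z := τ) hτ
  refine mul_ne_zero (mul_ne_zero (mul_ne_zero ?_ ?_) (Complex.exp_ne_zero _))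
    (mul_ne_zero (by simp) (pow_ne_zero 3 he)) <;> exact zpow_ne_zero _ (by norm_num)

/-- Off the lattice is an open condition on `(τ, z)`. -/
lemma isOpen_setOf_not_lattice :
    IsOpen {p : ℂ × ℂ | 0 < p.1.im ∧ ∀ m n : ℤ, p.2 ≠ m * p.1 + n} := by
  rw [isOpen_iff_mem_nhds]
  rintro ⟨τ, z⟩ ⟨hτ, hz⟩
  -- On the half plane, the complement of the lattice is where the jointly continuous function `θ₁₁`
  -- does not vanish, so openness follows.
  have hc : ContinuousAt (fun p : ℂ × ℂ => theta11 p.1 p.2) (τ, z) := by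
    have h : (fun p : ℂ × ℂ => theta11 p.1 p.2) = fun p : ℂ × ℂ =>
      exp (π * I * (p.1 / 4 + p.2 + 1 / 2)) * jacobiTheta₂ (p.2 + 1 / 2 + p.1 / 2) p.1 :=
      funext fun p => theta11_eq_jacobiTheta₂ p.1 p.2
    rw [h]
    refine ContinuousAt.mul (by fun_prop) ?_
    have := continuousAt_jacobiTheta₂ (z + 1 / 2 + τ / 2) hτ
    exact this.comp (f := fun p : ℂ × ℂ => (p.2 + 1 / 2 + p.1 / 2, p.1)) (x := (τ, z)) (by fun_prop)
  have h1 : ∀ᶠ p : ℂ × ℂ in 𝓝 (τ, z), theta11 p.1 p.2 ≠ 0 :=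
    hc.eventually_ne (theta11_ne_zero hτ hz)
  have h2 : ∀ᶠ p : ℂ × ℂ in 𝓝 (τ, z), 0 < p.1.im :=
    (continuous_im.comp continuous_fst).continuousAt.eventually_const_lt (u := 0) hτ
  filter_upwards [h1, h2] with p hp1 hp2
  refine ⟨hp2, fun m n h => hp1 ?_⟩
  rw [h]
  exact theta11_lattice _ _ _

/-! ### Quotients of entire functions -/

/-- Filling in the removable singularities of `f / g` by limits gives an entire function. -/
lemma differentiable_limUnder_div {f g : ℂ → ℂ} (hf : Differentiable ℂ f)
    (hg : Differentiable ℂ g) (h : ∀ z, g z = 0 → f z = 0 ∧ deriv g z ≠ 0) :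
    Differentiable ℂ (fun z => limUnder (𝓝[≠] z) fun x => f x / g x) ∧
      (∀ z, (limUnder (𝓝[≠] z) fun x => f x / g x) * g z = f z) ∧
      ∀ z, g z = 0 → (limUnder (𝓝[≠] z) fun x => f x / g x) = deriv f z / deriv g z := by
  -- Near a zero of `g` the quotient is modelled by the quotient of the divided slopes of `f` and
  -- `g`, which is holomorphic because `g` has a simple zero; elsewhere the model is `f / g` itself.
  have key : ∀ z₀ : ℂ, ∃ h : ℂ → ℂ, (∀ᶠ x in 𝓝 z₀, DifferentiableAt ℂ h x) ∧
      (∀ᶠ x in 𝓝[≠] z₀, f x / g x = h x) ∧ (g z₀ ≠ 0 → h z₀ = f z₀ / g z₀) ∧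
      (g z₀ = 0 → h z₀ = deriv f z₀ / deriv g z₀) := by
    intro z₀
    by_cases hz : g z₀ = 0
    · obtain ⟨hfz, hgz⟩ := h z₀ hz
      have hdf : Differentiable ℂ (dslope f z₀) := by
        rw [← differentiableOn_univ] at hf ⊢
        exact (Complex.differentiableOn_dslope univ_mem).2 hf
      have hdg : Differentiable ℂ (dslope g z₀) := by
        rw [← differentiableOn_univ] at hg ⊢
        exact (Complex.differentiableOn_dslope univ_mem).2 hg
      refine ⟨fun x => dslope f z₀ x / dslope g z₀ x, ?_, ?_, fun h => absurd hz h,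
        fun _ => by simp⟩
      · have : ∀ᶠ x in 𝓝 z₀, dslope g z₀ x ≠ 0 :=
          hdg.continuous.continuousAt.eventually_ne (by simpa using hgz)
        filter_upwards [this] with x hx
        exact (hdf x).div (hdg x) hx
      · filter_upwards [self_mem_nhdsWithin] with x hx
        have hx' : x - z₀ ≠ 0 := sub_ne_zero.2 hx
        rw [dslope_of_ne _ hx, dslope_of_ne _ hx, slope_def_field, slope_def_field, hfz, hz,
          sub_zero, sub_zero, div_div_div_cancel_right₀ hx']
    · refine ⟨fun x => f x / g x, ?_, Eventually.of_forall fun _ => rfl, fun _ => rfl,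
        fun h => absurd h hz⟩
      filter_upwards [hg.continuous.continuousAt.eventually_ne hz] with x hx
      exact (hf x).div (hg x) hx
  -- The limits taken at all points near `z₀` are values of the one local model at `z₀`, hence the
  -- filled-in function is differentiable there.
  have key2 : ∀ z₀ : ℂ, ∃ h : ℂ → ℂ, DifferentiableAt ℂ h z₀ ∧
      (∀ᶠ x in 𝓝 z₀, (limUnder (𝓝[≠] x) fun x => f x / g x) = h x) ∧
      (g z₀ ≠ 0 → h z₀ = f z₀ / g z₀) ∧ (g z₀ = 0 → h z₀ = deriv f z₀ / deriv g z₀) := by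
    intro z₀
    obtain ⟨h, hd, he, h1, h2⟩ := key z₀
    refine ⟨h, hd.self_of_nhds, ?_, h1, h2⟩
    rw [eventually_nhdsWithin_iff] at he
    filter_upwards [hd, he.eventually_nhds] with x hx hx'
    have hE : (fun y => f y / g y) =ᶠ[𝓝[≠] x] h := by
      by_cases hxz : x = z₀
      · subst hxz
        rw [Filter.EventuallyEq, eventually_nhdsWithin_iff]
        exact hx'
      · have : ∀ᶠ y in 𝓝 x, y ≠ z₀ := isOpen_ne.mem_nhds hxz
        refine eventually_nhdsWithin_of_eventually_nhds ?_
        filter_upwards [hx', this] with y hy hy'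
        exact hy hy'
    exact Tendsto.limUnder_eq
      ((hx.continuousAt.tendsto.mono_left nhdsWithin_le_nhds).congr' hE.symm)
  refine ⟨fun z₀ => ?_, fun z₀ => ?_, fun z₀ hz => ?_⟩
  · obtain ⟨h, hd, he, -, -⟩ := key2 z₀
    exact hd.congr_of_eventuallyEq he
  · obtain ⟨F, -, he, h1, -⟩ := key2 z₀
    rw [he.self_of_nhds]
    by_cases hz : g z₀ = 0
    · rw [hz, mul_zero, (h z₀ hz).1]
    · rw [h1 hz, div_mul_cancel₀ _ hz]
  · obtain ⟨F, -, he, -, h2⟩ := key2 z₀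
    rw [he.self_of_nhds, h2 hz]

/-! ### The numerator of the affine characters -/

/-- The difference `ϑ_{k,j} - ϑ_{k,-j}` at `(τ; ζ/2)`. -/
def thetaNum (k : ℕ) (j : ℤ) (τ ζ : ℂ) : ℂ :=
  levelTheta k j τ (ζ / 2) - levelTheta k (-j) τ (ζ / 2)

/-- The odd indicator function of the residue classes of `j` and `-j` modulo `2k`. -/
def oddResidue (k : ℕ) (j p : ℤ) : ℂ :=
  (if (2 * k : ℤ) ∣ p - j then 1 else 0) - (if (2 * k : ℤ) ∣ p + j then 1 else 0)

lemma norm_oddResidue_le (k : ℕ) (j p : ℤ) : ‖oddResidue k j p‖ ≤ 2 := by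
  rw [oddResidue]
  refine (norm_sub_le _ _).trans ?_
  split_ifs <;> norm_num

lemma oddResidue_neg (k : ℕ) (j p : ℤ) : oddResidue k j (-p) = -oddResidue k j p := by
  have h1 : (2 * k : ℤ) ∣ -p - j ↔ (2 * k : ℤ) ∣ p + j := by
    rw [← Int.dvd_neg]; ring_nf
  have h2 : (2 * k : ℤ) ∣ -p + j ↔ (2 * k : ℤ) ∣ p - j := by
    rw [← Int.dvd_neg]; ring_nf
  simp only [oddResidue, h1, h2, neg_sub]

lemma oddResidue_add (k : ℕ) (j p m : ℤ) : oddResidue k j (p + 2 * k * m) = oddResidue k j p := by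
  have h1 : (2 * k : ℤ) ∣ p + 2 * k * m - j ↔ (2 * k : ℤ) ∣ p - j := by
    rw [show p + 2 * k * m - j = p - j + 2 * k * m by ring]
    exact Int.dvd_add_left (Dvd.intro _ rfl)
  have h2 : (2 * k : ℤ) ∣ p + 2 * k * m + j ↔ (2 * k : ℤ) ∣ p + j := by
    rw [show p + 2 * k * m + j = p + j + 2 * k * m by ring]
    exact Int.dvd_add_left (Dvd.intro _ rfl)
  simp only [oddResidue, h1, h2]

/-- The theta exponential `q ^ (p² / 4k)`. -/
def thetaExp (k : ℕ) (τ : ℂ) (p : ℤ) : ℂ := exp (2 * π * I * ((p : ℂ) ^ 2 / (4 * k)) * τ)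

lemma norm_thetaExp (k : ℕ) (τ : ℂ) (p : ℤ) :
    ‖thetaExp k τ p‖ = Real.exp (-(π * τ.im / (2 * k)) * (p : ℝ) ^ 2) := by
  rw [thetaExp, show 2 * π * I * ((p : ℂ) ^ 2 / (4 * k)) * τ =
    2 * π * I * (((p ^ 2 / (4 * k) : ℝ) : ℂ) * τ) by push_cast; ring, norm_exp_two_pi_I_mul,
    im_ofReal_mul]
  congr 1
  ring

lemma summable_thetaExp_mul {k : ℕ} (hk : k ≠ 0) {τ : ℂ} (hτ : 0 < τ.im) (j : ℕ) (b : ℝ) :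
    Summable (fun p : ℤ => ‖thetaExp k τ p‖ * (|(p : ℝ)| ^ j * Real.exp (b * |(p : ℝ)|))) := by
  have hk' : (0 : ℝ) < k := by exact_mod_cast Nat.pos_of_ne_zero hk
  refine (summable_pow_mul_gaussian j b (c := π * τ.im / (2 * k)) (by positivity)).congr fun p => ?_
  rw [norm_thetaExp, Real.exp_add]
  ring

lemma norm_exp_pi_I_mul_le (p : ℤ) (ζ : ℂ) :
    ‖exp (π * I * p * ζ)‖ ≤ Real.exp (π * |ζ.im| * |(p : ℝ)|) := by
  rw [show π * I * p * ζ = 2 * π * I * (((p / 2 : ℝ) : ℂ) * ζ) by push_cast; ring,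
    norm_exp_two_pi_I_mul, im_ofReal_mul]
  refine Real.exp_le_exp.2 ?_
  have : -(p * ζ.im) ≤ |ζ.im| * |(p : ℝ)| := by
    rw [← abs_mul, mul_comm]; exact neg_le_abs _
  nlinarith [Real.pi_pos]

lemma summable_thetaExp_mul_exp {k : ℕ} (hk : k ≠ 0) {τ : ℂ} (hτ : 0 < τ.im) (ζ : ℂ) :
    Summable (fun p : ℤ => thetaExp k τ p * exp (π * I * p * ζ)) := by
  refine Summable.of_norm_bounded (summable_thetaExp_mul hk hτ 0 (π * |ζ.im|)) fun p => ?_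
  rw [norm_mul, pow_zero, one_mul]
  exact mul_le_mul_of_nonneg_left (norm_exp_pi_I_mul_le p ζ) (norm_nonneg _)

lemma levelTheta_half_eq_tsum {k : ℕ} (hk : k ≠ 0) (r : ℤ) (τ ζ : ℂ) :
    levelTheta k r τ (ζ / 2) =
      ∑' p : ℤ, if (2 * k : ℤ) ∣ p - r then thetaExp k τ p * exp (π * I * p * ζ) else 0 := by
  rw [← tsum_residueClass (by simpa using hk), levelTheta]
  refine tsum_congr fun n => ?_
  rw [thetaExp, ← Complex.exp_add]
  congr 1
  ring

lemma thetaNum_eq_tsum {k : ℕ} (hk : k ≠ 0) (j : ℤ) {τ : ℂ} (hτ : 0 < τ.im) (ζ : ℂ) :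
    thetaNum k j τ ζ = ∑' p : ℤ, oddResidue k j p * thetaExp k τ p * exp (π * I * p * ζ) := by
  have hs := summable_thetaExp_mul_exp hk hτ ζ
  rw [thetaNum, levelTheta_half_eq_tsum hk, levelTheta_half_eq_tsum hk,
    ← (summable_residueClass _ _ hs).tsum_sub (summable_residueClass _ _ hs)]
  refine tsum_congr fun p => ?_
  rw [oddResidue, sub_neg_eq_add]
  split_ifs <;> ring

lemma thetaExp_neg_sub (k : ℕ) (hk : k ≠ 0) (τ : ℂ) (p m : ℤ) :
    thetaExp k τ (p + 2 * k * m) =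
      thetaExp k τ p * exp (2 * π * I * ((m * p + k * m ^ 2 : ℤ) * τ)) := by
  have : (k : ℂ) ≠ 0 := by exact_mod_cast hk
  rw [thetaExp, thetaExp, ← Complex.exp_add]
  congr 1
  push_cast
  field_simp
  ring

/-- At a lattice point the involution `p ↦ -p - 2km` preserves the exponential up to an integral
phase and changes the sign of the odd residue indicator, so the series cancels. -/
lemma thetaNum_lattice {k : ℕ} (hk : k ≠ 0) (j : ℤ) {τ : ℂ} (hτ : 0 < τ.im) (m n : ℤ) :
    thetaNum k j τ (m * τ + n) = 0 := by
  rw [thetaNum_eq_tsum hk j hτ]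
  have h := ((Equiv.neg ℤ).trans (Equiv.addRight (2 * k * -m))).tsum_eq
    (fun p : ℤ => oddResidue k j p * thetaExp k τ p * exp (π * I * p * (m * τ + n)))
  have h2 : ∀ p : ℤ, oddResidue k j (-p + 2 * k * -m) * thetaExp k τ (-p + 2 * k * -m) *
      exp (π * I * ((-p + 2 * k * -m : ℤ) : ℂ) * (m * τ + n)) =
      -(oddResidue k j p * thetaExp k τ p * exp (π * I * p * (m * τ + n))) := by
    intro p
    rw [oddResidue_add, oddResidue_neg, thetaExp_neg_sub k hk]
    have : thetaExp k τ (-p) = thetaExp k τ p := by simp [thetaExp]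
    rw [this]
    have : exp (2 * π * I * ((-m * -p + k * (-m) ^ 2 : ℤ) * τ)) *
        exp (π * I * ((-p + 2 * k * -m : ℤ) : ℂ) * (m * τ + n)) =
        exp (π * I * p * (m * τ + n)) := by
      rw [← Complex.exp_add, show 2 * π * I * ((-m * -p + k * (-m) ^ 2 : ℤ) * τ) +
        π * I * ((-p + 2 * k * -m : ℤ) : ℂ) * (m * τ + n) =
        π * I * p * (m * τ + n) + 2 * π * I * ((-(n * p) - k * m * n : ℤ) : ℂ) by push_cast; ring,
        Complex.exp_add, exp_two_pi_I_mul_int, mul_one]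
    linear_combination (-oddResidue k j p * thetaExp k τ p) * this
  simp only [Equiv.trans_apply, Equiv.neg_apply, Equiv.coe_addRight, h2] at h
  rw [tsum_neg] at h
  exact self_eq_neg.1 h.symm

lemma thetaNum_add_two {k : ℕ} (hk : k ≠ 0) (j : ℤ) {τ : ℂ} (hτ : 0 < τ.im) (ζ : ℂ) :
    thetaNum k j τ (ζ + 2) = thetaNum k j τ ζ := by
  rw [thetaNum_eq_tsum hk j hτ, thetaNum_eq_tsum hk j hτ]
  refine tsum_congr fun p => ?_
  rw [show π * I * p * (ζ + 2) = π * I * p * ζ + 2 * π * I * p by ring, Complex.exp_add,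
    exp_two_pi_I_mul_int, mul_one]

lemma thetaNum_add_two_mul {k : ℕ} (hk : k ≠ 0) (j : ℤ) {τ : ℂ} (hτ : 0 < τ.im) (ζ : ℂ) :
    thetaNum k j τ (ζ + 2 * τ) = exp (-(2 * π * I * (k * (τ + ζ)))) * thetaNum k j τ ζ := by
  rw [thetaNum_eq_tsum hk j hτ, thetaNum_eq_tsum hk j hτ, ← tsum_mul_left,
    ← (Equiv.addRight (2 * k * 1 : ℤ)).tsum_eq (fun p : ℤ => exp (-(2 * π * I * (k * (τ + ζ)))) *
      (oddResidue k j p * thetaExp k τ p * exp (π * I * p * ζ)))]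
  refine tsum_congr fun p => ?_
  rw [Equiv.coe_addRight, oddResidue_add, thetaExp_neg_sub k hk]
  have : exp (π * I * p * (ζ + 2 * τ)) = exp (-(2 * π * I * (k * (τ + ζ)))) *
      (exp (2 * π * I * ((1 * p + k * 1 ^ 2 : ℤ) * τ)) *
        exp (π * I * ((p + 2 * k * 1 : ℤ) : ℂ) * ζ)) := by
    rw [← Complex.exp_add, ← Complex.exp_add]
    congr 1
    push_cast
    ring
  rw [this]
  ring

lemma levelTheta_eq_jacobiTheta₂ {k : ℕ} (hk : k ≠ 0) (r : ℤ) (τ x : ℂ) :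
    levelTheta k r τ x = exp (2 * π * I * ((r : ℂ) ^ 2 / (4 * k)) * τ + 2 * π * I * r * x) *
      jacobiTheta₂ (2 * k * x + r * τ) (2 * k * τ) := by
  have : (k : ℂ) ≠ 0 := by exact_mod_cast hk
  rw [levelTheta, jacobiTheta₂, ← tsum_mul_left]
  refine tsum_congr fun n => ?_
  rw [jacobiTheta₂_term, ← Complex.exp_add]
  congr 1
  push_cast
  field_simp
  ring

lemma two_mul_natCast_mul_im_pos {k : ℕ} (hk : k ≠ 0) {τ : ℂ} (hτ : 0 < τ.im) :
    0 < (2 * k * τ : ℂ).im := by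
  have hk' : (0 : ℝ) < k := by exact_mod_cast Nat.pos_of_ne_zero hk
  have : (2 * k * τ : ℂ).im = 2 * k * τ.im := by
    rw [show (2 * k * τ : ℂ) = ((2 * k : ℝ) : ℂ) * τ by push_cast; ring, im_ofReal_mul]
  rw [this]
  positivity

lemma differentiable_levelTheta {k : ℕ} (hk : k ≠ 0) (r : ℤ) {τ : ℂ} (hτ : 0 < τ.im) :
    Differentiable ℂ (levelTheta k r τ) := by
  intro x
  rw [funext (levelTheta_eq_jacobiTheta₂ hk r τ)]
  refine DifferentiableAt.mul (by fun_prop) ?_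
  exact (differentiableAt_jacobiTheta₂_fst (2 * k * x + r * τ)
    (two_mul_natCast_mul_im_pos hk hτ)).comp x (f := fun x => 2 * k * x + r * τ) (by fun_prop)

lemma differentiable_thetaNum {k : ℕ} (hk : k ≠ 0) (j : ℤ) {τ : ℂ} (hτ : 0 < τ.im) :
    Differentiable ℂ (thetaNum k j τ) := by
  have h1 := differentiable_levelTheta hk j hτ
  have h2 := differentiable_levelTheta hk (-j) hτ
  unfold thetaNum
  fun_prop

/-- At level `2` only odd `p = 2m + 1` survive, with sign `(-1) ^ m`, which is the expansion of
`θ₁₁`. Thus the denominator of every affine character is a multiple of `θ₁₁`. -/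
lemma thetaNum_two_one {τ : ℂ} (hτ : 0 < τ.im) (ζ : ℂ) :
    thetaNum 2 1 τ ζ = -(I * theta11 τ ζ) := by
  rw [thetaNum_eq_tsum two_ne_zero 1 hτ, theta11_eq_tsum, ← tsum_mul_left, ← tsum_neg]
  have hinj : Function.Injective (fun m : ℤ => 2 * m + 1) := fun a b h => by
    simpa using h
  rw [← hinj.tsum_eq]
  · refine tsum_congr fun m => ?_
    have h1 : oddResidue 2 1 (2 * m + 1) = (-1) ^ m := by
      rcases Int.even_or_odd' m with ⟨l, rfl | rfl⟩
      · have e1 : ((2 * (2 : ℕ) : ℤ)) ∣ 2 * (2 * l) + 1 - 1 := ⟨l, by push_cast; ring⟩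
        have e2 : ¬ ((2 * (2 : ℕ) : ℤ)) ∣ 2 * (2 * l) + 1 + 1 := by omega
        rw [oddResidue, if_pos e1, if_neg e2, zpow_mul]; norm_num
      · have e1 : ¬ ((2 * (2 : ℕ) : ℤ)) ∣ 2 * (2 * l + 1) + 1 - 1 := by omega
        have e2 : ((2 * (2 : ℕ) : ℤ)) ∣ 2 * (2 * l + 1) + 1 + 1 := ⟨l + 1, by push_cast; ring⟩
        rw [oddResidue, if_neg e1, if_pos e2, zpow_add₀ (by norm_num), zpow_mul]; norm_num
    rw [h1, oddThetaCoeff, thetaExp]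
    have h2 : exp (2 * π * I * (((2 * m + 1 : ℤ) : ℂ) ^ 2 / (4 * (2 : ℕ))) * τ) *
        exp (π * I * ((2 * m + 1 : ℤ) : ℂ) * ζ) =
        exp (π * I * ((m : ℂ) + 1 / 2) ^ 2 * τ) * exp (2 * π * I * ζ * (m + 1 / 2)) := by
      rw [← Complex.exp_add, ← Complex.exp_add]
      congr 1
      push_cast
      ring
    linear_combination (-1) ^ m * h2 + ((-1) ^ m * exp (π * I * ((m : ℂ) + 1 / 2) ^ 2 * τ) *
      exp (2 * π * I * ζ * (m + 1 / 2))) * I_mul_I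
  · intro p hp
    by_contra hne
    have hev : ¬ ∃ m : ℤ, 2 * m + 1 = p := fun ⟨m, hm⟩ => hne ⟨m, hm⟩
    have e1 : ¬ ((2 * (2 : ℕ) : ℤ)) ∣ p - 1 := fun ⟨c, hc⟩ => hev ⟨2 * c, by push_cast at hc; omega⟩
    have e2 : ¬ ((2 * (2 : ℕ) : ℤ)) ∣ p + 1 := fun ⟨c, hc⟩ =>
      hev ⟨2 * c - 1, by push_cast at hc; omega⟩
    exact hp (by simp only [oddResidue, if_neg e1, if_neg e2, sub_zero, zero_mul])

/-! ### The affine characters -/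

/-- The numerator vanishes on the lattice and the denominator has simple zeros exactly there, so the
quotient extends to an entire function; its value at `0` is the quotient of derivatives. -/
lemma affineChar_spec {k : ℕ} (hk : k ≠ 0) (l : ℤ) {τ : ℂ} (hτ : 0 < τ.im) :
    Differentiable ℂ (affineChar k l τ) ∧
      (∀ ζ, affineChar k l τ ζ * theta11 τ ζ = I * thetaNum k (l + 1) τ ζ) ∧
      affineChar k l τ 0 = deriv (thetaNum k (l + 1) τ) 0 / (2 * π * I * ModularForm.eta τ ^ 3) := by
  have hg : Differentiable ℂ (thetaNum 2 1 τ) := differentiable_thetaNum two_ne_zero 1 hτ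
  have hfun : thetaNum 2 1 τ = fun ζ => -I * theta11 τ ζ := funext fun ζ => by
    rw [thetaNum_two_one hτ]; ring
  have hd : ∀ ζ, deriv (thetaNum 2 1 τ) ζ = -I * deriv (theta11 τ) ζ := fun ζ => by
    rw [hfun, deriv_const_mul_field]
  obtain ⟨h1, h2, h3⟩ := differentiable_limUnder_div
    (differentiable_thetaNum hk (l + 1) hτ) hg (fun ζ hζ => by
      rw [hfun] at hζ
      obtain ⟨m, n, rfl⟩ := (theta11_eq_zero_iff hτ).1
        ((mul_eq_zero.1 hζ).resolve_left (neg_ne_zero.2 I_ne_zero))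
      refine ⟨thetaNum_lattice hk _ hτ m n, ?_⟩
      rw [hd]
      exact mul_ne_zero (neg_ne_zero.2 I_ne_zero) (deriv_theta11_lattice_ne_zero hτ m n))
  refine ⟨h1, fun ζ => ?_, ?_⟩
  · have h4 : affineChar k l τ ζ * thetaNum 2 1 τ ζ = thetaNum k (l + 1) τ ζ := h2 ζ
    rw [thetaNum_two_one hτ] at h4
    linear_combination I * h4 + (affineChar k l τ ζ * theta11 τ ζ) * I_mul_I
  · refine (h3 0 (by rw [hfun]; simp [theta11_zero])).trans ?_
    rw [hd, (hasDerivAt_theta11_zero hτ).deriv]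
    congr 1
    ring

/-- The zeros of `θ₁₁` are countable, so their complement is dense. This lets functional equations
be proved after multiplication by `θ₁₁` and then divided. -/
lemma eq_of_mul_theta11_eq {τ : ℂ} (hτ : 0 < τ.im) {A B : ℂ → ℂ} (hA : Continuous A)
    (hB : Continuous B) (h : ∀ ζ, A ζ * theta11 τ ζ = B ζ * theta11 τ ζ) : A = B := by
  have hc : (Set.range fun p : ℤ × ℤ => (p.1 : ℂ) * τ + p.2).Countable := Set.countable_range _
  refine hA.ext_on (hc.dense_compl ℝ) hB fun ζ hζ => ?_
  refine mul_right_cancel₀ (theta11_ne_zero hτ fun m n hmn => hζ ⟨(m, n), hmn.symm⟩) (h ζ)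

lemma affineChar_add_two {k : ℕ} (hk : k ≠ 0) (l : ℤ) {τ : ℂ} (hτ : 0 < τ.im) (ζ : ℂ) :
    affineChar k l τ (ζ + 2) = affineChar k l τ ζ := by
  obtain ⟨h1, h2, -⟩ := affineChar_spec hk l hτ
  have hc := h1.continuous
  refine congrFun (eq_of_mul_theta11_eq hτ (A := fun ζ => affineChar k l τ (ζ + 2))
    (by fun_prop) hc fun ζ => ?_) ζ
  have h3 := theta11_add_lattice τ ζ 0 2
  simp only [Int.cast_zero, zero_mul, zero_add, Int.cast_ofNat, zpow_zero, one_mul, mul_zero,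
    neg_zero, sub_zero, Complex.exp_zero, mul_one, ne_eq, OfNat.ofNat_ne_zero, not_false_eq_true,
    zero_pow] at h3
  have h4 : theta11 τ (ζ + 2) = theta11 τ ζ := by rw [h3]; norm_num
  rw [h2 ζ, ← thetaNum_add_two hk _ hτ, ← h2, h4]

/-- The numerator has index `k` and the denominator index `2` under `ζ ↦ ζ + 2τ`; the character
inherits the difference `k - 2`. -/
lemma affineChar_add_two_mul {k : ℕ} (hk : k ≠ 0) (l : ℤ) {τ : ℂ} (hτ : 0 < τ.im) (ζ : ℂ) :
    affineChar k l τ (ζ + 2 * τ) =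
      exp (-(2 * π * I * ((k - 2) * (τ + ζ)))) * affineChar k l τ ζ := by
  obtain ⟨h1, h2, -⟩ := affineChar_spec hk l hτ
  have hc := h1.continuous
  refine congrFun (eq_of_mul_theta11_eq hτ (A := fun ζ => affineChar k l τ (ζ + 2 * τ))
    (B := fun ζ => exp (-(2 * π * I * ((k - 2) * (τ + ζ)))) * affineChar k l τ ζ)
    (by fun_prop) (by fun_prop) fun ζ => ?_) ζ
  have h3 := theta11_add_lattice τ ζ 2 0
  simp only [Int.cast_zero, Int.cast_ofNat, zpow_zero, mul_one, add_zero] at h3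
  have h5 := h2 (ζ + 2 * τ)
  rw [thetaNum_add_two_mul hk _ hτ, h3] at h5
  have hE : exp (-(2 * π * I * (k * (τ + ζ)))) = exp (-(2 * π * I * ((k - 2) * (τ + ζ)))) *
      exp (-(π * I * 2 ^ 2 * τ) - 2 * π * I * 2 * ζ) := by
    rw [← Complex.exp_add]; congr 1; ring
  rw [hE] at h5
  have hne := Complex.exp_ne_zero (-(π * I * 2 ^ 2 * τ) - 2 * π * I * 2 * ζ)
  norm_num only at h5 hne ⊢
  refine mul_left_cancel₀ hne ?_
  linear_combination h5 - exp (-(2 * π * I * ((k - 2) * (τ + ζ)))) *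
    exp (-(π * I * 4 * τ) - 2 * π * I * 2 * ζ) * h2 ζ

/-! ### Fourier coefficients of the affine characters -/

/-- The integral of a `2`-periodic entire function over a horizontal period does not depend on the
height. -/
lemma intervalIntegral_add_of_periodic {F : ℂ → ℂ} (hF : Differentiable ℂ F)
    (hper : ∀ ζ, F (ζ + 2) = F ζ) (w : ℂ) :
    ∫ x in (0 : ℝ)..2, F (x + w) = ∫ x in (0 : ℝ)..2, F x := by
  -- Cauchy's theorem on the rectangle of width `2`: the vertical sides cancel by periodicity. The
  -- real part of `w` is removed afterwards by periodicity along the line.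
  have h1 := Complex.integral_boundary_rect_eq_zero_of_differentiableOn F 0 (2 + w.im * I)
    hF.differentiableOn
  simp only [zero_re, zero_im, ofReal_zero, zero_mul, add_zero, add_re, re_ofNat, mul_re, ofReal_re,
    I_re, mul_zero, ofReal_im, I_im, mul_one, sub_self, add_im, im_ofNat, mul_im, zero_add,
    ofReal_ofNat] at h1
  have h2 : ∀ y : ℝ, F (2 + y * I) = F (y * I) := fun y => by rw [add_comm, hper]
  simp_rw [h2] at h1
  have h3 : ∫ x in (0 : ℝ)..2, F x = ∫ x in (0 : ℝ)..2, F (x + w.im * I) := by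
    linear_combination h1
  have hp : Function.Periodic (fun x : ℝ => F (x + w.im * I)) 2 := fun x => by
    simp only [ofReal_add, ofReal_ofNat]
    rw [← hper (x + w.im * I)]
    congr 1
    ring
  have h4 := hp.intervalIntegral_add_eq w.re 0
  rw [zero_add] at h4
  have h5 := intervalIntegral.integral_comp_add_right (fun x : ℝ => F (x + w.im * I))
    (a := 0) (b := 2) w.re
  rw [zero_add, add_comm (2 : ℝ)] at h5
  rw [h3, ← h4, ← h5]
  refine intervalIntegral.integral_congr fun x _ => ?_
  simp only [ofReal_add]
  rw [add_assoc, re_add_im]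

/-- The coefficient of `exp (πirζ)` in the Fourier expansion of the affine character. -/
def affineCoeff (k : ℕ) (l r : ℤ) (τ : ℂ) : ℂ :=
  (1 / 2) * ∫ x in (0 : ℝ)..2, affineChar k l τ x * exp (-(π * I * r * x))

lemma stringFn_eq (k : ℕ) (l r : ℤ) (τ : ℂ) :
    stringFn k l r τ = exp (-(2 * π * I * ((r : ℂ) ^ 2 / (4 * ((k : ℂ) - 2))) * τ)) *
      affineCoeff k l r τ := rfl

lemma affineCoeff_eq_shift {k : ℕ} (hk : k ≠ 0) (l r : ℤ) {τ : ℂ} (hτ : 0 < τ.im) (w : ℂ) :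
    affineCoeff k l r τ =
      (1 / 2) * ∫ x in (0 : ℝ)..2, affineChar k l τ (x + w) * exp (-(π * I * r * (x + w))) := by
  have h1 := (affineChar_spec hk l hτ).1
  rw [affineCoeff, ← intervalIntegral_add_of_periodic
    (F := fun ζ => affineChar k l τ ζ * exp (-(π * I * r * ζ))) (by fun_prop) (fun ζ => ?_) w]
  rw [affineChar_add_two hk l hτ, show -(π * I * r * (ζ + 2)) = -(π * I * r * ζ) +
    2 * π * I * ((-r : ℤ) : ℂ) by push_cast; ring, Complex.exp_add, exp_two_pi_I_mul_int, mul_one]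

/-- Moving the contour to height `+1` or `-1`, according to the sign of `r`, gains the factor `exp
(-π |r|)`. -/
lemma exists_affineCoeff_bound {k : ℕ} (hk : k ≠ 0) (l : ℤ) {τ : ℂ} (hτ : 0 < τ.im) :
    ∃ C : ℝ, ∀ r : ℤ, ‖affineCoeff k l r τ‖ ≤ C * Real.exp (-π * |(r : ℝ)|) := by
  have hc := (affineChar_spec hk l hτ).1.continuous
  have hb : ∀ w : ℂ, ∃ C : ℝ, ∀ x ∈ Set.uIoc (0 : ℝ) 2, ‖affineChar k l τ (x + w)‖ ≤ C := by
    intro w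
    obtain ⟨C, hC⟩ := isCompact_uIcc.exists_bound_of_continuousOn (s := Set.uIcc (0 : ℝ) 2)
      (f := fun x : ℝ => affineChar k l τ (x + w)) (by fun_prop)
    exact ⟨C, fun x hx => hC x (Set.uIoc_subset_uIcc hx)⟩
  obtain ⟨A, hA⟩ := hb I
  obtain ⟨B, hB⟩ := hb (-I)
  have hA0 : 0 ≤ A := (norm_nonneg _).trans (hA 1 (by simp))
  have hB0 : 0 ≤ B := (norm_nonneg _).trans (hB 1 (by simp))
  have key : ∀ (r : ℤ) (s C : ℝ), (∀ x ∈ Set.uIoc (0 : ℝ) 2, ‖affineChar k l τ (x + s * I)‖ ≤ C) →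
      ‖affineCoeff k l r τ‖ ≤ C * Real.exp (π * r * s) := by
    intro r s C hC
    rw [affineCoeff_eq_shift hk l r hτ (s * I), norm_mul]
    have h := intervalIntegral.norm_integral_le_of_norm_le_const (a := 0) (b := 2)
      (C := C * Real.exp (π * r * s))
      (f := fun x : ℝ => affineChar k l τ (x + s * I) * exp (-(π * I * r * (x + s * I))))
      (fun x hx => by
        rw [norm_mul]
        have : ‖exp (-(π * I * r * (x + s * I)))‖ = Real.exp (π * r * s) := by
          rw [Complex.norm_exp]; congr 1; simp
        rw [this]
        exact mul_le_mul_of_nonneg_right (hC x hx) (Real.exp_pos _).le)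
    norm_num at h ⊢
    linarith
  refine ⟨A + B, fun r => ?_⟩
  rcases le_total 0 r with hr | hr
  · have hr' : |(r : ℝ)| = r := abs_of_nonneg (by exact_mod_cast hr)
    have h := key r (-1) B (by simpa using hB)
    rw [hr', show -π * (r : ℝ) = π * r * -1 by ring]
    exact h.trans (mul_le_mul_of_nonneg_right (by linarith) (Real.exp_pos _).le)
  · have hr' : |(r : ℝ)| = -r := abs_of_nonpos (by exact_mod_cast hr)
    have h := key r 1 A (by simpa using hA)
    rw [hr', show -π * -(r : ℝ) = π * r * 1 by ring]
    exact h.trans (mul_le_mul_of_nonneg_right (by linarith) (Real.exp_pos _).le)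

lemma summable_affineCoeff {k : ℕ} (hk : k ≠ 0) (l : ℤ) {τ : ℂ} (hτ : 0 < τ.im) :
    Summable (fun r => affineCoeff k l r τ) := by
  obtain ⟨C, hC⟩ := exists_affineCoeff_bound hk l hτ
  exact Summable.of_norm_bounded ((summable_exp_neg_mul_abs Real.pi_pos).mul_left C) hC

/-- Moving the contour by `2τ` and using the quasi-periodicity of the character shifts the index by
`2(k - 2)`. -/
lemma affineCoeff_add {k : ℕ} (hk : k ≠ 0) (l r : ℤ) {τ : ℂ} (hτ : 0 < τ.im) :
    affineCoeff k l (r + 2 * (k - 2)) τ =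
      exp (2 * π * I * ((k - 2 + r) * τ)) * affineCoeff k l r τ := by
  rw [affineCoeff_eq_shift hk l r hτ (2 * τ), affineCoeff, mul_left_comm]
  congr 1
  rw [← intervalIntegral.integral_const_mul]
  refine intervalIntegral.integral_congr fun x _ => ?_
  rw [affineChar_add_two_mul hk l hτ]
  have : exp (-(π * I * ((r + 2 * (k - 2) : ℤ) : ℂ) * x)) =
      exp (2 * π * I * ((k - 2 + r) * τ)) * (exp (-(2 * π * I * ((k - 2) * (τ + x)))) *
        exp (-(π * I * r * (x + 2 * τ)))) := by
    rw [← Complex.exp_add, ← Complex.exp_add]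
    congr 1
    push_cast
    ring
  rw [this]
  ring

/-- The prefactor `q ^ (-r² / 4(k-2))` is exactly what absorbs the multiplier of the Fourier
coefficients. -/
lemma stringFn_add {k : ℕ} (hk : 2 < k) (l r : ℤ) {τ : ℂ} (hτ : 0 < τ.im) :
    stringFn k l (r + 2 * (k - 2)) τ = stringFn k l r τ := by
  have hk2 : (k : ℂ) - 2 ≠ 0 := by
    rw [sub_ne_zero]; exact_mod_cast hk.ne'
  rw [stringFn_eq, stringFn_eq, affineCoeff_add (by omega) l r hτ, ← mul_assoc, ← Complex.exp_add]
  congr 2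
  push_cast
  field_simp
  ring

lemma stringFn_add_mul {k : ℕ} (hk : 2 < k) (l r n : ℤ) {τ : ℂ} (hτ : 0 < τ.im) :
    stringFn k l (r + 2 * (k - 2) * n) τ = stringFn k l r τ := by
  induction n using Int.induction_on with
  | zero => simp
  | succ n ih => rw [← ih, ← stringFn_add hk l (r + 2 * (k - 2) * n) hτ]; congr 1; ring
  | pred n ih => rw [← ih, ← stringFn_add hk l (r + 2 * (k - 2) * (-(n : ℤ) - 1)) hτ]; congr 1; ring

/-- Termwise integration of an absolutely convergent trigonometric series over a period. -/
lemma hasSum_integral_mul_exp {ι : Type*} [Countable ι] {X : ℝ → ℂ} (hX : Continuous X)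
    {c : ι → ℂ} (hc : Summable c) (p : ι → ℤ) :
    HasSum (fun i => c i * ∫ x in (0 : ℝ)..2, X x * exp (π * I * p i * x))
      (∫ x in (0 : ℝ)..2, X x * ∑' i, c i * exp (π * I * p i * x)) := by
  have hn : ∀ (i : ι) (x : ℝ), ‖exp (π * I * p i * x)‖ = 1 := fun i x => by
    rw [show π * I * p i * x = ((π * p i * x : ℝ) : ℂ) * I by push_cast; ring,
      Complex.norm_exp_ofReal_mul_I]
  have h := intervalIntegral.hasSum_integral_of_dominated_convergence (μ := volume) (a := 0) (b := 2)
    (F := fun i (x : ℝ) => X x * (c i * exp (π * I * p i * x)))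
    (f := fun x : ℝ => X x * ∑' i, c i * exp (π * I * p i * x))
    (fun i x => ‖X x‖ * ‖c i‖) (fun i => by
      refine Continuous.aestronglyMeasurable ?_
      fun_prop) (fun i => ae_of_all _ fun x _ => by rw [norm_mul, norm_mul, hn, mul_one])
    (ae_of_all _ fun x _ => hc.norm.mul_left _) (by
      simp_rw [tsum_mul_left]
      refine Continuous.intervalIntegrable ?_ _ _
      fun_prop) (ae_of_all _ fun x _ => by
      refine Summable.hasSum ?_ |>.mul_left _
      refine Summable.of_norm_bounded hc.norm fun i => ?_
      rw [norm_mul, hn, mul_one])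
  refine h.congr_fun fun i => ?_
  rw [← intervalIntegral.integral_const_mul]
  refine intervalIntegral.integral_congr fun x _ => ?_
  ring

lemma integral_exp_pi_I_mul_int (n : ℤ) :
    ∫ x in (0 : ℝ)..2, exp (π * I * n * x) = if n = 0 then 2 else 0 := by
  split_ifs with h
  · simp [h]
  · have hn : (π * I * n : ℂ) ≠ 0 :=
      mul_ne_zero (mul_ne_zero (by exact_mod_cast Real.pi_ne_zero) I_ne_zero) (by exact_mod_cast h)
    rw [integral_exp_mul_complex hn]
    rw [show π * I * n * ((2 : ℝ) : ℂ) = 2 * π * I * n by push_cast; ring, exp_two_pi_I_mul_int]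
    simp

/-- The Fourier coefficients of the identity `χ_l θ₁₁ = i (ϑ_{k,l+1} - ϑ_{k,-l-1})`. -/
lemma tsum_affineCoeff_mul_oddThetaCoeff {k : ℕ} (hk : k ≠ 0) (l r : ℤ) {τ : ℂ} (hτ : 0 < τ.im) :
    ∑' m : ℤ, affineCoeff k l (r - (2 * m + 1)) τ * oddThetaCoeff τ m =
      I * (oddResidue k (l + 1) r * thetaExp k τ r) := by
  obtain ⟨h1, h2, -⟩ := affineChar_spec hk l hτ
  have hc := h1.continuous
  have hA := hasSum_integral_mul_exp
    (X := fun x : ℝ => affineChar k l τ x * exp (-(π * I * r * x))) (by fun_prop)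
    (summable_oddThetaCoeff hτ) (fun m => 2 * m + 1)
  have hB := hasSum_integral_mul_exp (X := fun x : ℝ => exp (-(π * I * r * x))) (by fun_prop)
    (c := fun p => oddResidue k (l + 1) p * thetaExp k τ p) (by
      refine Summable.of_norm_bounded ((summable_thetaExp_mul hk hτ 0 0).mul_left 2) fun p => ?_
      rw [norm_mul]
      simpa using mul_le_mul_of_nonneg_right (norm_oddResidue_le k (l + 1) p) (norm_nonneg _)) id
  have hAB : (∫ x in (0 : ℝ)..2, affineChar k l τ x * exp (-(π * I * r * x)) *
      ∑' m : ℤ, oddThetaCoeff τ m * exp (π * I * ((2 * m + 1 : ℤ) : ℂ) * x)) =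
      I * ∫ x in (0 : ℝ)..2, exp (-(π * I * r * x)) *
        ∑' p : ℤ, oddResidue k (l + 1) p * thetaExp k τ p * exp (π * I * ((id p : ℤ) : ℂ) * x) := by
    rw [← intervalIntegral.integral_const_mul]
    refine intervalIntegral.integral_congr fun x _ => ?_
    have e1 := theta11_eq_tsum τ x
    have e2 := thetaNum_eq_tsum hk (l + 1) hτ x
    have e3 : ∑' m : ℤ, oddThetaCoeff τ m * exp (π * I * ((2 * m + 1 : ℤ) : ℂ) * x) =
        theta11 τ x := by
      rw [e1]
      refine tsum_congr fun m => ?_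
      congr 2
      push_cast
      ring
    simp only [id]
    rw [e3, ← e2]
    linear_combination exp (-(π * I * r * x)) * h2 x
  rw [hAB, ← hB.tsum_eq] at hA
  have h3 : ∀ p : ℤ, oddResidue k (l + 1) p * thetaExp k τ p *
      ∫ x in (0 : ℝ)..2, exp (-(π * I * r * x)) * exp (π * I * ((id p : ℤ) : ℂ) * x) =
      if p = r then 2 * (oddResidue k (l + 1) r * thetaExp k τ r) else 0 := by
    intro p
    have : ∀ x : ℝ, exp (-(π * I * r * x)) * exp (π * I * ((id p : ℤ) : ℂ) * x) =
        exp (π * I * ((p - r : ℤ) : ℂ) * x) := fun x => by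
      rw [← Complex.exp_add]; congr 1; push_cast [id]; ring
    simp_rw [this]
    rw [integral_exp_pi_I_mul_int]
    by_cases hp : p = r
    · subst hp; simp; ring
    · rw [if_neg (by omega), if_neg hp, mul_zero]
  rw [tsum_congr h3, tsum_ite_eq] at hA
  have h4 := hA.mul_left (1 / 2)
  rw [show (1 / 2 : ℂ) * (I * (2 * (oddResidue k (l + 1) r * thetaExp k τ r))) =
    I * (oddResidue k (l + 1) r * thetaExp k τ r) by ring] at h4
  rw [← h4.tsum_eq]
  refine tsum_congr fun m => ?_
  have h5 : affineCoeff k l (r - (2 * m + 1)) τ = (1 / 2) * ∫ x in (0 : ℝ)..2,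
      affineChar k l τ x * exp (-(π * I * r * x)) * exp (π * I * ((2 * m + 1 : ℤ) : ℂ) * x) := by
    rw [affineCoeff]
    congr 1
    refine intervalIntegral.integral_congr fun x _ => ?_
    rw [mul_assoc (affineChar k l τ x), ← Complex.exp_add]
    congr 2
    push_cast
    ring
  rw [h5]
  ring

/-! ### The characters of the supersymmetric coset -/

/-- The terms of the expansion of the coset characters. -/
def cosetTerm (k : ℕ) (l r : ℤ) (τ w : ℂ) (p : ℤ) : ℂ :=
  exp (-(2 * π * I * ((r : ℂ) ^ 2 / (4 * k)) * τ) + 2 * π * I * w * (r / k)) *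
    (affineCoeff k l (r + p) τ * exp (2 * π * I * ((p : ℂ) ^ 2 / 8) * τ + π * I * p * w))

lemma summable_cosetTerm {k : ℕ} (hk : k ≠ 0) (l r : ℤ) {τ : ℂ} (hτ : 0 < τ.im) (w : ℂ) :
    Summable (cosetTerm k l r τ w) := by
  refine Summable.mul_left _ ?_
  have h1 := summable_thetaExp_mul_exp two_ne_zero hτ w
  obtain ⟨C, hC⟩ := exists_affineCoeff_bound hk l hτ
  refine Summable.of_norm_bounded (h1.norm.mul_left |C|) fun p => ?_
  rw [norm_mul]
  have e : thetaExp 2 τ p * exp (π * I * p * w) =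
      exp (2 * π * I * ((p : ℂ) ^ 2 / 8) * τ + π * I * p * w) := by
    rw [thetaExp, ← Complex.exp_add]; congr 1; push_cast; ring
  rw [e]
  refine mul_le_mul_of_nonneg_right ((hC _).trans ?_) (norm_nonneg _)
  refine (mul_le_mul_of_nonneg_right (le_abs_self C) (Real.exp_pos _).le).trans ?_
  refine mul_le_of_le_one_right (abs_nonneg _) (Real.exp_le_one_iff.2 ?_)
  have := Real.pi_pos
  nlinarith [abs_nonneg ((r + p : ℤ) : ℝ)]

lemma tsum_range_add_mul {N : ℕ} (hN : N ≠ 0) {f : ℤ → ℂ} (hf : Summable f) :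
    ∑ n ∈ Finset.range N, ∑' M : ℤ, f (n + N * M) = ∑' ν : ℤ, f ν := by
  have hN' : (N : ℤ) ≠ 0 := by exact_mod_cast hN
  have h1 : ∀ n ∈ Finset.range N, ∑' M : ℤ, f (n + N * M) =
      ∑' p : ℤ, if (N : ℤ) ∣ p - n then f p else 0 := fun n _ => by
    rw [← tsum_residueClass hN']
    exact tsum_congr fun M => by rw [add_comm]
  rw [Finset.sum_congr rfl h1, ← Summable.tsum_finsetSum
    fun n _ => summable_residueClass _ _ hf]
  refine tsum_congr fun p => ?_
  have hmod := Int.emod_nonneg p hN'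
  have hlt := Int.emod_lt_of_pos p (by omega : (0 : ℤ) < N)
  rw [Finset.sum_eq_single (p % N).toNat]
  · rw [if_pos]
    rw [Int.toNat_of_nonneg hmod]
    exact Int.dvd_self_sub_emod
  · intro n hn hne
    rw [if_neg]
    intro hd
    apply hne
    have hn' := Finset.mem_range.1 hn
    have h2 : p % N = n := by
      rw [Int.emod_eq_emod_iff_emod_sub_eq_zero.2 (Int.emod_eq_zero_of_dvd hd)]
      exact Int.emod_eq_of_lt (by omega) (by omega)
    omega
  · intro h
    simp only [Finset.mem_range] at h
    omega

/-- Periodicity of the string functions merges the sum over `n` modulo `k - 2` with the theta series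
into one sum over `ν = n + (k - 2) M`. With `p = 4ν - s` the exponents combine by `(2r + kp)² /
8k(k-2) - (r + p)² / 4(k-2) = -r² / 4k + p² / 8`, in which `k - 2` no longer appears. -/
lemma cosetFn_eq_tsum {k : ℕ} (hk : 2 < k) (l s r : ℤ) {τ : ℂ} (hτ : 0 < τ.im) (w : ℂ) :
    cosetFn k l s r τ w = ∑' ν : ℤ, cosetTerm k l r τ w (4 * ν - s) := by
  have hk2 : (k : ℂ) - 2 ≠ 0 := by
    rw [sub_ne_zero]; exact_mod_cast hk.ne'
  have hk0 : (k : ℂ) ≠ 0 := by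
    have : k ≠ 0 := by omega
    exact_mod_cast this
  have hinj : Function.Injective (fun ν : ℤ => 4 * ν - s) := fun a b h => by
    simpa using h
  have hs : Summable (fun ν : ℤ => cosetTerm k l r τ w (4 * ν - s)) :=
    (summable_cosetTerm (by omega) l r hτ w).comp_injective hinj
  rw [cosetFn, if_neg (by omega), ← tsum_range_add_mul (N := k - 2) (by omega) hs]
  refine Finset.sum_congr rfl fun n _ => ?_
  rw [levelTheta, ← tsum_mul_left]
  refine tsum_congr fun M => ?_
  have e1 : r + (4 * (n + ((k - 2 : ℕ) : ℤ) * M) - s) = r - s + 4 * n + 2 * (k - 2) * (2 * M) := by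
    push_cast [Nat.cast_sub hk.le]; ring
  have e2 := stringFn_add_mul hk l (r - s + 4 * n) (2 * M) hτ
  rw [← e1] at e2
  rw [← e2, stringFn_eq, cosetTerm]
  have hE : exp (-(2 * π * I * (((r + (4 * (n + ((k - 2 : ℕ) : ℤ) * M) - s) : ℤ) : ℂ) ^ 2 /
        (4 * ((k : ℂ) - 2))) * τ)) *
      exp (2 * π * I * (((2 * (2 * k * (k - 2) : ℕ) * M + (2 * r + k * (4 * n - s)) : ℤ) : ℂ) ^ 2 /
        (4 * (2 * k * (k - 2) : ℕ))) * τ + 2 * π * I *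
        ((2 * (2 * k * (k - 2) : ℕ) * M + (2 * r + k * (4 * n - s)) : ℤ) : ℂ) * (w / (2 * k))) =
      exp (-(2 * π * I * ((r : ℂ) ^ 2 / (4 * k)) * τ) + 2 * π * I * w * (r / k)) *
      exp (2 * π * I * (((4 * (n + ((k - 2 : ℕ) : ℤ) * M) - s : ℤ) : ℂ) ^ 2 / 8) * τ +
        π * I * ((4 * (n + ((k - 2 : ℕ) : ℤ) * M) - s : ℤ) : ℂ) * w) := by
    rw [← Complex.exp_add, ← Complex.exp_add]
    congr 1
    push_cast [Nat.cast_sub hk.le]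
    field_simp
    ring
  linear_combination affineCoeff k l (r + (4 * (n + ((k - 2 : ℕ) : ℤ) * M) - s)) τ * hE

lemma affineChar_two_zero {τ : ℂ} (hτ : 0 < τ.im) (ζ : ℂ) : affineChar 2 0 τ ζ = 1 := by
  obtain ⟨h1, h2, -⟩ := affineChar_spec two_ne_zero 0 hτ
  refine congrFun (eq_of_mul_theta11_eq hτ (B := fun _ => 1) h1.continuous continuous_const
    fun ζ => ?_) ζ
  rw [h2, zero_add, thetaNum_two_one hτ]
  linear_combination -theta11 τ ζ * I_mul_I

lemma affineCoeff_two_zero (r : ℤ) {τ : ℂ} (hτ : 0 < τ.im) :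
    affineCoeff 2 0 r τ = if r = 0 then 1 else 0 := by
  have := integral_exp_pi_I_mul_int (-r)
  simp only [affineCoeff, affineChar_two_zero hτ, one_mul]
  rw [show (fun x : ℝ => exp (-(π * I * r * x))) = fun x : ℝ => exp (π * I * ((-r : ℤ) : ℂ) * x) by
    funext x; congr 1; push_cast; ring, this]
  by_cases h : r = 0 <;> simp [h]

/-- At `k = 2` the character is constant, so only `p = -r` contributes and its exponential is `1`.
The separately defined case `k = 2` thus obeys the same expansion as `k ≥ 3`. -/
lemma cosetFn_two_eq_tsum (s r : ℤ) {τ : ℂ} (hτ : 0 < τ.im) (w : ℂ) :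
    cosetFn 2 0 s r τ w = ∑' ν : ℤ, cosetTerm 2 0 r τ w (4 * ν - s) := by
  have hval : ∀ p : ℤ, cosetTerm 2 0 r τ w p = if p = -r then 1 else 0 := by
    intro p
    rw [cosetTerm, affineCoeff_two_zero _ hτ]
    by_cases hp : p = -r
    · subst hp
      rw [if_pos (by ring), if_pos rfl, one_mul, ← Complex.exp_add, ← Complex.exp_zero]
      congr 1
      push_cast
      ring
    · rw [if_neg (by omega), if_neg hp, zero_mul, mul_zero]
  simp_rw [hval]
  rw [cosetFn, if_pos rfl, affineChar_two_zero hτ]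
  split_ifs with h
  · obtain ⟨c, hc⟩ := h
    rw [tsum_eq_single (-c) fun ν hν => if_neg (by omega), if_pos (by omega)]
  · rw [tsum_congr fun ν => if_neg fun h' => h ⟨-ν, by omega⟩, tsum_zero]

/-! ### The Appell-Lerch sums as theta-like series -/

/-- The terms `s = 1` and `s = 3` run over `p ≡ 3` and `p ≡ 1` modulo `4`; with the relative sign
they form one alternating sum over odd `p`. For `k = 2` the range of `j` leaves only `j = 1`, the
vacuum character. -/
lemma cosetChar_eq_tsum {k : ℕ} (hk : 2 ≤ k) {j : ℤ} (hj : 1 ≤ j) (hjk : j ≤ k - 1) (r : ℤ) {τ : ℂ}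
    (hτ : 0 < τ.im) (w : ℂ) :
    cosetChar k 1 1 (j - 1) r τ w =
      -I * ∑' m : ℤ, (-1) ^ m * cosetTerm k (j - 1) r τ w (2 * m + 1) := by
  have hG := summable_cosetTerm (k := k) (by omega) (j - 1) r hτ w
  have hfn : ∀ s : ℤ, cosetFn k (j - 1) s r τ w =
      ∑' ν : ℤ, cosetTerm k (j - 1) r τ w (4 * ν - s) := by
    intro s
    rcases hk.lt_or_eq with h | h
    · exact cosetFn_eq_tsum h _ s r hτ w
    · subst h
      obtain rfl : j = 1 := by push_cast at hjk; omega
      exact cosetFn_two_eq_tsum s r hτ w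
  have hinj : Function.Injective (fun m : ℤ => 2 * m + 1) := fun a b h => by simpa using h
  have hs : Summable (fun m : ℤ => (-1 : ℂ) ^ m * cosetTerm k (j - 1) r τ w (2 * m + 1)) := by
    refine Summable.of_norm_bounded (hG.comp_injective hinj).norm fun m => ?_
    rw [norm_mul, norm_neg_one_zpow, one_mul]
    rfl
  rw [← tsum_range_add_mul two_ne_zero hs, Finset.sum_range_succ, Finset.sum_range_one, cosetChar,
    hfn, hfn]
  have e0 : ∑' ν : ℤ, cosetTerm k (j - 1) r τ w (4 * ν - ((1 : ℕ) + 2)) =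
      ∑' M : ℤ, (-1 : ℂ) ^ (((0 : ℕ) : ℤ) + (2 : ℕ) * M) *
        cosetTerm k (j - 1) r τ w (2 * (((0 : ℕ) : ℤ) + (2 : ℕ) * M) + 1) := by
    rw [← (Equiv.addRight (1 : ℤ)).tsum_eq]
    refine tsum_congr fun M => ?_
    rw [show (((0 : ℕ) : ℤ) + (2 : ℕ) * M) = 2 * M by push_cast; ring, zpow_mul, Equiv.coe_addRight]
    norm_num
    congr 1
    ring
  have e1 : ∑' ν : ℤ, cosetTerm k (j - 1) r τ w (4 * ν - (1 : ℕ)) =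
      -∑' M : ℤ, (-1 : ℂ) ^ (((1 : ℕ) : ℤ) + (2 : ℕ) * M) *
        cosetTerm k (j - 1) r τ w (2 * (((1 : ℕ) : ℤ) + (2 : ℕ) * M) + 1) := by
    rw [← (Equiv.addRight (1 : ℤ)).tsum_eq, ← tsum_neg]
    refine tsum_congr fun M => ?_
    rw [show (((1 : ℕ) : ℤ) + (2 : ℕ) * M) = 1 + 2 * M by push_cast; ring,
      zpow_add₀ (by norm_num), zpow_mul, Equiv.coe_addRight]
    norm_num
    congr 1
    ring
  rw [e0, e1, show (π : ℂ) * I * (1 : ℕ) * (1 : ℕ) / 2 = π / 2 * I by push_cast; ring,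
    Complex.exp_pi_div_two_mul_I]
  ring

/-- The Fourier coefficient of `χ_l(ζ) θ₁₁(ζ + z)`. -/
def shiftedCoeff (k : ℕ) (l r : ℤ) (τ z : ℂ) : ℂ :=
  ∑' m : ℤ, affineCoeff k l (r - (2 * m + 1)) τ *
    (oddThetaCoeff τ m * exp (2 * π * I * z * (m + 1 / 2)))

/-- The factor `q ^ ((n² + j'n) / k)` cancels the `n`-dependence of the prefactor `q ^ (-(2n + j')²
/ 4k)` of the coset character, and the `z`-exponents cancel likewise. What remains is `q ^ (-j'² /
4k)`, compensated on the left, and the coefficients of an odd theta function shifted by `z`. -/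
lemma mu_eq_tsum_shiftedCoeff {k : ℕ} (hk : 2 ≤ k) {j : ℤ} (hj : 1 ≤ j) (hjk : j ≤ k - 1) (j' : ℤ)
    {τ : ℂ} (hτ : 0 < τ.im) (z : ℂ) :
    theta11 τ z * mu k j j' τ z z 0 * thetaExp k τ j' = if theta11 τ z = 0 then 0 else
      ∑' n : ℤ, appellFactor τ z n * shiftedCoeff k (j - 1) (2 * n + j') τ z := by
  split_ifs with h0
  · rw [h0]; ring
  have hk0 : (k : ℂ) ≠ 0 := by
    have : k ≠ 0 := by omega
    exact_mod_cast this
  have hcancel : ∀ A S T : ℂ, theta11 τ z * (A / theta11 τ z * S) * T = A * (S * T) :=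
    fun A S T => by field_simp
  rw [mu, hcancel, ← tsum_mul_right, ← tsum_mul_left]
  refine tsum_congr fun n => ?_
  -- The reindexing `m ↦ -m - 1` accounts for the coset character being evaluated at `-z`.
  rw [cosetChar_eq_tsum hk hj hjk _ hτ, shiftedCoeff, appellFactor,
    ← ((Equiv.neg ℤ).trans (Equiv.addRight (-1))).tsum_eq
      (fun m : ℤ => (-1 : ℂ) ^ m * cosetTerm k (j - 1) (2 * n + j') τ (0 - z) (2 * m + 1))]
  simp only [← tsum_mul_left, ← tsum_mul_right]
  refine tsum_congr fun m => ?_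
  simp only [Equiv.trans_apply, Equiv.neg_apply, Equiv.coe_addRight]
  have hsgn : (-1 : ℂ) ^ (-m + -1) = -(-1) ^ m := by
    rw [zpow_add₀ (by simp), zpow_neg, ← inv_zpow, show (-1 : ℂ)⁻¹ = -1 by norm_num]
    norm_num
  rw [hsgn, cosetTerm, oddThetaCoeff, thetaExp,
    show 2 * n + j' + (2 * (-m + -1) + 1) = 2 * n + j' - (2 * m + 1) by ring]
  have hE : exp (2 * π * I * z * (j' / k)) * exp (2 * π * I * (((n : ℂ) ^ 2 + j' * n) / k) * τ) *
      exp (2 * π * I * n * (z + (1 - 2 / (k : ℂ)) * (0 - z))) *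
      exp (-(2 * π * I * (((2 * n + j' : ℤ) : ℂ) ^ 2 / (4 * k)) * τ) +
        2 * π * I * (0 - z) * (((2 * n + j' : ℤ) : ℂ) / k)) *
      exp (2 * π * I * (((2 * (-m + -1) + 1 : ℤ) : ℂ) ^ 2 / 8) * τ +
        π * I * ((2 * (-m + -1) + 1 : ℤ) : ℂ) * (0 - z)) *
      exp (2 * π * I * ((j' : ℂ) ^ 2 / (4 * k)) * τ) =
      exp (π * I * ((m : ℂ) + 1 / 2) ^ 2 * τ) * exp (2 * π * I * z * (m + 1 / 2)) := by
    simp only [← Complex.exp_add]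
    congr 1
    push_cast
    field_simp
    ring
  linear_combination (1 / (1 - exp (2 * π * I * (z + n * τ))) *
    affineCoeff k (j - 1) (2 * n + j' - (2 * m + 1)) τ * I * (-1) ^ m) * hE

/-- In terms of functions, this multiplies `χ(ζ) θ₁₁(ζ + z)` by the Kronecker constant: each
weighted theta coefficient becomes a convolution of `A` with unweighted ones, and the convolution of
the latter with the coefficients of `χ` is the character identity `χ θ₁₁ = i (ϑ_{k,l+1} -
ϑ_{k,-l-1})`. -/
lemma mul_shiftedCoeff {k : ℕ} (hk : k ≠ 0) (l r : ℤ) {τ z : ℂ} (hτ : 0 < τ.im)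
    (hz : ∀ m n : ℤ, z ≠ m * τ + n) {K : ℂ}
    (hK : ∀ s : ℤ, ∑' m, oddThetaCoeff τ m * appellFactor τ z (s - m) =
      K * (oddThetaCoeff τ s * exp (2 * π * I * z * s))) :
    K * shiftedCoeff k l r τ z = exp (π * I * z) * ∑' s : ℤ, appellFactor τ z s *
      (I * (oddResidue k (l + 1) (r - 2 * s) * thetaExp k τ (r - 2 * s))) := by
  set F : ℤ → ℤ → ℂ := fun m m' =>
    affineCoeff k l (r - (2 * m + 1)) τ * (oddThetaCoeff τ m' * appellFactor τ z (m - m')) with hF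
  obtain ⟨C, hC, hb⟩ := exists_appellFactor_bound hτ hz
  have hinj : Function.Injective (fun m : ℤ => r - (2 * m + 1)) := fun a b h => by
    simpa using h
  have ha : Summable (fun m : ℤ => ‖affineCoeff k l (r - (2 * m + 1)) τ‖) :=
    ((summable_affineCoeff hk l hτ).comp_injective hinj).norm
  have ht : Summable (fun m : ℤ => ‖oddThetaCoeff τ m‖) := (summable_oddThetaCoeff hτ).norm
  have hS : Summable (fun p : ℤ × ℤ => F p.1 p.2) := by
    refine Summable.of_norm_bounded ((ha.mul_of_nonneg ht (fun _ => norm_nonneg _)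
      (fun _ => norm_nonneg _)).mul_right C) fun p => ?_
    simp only [hF, norm_mul]
    rw [← mul_assoc]
    gcongr
    exact (hb _).1
  -- The shear takes the difference of the two theta indices as a new variable, isolating the Appell
  -- factor from the remaining convolution.
  let e : ℤ × ℤ ≃ ℤ × ℤ :=
    { toFun := fun p => (p.1 + p.2, p.2)
      invFun := fun p => (p.1 - p.2, p.2)
      left_inv := fun p => by simp
      right_inv := fun p => by simp }
  have hS' : Summable (fun p : ℤ × ℤ => F (p.1 + p.2) p.2) := (e.summable_iff (f := fun p : ℤ × ℤ =>
    F p.1 p.2)).2 hS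
  have h1 : K * shiftedCoeff k l r τ z = exp (π * I * z) * ∑' p : ℤ × ℤ, F p.1 p.2 := by
    rw [hS.tsum_prod, shiftedCoeff, ← tsum_mul_left, ← tsum_mul_left]
    refine tsum_congr fun m => ?_
    simp only [hF]
    rw [tsum_mul_left, hK]
    have : exp (2 * π * I * z * (m + 1 / 2)) = exp (π * I * z) * exp (2 * π * I * z * m) := by
      rw [← Complex.exp_add]; congr 1; ring
    rw [this]
    ring
  rw [h1, ← e.tsum_eq]
  congr 1
  refine (hS'.tsum_prod).trans (tsum_congr fun s => ?_)
  have h2 := tsum_affineCoeff_mul_oddThetaCoeff hk l (r - 2 * s) hτ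
  rw [← h2, ← tsum_mul_left]
  refine tsum_congr fun m => ?_
  simp only [hF]
  rw [show r - (2 * (s + m) + 1) = r - 2 * s - (2 * m + 1) by ring, add_sub_cancel_right]
  ring

/-- The coefficients `ε_j(2s + j') q ^ ((s² + s j') / k)`. -/
def pairCoeff (k : ℕ) (j j' : ℤ) (τ : ℂ) (s : ℤ) : ℂ :=
  oddResidue k j (2 * s + j') * thetaExp k τ (2 * s + j') / thetaExp k τ j'

/-! ### From the Appell-Lerch sums to double sums of products of two Appell factors, and their
evaluation. -/

lemma thetaExp_ne_zero (k : ℕ) (τ : ℂ) (p : ℤ) : thetaExp k τ p ≠ 0 := Complex.exp_ne_zero _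

lemma thetaExp_neg (k : ℕ) (τ : ℂ) (p : ℤ) : thetaExp k τ (-p) = thetaExp k τ p := by
  simp [thetaExp]

/-- Multiplying by the Kronecker constant `K` expands the shifted coefficients, while `K θ₁₁(z)` is
an explicit multiple of `η³`; the theta function in the denominator of `μ` disappears. -/
lemma eta_cube_mul_mu_eq_tsum_tsum {k : ℕ} (hk : 2 ≤ k) {j : ℤ} (hj : 1 ≤ j) (hjk : j ≤ k - 1)
    (j' : ℤ) {τ z : ℂ} (hτ : 0 < τ.im) (hz : ∀ m n : ℤ, z ≠ m * τ + n) :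
    ModularForm.eta τ ^ 3 * mu k j j' τ z z 0 =
      -∑' n : ℤ, ∑' s : ℤ, pairCoeff k j j' τ s * (appellFactor τ z n * appellFactor τ z (n - s)) := by
  obtain ⟨K, hK, hKθ⟩ := exists_kronecker hτ hz
  have h1 := mu_eq_tsum_shiftedCoeff hk hj hjk j' hτ z
  rw [if_neg (theta11_ne_zero hτ hz)] at h1
  have h2 : K * ∑' n : ℤ, appellFactor τ z n * shiftedCoeff k (j - 1) (2 * n + j') τ z =
      (exp (π * I * z) * I * thetaExp k τ j') * ∑' n : ℤ, ∑' s : ℤ, pairCoeff k j j' τ s *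
        (appellFactor τ z n * appellFactor τ z (n - s)) := by
    rw [← tsum_mul_left, ← tsum_mul_left]
    refine tsum_congr fun n => ?_
    rw [mul_left_comm, mul_shiftedCoeff (by omega) _ _ hτ hz hK, sub_add_cancel,
      ← (Equiv.subLeft n).tsum_eq (fun s : ℤ => appellFactor τ z s * _), ← tsum_mul_left,
      ← tsum_mul_left, ← tsum_mul_left]
    refine tsum_congr fun s => ?_
    have := thetaExp_ne_zero k τ j'
    rw [Equiv.subLeft_apply, show 2 * n + j' - 2 * (n - s) = 2 * s + j' by ring, pairCoeff]
    field_simp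
  rw [← h1] at h2
  have hne : exp (π * I * z) * I * thetaExp k τ j' ≠ 0 :=
    mul_ne_zero (mul_ne_zero (Complex.exp_ne_zero _) I_ne_zero) (thetaExp_ne_zero _ _ _)
  refine mul_left_cancel₀ hne ?_
  rw [mul_neg, ← h2]
  linear_combination (mu k j j' τ z z 0 * thetaExp k τ j') * hKθ

/-- Under `s ↦ -s - j'` the argument `2s + j'` changes sign, the residue indicator is odd and the
Gaussian even. This vanishing is what permits subtracting `1` from one of the two Appell factors. -/
lemma tsum_pairCoeff (k : ℕ) (j j' : ℤ) (τ : ℂ) : ∑' s : ℤ, pairCoeff k j j' τ s = 0 := by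
  have h := ((Equiv.neg ℤ).trans (Equiv.addRight (-j'))).tsum_eq (pairCoeff k j j' τ)
  have h2 : ∀ s, pairCoeff k j j' τ (-s + -j') = -pairCoeff k j j' τ s := by
    intro s
    rw [pairCoeff, pairCoeff, show 2 * (-s + -j') + j' = -(2 * s + j') by ring, oddResidue_neg,
      thetaExp_neg]
    ring
  simp only [Equiv.trans_apply, Equiv.neg_apply, Equiv.coe_addRight, h2] at h
  rw [tsum_neg] at h
  exact self_eq_neg.1 h.symm

lemma summable_pairCoeff_mul {k : ℕ} (hk : k ≠ 0) (j j' : ℤ) {τ : ℂ} (hτ : 0 < τ.im) (i : ℕ) {b : ℝ}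
    (hb : 0 ≤ b) :
    Summable (fun s : ℤ => ‖pairCoeff k j j' τ s‖ * (|(s : ℝ)| ^ i * Real.exp (b * |(s : ℝ)|))) := by
  have hinj : Function.Injective (fun s : ℤ => 2 * s + j') := fun a b h => by simpa using h
  have h1 := (((summable_thetaExp_mul hk hτ 0 (b + i)).comp_injective hinj).mul_left
    (2 / ‖thetaExp k τ j'‖ * Real.exp ((b + i) * |(j' : ℝ)|)))
  refine h1.of_nonneg_of_le (fun s => by positivity) fun s => ?_
  have hs : |(s : ℝ)| ≤ |((2 * s + j' : ℤ) : ℝ)| + |(j' : ℝ)| := by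
    have : (s : ℝ) = ((2 * s + j' : ℤ) : ℝ) / 2 - j' / 2 := by push_cast; ring
    calc |(s : ℝ)| = |((2 * s + j' : ℤ) : ℝ) / 2 - j' / 2| := by rw [← this]
      _ ≤ |((2 * s + j' : ℤ) : ℝ) / 2| + |(j' : ℝ) / 2| := abs_sub _ _
      _ ≤ _ := by
        rw [abs_div, abs_div, abs_two]
        linarith [abs_nonneg ((2 * s + j' : ℤ) : ℝ), abs_nonneg (j' : ℝ)]
  have hp : |(s : ℝ)| ^ i ≤ Real.exp (i * |(s : ℝ)|) := by
    rw [Real.exp_nat_mul]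
    exact pow_le_pow_left₀ (abs_nonneg _) (by linarith [Real.add_one_le_exp |(s : ℝ)|]) _
  have hw : |(s : ℝ)| ^ i * Real.exp (b * |(s : ℝ)|) ≤
      Real.exp ((b + i) * |(j' : ℝ)|) * Real.exp ((b + i) * |((2 * s + j' : ℤ) : ℝ)|) := by
    calc _ ≤ Real.exp (i * |(s : ℝ)|) * Real.exp (b * |(s : ℝ)|) := by gcongr
      _ = Real.exp ((b + i) * |(s : ℝ)|) := by rw [← Real.exp_add]; ring_nf
      _ ≤ Real.exp ((b + i) * (|((2 * s + j' : ℤ) : ℝ)| + |(j' : ℝ)|)) := by gcongr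
      _ = _ := by rw [← Real.exp_add]; ring_nf
  have hc : ‖pairCoeff k j j' τ s‖ ≤ 2 / ‖thetaExp k τ j'‖ * ‖thetaExp k τ (2 * s + j')‖ := by
    rw [pairCoeff, norm_div, norm_mul, div_mul_eq_mul_div]
    gcongr
    exact norm_oddResidue_le _ _ _
  simp only [Function.comp, pow_zero, one_mul]
  calc _ ≤ (2 / ‖thetaExp k τ j'‖ * ‖thetaExp k τ (2 * s + j')‖) *
        (Real.exp ((b + i) * |(j' : ℝ)|) * Real.exp ((b + i) * |((2 * s + j' : ℤ) : ℝ)|)) := by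
        gcongr
    _ = _ := by ring

lemma summable_pairCoeff {k : ℕ} (hk : k ≠ 0) (j j' : ℤ) {τ : ℂ} (hτ : 0 < τ.im) :
    Summable (pairCoeff k j j' τ) := by
  refine Summable.of_norm ((summable_pairCoeff_mul hk j j' hτ 0 le_rfl).congr fun s => ?_)
  simp

/-- The series `∑ y q ^ n / (1 - y q ^ n) ^ 2`, the Weierstrass function up to normalisation. -/
def weierstrassSum (τ z : ℂ) : ℂ :=
  ∑' n : ℤ, exp (2 * π * I * (z + n * τ)) * appellFactor τ z n ^ 2

/-- The regularised sums `∑ₙ 1 / ((1 - y q ^ n) (1 - y q ^ (n - s)))`. -/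
def pairValue (τ z : ℂ) (s : ℤ) : ℂ :=
  if s = 0 then weierstrassSum τ z else s / (exp (2 * π * I * (s * τ)) - 1)

lemma exp_two_pi_I_mul_int_mul_ne_one {τ : ℂ} (hτ : 0 < τ.im) {s : ℤ} (hs : s ≠ 0) :
    exp (2 * π * I * (s * τ)) - 1 ≠ 0 := by
  rw [sub_ne_zero, Ne, exp_two_pi_I_mul_eq_one_iff]
  rintro ⟨n, hn⟩
  have := congrArg Complex.im hn
  simp only [mul_im, intCast_re, intCast_im, zero_mul, add_zero, mul_eq_zero, Int.cast_eq_zero] at this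
  exact this.elim hs hτ.ne'

/-- For `s ≠ 0` partial fractions give `(q ^ s - 1) A_n (A_{n-s} - 1) = A_n - A_{n-s}`, which
telescopes to `s`, independently of `z`. For `s = 0` the term is `y q ^ n A_n²`. -/
lemma tsum_appellFactor_mul_sub_one {τ z : ℂ} (hτ : 0 < τ.im) (hz : ∀ m n : ℤ, z ≠ m * τ + n)
    (s : ℤ) :
    ∑' n, appellFactor τ z n * (appellFactor τ z (n - s) - 1) = pairValue τ z s := by
  rw [pairValue]
  split_ifs with h
  · subst h
    rw [weierstrassSum]
    refine tsum_congr fun n => ?_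
    rw [sub_zero, appellFactor_sub_one hz]
    ring
  · have hq := exp_two_pi_I_mul_int_mul_ne_one hτ h
    rw [eq_div_iff hq, ← tsum_mul_right]
    refine Eq.trans (tsum_congr fun n => ?_) (hasSum_appellFactor_sub hτ hz s).tsum_eq
    have h1 := appellFactor_sub_one hz n
    have h2 := appellFactor_sub_one hz (n - s)
    have h3 : exp (2 * π * I * (z + n * τ)) =
        exp (2 * π * I * (z + ((n - s : ℤ) : ℂ) * τ)) * exp (2 * π * I * (s * τ)) := by
      rw [← Complex.exp_add]; congr 1; push_cast; ring
    rw [h3] at h1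
    linear_combination (exp (2 * π * I * (s * τ))) * appellFactor τ z n * h2 -
      appellFactor τ z (n - s) * h1

/-- The Appell-Lerch sums in closed form. -/
lemma eta_cube_mul_mu {k : ℕ} (hk : 2 ≤ k) {j : ℤ} (hj : 1 ≤ j) (hjk : j ≤ k - 1)
    (j' : ℤ) {τ z : ℂ} (hτ : 0 < τ.im) (hz : ∀ m n : ℤ, z ≠ m * τ + n) :
    HasSum (fun s : ℤ => -(pairCoeff k j j' τ s * pairValue τ z s))
      (ModularForm.eta τ ^ 3 * mu k j j' τ z z 0) := by
  obtain ⟨C, hC, hb⟩ := exists_appellFactor_bound hτ hz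
  have hk0 : k ≠ 0 := by omega
  have hc : 0 < 2 * π * τ.im := by positivity
  set F : ℤ → ℤ → ℂ := fun n s =>
    pairCoeff k j j' τ s * (appellFactor τ z n * (appellFactor τ z (n - s) - 1)) with hF
  have hS : Summable (fun p : ℤ × ℤ => F p.1 p.2) := by
    have hA := summable_exp_neg_mul_abs (c := 2 * π * τ.im) hc
    have hB := summable_pairCoeff_mul hk0 j j' hτ 0 (b := 2 * π * τ.im) hc.le
    have hAB := (hA.mul_of_nonneg hB (fun _ => by positivity)
      (fun _ => by positivity)).mul_left (C * C)
    refine Summable.of_norm_bounded hAB fun p => ?_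
    obtain ⟨n, s⟩ := p
    simp only [hF, norm_mul, pow_zero, one_mul]
    have hone : (1 : ℝ) ≤ Real.exp (2 * π * τ.im * |(s : ℝ)|) := Real.one_le_exp (by positivity)
    -- For `n ≥ 0` the decay comes from `A_{n-s} - 1`, for `n ≤ 0` from `A_n`; the loss `exp (2π τ₂
    -- |s|)` is absorbed by the Gaussian decay in `s`.
    have key : ‖appellFactor τ z n‖ * ‖appellFactor τ z (n - s) - 1‖ ≤
        C * C * (Real.exp (-(2 * π * τ.im) * |(n : ℝ)|) * Real.exp (2 * π * τ.im * |(s : ℝ)|)) := by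
      rcases le_total 0 n with hn | hn
      · have hn' : |(n : ℝ)| = n := abs_of_nonneg (by exact_mod_cast hn)
        calc _ ≤ C * (C * Real.exp (-(2 * π * τ.im * ((n - s : ℤ) : ℝ)))) :=
              mul_le_mul (hb n).1 (hb (n - s)).2.2.2 (norm_nonneg _) hC.le
          _ = C * C * Real.exp (-(2 * π * τ.im * ((n - s : ℤ) : ℝ))) := by ring
          _ ≤ C * C * Real.exp (-(2 * π * τ.im) * n + 2 * π * τ.im * |(s : ℝ)|) := by
              gcongr
              push_cast
              nlinarith [le_abs_self (s : ℝ)]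
          _ = _ := by rw [Real.exp_add, hn']
      · have hn' : |(n : ℝ)| = -n := abs_of_nonpos (by exact_mod_cast hn)
        calc _ ≤ (C * Real.exp (2 * π * τ.im * n)) * C :=
              mul_le_mul (hb n).2.2.1 (hb (n - s)).2.1 (norm_nonneg _) (by positivity)
          _ = C * C * (Real.exp (-(2 * π * τ.im) * |(n : ℝ)|) * 1) := by
              rw [hn', neg_mul_neg]; ring
          _ ≤ _ := by gcongr
    calc _ ≤ ‖pairCoeff k j j' τ s‖ * _ := mul_le_mul_of_nonneg_left key (norm_nonneg _)
      _ = _ := by ring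
  have h1 : ModularForm.eta τ ^ 3 * mu k j j' τ z z 0 = -∑' n : ℤ, ∑' s : ℤ, F n s := by
    rw [eta_cube_mul_mu_eq_tsum_tsum hk hj hjk j' hτ hz]
    congr 1
    refine tsum_congr fun n => ?_
    have hsum := summable_pairCoeff hk0 j j' hτ
    have e1 := summable_mul_appellFactor hτ hz hsum (fun s => n - s)
    have e2 : ∀ s, F n s = appellFactor τ z n * (pairCoeff k j j' τ s * appellFactor τ z (n - s)) -
        appellFactor τ z n * pairCoeff k j j' τ s := fun s => by simp only [hF]; ring
    rw [tsum_congr e2, (e1.mul_left _).tsum_sub (hsum.mul_left _), tsum_mul_left, tsum_mul_left,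
      tsum_pairCoeff, mul_zero, sub_zero, ← tsum_mul_left]
    exact tsum_congr fun s => by ring
  rw [h1, ← hS.tsum_comm (f := F)]
  have h2 : ∀ s, ∑' n, F n s = pairCoeff k j j' τ s * pairValue τ z s := fun s => by
    rw [← tsum_appellFactor_mul_sub_one hτ hz, ← tsum_mul_left]
  have h3 : Summable (fun s => ∑' n, F n s) := by
    have := (Equiv.prodComm ℤ ℤ).summable_iff.2 hS
    exact this.prod
  refine (h3.hasSum.neg).congr_fun fun s => ?_
  rw [h2]

/-! ### Summation against the invariant matrices -/

/-- Odd functions of period `2k` vanish at `0` and `k`, and the indicators with `0 < j < k` form a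
basis of them whose coordinates are the values at `j`. -/
lemma sum_mul_oddResidue {k : ℕ} (hk : k ≠ 0) {W : ℤ → ℂ} (hper : ∀ p m : ℤ, W (p + 2 * k * m) = W p)
    (hodd : ∀ p, W (-p) = -W p) (p : ℤ) :
    ∑ j ∈ Finset.Icc 1 (k - 1), W (j : ℕ) * oddResidue k (j : ℕ) p = W p := by
  have hk' : (0 : ℤ) < 2 * k := by positivity
  obtain ⟨r, m, hr0, hr1, rfl⟩ : ∃ r m : ℤ, 0 ≤ r ∧ r < 2 * k ∧ p = r + 2 * k * m :=
    ⟨p % (2 * k), p / (2 * k), Int.emod_nonneg _ hk'.ne', Int.emod_lt_of_pos _ hk',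
      (Int.emod_add_mul_ediv p (2 * k)).symm⟩
  rw [hper]
  simp only [oddResidue_add]
  have hdvd : ∀ x : ℤ, -(2 * k) < x → x < 2 * k → ((2 * k : ℤ) ∣ x ↔ x = 0) := fun x h1 h2 =>
    ⟨fun h => Int.eq_zero_of_abs_lt_dvd h (abs_lt.2 ⟨h1, h2⟩), fun h => h ▸ dvd_zero _⟩
  have hres : ∀ j ∈ Finset.Icc 1 (k - 1), oddResidue k (j : ℕ) r =
      (if r = j then 1 else 0) - (if r = 2 * k - j then 1 else 0) := fun j hj => by
    rw [Finset.mem_Icc] at hj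
    rw [oddResidue]
    congr 1
    · exact if_congr (by rw [hdvd _ (by omega) (by omega)]; omega) rfl rfl
    · refine if_congr ?_ rfl rfl
      rw [show r + (j : ℤ) = (r + j - 2 * k) + 2 * k * 1 by ring,
        dvd_add_left (dvd_mul_right _ 1), hdvd _ (by omega) (by omega)]
      omega
  have key : W r = ∑ j ∈ Finset.Icc 1 (k - 1), W (j : ℕ) *
      ((if r = j then 1 else 0) - (if r = 2 * k - j then 1 else 0)) := by
    rcases lt_trichotomy r k with h | h | h
    · rcases hr0.eq_or_lt with h0 | h0
      · have : W 0 = 0 := by have := hodd 0; rw [neg_zero] at this; exact self_eq_neg.1 this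
        rw [← h0, this, Finset.sum_eq_zero]
        intro j hj
        rw [Finset.mem_Icc] at hj
        rw [if_neg (by omega), if_neg (by omega)]; simp
      · lift r to ℕ using hr0
        rw [Finset.sum_eq_single r]
        · rw [if_pos rfl, if_neg (by omega)]; simp
        · intro j hj hne
          rw [Finset.mem_Icc] at hj
          rw [if_neg (by omega), if_neg (by omega)]; simp
        · intro hn
          rw [Finset.mem_Icc] at hn
          omega
    · have : W k = 0 := by
        have h1 := hodd k
        rw [← hper (-k) 1, show -(k : ℤ) + 2 * k * 1 = k by ring] at h1
        exact self_eq_neg.1 h1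
      rw [h, this, Finset.sum_eq_zero]
      intro j hj
      rw [Finset.mem_Icc] at hj
      rw [if_neg (by omega), if_neg (by omega)]; simp
    · obtain ⟨i, hi⟩ : ∃ i : ℕ, (i : ℤ) = 2 * k - r := ⟨(2 * k - r).toNat, by omega⟩
      rw [Finset.sum_eq_single i]
      · rw [if_neg (by omega), if_pos (by omega), show r = -(i : ℤ) + 2 * k * 1 by omega, hper, hodd]
        simp
      · intro j hj hne
        rw [Finset.mem_Icc] at hj
        rw [if_neg (by omega), if_neg (by omega)]; simp
      · intro hn
        rw [Finset.mem_Icc] at hn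
        omega
  rw [key]
  exact Finset.sum_congr rfl fun j hj => by rw [hres j hj]

/-- The matrix `Ω̂^{(k,d)}`. -/
def omegaHatDiv (k d : ℕ) (r r' : ℤ) : ℂ := omegaDiv k d r r' - omegaDiv k d r (-r')

variable {k d e : ℕ}

lemma omegaDiv_mul (hd : d ≠ 0) (r r' : ℤ) : omegaDiv (d * e) d r r' =
    if (2 * d : ℤ) ∣ r + r' ∧ (2 * e : ℤ) ∣ r - r' then 1 else 0 := by
  have : 2 * (d * e) / d = 2 * e := by
    rw [mul_left_comm, Nat.mul_div_cancel_left _ (Nat.pos_of_ne_zero hd)]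
  simp only [omegaDiv, this, Nat.cast_mul, Nat.cast_ofNat]

lemma omegaDiv_add_left (hd : d ≠ 0) (r r' m : ℤ) :
    omegaDiv (d * e) d (r + 2 * (d * e : ℕ) * m) r' = omegaDiv (d * e) d r r' := by
  rw [omegaDiv_mul hd, omegaDiv_mul hd]
  refine if_congr (and_congr ?_ ?_) rfl rfl
  · rw [show r + 2 * ((d * e : ℕ) : ℤ) * m + r' = r + r' + 2 * d * (e * m) by push_cast; ring,
      dvd_add_left (dvd_mul_right _ _)]
  · rw [show r + 2 * ((d * e : ℕ) : ℤ) * m - r' = r - r' + 2 * e * (d * m) by push_cast; ring,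
      dvd_add_left (dvd_mul_right _ _)]

lemma omegaDiv_neg (k d : ℕ) (r r' : ℤ) : omegaDiv k d (-r) (-r') = omegaDiv k d r r' := by
  rw [omegaDiv, omegaDiv]
  refine if_congr (and_congr ?_ ?_) rfl rfl
  · rw [← dvd_neg]; ring_nf
  · rw [← dvd_neg]; ring_nf

lemma omegaDiv_comm (k d : ℕ) (r r' : ℤ) : omegaDiv k d r r' = omegaDiv k d r' r := by
  rw [omegaDiv, omegaDiv]
  refine if_congr (and_congr (by rw [add_comm]) ?_) rfl rfl
  rw [← dvd_neg]; ring_nf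

lemma sum_omegaHatDiv_mul_oddResidue (hd : d ≠ 0) (he : e ≠ 0) (p j' : ℤ) :
    ∑ j ∈ Finset.Icc 1 (d * e - 1), omegaHatDiv (d * e) d (j : ℕ) j' * oddResidue (d * e) (j : ℕ) p =
      omegaHatDiv (d * e) d p j' := by
  refine sum_mul_oddResidue (mul_ne_zero hd he) (W := fun p => omegaHatDiv (d * e) d p j') ?_ ?_ p
  · intro p m
    simp only [omegaHatDiv, omegaDiv_add_left hd]
  · intro p
    simp only [omegaHatDiv]
    rw [omegaDiv_neg, ← omegaDiv_neg _ _ (-p) j', neg_neg, neg_sub]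

/-- The weight `[e ∣ s][d ∣ s + m] - [d ∣ s][e ∣ s + m]`. -/
def latticeWeight (d e : ℕ) (s m : ℤ) : ℂ :=
  (if (e : ℤ) ∣ s ∧ (d : ℤ) ∣ s + m then 1 else 0) - (if (d : ℤ) ∣ s ∧ (e : ℤ) ∣ s + m then 1 else 0)

lemma omegaHatDiv_two_mul_add (hd : d ≠ 0) (s j' : ℤ) :
    omegaHatDiv (d * e) d (2 * s + j') j' = latticeWeight d e s j' := by
  rw [omegaHatDiv, omegaDiv_mul hd, omegaDiv_mul hd, latticeWeight]
  have h : ∀ n x : ℤ, 2 * n ∣ 2 * x ↔ n ∣ x := fun n x => mul_dvd_mul_iff_left two_ne_zero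
  congr 1
  · refine if_congr ?_ rfl rfl
    rw [show 2 * s + j' + j' = 2 * (s + j') by ring, show 2 * s + j' - j' = 2 * s by ring, h, h,
      and_comm]
  · refine if_congr ?_ rfl rfl
    rw [show 2 * s + j' + -j' = 2 * s by ring, show 2 * s + j' - -j' = 2 * (s + j') by ring, h, h]

lemma latticeWeight_add (s m t : ℤ) :
    latticeWeight d e s (m + (d * e : ℕ) * t) = latticeWeight d e s m := by
  simp only [latticeWeight]
  congr 1
  · refine if_congr (and_congr_right' ?_) rfl rfl
    rw [show s + (m + ((d * e : ℕ) : ℤ) * t) = s + m + d * (e * t) by push_cast; ring,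
      dvd_add_left (dvd_mul_right _ _)]
  · refine if_congr (and_congr_right' ?_) rfl rfl
    rw [show s + (m + ((d * e : ℕ) : ℤ) * t) = s + m + e * (d * t) by push_cast; ring,
      dvd_add_left (dvd_mul_right _ _)]

lemma latticeWeight_zero_right (s : ℤ) : latticeWeight d e s 0 = 0 := by
  simp only [latticeWeight, add_zero, sub_eq_zero]
  exact if_congr and_comm rfl rfl

/-- The matrix is odd and periodic in its first index, so summing over `j` replaces the residue
indicator by a matrix entry at `2s + j'`. The residue conditions then involve only `s` and `s + j'`.
-/
lemma sum_omegaHatDiv_mul_pairCoeff (hd : d ≠ 0) (he : e ≠ 0) (j' s : ℤ) (τ : ℂ) :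
    ∑ j ∈ Finset.Icc 1 (d * e - 1), omegaHatDiv (d * e) d (j : ℕ) j' *
      pairCoeff (d * e) (j : ℕ) j' τ s =
      latticeWeight d e s j' * exp (2 * π * I * (s * (s + j') / (d * e)) * τ) := by
  rw [← omegaHatDiv_two_mul_add hd, ← sum_omegaHatDiv_mul_oddResidue hd he, Finset.sum_mul]
  refine Finset.sum_congr rfl fun j _ => ?_
  rw [pairCoeff, mul_div_assoc, ← mul_assoc]
  congr 1
  rw [thetaExp, thetaExp, ← Complex.exp_sub]
  congr 1
  have h1 : (d : ℂ) ≠ 0 := by exact_mod_cast hd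
  have h2 : (e : ℂ) ≠ 0 := by exact_mod_cast he
  push_cast
  field_simp
  ring

/-- The geometric series is expanded in `q ^ s` for `s > 0` and in `q ^ (-s)` for `s < 0`, whichever
has modulus below `1`. In the second case it starts at `t = -1`, which the sign condition records.
-/
lemma hasSum_neg_pairValue {τ : ℂ} (hτ : 0 < τ.im) (z : ℂ) {s : ℤ} (hs : s ≠ 0) :
    HasSum (fun t : ℤ => if (0 < s ↔ 0 ≤ t) then ((|s| : ℤ) : ℂ) * exp (2 * π * I * (s * t * τ)) else 0)
      (-(pairValue τ z s)) := by
  rw [pairValue, if_neg hs]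
  have hq := exp_two_pi_I_mul_int_mul_ne_one hτ hs
  have hpow : ∀ n : ℕ, exp (2 * π * I * (s * n * τ)) = exp (2 * π * I * (s * τ)) ^ n := fun n => by
    rw [← Complex.exp_nat_mul]; ring_nf
  have hpow' : ∀ n : ℕ, exp (2 * π * I * (s * (-(n + 1)) * τ)) =
      exp (-(2 * π * I * (s * τ))) * exp (-(2 * π * I * (s * τ))) ^ n := fun n => by
    rw [← Complex.exp_nat_mul, ← Complex.exp_add]; ring_nf
  set F : ℤ → ℂ := fun t =>
    if (0 < s ↔ 0 ≤ t) then ((|s| : ℤ) : ℂ) * exp (2 * π * I * (s * t * τ)) else 0 with hF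
  rcases lt_or_gt_of_ne hs with h | h
  · have hn : ‖exp (-(2 * π * I * (s * τ)))‖ < 1 := by
      rw [Complex.norm_exp, Real.exp_lt_one_iff]
      have : (s : ℝ) < 0 := by exact_mod_cast h
      have h3 : (-(2 * π * I * (s * τ))).re = 2 * π * (s * τ.im) := by simp
      rw [h3]
      exact mul_neg_of_pos_of_neg Real.two_pi_pos (mul_neg_of_neg_of_pos this hτ)
    have h1 : HasSum (fun n : ℕ => F n) 0 := by
      refine hasSum_zero.congr_fun fun n => ?_
      simp only [hF]
      rw [if_neg (by omega)]
    have h2 : HasSum (fun n : ℕ => F (-((n : ℤ) + 1)))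
        (((|s| : ℤ) : ℂ) * exp (-(2 * π * I * (s * τ))) *
          (1 - exp (-(2 * π * I * (s * τ))))⁻¹) := by
      refine ((hasSum_geometric_of_norm_lt_one hn).mul_left _).congr_fun fun n => ?_
      simp only [hF]
      rw [if_pos (by omega), mul_assoc (((|s| : ℤ) : ℂ)), ← hpow' n]
      push_cast; rfl
    have h3 := HasSum.of_nat_of_neg_add_one h1 h2
    rw [zero_add, abs_of_neg h, Complex.exp_neg] at h3
    convert h3 using 1
    have hE := Complex.exp_ne_zero (2 * π * I * (s * τ))
    generalize exp (2 * π * I * (s * τ)) = q at hq hE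
    have : 1 - q⁻¹ ≠ 0 := by
      intro h0
      apply hq
      field_simp at h0
      simpa using h0
    field_simp
    push_cast
    ring
  · have hn : ‖exp (2 * π * I * (s * τ))‖ < 1 := by
      rw [Complex.norm_exp, Real.exp_lt_one_iff]
      have : (0 : ℝ) < s := by exact_mod_cast h
      have h3 : (2 * π * I * (s * τ)).re = -(2 * π * (s * τ.im)) := by simp
      rw [h3, neg_lt_zero]
      positivity
    have h1 : HasSum (fun n : ℕ => F (-((n : ℤ) + 1))) 0 := by
      refine hasSum_zero.congr_fun fun n => ?_
      simp only [hF]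
      rw [if_neg (by omega)]
    have h2 : HasSum (fun n : ℕ => F n)
        (((|s| : ℤ) : ℂ) * (1 - exp (2 * π * I * (s * τ)))⁻¹) := by
      refine ((hasSum_geometric_of_norm_lt_one hn).mul_left _).congr_fun fun n => ?_
      simp only [hF]
      rw [if_pos (by omega), ← hpow n]
      push_cast; rfl
    have h3 := HasSum.of_nat_of_neg_add_one h2 h1
    rw [add_zero, abs_of_pos h, ← neg_sub, inv_neg, mul_neg, ← div_eq_mul_inv] at h3
    exact h3

/-! ### The double series of the Appell-Lerch sums -/

/-- The terms of the double series over `(s, m)` with `sm > 0`. -/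
def appellTerm (d e : ℕ) (τ : ℂ) (s m : ℤ) : ℂ :=
  if 0 < s * m then ((|s| : ℤ) : ℂ) * exp (2 * π * I * (s * (s + m) / (d * e)) * τ) else 0

lemma summable_appellTerm (hd : d ≠ 0) (he : e ≠ 0) {τ : ℂ} (hτ : 0 < τ.im) :
    Summable (fun p : ℤ × ℤ => appellTerm d e τ p.1 p.2) := by
  have hd' : (0 : ℝ) < d := by exact_mod_cast Nat.pos_of_ne_zero hd
  have he' : (0 : ℝ) < e := by exact_mod_cast Nat.pos_of_ne_zero he
  set c : ℝ := 2 * π * τ.im / (d * e) with hc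
  have hc0 : 0 < c := by positivity
  have hg : Summable (fun p : ℤ × ℤ =>
      (|(p.1 : ℝ)| ^ 1 * Real.exp (-c * p.1 ^ 2 + 0 * |(p.1 : ℝ)|)) * Real.exp (-c * |(p.2 : ℝ)|)) :=
    Summable.mul_of_nonneg (f := fun s : ℤ => |(s : ℝ)| ^ 1 * Real.exp (-c * s ^ 2 + 0 * |(s : ℝ)|))
      (g := fun m : ℤ => Real.exp (-c * |(m : ℝ)|))
      (summable_pow_mul_gaussian 1 0 hc0) (by simpa using summable_exp_neg_mul_abs hc0)
      (fun _ => by positivity) (fun _ => by positivity)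
  refine hg.of_norm_bounded fun p => ?_
  obtain ⟨s, m⟩ := p
  simp only [appellTerm]
  split_ifs with h
  · rw [norm_mul, Complex.norm_exp]
    have h1 : (2 * π * I * (s * (s + m) / (d * e)) * τ : ℂ).re = -(c * (s * (s + m))) := by
      have : (2 * π * I * (s * (s + m) / (d * e)) * τ : ℂ) =
          ((2 * π * (s * (s + m) / (d * e)) : ℝ) : ℂ) * (I * τ) := by push_cast; ring
      rw [this, Complex.re_ofReal_mul]
      simp only [I_mul_re]
      rw [hc]; ring
    have h2 : ‖((|s| : ℤ) : ℂ)‖ = |(s : ℝ)| := by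
      rw [Complex.norm_intCast, Int.cast_abs, abs_abs]
    -- Since `s` is a nonzero integer and `sm > 0`, the product `sm` dominates `|m|`, giving decay
    -- in `m` independent of `s`.
    have h3 : |(m : ℝ)| ≤ s * m := by
      have h4 : |m| ≤ |s| * |m| := by
        have : 1 ≤ |s| := Int.one_le_abs (by rintro rfl; simp at h)
        exact le_mul_of_one_le_left (abs_nonneg m) this
      rw [← abs_mul, abs_of_pos h] at h4
      exact_mod_cast h4
    rw [h1, h2, pow_one, mul_assoc, ← Real.exp_add]
    refine mul_le_mul_of_nonneg_left (Real.exp_le_exp.2 ?_) (abs_nonneg _)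
    linarith [mul_le_mul_of_nonneg_left h3 hc0.le]
  · rw [norm_zero]; positivity

lemma sum_range_mul_dvd (hd : d ≠ 0) (e : ℕ) :
    ∑ j ∈ Finset.range (d * e), (if (d : ℤ) ∣ (j : ℕ) then (1 : ℂ) else 0) = e := by
  induction e with
  | zero => simp
  | succ e ih =>
    rw [mul_add, mul_one, Finset.sum_range_add, ih, Finset.sum_eq_single 0]
    · rw [if_pos ⟨e, by push_cast; ring⟩]; push_cast; ring
    · intro j hj h0
      rw [Finset.mem_range] at hj
      refine if_neg fun h => ?_
      rw [Nat.cast_add, Nat.cast_mul, dvd_add_right (dvd_mul_right _ _)] at h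
      exact absurd (Nat.le_of_dvd (Nat.pos_of_ne_zero h0) (by exact_mod_cast h)) (by omega)
    · intro h
      exact absurd (Finset.mem_range.2 (Nat.pos_of_ne_zero hd)) h

/-- Writing `m = j' + de·t` merges the residue `j'` and the geometric index `t` into one integer.
For `0 < j' < de` the sign of `m` is positive exactly when `t ≥ 0`, so the condition becomes `sm >
0`; at `j' = 0` the weight vanishes. -/
lemma sum_latticeWeight_mul_pairValue (hd : d ≠ 0) (he : e ≠ 0) {τ : ℂ} (hτ : 0 < τ.im) (z : ℂ)
    {s : ℤ} (hs : s ≠ 0) :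
    ∑ j' ∈ Finset.range (d * e), latticeWeight d e s (j' : ℕ) *
      exp (2 * π * I * (s * (s + (j' : ℤ)) / (d * e)) * τ) * -(pairValue τ z s) =
      ∑' m : ℤ, latticeWeight d e s m * appellTerm d e τ s m := by
  have hd' : (d : ℂ) ≠ 0 := by exact_mod_cast hd
  have he' : (e : ℂ) ≠ 0 := by exact_mod_cast he
  have hS : Summable (fun m : ℤ => latticeWeight d e s m * appellTerm d e τ s m) := by
    refine Summable.of_norm_bounded (g := fun m => 2 * ‖appellTerm d e τ s m‖)
      (((summable_appellTerm hd he hτ).norm.prod_factor s).mul_left 2) fun m => ?_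
    rw [norm_mul]
    gcongr
    rw [latticeWeight]
    refine (norm_sub_le _ _).trans ?_
    split_ifs <;> norm_num
  rw [← tsum_range_add_mul (mul_ne_zero hd he) hS]
  refine Finset.sum_congr rfl fun j hj => ?_
  rw [Finset.mem_range] at hj
  rw [← (hasSum_neg_pairValue hτ z hs).tsum_eq, ← tsum_mul_left]
  refine tsum_congr fun t => ?_
  rw [latticeWeight_add]
  rcases Nat.eq_zero_or_pos j with rfl | hj0
  · simp [latticeWeight_zero_right]
  rw [mul_assoc, appellTerm]
  congr 1
  have hiff : (0 < s * ((j : ℤ) + (d * e : ℕ) * t)) ↔ (0 < s ↔ 0 ≤ t) := by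
    have h1 : 0 ≤ t → 0 < (j : ℤ) + (d * e : ℕ) * t := fun h => by positivity
    have h2 : t < 0 → (j : ℤ) + (d * e : ℕ) * t < 0 := fun h => by
      have : (j : ℤ) < (d * e : ℕ) := by exact_mod_cast hj
      nlinarith
    constructor
    · intro h
      rcases pos_and_pos_or_neg_and_neg_of_mul_pos h with ⟨h3, h4⟩ | ⟨h3, h4⟩
      · exact ⟨fun _ => by by_contra! h5; linarith [h2 h5], fun _ => h3⟩
      · exact ⟨fun h5 => by omega, fun h5 => by linarith [h1 h5]⟩
    · intro h
      rcases lt_or_gt_of_ne hs with h3 | h3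
      · exact mul_pos_of_neg_of_neg h3 (h2 (by by_contra! h5; have := h.2 h5; omega))
      · exact mul_pos h3 (h1 (h.1 h3))
  by_cases h : (0 < s ↔ 0 ≤ t)
  · rw [if_pos h, if_pos (hiff.2 h), mul_left_comm, ← Complex.exp_add]
    congr 2
    push_cast
    field_simp
    ring
  · rw [if_neg h, if_neg (fun h' => h (hiff.1 h')), mul_zero]

/-- The coefficients of `q ^ (ab)` in the double series `η³ μ`. -/
def divisorTerm (d e : ℕ) (τ : ℂ) (a b : ℤ) : ℂ :=
  ((if 0 < (e * b : ℤ) * (d * a - e * b) then ((|e * b| : ℤ) : ℂ) else 0) -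
    (if 0 < (d * a : ℤ) * (e * b - d * a) then ((|d * a| : ℤ) : ℂ) else 0)) *
    exp (2 * π * I * (a * b) * τ)

/-- The divisibility conditions say `s = eb` and `s + m = da`, and in these coordinates the exponent
`s(s + m) / de` is `ab`. -/
lemma hasSum_residue_appellTerm (hd : d ≠ 0) (he : e ≠ 0) {τ : ℂ} (hτ : 0 < τ.im) :
    HasSum (fun p : ℤ × ℤ => if 0 < (e * p.2 : ℤ) * (d * p.1 - e * p.2) then
        ((|e * p.2| : ℤ) : ℂ) * exp (2 * π * I * (p.1 * p.2) * τ) else 0)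
      (∑' p : ℤ × ℤ, (if (e : ℤ) ∣ p.1 ∧ (d : ℤ) ∣ p.1 + p.2 then 1 else 0) *
        appellTerm d e τ p.1 p.2) := by
  have hd' : (d : ℂ) ≠ 0 := by exact_mod_cast hd
  have he' : (e : ℂ) ≠ 0 := by exact_mod_cast he
  have hdz : (d : ℤ) ≠ 0 := by exact_mod_cast hd
  have hez : (e : ℤ) ≠ 0 := by exact_mod_cast he
  have hS : Summable (fun p : ℤ × ℤ => (if (e : ℤ) ∣ p.1 ∧ (d : ℤ) ∣ p.1 + p.2 then 1 else 0) *
      appellTerm d e τ p.1 p.2) := by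
    refine Summable.of_norm_bounded (summable_appellTerm hd he hτ).norm fun p => ?_
    rw [norm_mul]
    refine mul_le_of_le_one_left (norm_nonneg _) ?_
    split_ifs <;> simp
  let φ : ℤ × ℤ → ℤ × ℤ := fun p => (e * p.2, d * p.1 - e * p.2)
  have hφ : Function.Injective φ := by
    rintro ⟨a, b⟩ ⟨a', b'⟩ h
    simp only [φ, Prod.mk.injEq] at h
    have h1 : b = b' := mul_left_cancel₀ hez h.1
    subst h1
    have h2 : a = a' := mul_left_cancel₀ hdz (by linarith [h.2])
    rw [h2]
  have h := (hφ.hasSum_iff (f := fun p : ℤ × ℤ =>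
    (if (e : ℤ) ∣ p.1 ∧ (d : ℤ) ∣ p.1 + p.2 then 1 else 0) * appellTerm d e τ p.1 p.2) ?_).2 hS.hasSum
  · refine h.congr_fun fun p => ?_
    simp only [Function.comp, φ]
    rw [if_pos (show (e : ℤ) ∣ e * p.2 ∧ (d : ℤ) ∣ e * p.2 + (d * p.1 - e * p.2) from
      ⟨dvd_mul_right _ _, by rw [add_sub_cancel]; exact dvd_mul_right _ _⟩), one_mul, appellTerm]
    refine if_congr Iff.rfl ?_ rfl
    congr 2
    push_cast
    field_simp
    ring
  · rintro ⟨s, m⟩ hp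
    rw [if_neg, zero_mul]
    rintro ⟨⟨b, hb⟩, ⟨a, ha⟩⟩
    exact hp ⟨(a, b), by simp only [φ, Prod.mk.injEq]; exact ⟨hb.symm, by simp only at hb ha; linarith⟩⟩

/-- The second half of the weight is the first with `d` and `e` exchanged; exchanging `a` and `b` as
well restores the common exponent. -/
lemma hasSum_divisorTerm (hd : d ≠ 0) (he : e ≠ 0) {τ : ℂ} (hτ : 0 < τ.im) :
    HasSum (fun p : ℤ × ℤ => divisorTerm d e τ p.1 p.2)
      (∑' p : ℤ × ℤ, latticeWeight d e p.1 p.2 * appellTerm d e τ p.1 p.2) := by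
  have h1 := hasSum_residue_appellTerm hd he hτ
  have h2 := (Equiv.prodComm ℤ ℤ).hasSum_iff.2 (hasSum_residue_appellTerm he hd hτ)
  have hS : ∀ d' e' : ℕ, Summable (fun p : ℤ × ℤ =>
      (if (e' : ℤ) ∣ p.1 ∧ (d' : ℤ) ∣ p.1 + p.2 then 1 else 0) * appellTerm d e τ p.1 p.2) := by
    intro d' e'
    refine Summable.of_norm_bounded (summable_appellTerm hd he hτ).norm fun p => ?_
    rw [norm_mul]
    refine mul_le_of_le_one_left (norm_nonneg _) ?_
    split_ifs <;> simp
  have h3 : ∑' p : ℤ × ℤ, latticeWeight d e p.1 p.2 * appellTerm d e τ p.1 p.2 =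
      ∑' p : ℤ × ℤ, (if (e : ℤ) ∣ p.1 ∧ (d : ℤ) ∣ p.1 + p.2 then 1 else 0) *
        appellTerm d e τ p.1 p.2 -
      ∑' p : ℤ × ℤ, (if (d : ℤ) ∣ p.1 ∧ (e : ℤ) ∣ p.1 + p.2 then 1 else 0) *
        appellTerm e d τ p.1 p.2 := by
    have h4 : ∀ p : ℤ × ℤ, appellTerm e d τ p.1 p.2 = appellTerm d e τ p.1 p.2 := fun p => by
      rw [appellTerm, appellTerm, mul_comm (e : ℂ)]
    simp only [h4]
    rw [← (hS d e).tsum_sub (hS e d)]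
    exact tsum_congr fun p => by rw [latticeWeight, sub_mul]
  rw [h3]
  refine (h1.sub h2).congr_fun fun p => ?_
  simp only [divisorTerm, Function.comp, Equiv.prodComm_apply, Prod.fst_swap, Prod.snd_swap, sub_mul,
    ite_mul, zero_mul]
  congr 1
  exact if_congr Iff.rfl (by rw [mul_comm (p.2 : ℂ)]) rfl

/-- The contribution of `Ω^{(k,d)}` to `η³ μ^Y(τ; z, z, 0)`. -/
lemma sum_omegaHatDiv_mul_mu (hd : d ≠ 0) (he : e ≠ 0) (hk : 2 ≤ d * e) {τ z : ℂ}
    (hτ : 0 < τ.im) (hz : ∀ m n : ℤ, z ≠ m * τ + n) :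
    ModularForm.eta τ ^ 3 * ∑ j ∈ Finset.Icc 1 (d * e - 1), ∑ j' ∈ Finset.Icc 1 (d * e - 1),
      omegaHatDiv (d * e) d (j : ℕ) (j' : ℕ) * mu (d * e) (j : ℕ) (j' : ℕ) τ z z 0 =
      -(((e : ℂ) - d) * weierstrassSum τ z) + ∑' p : ℤ × ℤ, divisorTerm d e τ p.1 p.2 := by
  set f : ℤ → ℂ := fun s => ∑ j' ∈ Finset.range (d * e), latticeWeight d e s (j' : ℕ) *
      exp (2 * π * I * (s * (s + (j' : ℤ)) / (d * e)) * τ) * -(pairValue τ z s) with hf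
  have h1 : HasSum f (ModularForm.eta τ ^ 3 * ∑ j ∈ Finset.Icc 1 (d * e - 1),
      ∑ j' ∈ Finset.Icc 1 (d * e - 1),
      omegaHatDiv (d * e) d (j : ℕ) (j' : ℕ) * mu (d * e) (j : ℕ) (j' : ℕ) τ z z 0) := by
    simp only [Finset.mul_sum]
    have h := hasSum_sum (s := Finset.Icc 1 (d * e - 1)) fun j hj =>
      hasSum_sum (s := Finset.Icc 1 (d * e - 1)) fun j' (_ : j' ∈ _) =>
        (eta_cube_mul_mu hk (j := (j : ℕ)) (by rw [Finset.mem_Icc] at hj; omega)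
          (by rw [Finset.mem_Icc] at hj; omega) (j' : ℕ) hτ hz).mul_left
          (omegaHatDiv (d * e) d (j : ℕ) (j' : ℕ))
    simp only [mul_left_comm (ModularForm.eta τ ^ 3)]
    refine h.congr_fun fun s => ?_
    rw [Finset.sum_comm, hf]
    have hsub : Finset.Icc 1 (d * e - 1) ⊆ Finset.range (d * e) := fun j hj => by
      rw [Finset.mem_Icc] at hj; rw [Finset.mem_range]; omega
    simp only
    rw [← Finset.sum_subset hsub]
    · refine Finset.sum_congr rfl fun j' _ => ?_
      rw [← sum_omegaHatDiv_mul_pairCoeff hd he, Finset.sum_mul]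
      refine Finset.sum_congr rfl fun j _ => by ring
    · intro j hj hj'
      rw [Finset.mem_range] at hj
      rw [Finset.mem_Icc] at hj'
      obtain rfl : j = 0 := by omega
      simp [latticeWeight_zero_right]
  have hS : Summable (fun p : ℤ × ℤ => latticeWeight d e p.1 p.2 * appellTerm d e τ p.1 p.2) := by
    refine Summable.of_norm_bounded (g := fun p : ℤ × ℤ => 2 * ‖appellTerm d e τ p.1 p.2‖)
      ((summable_appellTerm hd he hτ).norm.mul_left 2) fun p => ?_
    rw [norm_mul]
    gcongr
    rw [latticeWeight]
    refine (norm_sub_le _ _).trans ?_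
    split_ifs <;> norm_num
  rw [(hasSum_divisorTerm hd he hτ).tsum_eq, hS.tsum_prod, ← h1.tsum_eq,
    h1.summable.tsum_eq_add_tsum_ite 0]
  congr 1
  -- The term `s = 0` counts the multiples of `d`, minus those of `e`, among the residues modulo
  -- `de`; there are `e` and `d` of them.
  · simp only [hf, latticeWeight, pairValue, if_true, dvd_zero, true_and, zero_add, Int.cast_zero,
      zero_mul, mul_zero, zero_div, Complex.exp_zero, mul_one]
    rw [← Finset.sum_mul, Finset.sum_sub_distrib, sum_range_mul_dvd hd, mul_comm d e,
      sum_range_mul_dvd he]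
    ring
  · refine tsum_congr fun s => ?_
    split_ifs with h
    · subst h
      simp [appellTerm]
    · exact sum_latticeWeight_mul_pairValue hd he hτ z h

/-! ### The error function -/

lemma hasDerivAt_errorE (x : ℝ) : HasDerivAt errorE (2 * Real.exp (-π * x ^ 2)) x := by
  have hc : Continuous fun t : ℝ => Real.exp (-π * t ^ 2) := by fun_prop
  exact (intervalIntegral.integral_hasDerivAt_right (hc.intervalIntegrable _ _)
    hc.stronglyMeasurable.stronglyMeasurableAtFilter hc.continuousAt).const_mul 2

lemma errorE_zero : errorE 0 = 0 := by simp [errorE]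

lemma errorE_neg (x : ℝ) : errorE (-x) = -errorE x := by
  have h := intervalIntegral.integral_comp_neg (a := 0) (b := x) fun t : ℝ => Real.exp (-π * t ^ 2)
  simp only [neg_sq, neg_zero] at h
  rw [errorE, errorE, h, intervalIntegral.integral_symm]
  ring

lemma tendsto_errorE : Tendsto errorE atTop (𝓝 1) := by
  have h := intervalIntegral_tendsto_integral_Ioi 0 (integrable_exp_neg_mul_sq Real.pi_pos).integrableOn
    tendsto_id
  rw [integral_gaussian_Ioi, div_self Real.pi_ne_zero, Real.sqrt_one] at h
  have h2 := h.const_mul 2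
  rw [show (2 : ℝ) * (1 / 2) = 1 by norm_num] at h2
  exact h2

lemma continuous_errorE : Continuous errorE :=
  continuous_iff_continuousAt.2 fun x => (hasDerivAt_errorE x).continuousAt

lemma one_sub_errorE (x : ℝ) :
    1 - errorE x = ∫ u in Set.Ioi (0 : ℝ), 2 * Real.exp (-π * (x + u) ^ 2) := by
  have h := integral_Ioi_of_hasDerivAt_of_nonneg' (a := 0) (g := fun u => errorE (x + u)) (l := 1)
    (g' := fun u => 2 * Real.exp (-π * (x + u) ^ 2))
    (fun u _ => (hasDerivAt_errorE (x + u)).comp_const_add x u)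
    (fun u _ => by positivity) (tendsto_errorE.comp (tendsto_atTop_add_const_left _ x tendsto_id))
  rw [h, add_zero]

lemma one_sub_errorE_nonneg (x : ℝ) : 0 ≤ 1 - errorE x := by
  rw [one_sub_errorE]
  exact setIntegral_nonneg measurableSet_Ioi fun u _ => by positivity

/-- In the tail integral `(x + u)² ≥ x² + u²` for `x, u ≥ 0`, which leaves the full half-line
Gaussian. -/
lemma one_sub_errorE_le {x : ℝ} (hx : 0 ≤ x) : 1 - errorE x ≤ Real.exp (-π * x ^ 2) := by
  have h0 := one_sub_errorE 0
  rw [errorE_zero, sub_zero] at h0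
  have hint : IntegrableOn (fun u : ℝ => 2 * Real.exp (-π * u ^ 2)) (Set.Ioi 0) :=
    ((integrable_exp_neg_mul_sq Real.pi_pos).const_mul 2).integrableOn
  rw [one_sub_errorE, show Real.exp (-π * x ^ 2) = Real.exp (-π * x ^ 2) * 1 by ring, h0,
    ← integral_const_mul]
  simp only [zero_add]
  refine integral_mono_of_nonneg (ae_of_all _ fun u => by positivity) (hint.const_mul _) ?_
  refine (ae_restrict_iff' measurableSet_Ioi).2 (ae_of_all _ fun u hu => ?_)
  simp only
  rw [mul_left_comm, ← Real.exp_add]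
  refine mul_le_mul_of_nonneg_left (Real.exp_le_exp.2 ?_) two_pos.le
  have : 0 ≤ π * (x * u) := mul_nonneg Real.pi_pos.le (mul_nonneg hx (le_of_lt hu))
  nlinarith

/-- The odd function `sgn x - E(x)`. -/
def signErfc (x : ℝ) : ℝ := Real.sign x - errorE x

lemma signErfc_of_pos {x : ℝ} (hx : 0 < x) : signErfc x = 1 - errorE x := by
  rw [signErfc, Real.sign_of_pos hx]

lemma signErfc_neg (x : ℝ) : signErfc (-x) = -signErfc x := by
  rw [signErfc, signErfc, Real.sign_neg, errorE_neg]; ring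

lemma signErfc_zero : signErfc 0 = 0 := by simp [signErfc, errorE_zero]

lemma abs_signErfc (x : ℝ) : |signErfc x| = signErfc |x| := by
  rcases lt_trichotomy x 0 with h | rfl | h
  · rw [← abs_neg, ← signErfc_neg, abs_of_neg h, signErfc_of_pos (neg_pos.2 h),
      abs_of_nonneg (one_sub_errorE_nonneg _)]
  · simp [signErfc_zero]
  · rw [abs_of_pos h, signErfc_of_pos h, abs_of_nonneg (one_sub_errorE_nonneg _)]

lemma abs_signErfc_le (x : ℝ) : |signErfc x| ≤ Real.exp (-π * x ^ 2) := by
  rw [abs_signErfc]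
  rcases eq_or_ne x 0 with rfl | h
  · simp [signErfc_zero]
  · rw [signErfc_of_pos (abs_pos.2 h), ← sq_abs]
    exact one_sub_errorE_le (abs_nonneg x)

/-! ### The Eichler integrals of the unary theta functions -/

/-- On the vertical path `z + τ = i(2τ₂ + t)` is purely imaginary, so both half-integral powers
contribute the phase `exp (-πi/4)`; these two phases and the factor `i` from `dz` multiply to `1`.
-/
lemma eichlerIntegral_half (g : ℂ → ℂ) {τ : ℂ} (hτ : 0 < τ.im) :
    eichlerIntegral (1 / 2) g τ = (√(2 * π) : ℝ) *
      ∫ t in Set.Ioi (0 : ℝ), (((√(2 * τ.im + t))⁻¹ : ℝ) : ℂ) * conj (g (τ + t * I)) := by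
  rw [eichlerIntegral, ← integral_const_mul, ← integral_const_mul]
  refine setIntegral_congr_fun measurableSet_Ioi fun t ht => ?_
  have ht' : (0 : ℝ) < t := ht
  have hx : 0 < 2 * τ.im + t := by positivity
  have h1 : -conj τ + t * I + τ = ((2 * τ.im + t : ℝ) : ℂ) * I := by
    apply Complex.ext <;> simp
    ring
  have h2 : -conj (-conj τ + t * I) = τ + t * I := by simp [add_comm]
  have h3 : ∀ x : ℝ, 0 < x → ((x : ℂ) * I) ^ (-(1 / 2 : ℂ)) =
      ((√x)⁻¹ : ℝ) * exp (-(π * I / 4)) := fun x hx => by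
    rw [Complex.cpow_def_of_ne_zero (mul_ne_zero (by exact_mod_cast hx.ne') I_ne_zero),
      Complex.log_ofReal_mul hx I_ne_zero, Complex.log_I, ← Real.exp_log (inv_pos.2 (Real.sqrt_pos.2 hx)),
      Real.log_inv, Real.log_sqrt hx.le, Complex.ofReal_exp, ← Complex.exp_add]
    congr 1
    push_cast
    ring
  have h4 : (I / (2 * π)) ^ (-(1 / 2 : ℂ)) = (√(2 * π) : ℝ) * exp (-(π * I / 4)) := by
    have := h3 (1 / (2 * π)) (by positivity)
    rw [show I / (2 * π) = ((1 / (2 * π) : ℝ) : ℂ) * I by push_cast; ring, this, one_div,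
      Real.sqrt_inv, inv_inv]
  have h5 : exp (-(π * I / 4)) * exp (-(π * I / 4)) * I = 1 := by
    rw [← Complex.exp_add]
    have : -(π * I / 4) + -(π * I / 4) = -((π / 2 : ℂ) * I) := by ring
    rw [this, Complex.exp_neg, Complex.exp_pi_div_two_mul_I]
    exact inv_mul_cancel₀ I_ne_zero
  rw [h1, h2]
  have h6 : ((1 / 2 : ℝ) : ℂ) - 1 = -(1 / 2 : ℂ) := by push_cast; ring
  have h7 : -((1 / 2 : ℝ) : ℂ) = -(1 / 2 : ℂ) := by push_cast; ring
  rw [h6, h7, h4, h3 _ hx]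
  linear_combination ((√(2 * π) : ℝ) * ((√(2 * τ.im + t))⁻¹ : ℝ) * conj (g (τ + t * I))) * h5

/-- An antiderivative is `√(2κ) E(p √((2y + t) / 2κ))`, whose limit at `+∞` is `√(2κ)` because `p >
0`; positivity of the integrand gives integrability at the same time. -/
lemma integral_inv_sqrt_mul_gaussian_of_pos {κ y p : ℝ} (hκ : 0 < κ) (hy : 0 < y) (hp : 0 < p) :
    IntegrableOn (fun t => (√(2 * y + t))⁻¹ * (p * Real.exp (-(π * p ^ 2 * (2 * y + t) / (2 * κ)))))
      (Set.Ioi 0) ∧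
    ∫ t in Set.Ioi (0 : ℝ), (√(2 * y + t))⁻¹ *
      (p * Real.exp (-(π * p ^ 2 * (2 * y + t) / (2 * κ)))) =
      √(2 * κ) * signErfc (p * √(y / κ)) := by
  have hd : ∀ t ∈ Set.Ici (0 : ℝ), HasDerivAt
      (fun t => √(2 * κ) * errorE (p * √((2 * y + t) / (2 * κ))))
      ((√(2 * y + t))⁻¹ * (p * Real.exp (-(π * p ^ 2 * (2 * y + t) / (2 * κ))))) t := by
    intro t ht
    have ht' : (0 : ℝ) ≤ t := ht
    have hx : 0 < 2 * y + t := by positivity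
    have h1 : HasDerivAt (fun t => (2 * y + t) / (2 * κ)) (1 / (2 * κ)) t :=
      ((hasDerivAt_id t).const_add (2 * y)).div_const (2 * κ)
    have h2 : HasDerivAt (fun t => √(2 * κ) * errorE (p * √((2 * y + t) / (2 * κ)))) _ t :=
      ((hasDerivAt_errorE (p * √((2 * y + t) / (2 * κ)))).comp t
      ((h1.sqrt (by positivity)).const_mul p)).const_mul √(2 * κ)
    refine h2.congr_deriv ?_
    have h3 : (p * √((2 * y + t) / (2 * κ))) ^ 2 = p ^ 2 * ((2 * y + t) / (2 * κ)) := by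
      rw [mul_pow, Real.sq_sqrt (by positivity)]
    rw [h3, show -π * (p ^ 2 * ((2 * y + t) / (2 * κ))) = -(π * p ^ 2 * (2 * y + t) / (2 * κ)) by ring,
      Real.sqrt_div hx.le]
    have h4 : √(2 * κ) ^ 2 = 2 * κ := Real.sq_sqrt (by positivity)
    have h5 : 0 < √(2 * κ) := Real.sqrt_pos.2 (by positivity)
    have h6 : 0 < √(2 * y + t) := Real.sqrt_pos.2 hx
    generalize √(2 * κ) = w at h4 h5
    rw [← h4]
    field_simp
  have hpos : ∀ t ∈ Set.Ioi (0 : ℝ),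
      0 ≤ (√(2 * y + t))⁻¹ * (p * Real.exp (-(π * p ^ 2 * (2 * y + t) / (2 * κ)))) :=
    fun t _ => by positivity
  have hlim : Tendsto (fun t => √(2 * κ) * errorE (p * √((2 * y + t) / (2 * κ)))) atTop
      (𝓝 (√(2 * κ) * 1)) := by
    refine (tendsto_errorE.comp ?_).const_mul _
    refine Tendsto.const_mul_atTop hp (Real.tendsto_sqrt_atTop.comp ?_)
    exact (tendsto_atTop_add_const_left _ _ tendsto_id).atTop_div_const (by positivity)
  refine ⟨integrableOn_Ioi_deriv_of_nonneg' hd hpos hlim, ?_⟩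
  rw [integral_Ioi_of_hasDerivAt_of_nonneg' hd hpos hlim, signErfc_of_pos (by positivity), add_zero,
    mul_div_mul_left _ _ two_ne_zero]
  ring

lemma integral_inv_sqrt_mul_gaussian {κ y : ℝ} (hκ : 0 < κ) (hy : 0 < y) (p : ℝ) :
    IntegrableOn (fun t => (√(2 * y + t))⁻¹ * (p * Real.exp (-(π * p ^ 2 * (2 * y + t) / (2 * κ)))))
      (Set.Ioi 0) ∧
    ∫ t in Set.Ioi (0 : ℝ), (√(2 * y + t))⁻¹ *
      (p * Real.exp (-(π * p ^ 2 * (2 * y + t) / (2 * κ)))) =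
      √(2 * κ) * signErfc (p * √(y / κ)) := by
  rcases lt_trichotomy p 0 with h | rfl | h
  · obtain ⟨h1, h2⟩ := integral_inv_sqrt_mul_gaussian_of_pos hκ hy (neg_pos.2 h)
    have h3 : (fun t => (√(2 * y + t))⁻¹ *
        (p * Real.exp (-(π * p ^ 2 * (2 * y + t) / (2 * κ))))) = fun t => -((√(2 * y + t))⁻¹ *
        (-p * Real.exp (-(π * (-p) ^ 2 * (2 * y + t) / (2 * κ))))) := by
      funext t; rw [neg_sq]; ring
    rw [h3, integral_neg, h2, neg_mul, signErfc_neg]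
    exact ⟨h1.neg, by ring⟩
  · simp [signErfc_zero]
  · exact integral_inv_sqrt_mul_gaussian_of_pos hκ hy h

variable {k : ℕ}

lemma unaryTheta_eq_tsum (hk : k ≠ 0) (r : ℤ) (τ : ℂ) :
    unaryTheta k r τ = ∑' p : ℤ, if (2 * k : ℤ) ∣ p - r then p * thetaExp k τ p else 0 := by
  rw [unaryTheta, ← tsum_residueClass (N := 2 * k) (by positivity)]
  rfl

/-- Conjugating `q ^ (p² / 4k)` amounts to inverting it and inserting a real Gaussian, since `conj τ
= τ - 2iτ₂`. -/
lemma inv_sqrt_mul_conj_thetaExp (hk : k ≠ 0) {τ : ℂ} (p : ℤ) (t : ℝ) :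
    (((√(2 * τ.im + t))⁻¹ : ℝ) : ℂ) * conj ((p : ℂ) * thetaExp k (τ + t * I) p) =
      (thetaExp k τ p)⁻¹ * (((√(2 * τ.im + t))⁻¹ *
        (p * Real.exp (-(π * (p : ℝ) ^ 2 * (2 * τ.im + t) / (2 * k)))) : ℝ) : ℂ) := by
  have hk' : (k : ℂ) ≠ 0 := by exact_mod_cast hk
  have h : conj (thetaExp k (τ + t * I) p) =
      (thetaExp k τ p)⁻¹ * (Real.exp (-(π * (p : ℝ) ^ 2 * (2 * τ.im + t) / (2 * k))) : ℝ) := by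
    rw [thetaExp, thetaExp, ← Complex.exp_conj, ← Complex.exp_neg, Complex.ofReal_exp,
      ← Complex.exp_add]
    congr 1
    have h2 : conj τ = τ - 2 * τ.im * I := by
      apply Complex.ext <;> simp; ring
    simp only [map_mul, map_add, conj_I, conj_ofReal, map_div₀, map_pow, map_ofNat, map_intCast,
      map_natCast, h2]
    push_cast
    field_simp
    linear_combination (4 * (p : ℂ) ^ 2 * (2 * τ.im + t)) * I_sq
  rw [map_mul, h, map_intCast]
  push_cast
  ring

/-- The coefficients of the Eichler integral of the unary theta functions. -/
def starTerm (k : ℕ) (τ : ℂ) (p : ℤ) : ℂ :=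
  (signErfc (p * √(τ.im / k)) : ℝ) * (thetaExp k τ p)⁻¹

lemma norm_starTerm_le (hk : k ≠ 0) {τ : ℂ} (hτ : 0 < τ.im) (p : ℤ) :
    ‖starTerm k τ p‖ ≤ Real.exp (-(π * τ.im / (2 * k)) * p ^ 2) := by
  have hk' : (0 : ℝ) < k := by positivity
  rw [starTerm, norm_mul, norm_inv, norm_thetaExp, ← Real.exp_neg, Complex.norm_real, Real.norm_eq_abs]
  refine (mul_le_mul_of_nonneg_right (abs_signErfc_le _) (Real.exp_pos _).le).trans ?_
  rw [← Real.exp_add, mul_pow, Real.sq_sqrt (by positivity)]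
  refine Real.exp_le_exp.2 (le_of_eq ?_)
  field_simp
  ring

lemma summable_starTerm (hk : k ≠ 0) {τ : ℂ} (hτ : 0 < τ.im) : Summable (starTerm k τ) := by
  have hk' : (0 : ℝ) < k := by positivity
  have := summable_pow_mul_gaussian 0 0 (show 0 < π * τ.im / (2 * k) by positivity)
  refine this.of_norm_bounded fun p => (norm_starTerm_le hk hτ p).trans (le_of_eq ?_)
  simp

lemma sqrt_two_pi_mul_sqrt (k : ℕ) : √(2 * π) * √(2 * k) = √(4 * π * k) := by
  rw [← Real.sqrt_mul (by positivity)]; congr 1; ring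

/-- Termwise integration. It is justified by the same integral with `p` replaced by `|p|`, so the
norms of the terms reproduce the summable series of `|starTerm|`. -/
lemma unaryThetaStar_eq_tsum (hk : k ≠ 0) (r : ℤ) {τ : ℂ} (hτ : 0 < τ.im) :
    unaryThetaStar k r τ =
      (√(4 * π * k) : ℝ) * ∑' p : ℤ, if (2 * k : ℤ) ∣ p - r then starTerm k τ p else 0 := by
  have hk' : (0 : ℝ) < k := by positivity
  have hk2 : (2 * k : ℤ) ≠ 0 := by positivity
  rw [unaryThetaStar, eichlerIntegral_half _ hτ, ← sqrt_two_pi_mul_sqrt, Complex.ofReal_mul, mul_assoc]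
  congr 1
  set F : ℤ → ℝ → ℂ := fun p t => if (2 * k : ℤ) ∣ p - r then (((√(2 * τ.im + t))⁻¹ : ℝ) : ℂ) *
    conj ((p : ℂ) * thetaExp k (τ + t * I) p) else 0 with hF
  have hFe : ∀ p : ℤ, F p = fun t => if (2 * k : ℤ) ∣ p - r then
      (thetaExp k τ p)⁻¹ * (((√(2 * τ.im + t))⁻¹ *
        (p * Real.exp (-(π * (p : ℝ) ^ 2 * (2 * τ.im + t) / (2 * k)))) : ℝ) : ℂ) else 0 := fun p => by
    funext t
    rw [hF]
    simp only [inv_sqrt_mul_conj_thetaExp hk]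
  have hint : ∀ p : ℤ, Integrable (F p) (volume.restrict (Set.Ioi 0)) := fun p => by
    rw [hFe]
    split_ifs
    · exact ((integral_inv_sqrt_mul_gaussian hk' hτ p).1.ofReal).const_mul _
    · exact integrable_zero _ _ _
  have hval : ∀ p : ℤ, ∫ t in Set.Ioi (0 : ℝ), F p t =
      (√(2 * k) : ℝ) * if (2 * k : ℤ) ∣ p - r then starTerm k τ p else 0 := fun p => by
    rw [hFe]
    split_ifs
    · rw [integral_const_mul, integral_complex_ofReal, (integral_inv_sqrt_mul_gaussian hk' hτ p).2,
        starTerm]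
      push_cast; ring
    · simp
  have hnorm : Summable fun p : ℤ => ∫ t in Set.Ioi (0 : ℝ), ‖F p t‖ := by
    have hs := ((summable_starTerm hk hτ).norm).mul_left √(2 * k)
    refine hs.of_nonneg_of_le (fun p => integral_nonneg fun t => norm_nonneg _) fun p => ?_
    rw [hFe]
    split_ifs
    · have h1 : ∀ t ∈ Set.Ioi (0 : ℝ), ‖(thetaExp k τ p)⁻¹ * (((√(2 * τ.im + t))⁻¹ *
          (p * Real.exp (-(π * (p : ℝ) ^ 2 * (2 * τ.im + t) / (2 * k)))) : ℝ) : ℂ)‖ =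
          ‖(thetaExp k τ p)⁻¹‖ * ((√(2 * τ.im + t))⁻¹ *
          (|(p : ℝ)| * Real.exp (-(π * |(p : ℝ)| ^ 2 * (2 * τ.im + t) / (2 * k))))) := fun t ht => by
        rw [norm_mul, Complex.norm_real, Real.norm_eq_abs, abs_mul, abs_mul, Real.abs_exp, sq_abs,
          abs_of_nonneg (inv_nonneg.2 (Real.sqrt_nonneg _))]
      rw [setIntegral_congr_fun measurableSet_Ioi h1, integral_const_mul,
        (integral_inv_sqrt_mul_gaussian hk' hτ |(p : ℝ)|).2, starTerm, norm_mul, Complex.norm_real,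
        Real.norm_eq_abs, abs_signErfc, abs_mul, abs_of_nonneg (Real.sqrt_nonneg (τ.im / k))]
      exact le_of_eq (by ring)
    · simp only [norm_zero, integral_zero]
      positivity
  have h := (hasSum_integral_of_summable_integral_norm hint hnorm).tsum_eq
  simp only [hval] at h
  rw [tsum_mul_left] at h
  rw [h]
  refine setIntegral_congr_fun measurableSet_Ioi fun t ht => ?_
  rw [unaryTheta_eq_tsum hk, conj_tsum, ← tsum_mul_left]
  refine tsum_congr fun p => ?_
  rw [hF]
  simp only [apply_ite conj, map_zero, mul_ite, mul_zero]

/-! ### Divisors attached to a root system -/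

/-- The divisors `d` of the Coxeter number for which `Ω^{(k,d)}` is a summand of `Ω^Y`. -/
def ADE.divisorSet : ADE → Finset ℕ
  | .A _ _ => {1}
  | .D n _ => {1, n - 1}
  | .E6 => {1, 4, 6}
  | .E7 => {1, 6, 9}
  | .E8 => {1, 6, 10, 15}

lemma ADE.omega_eq_sum (Y : ADE) (r r' : ℤ) :
    Y.omega r r' = ∑ d ∈ Y.divisorSet, omegaDiv Y.coxeter d r r' := by
  cases Y with
  | A n hn => simp [ADE.omega, ADE.divisorSet, ADE.coxeter]
  | D n hn =>
    rw [ADE.divisorSet, Finset.sum_pair (by omega)]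
    rfl
  | E6 => simp [ADE.omega, ADE.divisorSet, ADE.coxeter, add_assoc]
  | E7 => simp [ADE.omega, ADE.divisorSet, ADE.coxeter, add_assoc]
  | E8 => simp [ADE.omega, ADE.divisorSet, ADE.coxeter, add_assoc]

lemma ADE.two_le_coxeter (Y : ADE) : 2 ≤ Y.coxeter := by
  cases Y <;> simp only [ADE.coxeter] <;> omega

lemma ADE.coxeter_ne_zero (Y : ADE) : Y.coxeter ≠ 0 := by
  have := Y.two_le_coxeter
  omega

lemma ADE.mul_div_coxeter (Y : ADE) {d : ℕ} (hd : d ∈ Y.divisorSet) :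
    d * (Y.coxeter / d) = Y.coxeter := by
  refine Nat.mul_div_cancel' ?_
  cases Y with
  | A n hn => simp only [ADE.divisorSet, Finset.mem_singleton] at hd; rw [hd]; exact one_dvd _
  | D n hn =>
    simp only [ADE.divisorSet, Finset.mem_insert, Finset.mem_singleton] at hd
    rcases hd with rfl | rfl
    · exact one_dvd _
    · exact dvd_mul_left _ _
  | E6 =>
    simp only [ADE.divisorSet, Finset.mem_insert, Finset.mem_singleton] at hd
    rcases hd with rfl | rfl | rfl <;> norm_num [ADE.coxeter]
  | E7 =>
    simp only [ADE.divisorSet, Finset.mem_insert, Finset.mem_singleton] at hd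
    rcases hd with rfl | rfl | rfl <;> norm_num [ADE.coxeter]
  | E8 =>
    simp only [ADE.divisorSet, Finset.mem_insert, Finset.mem_singleton] at hd
    rcases hd with rfl | rfl | rfl | rfl <;> norm_num [ADE.coxeter]

lemma ADE.ne_zero_of_mem (Y : ADE) {d : ℕ} (hd : d ∈ Y.divisorSet) : d ≠ 0 ∧ Y.coxeter / d ≠ 0 := by
  have h := Y.mul_div_coxeter hd
  have h2 := Y.coxeter_ne_zero
  rw [← h] at h2
  exact mul_ne_zero_iff.1 h2

lemma ADE.omegaHat_eq_sum (Y : ADE) (r r' : ℤ) :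
    Y.omegaHat r r' = ∑ d ∈ Y.divisorSet, omegaHatDiv Y.coxeter d r r' := by
  simp only [ADE.omegaHat, omegaHatDiv, Y.omega_eq_sum, Finset.sum_sub_distrib]

lemma ADE.omega_neg (Y : ADE) (r r' : ℤ) : Y.omega (-r) (-r') = Y.omega r r' := by
  simp only [Y.omega_eq_sum, omegaDiv_neg]

lemma ADE.omega_comm (Y : ADE) (r r' : ℤ) : Y.omega r r' = Y.omega r' r := by
  simp only [Y.omega_eq_sum, omegaDiv_comm _ _ r r']

lemma ADE.omega_add_left (Y : ADE) (r r' m : ℤ) :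
    Y.omega (r + 2 * Y.coxeter * m) r' = Y.omega r r' := by
  simp only [Y.omega_eq_sum]
  refine Finset.sum_congr rfl fun d hd => ?_
  have h := omegaDiv_add_left (d := d) (e := Y.coxeter / d) (Y.ne_zero_of_mem hd).1 r r' m
  rwa [Y.mul_div_coxeter hd] at h

lemma ADE.omega_add_right (Y : ADE) (r r' m : ℤ) :
    Y.omega r (r' + 2 * Y.coxeter * m) = Y.omega r r' := by
  rw [Y.omega_comm, Y.omega_add_left, Y.omega_comm]

/-- Each summand requires `2d ∣ r + r'`, so only entries of equal parity survive; this makes the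
factor `δ` in the completion redundant. -/
lemma ADE.omega_eq_zero (Y : ADE) {r r' : ℤ} (h : ¬ (2 : ℤ) ∣ r - r') : Y.omega r r' = 0 := by
  rw [Y.omega_eq_sum]
  refine Finset.sum_eq_zero fun d _ => ?_
  rw [omegaDiv, if_neg]
  rintro ⟨h1, -⟩
  have : (2 : ℤ) ∣ r + r' := (Dvd.intro _ (by push_cast; rfl)).trans h1
  omega

lemma ADE.omega_coxeter_sub (Y : ADE) (r r' : ℤ) :
    Y.omega (Y.coxeter - r) (Y.coxeter - r') = Y.omega r r' := by
  simp only [Y.omega_eq_sum]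
  refine Finset.sum_congr rfl fun d hd => ?_
  rw [← Y.mul_div_coxeter hd]
  have hd0 := (Y.ne_zero_of_mem hd).1
  generalize Y.coxeter / d = e
  rw [omegaDiv_mul hd0, omegaDiv_mul hd0]
  refine if_congr (and_congr ?_ ?_) rfl rfl
  · rw [show ((d * e : ℕ) : ℤ) - r + ((d * e : ℕ) - r') = 2 * d * e - (r + r') by push_cast; ring,
      dvd_sub_right (dvd_mul_right _ _)]
  · rw [← dvd_neg]; ring_nf

/-- Reflection `r ↦ k - r` in both indices is a symmetry, so the two halves of the symmetrised `μ̃`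
contribute equally to the sum over `j` and `j'`. -/
lemma ADE.omegaHat_coxeter_sub (Y : ADE) (r r' : ℤ) :
    Y.omegaHat (Y.coxeter - r) (Y.coxeter - r') = Y.omegaHat r r' := by
  rw [ADE.omegaHat, ADE.omegaHat, Y.omega_coxeter_sub, ← Y.omega_coxeter_sub r (-r')]
  congr 1
  rw [← Y.omega_add_right _ (-(Y.coxeter - r')) 1]
  congr 1
  ring

/-! ### Sums over residue classes -/

/-- The sum of `G` over the integers congruent to `r` modulo `2k`. -/
def residueSum (k : ℕ) (G : ℤ → ℂ) (r : ℤ) : ℂ := ∑' p : ℤ, if (2 * k : ℤ) ∣ p - r then G p else 0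

variable {k : ℕ}

lemma residueSum_neg {G : ℤ → ℂ} (hG : ∀ p, G (-p) = -G p) (r : ℤ) :
    residueSum k G (-r) = -residueSum k G r := by
  rw [residueSum, residueSum, ← tsum_neg, ← (Equiv.neg ℤ).tsum_eq]
  refine tsum_congr fun p => ?_
  rw [Equiv.neg_apply, hG, ← neg_zero, ← apply_ite Neg.neg, neg_zero]
  congr 1
  refine if_congr ?_ rfl rfl
  rw [← dvd_neg]; ring_nf

lemma residueSum_add (G : ℤ → ℂ) (r m : ℤ) :
    residueSum k G (r + 2 * k * m) = residueSum k G r := by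
  rw [residueSum, residueSum]
  refine tsum_congr fun p => if_congr ?_ rfl rfl
  rw [show p - (r + 2 * k * m) = p - r - 2 * k * m by ring, dvd_sub_left (dvd_mul_right _ _)]

/-- The coefficients of the unary theta functions. -/
def unaryCoeff (k : ℕ) (τ : ℂ) (p : ℤ) : ℂ := p * thetaExp k τ p

lemma unaryCoeff_neg (k : ℕ) (τ : ℂ) (p : ℤ) : unaryCoeff k τ (-p) = -unaryCoeff k τ p := by
  rw [unaryCoeff, unaryCoeff, thetaExp_neg]; push_cast; ring

lemma summable_unaryCoeff (hk : k ≠ 0) {τ : ℂ} (hτ : 0 < τ.im) : Summable (unaryCoeff k τ) := by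
  refine (summable_thetaExp_mul hk hτ 1 0).of_norm_bounded fun p => le_of_eq ?_
  rw [unaryCoeff, norm_mul, Complex.norm_intCast]
  simp [mul_comm]

lemma starTerm_neg (k : ℕ) (τ : ℂ) (p : ℤ) : starTerm k τ (-p) = -starTerm k τ p := by
  rw [starTerm, starTerm, thetaExp_neg]
  push_cast
  rw [neg_mul, signErfc_neg]
  push_cast; ring

lemma unaryTheta_eq_residueSum (hk : k ≠ 0) (r : ℤ) (τ : ℂ) :
    unaryTheta k r τ = residueSum k (unaryCoeff k τ) r := unaryTheta_eq_tsum hk r τ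

lemma unaryThetaStar_eq_residueSum (hk : k ≠ 0) (r : ℤ) {τ : ℂ} (hτ : 0 < τ.im) :
    unaryThetaStar k r τ = (√(4 * π * k) : ℝ) * residueSum k (starTerm k τ) r :=
  unaryThetaStar_eq_tsum hk r hτ

/-- The nonzero classes `j` and `-j`, `0 < j < k`, together with `0` and `k`, exhaust `ℤ/2k`. -/
lemma sum_fin_two_mul (hk : k ≠ 0) {f : ℤ → ℂ} (hper : ∀ r m : ℤ, f (r + 2 * k * m) = f r) :
    ∑ r : Fin (2 * k), f (r : ℕ) =
      f 0 + f k + ∑ j ∈ Finset.Icc 1 (k - 1), (f (j : ℕ) + f (-(j : ℕ))) := by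
  rw [Fin.sum_univ_eq_sum_range (fun i : ℕ => f i), two_mul, Finset.sum_range_add]
  obtain ⟨n, rfl⟩ := Nat.exists_eq_succ_of_ne_zero hk
  have hIcc : Finset.Icc 1 (n.succ - 1) = (Finset.range n).map ⟨(· + 1), add_left_injective 1⟩ := by
    ext x
    simp only [Finset.mem_Icc, Finset.mem_map, Finset.mem_range, Function.Embedding.coeFn_mk]
    constructor
    · intro h; exact ⟨x - 1, by omega, by omega⟩
    · rintro ⟨y, hy, rfl⟩; omega
  rw [hIcc, Finset.sum_map, Finset.sum_range_succ', Finset.sum_range_succ', Finset.sum_add_distrib]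
  simp only [Function.Embedding.coeFn_mk]
  have h : ∑ i ∈ Finset.range n, f ((n.succ + (i + 1) : ℕ) : ℤ) =
      ∑ i ∈ Finset.range n, f (-((i + 1 : ℕ) : ℤ)) := by
    rw [← Finset.sum_range_reflect]
    refine Finset.sum_congr rfl fun i hi => ?_
    rw [Finset.mem_range] at hi
    rw [← hper (-((i + 1 : ℕ) : ℤ)) 1]
    congr 1
    push_cast
    rw [Nat.cast_sub (by omega), Nat.cast_sub (by omega)]
    push_cast; ring
  rw [h]
  push_cast
  simp only [add_zero]
  ring

lemma sum_fin_ite (hk : k ≠ 0) {f : ℤ → ℂ} (hper : ∀ r m : ℤ, f (r + 2 * k * m) = f r) (p : ℤ) :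
    ∑ r : Fin (2 * k), f (r : ℕ) * (if (2 * k : ℤ) ∣ p - (r : ℕ) then 1 else 0) = f p := by
  have hk' : (0 : ℤ) < 2 * k := by positivity
  have h0 := Int.emod_nonneg p hk'.ne'
  have h1 := Int.emod_lt_of_pos p hk'
  have h2 : ∀ r : ℤ, (2 * k : ℤ) ∣ p - r ↔ (2 * k : ℤ) ∣ p % (2 * k) - r := fun r => by
    rw [← Int.emod_add_mul_ediv p (2 * k), add_sub_right_comm, dvd_add_left (dvd_mul_right _ _),
      Int.emod_add_mul_ediv]
  rw [Finset.sum_eq_single (⟨(p % (2 * k)).toNat, by omega⟩ : Fin (2 * k))]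
  · simp only
    rw [Int.toNat_of_nonneg h0, if_pos, mul_one]
    · conv_rhs => rw [← Int.emod_add_mul_ediv p (2 * k), hper]
    · rw [h2, sub_self]; exact dvd_zero _
  · rintro ⟨r, hr⟩ - hne
    simp only
    rw [if_neg, mul_zero]
    rw [h2]
    intro h
    apply hne
    have := Int.eq_zero_of_abs_lt_dvd h (abs_lt.2 ⟨by omega, by omega⟩)
    ext
    simp only
    omega
  · intro h; exact absurd (Finset.mem_univ _) h

/-- The bilinear form of `Ω^{(k,d)}` in two residue class sums, as a sum over a lattice. -/
lemma hasSum_omegaDiv_mul_residueSum {d e : ℕ} (hd : d ≠ 0) (he : e ≠ 0) {G H : ℤ → ℂ}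
    (hG : Summable G) (hH : Summable H) :
    HasSum (fun p : ℤ × ℤ => G (d * p.1 + e * p.2) * H (d * p.1 - e * p.2))
      (∑ r : Fin (2 * (d * e)), ∑ r' : Fin (2 * (d * e)), omegaDiv (d * e) d (r : ℕ) (r' : ℕ) *
        residueSum (d * e) G (r : ℕ) * residueSum (d * e) H (r' : ℕ)) := by
  have hk : d * e ≠ 0 := mul_ne_zero hd he
  set φG : ℤ → ℤ → ℂ := fun r p => if (2 * (d * e : ℕ) : ℤ) ∣ p - r then G p else 0 with hφG
  set φH : ℤ → ℤ → ℂ := fun r p => if (2 * (d * e : ℕ) : ℤ) ∣ p - r then H p else 0 with hφH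
  have h1 : ∀ r r' : ℤ, HasSum (fun p : ℤ × ℤ => φG r p.1 * φH r' p.2)
      (residueSum (d * e) G r * residueSum (d * e) H r') := fun r r' => by
    have hs1 : Summable (φG r) := summable_residueClass _ r hG
    have hs2 : Summable (φH r') := summable_residueClass _ r' hH
    have := (summable_mul_of_summable_norm hs1.norm hs2.norm).hasSum
    rwa [← tsum_mul_tsum_of_summable_norm hs1.norm hs2.norm] at this
  have h2 : HasSum (fun p : ℤ × ℤ => omegaDiv (d * e) d p.1 p.2 * (G p.1 * H p.2))
      (∑ r : Fin (2 * (d * e)), ∑ r' : Fin (2 * (d * e)), omegaDiv (d * e) d (r : ℕ) (r' : ℕ) *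
        residueSum (d * e) G (r : ℕ) * residueSum (d * e) H (r' : ℕ)) := by
    simp only [mul_assoc]
    have h3 := hasSum_sum (s := Finset.univ) fun (r : Fin (2 * (d * e))) _ =>
      hasSum_sum (s := Finset.univ) fun (r' : Fin (2 * (d * e))) _ =>
        (h1 (r : ℕ) (r' : ℕ)).mul_left (omegaDiv (d * e) d (r : ℕ) (r' : ℕ))
    refine h3.congr_fun fun p => ?_
    have hper : ∀ r' r m : ℤ, omegaDiv (d * e) d (r + 2 * (d * e : ℕ) * m) r' =
      omegaDiv (d * e) d r r' := fun r' r m => omegaDiv_add_left hd r r' m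
    rw [← sum_fin_ite hk (f := fun r => omegaDiv (d * e) d r p.2) (hper p.2) p.1, Finset.sum_mul]
    refine Finset.sum_congr rfl fun r _ => ?_
    rw [omegaDiv_comm, ← sum_fin_ite hk (f := fun r' => omegaDiv (d * e) d r' (r : ℕ))
      (hper (r : ℕ)) p.2, Finset.sum_mul, Finset.sum_mul]
    refine Finset.sum_congr rfl fun r' _ => ?_
    rw [omegaDiv_comm, hφG, hφH]
    simp only
    split_ifs <;> ring
  have hdz : (d : ℤ) ≠ 0 := by exact_mod_cast hd
  have hez : (e : ℤ) ≠ 0 := by exact_mod_cast he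
  -- The congruences defining `Ω^{(de,d)}` say that the sum and the difference of the two indices
  -- are `2da` and `2eb`.
  let φ : ℤ × ℤ → ℤ × ℤ := fun p => (d * p.1 + e * p.2, d * p.1 - e * p.2)
  have hφ : Function.Injective φ := by
    rintro ⟨a, b⟩ ⟨a', b'⟩ h
    simp only [φ, Prod.mk.injEq] at h
    have h1 : a = a' := mul_left_cancel₀ hdz (by linarith [h.1, h.2])
    have h2 : b = b' := mul_left_cancel₀ hez (by linarith [h.1, h.2])
    rw [h1, h2]
  refine ((hφ.hasSum_iff ?_).2 h2).congr_fun fun p => ?_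
  · rintro ⟨m, n⟩ hp
    rw [omegaDiv_mul hd, if_neg, zero_mul]
    rintro ⟨⟨a, ha⟩, ⟨b, hb⟩⟩
    refine hp ⟨(a, b), ?_⟩
    simp only [φ, Prod.mk.injEq]
    simp only [mul_assoc] at ha hb
    constructor <;> linarith
  · simp only [Function.comp, φ]
    rw [omegaDiv_mul hd, if_pos, one_mul]
    exact ⟨⟨p.1, by ring⟩, ⟨p.2, by ring⟩⟩

/-! ### Special values at the origin -/

lemma two_pi_I_mul_unaryTheta (hk : k ≠ 0) (r : ℤ) {τ : ℂ} (hτ : 0 < τ.im) :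
    2 * π * I * unaryTheta k r τ = exp (2 * π * I * ((r : ℂ) ^ 2 / (4 * k)) * τ) *
      (2 * π * I * r * jacobiTheta₂ (r * τ) (2 * k * τ) +
        2 * k * jacobiTheta₂' (r * τ) (2 * k * τ)) := by
  have hk' : (k : ℂ) ≠ 0 := by exact_mod_cast hk
  have him := two_mul_natCast_mul_im_pos hk hτ
  have h1 := (summable_jacobiTheta₂_term_iff (r * τ) (2 * k * τ)).2 him
  have h2 := (summable_jacobiTheta₂'_term_iff (r * τ) (2 * k * τ)).2 him
  rw [unaryTheta, jacobiTheta₂, jacobiTheta₂', ← tsum_mul_left, ← tsum_mul_left, ← tsum_mul_left,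
    ← (h1.mul_left _).tsum_add (h2.mul_left _), ← tsum_mul_left]
  refine tsum_congr fun n => ?_
  have h3 : exp (2 * π * I * (((2 * k * n + r : ℤ) : ℂ) ^ 2 / (4 * k)) * τ) =
      exp (2 * π * I * ((r : ℂ) ^ 2 / (4 * k)) * τ) * jacobiTheta₂_term n (r * τ) (2 * k * τ) := by
    rw [jacobiTheta₂_term, ← Complex.exp_add]
    congr 1
    push_cast
    field_simp
    ring
  rw [h3, jacobiTheta₂'_term]
  push_cast
  ring

lemma hasDerivAt_levelTheta_zero (hk : k ≠ 0) (r : ℤ) {τ : ℂ} (hτ : 0 < τ.im) :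
    HasDerivAt (levelTheta k r τ) (2 * π * I * unaryTheta k r τ) 0 := by
  have him := two_mul_natCast_mul_im_pos hk hτ
  have h1 : HasDerivAt (fun x : ℂ => exp (2 * π * I * ((r : ℂ) ^ 2 / (4 * k)) * τ + 2 * π * I * r * x))
      (exp (2 * π * I * ((r : ℂ) ^ 2 / (4 * k)) * τ + 2 * π * I * r * 0) * (2 * π * I * r * 1)) 0 :=
    (((hasDerivAt_id (0 : ℂ)).const_mul (2 * π * I * r)).const_add _).cexp
  have h2 : HasDerivAt (fun x : ℂ => jacobiTheta₂ (2 * k * x + r * τ) (2 * k * τ))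
      (jacobiTheta₂' (2 * k * 0 + r * τ) (2 * k * τ) * (2 * k * 1)) 0 :=
    HasDerivAt.comp (h := fun x : ℂ => 2 * k * x + r * τ) 0 (hasDerivAt_jacobiTheta₂_fst _ him)
      (((hasDerivAt_id (0 : ℂ)).const_mul (2 * k : ℂ)).add_const _)
  have h3 := h1.mul h2
  rw [show levelTheta k r τ = _ from funext fun x => levelTheta_eq_jacobiTheta₂ hk r τ x]
  refine h3.congr_deriv ?_
  rw [two_pi_I_mul_unaryTheta hk r hτ]
  simp only [mul_zero, add_zero, zero_add, mul_one]
  ring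

lemma unaryTheta_neg (hk : k ≠ 0) (r : ℤ) (τ : ℂ) : unaryTheta k (-r) τ = -unaryTheta k r τ := by
  rw [unaryTheta_eq_residueSum hk, unaryTheta_eq_residueSum hk, residueSum_neg (unaryCoeff_neg k τ)]

/-- By the derivative formula at the origin: the two level `k` theta functions are evaluated at
`ζ/2` and have opposite derivatives there, so the halves add up to `2πi S_{k,j}`. -/
lemma affineChar_zero (hk : k ≠ 0) (j : ℤ) {τ : ℂ} (hτ : 0 < τ.im) :
    affineChar k (j - 1) τ 0 = unaryTheta k j τ / ModularForm.eta τ ^ 3 := by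
  rw [(affineChar_spec hk (j - 1) hτ).2.2, sub_add_cancel]
  have h0 : ∀ r : ℤ, HasDerivAt (fun ζ : ℂ => levelTheta k r τ (ζ / 2))
      (2 * π * I * unaryTheta k r τ * (1 / 2)) 0 := fun r => by
    refine HasDerivAt.comp (h₂ := levelTheta k r τ) (h := fun ζ : ℂ => ζ / 2) 0 ?_ ((hasDerivAt_id (0 : ℂ)).div_const 2)
    rw [zero_div]
    exact hasDerivAt_levelTheta_zero hk r hτ
  have h : HasDerivAt (thetaNum k j τ) (2 * π * I * unaryTheta k j τ) 0 := by
    refine ((h0 j).sub (h0 (-j))).congr_deriv ?_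
    rw [unaryTheta_neg hk]
    ring
  rw [h.deriv]
  have : (2 * π * I : ℂ) ≠ 0 := Complex.two_pi_I_ne_zero
  rw [mul_div_mul_left _ _ this]

/-- At `u = 0` only the sign differs from the Eichler series: `sgn (p + 1/2) = sgn p` for every
nonzero integer `p`, and `p = 0` is excluded because `2k` does not divide `r`. -/
lemma zwegersR_zero (hk : k ≠ 0) {r : ℤ} (hr : ¬ (2 * k : ℤ) ∣ r) {τ : ℂ} (hτ : 0 < τ.im) :
    zwegersR k r τ 0 = residueSum k (starTerm k τ) r := by
  rw [residueSum, ← tsum_residueClass (N := 2 * k) (by positivity), zwegersR]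
  refine tsum_congr fun m => ?_
  have hp : 2 * k * m + r ≠ 0 := fun h => hr ⟨-m, by linarith⟩
  have hsign : ∀ p : ℤ, p ≠ 0 → Real.sign ((p : ℝ) + 1 / 2) = Real.sign p := fun p hp => by
    rcases lt_or_gt_of_ne hp with h | h
    · have : (p : ℝ) ≤ -1 := by exact_mod_cast (show p ≤ -1 by omega)
      rw [Real.sign_of_neg (by linarith), Real.sign_of_neg (by linarith)]
    · have : (1 : ℝ) ≤ p := by exact_mod_cast (show 1 ≤ p by omega)
      rw [Real.sign_of_pos (by linarith), Real.sign_of_pos (by linarith)]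
  rw [hsign _ hp, starTerm, signErfc, thetaExp, ← Complex.exp_neg]
  simp only [Complex.zero_im, mul_zero, zero_div, add_zero, sub_zero]
  have hk' : (k : ℂ) ≠ 0 := by exact_mod_cast hk
  have hsign' : Real.sign ((2 * k * m + r : ℤ) * √(τ.im / k)) = Real.sign (2 * k * m + r : ℤ) := by
    have h : 0 < √(τ.im / k) := Real.sqrt_pos.2 (by positivity)
    rcases lt_or_gt_of_ne hp with h1 | h1
    · have h2 : ((2 * k * m + r : ℤ) : ℝ) < 0 := by exact_mod_cast h1
      rw [Real.sign_of_neg h2, Real.sign_of_neg (mul_neg_of_neg_of_pos h2 h)]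
    · have h2 : (0 : ℝ) < (2 * k * m + r : ℤ) := by exact_mod_cast h1
      rw [Real.sign_of_pos h2, Real.sign_of_pos (mul_pos h2 h)]
  rw [hsign']
  congr 2
  field_simp
  ring

lemma zwegersRHat_zero (hk : k ≠ 0) {r : ℤ} (hr : ¬ (2 * k : ℤ) ∣ r) {τ : ℂ} (hτ : 0 < τ.im) :
    zwegersRHat k r τ 0 = 2 / (√(4 * π * k) : ℝ) * unaryThetaStar k r τ := by
  have h0 : ((√(4 * π * k) : ℝ) : ℂ) ≠ 0 := by
    have hk' : (0 : ℝ) < k := by positivity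
    exact_mod_cast (Real.sqrt_pos.2 (by positivity)).ne'
  rw [zwegersRHat, zero_div, zwegersR_zero hk hr hτ, zwegersR_zero hk (by rwa [dvd_neg]) hτ,
    residueSum_neg (starTerm_neg k τ), unaryThetaStar_eq_residueSum hk r hτ]
  field_simp
  ring

/-! ### The completed functions at the origin -/

lemma muADETilde_eq (Y : ADE) {τ : ℂ} (hτ : 0 < τ.im) (z : ℂ) :
    muADETilde Y τ z z 0 = muADE Y τ z z 0 -
      1 / ModularForm.eta τ ^ 3 * (1 / (√(4 * π * Y.coxeter) : ℝ)) *
        ∑ j ∈ Finset.Icc 1 (Y.coxeter - 1), ∑ j' ∈ Finset.Icc 1 (Y.coxeter - 1),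
          Y.omegaHat j j' * unaryTheta Y.coxeter j τ * unaryThetaStar Y.coxeter j' τ := by
  have hk := Y.coxeter_ne_zero
  set k := Y.coxeter with hkdef
  set X : ℤ → ℤ → ℂ := fun j j' => affineChar k (j - 1) τ 0 * zwegersRHat k j' τ 0 with hX
  have hmuT : ∀ j j' : ℤ, Y.omegaHat j j' * muTilde k j j' τ z z 0 =
      (1 / 2) * (Y.omegaHat j j' * mu k j j' τ z z 0 +
        Y.omegaHat (k - j) (k - j') * mu k (k - j) (k - j') τ z z 0) -
      (1 / 4) * (Y.omegaHat j j' * X j j' + Y.omegaHat (k - j) (k - j') * X (k - j) (k - j')) := by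
    intro j j'
    rw [Y.omegaHat_coxeter_sub, muTilde, hX]
    simp only [sub_self, zero_mul, add_zero]
    -- Either the parities agree and `δ = 1`, or the matrix entry vanishes.
    by_cases h : (2 : ℤ) ∣ j - j'
    · rw [if_pos h]; ring
    · have h2 : Y.omegaHat j j' = 0 := by
        rw [ADE.omegaHat, Y.omega_eq_zero h, Y.omega_eq_zero (by omega), sub_zero]
      rw [h2]; ring
  have hrefl : ∀ F : ℤ → ℤ → ℂ, ∑ j ∈ Finset.Icc 1 (k - 1), ∑ j' ∈ Finset.Icc 1 (k - 1),
      F (k - (j : ℕ)) (k - (j' : ℕ)) =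
      ∑ j ∈ Finset.Icc 1 (k - 1), ∑ j' ∈ Finset.Icc 1 (k - 1), F (j : ℕ) (j' : ℕ) := by
    have h1 : ∀ f : ℤ → ℂ, ∑ j ∈ Finset.Icc 1 (k - 1), f (k - (j : ℕ)) =
        ∑ j ∈ Finset.Icc 1 (k - 1), f (j : ℕ) := fun f => by
      refine Finset.sum_nbij' (fun j => k - j) (fun j => k - j) ?_ ?_ ?_ ?_ ?_ <;>
        intro j hj <;> rw [Finset.mem_Icc] at *
      · omega
      · omega
      · omega
      · omega
      · rw [Nat.cast_sub (by omega)]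
    intro F
    rw [← h1 (fun j => ∑ j' ∈ Finset.Icc 1 (k - 1), F j (j' : ℕ))]
    exact Finset.sum_congr rfl fun j _ => h1 (fun j' => F (k - (j : ℕ)) j')
  rw [muADETilde, muADE, ← hkdef]
  simp only [hmuT, Finset.sum_sub_distrib, ← Finset.mul_sum, Finset.sum_add_distrib]
  rw [hrefl (fun j j' => Y.omegaHat j j' * mu k j j' τ z z 0),
    hrefl (fun j j' => Y.omegaHat j j' * X j j')]
  have hXe : ∑ j ∈ Finset.Icc 1 (k - 1), ∑ j' ∈ Finset.Icc 1 (k - 1),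
      Y.omegaHat (j : ℕ) (j' : ℕ) * X (j : ℕ) (j' : ℕ) =
      2 * (1 / ModularForm.eta τ ^ 3 * (1 / (√(4 * π * k) : ℝ)) *
        ∑ j ∈ Finset.Icc 1 (k - 1), ∑ j' ∈ Finset.Icc 1 (k - 1),
          Y.omegaHat j j' * unaryTheta k j τ * unaryThetaStar k j' τ) := by
    simp only [Finset.mul_sum]
    refine Finset.sum_congr rfl fun j hj => Finset.sum_congr rfl fun j' hj' => ?_
    rw [Finset.mem_Icc] at hj hj'
    have hr : ¬ (2 * k : ℤ) ∣ (j' : ℤ) := fun h => by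
      have := Int.le_of_dvd (by omega) h
      omega
    rw [hX]
    simp only
    rw [affineChar_zero hk _ hτ, zwegersRHat_zero hk hr hτ]
    ring
  rw [hXe]
  ring

/-- Odd periodic functions vanish at `0` and `k`; folding the remaining classes in the second index
turns `Ω` into `Ω̂`, and folding in the first index gives two equal contributions. -/
lemma sum_omegaHat_eq (Y : ADE) {f g : ℤ → ℂ} (hf : ∀ r, f (-r) = -f r) (hg : ∀ r, g (-r) = -g r)
    (hf' : ∀ r m : ℤ, f (r + 2 * Y.coxeter * m) = f r)
    (hg' : ∀ r m : ℤ, g (r + 2 * Y.coxeter * m) = g r) :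
    ∑ r : Fin (2 * Y.coxeter), ∑ r' : Fin (2 * Y.coxeter), Y.omega (r : ℕ) (r' : ℕ) *
      f (r : ℕ) * g (r' : ℕ) = 2 * ∑ j ∈ Finset.Icc 1 (Y.coxeter - 1),
        ∑ j' ∈ Finset.Icc 1 (Y.coxeter - 1), Y.omegaHat j j' * f (j : ℕ) * g (j' : ℕ) := by
  have hk := Y.coxeter_ne_zero
  have h0 : ∀ {f : ℤ → ℂ}, (∀ r, f (-r) = -f r) → (∀ r m : ℤ, f (r + 2 * Y.coxeter * m) = f r) →
      f 0 = 0 ∧ f Y.coxeter = 0 := fun {f} h1 h2 => by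
    constructor
    · have := h1 0; rw [neg_zero] at this; exact self_eq_neg.1 this
    · have := h1 Y.coxeter
      rw [← h2 (-Y.coxeter) 1, show -(Y.coxeter : ℤ) + 2 * Y.coxeter * 1 = Y.coxeter by ring] at this
      exact self_eq_neg.1 this
  have h1 : ∀ r : ℤ, ∑ r' : Fin (2 * Y.coxeter), Y.omega r (r' : ℕ) * f r * g (r' : ℕ) =
      ∑ j' ∈ Finset.Icc 1 (Y.coxeter - 1), Y.omegaHat r j' * f r * g (j' : ℕ) := fun r => by
    rw [sum_fin_two_mul hk (f := fun r' => Y.omega r r' * f r * g r')]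
    · rw [(h0 hg hg').1, (h0 hg hg').2, mul_zero, mul_zero, zero_add, zero_add]
      refine Finset.sum_congr rfl fun j _ => ?_
      rw [hg, ADE.omegaHat]
      ring
    · intro r' m
      rw [Y.omega_add_right, hg']
  simp only [h1]
  rw [sum_fin_two_mul hk (f := fun r => ∑ j' ∈ Finset.Icc 1 (Y.coxeter - 1),
    Y.omegaHat r j' * f r * g (j' : ℕ))]
  · simp only [(h0 hf hf').1, (h0 hf hf').2, mul_zero, zero_mul, Finset.sum_const_zero, zero_add]
    rw [Finset.mul_sum]
    refine Finset.sum_congr rfl fun j _ => ?_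
    rw [two_mul, ← Finset.sum_add_distrib, ← Finset.sum_add_distrib]
    refine Finset.sum_congr rfl fun j' _ => ?_
    have : Y.omegaHat (-(j : ℕ)) (j' : ℕ) = -Y.omegaHat j j' := by
      rw [ADE.omegaHat, ADE.omegaHat, Y.omega_neg, ← Y.omega_neg (-(j : ℕ)), neg_neg, neg_sub]
    rw [hf, this]
    ring
  · intro r m
    refine Finset.sum_congr rfl fun j' _ => ?_
    rw [ADE.omegaHat, ADE.omegaHat, Y.omega_add_left, Y.omega_add_left, hf']

lemma sqrt_sixteen_pi_mul (k : ℕ) : √(16 * π * k) = 2 * √(4 * π * k) := by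
  rw [show 16 * π * k = 2 ^ 2 * (4 * π * k) by ring, Real.sqrt_mul (by positivity),
    Real.sqrt_sq (by positivity)]

lemma muADETilde_eq' (Y : ADE) {τ : ℂ} (hτ : 0 < τ.im) (z : ℂ) :
    muADETilde Y τ z z 0 = muADE Y τ z z 0 -
      1 / ModularForm.eta τ ^ 3 * (1 / (√(16 * π * Y.coxeter) : ℝ)) *
        ∑ j : Fin (2 * Y.coxeter), ∑ j' : Fin (2 * Y.coxeter),
          Y.omega j j' * unaryTheta Y.coxeter j τ * unaryThetaStar Y.coxeter j' τ := by
  have hk := Y.coxeter_ne_zero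
  rw [muADETilde_eq Y hτ, sqrt_sixteen_pi_mul, sum_omegaHat_eq Y
    (f := fun r => unaryTheta Y.coxeter r τ) (g := fun r => unaryThetaStar Y.coxeter r τ)]
  · push_cast
    ring
  · exact fun r => unaryTheta_neg hk r τ
  · intro r
    simp only [unaryThetaStar_eq_residueSum hk _ hτ, residueSum_neg (starTerm_neg _ τ), mul_neg]
  · intro r m
    simp only [unaryTheta_eq_residueSum hk, residueSum_add]
  · intro r m
    simp only [unaryThetaStar_eq_residueSum hk _ hτ, residueSum_add]

/-- The summands of the double series of the completion. -/
def completedTerm (d e : ℕ) (τ : ℂ) (a b : ℤ) : ℂ :=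
  divisorTerm d e τ a b - (1 / 2) * (unaryCoeff (d * e) τ (d * a + e * b) *
    starTerm (d * e) τ (d * a - e * b))

/-- The contribution of `Ω^{(de,d)}` to `η³ μ̃^Y(τ; z, z, 0)`. -/
def completedPart (d e : ℕ) (τ z : ℂ) : ℂ :=
  -(((e : ℂ) - d) * weierstrassSum τ z) + ∑' p : ℤ × ℤ, completedTerm d e τ p.1 p.2

lemma summable_completedTerm {d e : ℕ} (hd : d ≠ 0) (he : e ≠ 0) {τ : ℂ} (hτ : 0 < τ.im) :
    Summable (fun p : ℤ × ℤ => completedTerm d e τ p.1 p.2) :=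
  (hasSum_divisorTerm hd he hτ).summable.sub ((hasSum_omegaDiv_mul_residueSum hd he
    (summable_unaryCoeff (mul_ne_zero hd he) hτ)
    (summable_starTerm (mul_ne_zero hd he) hτ)).summable.mul_left _)

lemma eta_ne_zero {τ : ℂ} (hτ : 0 < τ.im) : ModularForm.eta τ ≠ 0 :=
  ModularForm.eta_ne_zero hτ

lemma eta_cube_mul_muADE (Y : ADE) {τ z : ℂ} (hτ : 0 < τ.im) (hz : ∀ m n : ℤ, z ≠ m * τ + n) :
    ModularForm.eta τ ^ 3 * muADE Y τ z z 0 = ∑ d ∈ Y.divisorSet,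
      (-((((Y.coxeter / d : ℕ) : ℂ) - d) * weierstrassSum τ z) +
        ∑' p : ℤ × ℤ, divisorTerm d (Y.coxeter / d) τ p.1 p.2) := by
  have h : muADE Y τ z z 0 = ∑ d ∈ Y.divisorSet, ∑ j ∈ Finset.Icc 1 (Y.coxeter - 1),
      ∑ j' ∈ Finset.Icc 1 (Y.coxeter - 1),
      omegaHatDiv Y.coxeter d (j : ℕ) (j' : ℕ) * mu Y.coxeter (j : ℕ) (j' : ℕ) τ z z 0 := by
    simp only [muADE, Y.omegaHat_eq_sum, Finset.sum_mul]
    symm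
    rw [Finset.sum_comm]
    exact Finset.sum_congr rfl fun j _ => Finset.sum_comm
  rw [h, Finset.mul_sum]
  refine Finset.sum_congr rfl fun d hd => ?_
  obtain ⟨h1, h2⟩ := Y.ne_zero_of_mem hd
  have h3 := sum_omegaHatDiv_mul_mu h1 h2 (by rw [Y.mul_div_coxeter hd]; exact Y.two_le_coxeter) hτ hz
  rwa [Y.mul_div_coxeter hd] at h3

lemma eta_cube_mul_muADETilde_eq (Y : ADE) {τ : ℂ} (hτ : 0 < τ.im) (z : ℂ) :
    ModularForm.eta τ ^ 3 * muADETilde Y τ z z 0 = ModularForm.eta τ ^ 3 * muADE Y τ z z 0 -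
      1 / (√(16 * π * Y.coxeter) : ℝ) *
        ∑ j : Fin (2 * Y.coxeter), ∑ j' : Fin (2 * Y.coxeter),
          Y.omega j j' * unaryTheta Y.coxeter j τ * unaryThetaStar Y.coxeter j' τ := by
  rw [muADETilde_eq' Y hτ]
  have := eta_ne_zero hτ
  field_simp

/-- Unfolding the contraction of `S` with `S*` over the pairs `(da + eb, da - eb)` puts the
correction on the same index set as the holomorphic series. The constant is `√(4πk) / √(16πk) =
1/2`. -/
lemma eta_cube_mul_muADETilde (Y : ADE) {τ z : ℂ} (hτ : 0 < τ.im)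
    (hz : ∀ m n : ℤ, z ≠ m * τ + n) :
    ModularForm.eta τ ^ 3 * muADETilde Y τ z z 0 =
      ∑ d ∈ Y.divisorSet, completedPart d (Y.coxeter / d) τ z := by
  have hk := Y.coxeter_ne_zero
  have hk' : (0 : ℝ) < Y.coxeter := by positivity
  have h0 : ((√(4 * π * Y.coxeter) : ℝ) : ℂ) ≠ 0 := by
    exact_mod_cast (Real.sqrt_pos.2 (by positivity)).ne'
  rw [eta_cube_mul_muADETilde_eq Y hτ, eta_cube_mul_muADE Y hτ hz]
  have h : 1 / (√(16 * π * Y.coxeter) : ℝ) *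
        ∑ j : Fin (2 * Y.coxeter), ∑ j' : Fin (2 * Y.coxeter),
          Y.omega j j' * unaryTheta Y.coxeter j τ * unaryThetaStar Y.coxeter j' τ =
      ∑ d ∈ Y.divisorSet, (1 / 2) * ∑' p : ℤ × ℤ,
        unaryCoeff Y.coxeter τ (d * p.1 + (Y.coxeter / d : ℕ) * p.2) *
        starTerm Y.coxeter τ (d * p.1 - (Y.coxeter / d : ℕ) * p.2) := by
    have h1 : ∀ d ∈ Y.divisorSet, ∑' p : ℤ × ℤ,
        unaryCoeff Y.coxeter τ (d * p.1 + (Y.coxeter / d : ℕ) * p.2) *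
        starTerm Y.coxeter τ (d * p.1 - (Y.coxeter / d : ℕ) * p.2) =
        ∑ j : Fin (2 * Y.coxeter), ∑ j' : Fin (2 * Y.coxeter),
          omegaDiv Y.coxeter d (j : ℕ) (j' : ℕ) * residueSum Y.coxeter (unaryCoeff Y.coxeter τ) (j : ℕ) *
            residueSum Y.coxeter (starTerm Y.coxeter τ) (j' : ℕ) := fun d hd => by
      obtain ⟨h1, h2⟩ := Y.ne_zero_of_mem hd
      have h3 := (hasSum_omegaDiv_mul_residueSum h1 h2 (summable_unaryCoeff hk hτ)
        (summable_starTerm hk hτ)).tsum_eq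
      rw [Y.mul_div_coxeter hd] at h3
      exact h3
    rw [← Finset.mul_sum, Finset.sum_congr rfl h1, Finset.sum_comm (s := Y.divisorSet)]
    simp only [Finset.mul_sum]
    refine Finset.sum_congr rfl fun j _ => ?_
    rw [Finset.sum_comm (s := Y.divisorSet)]
    refine Finset.sum_congr rfl fun j' _ => ?_
    rw [unaryTheta_eq_residueSum hk, unaryThetaStar_eq_residueSum hk _ hτ, Y.omega_eq_sum,
      sqrt_sixteen_pi_mul, Finset.sum_mul, Finset.sum_mul, Finset.mul_sum]
    refine Finset.sum_congr rfl fun d _ => ?_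
    push_cast
    field_simp
  rw [h, ← Finset.sum_sub_distrib]
  refine Finset.sum_congr rfl fun d hd => ?_
  obtain ⟨h1, h2⟩ := Y.ne_zero_of_mem hd
  have hk0 := Y.mul_div_coxeter hd
  simp only [completedPart, completedTerm]
  rw [(hasSum_divisorTerm h1 h2 hτ).summable.tsum_sub ((hasSum_omegaDiv_mul_residueSum h1 h2
    (summable_unaryCoeff (mul_ne_zero h1 h2) hτ)
    (summable_starTerm (mul_ne_zero h1 h2) hτ)).summable.mul_left _), tsum_mul_left, hk0]
  ring

/-! ### Functions of exponential decay -/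

lemma exists_one_add_abs_pow_mul_exp_le {c : ℝ} (hc : 0 < c) :
    ∃ C : ℝ, 0 < C ∧ ∀ x : ℝ, (1 + |x|) ^ 2 * Real.exp (-(c * |x|)) ≤ C * (1 + x ^ 2)⁻¹ := by
  -- The constant comes from `x⁴ / 4! ≤ exp x` at `c (1 + |x|)`: two powers bound the given weight
  -- and two produce the decay.
  refine ⟨(Nat.factorial 4) / c ^ 4 * Real.exp c, by positivity, fun x => ?_⟩
  have h1 := Real.pow_div_factorial_le_exp (c * (1 + |x|)) (by positivity) 4
  rw [div_le_iff₀ (by positivity), mul_pow, mul_add, mul_one, Real.exp_add] at h1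
  have h2 : (1 + x ^ 2) ≤ (1 + |x|) ^ 2 := by
    have := abs_nonneg x
    nlinarith [sq_abs x]
  rw [← div_eq_mul_inv, le_div_iff₀ (by positivity)]
  calc (1 + |x|) ^ 2 * Real.exp (-(c * |x|)) * (1 + x ^ 2)
      ≤ (1 + |x|) ^ 2 * Real.exp (-(c * |x|)) * (1 + |x|) ^ 2 := by gcongr
    _ = c ^ 4 * (1 + |x|) ^ 4 / c ^ 4 * Real.exp (-(c * |x|)) := by field_simp
    _ ≤ Real.exp c * Real.exp (c * |x|) * (Nat.factorial 4) / c ^ 4 * Real.exp (-(c * |x|)) := by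
        gcongr
    _ = (Nat.factorial 4) / c ^ 4 * Real.exp c * (Real.exp (c * |x|) * Real.exp (-(c * |x|))) := by ring
    _ = _ := by rw [← Real.exp_add, add_neg_cancel, Real.exp_zero, mul_one]

/-- Continuous functions of exponential decay. -/
structure ExpDecay (f : ℝ → ℂ) : Prop where
  continuous : Continuous f
  bound : ∃ C c : ℝ, 0 ≤ C ∧ 0 < c ∧ ∀ x, ‖f x‖ ≤ C * ((1 + |x|) ^ 2 * Real.exp (-(c * |x|)))

lemma ExpDecay.exists_le {f : ℝ → ℂ} (hf : ExpDecay f) :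
    ∃ C : ℝ, 0 ≤ C ∧ ∀ x, ‖f x‖ ≤ C * (1 + x ^ 2)⁻¹ := by
  obtain ⟨C, c, hC, hc, h⟩ := hf.bound
  obtain ⟨D, hD, h2⟩ := exists_one_add_abs_pow_mul_exp_le hc
  exact ⟨C * D, by positivity, fun x => (h x).trans (by rw [mul_assoc]; exact mul_le_mul_of_nonneg_left (h2 x) hC)⟩

lemma ExpDecay.integrable {f : ℝ → ℂ} (hf : ExpDecay f) : Integrable f := by
  obtain ⟨C, -, h⟩ := hf.exists_le
  exact (integrable_inv_one_add_sq.const_mul C).mono' hf.continuous.aestronglyMeasurable (ae_of_all _ h)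

lemma ExpDecay.isBigO {f : ℝ → ℂ} (hf : ExpDecay f) :
    f =O[cocompact ℝ] fun x : ℝ => |x| ^ (-2 : ℝ) := by
  obtain ⟨C, hC, h⟩ := hf.exists_le
  refine Asymptotics.IsBigO.of_bound C ?_
  have h0 : ∀ᶠ x : ℝ in cocompact ℝ, x ≠ 0 := by
    have : ({0} : Set ℝ)ᶜ ∈ cocompact ℝ := isCompact_singleton.compl_mem_cocompact
    exact this
  filter_upwards [h0] with x hx
  refine (h x).trans ?_
  rw [Real.norm_of_nonneg (by positivity), Real.rpow_neg (abs_nonneg _)]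
  have : |x| ^ (2 : ℝ) = x ^ 2 := by
    rw [show (2 : ℝ) = ((2 : ℕ) : ℝ) by norm_num, Real.rpow_natCast, sq_abs]
  rw [this]
  have : 0 < x ^ 2 := by positivity
  gcongr
  linarith

lemma ExpDecay.tsum_eq_tsum_fourier {f : ℝ → ℂ} (hf : ExpDecay f) {F : ℤ → ℂ}
    (hF : ∀ n : ℤ, ∫ x : ℝ, f x * exp (-(2 * π * I * n * x)) = F n) (hs : Summable F) :
    ∑' b : ℤ, f b = ∑' n : ℤ, F n := by
  have h1 : ∀ n : ℤ, FourierTransform.fourier f (n : ℝ) = F n := fun n => by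
    rw [Real.fourier_real_eq_integral_exp_smul, ← hF n]
    refine integral_congr_ae (ae_of_all _ fun x => ?_)
    simp only [smul_eq_mul]
    rw [mul_comm]
    congr 2
    push_cast
    ring
  have h := Real.tsum_eq_tsum_fourier_of_rpow_decay_of_summable hf.continuous one_lt_two hf.isBigO
    (by simpa only [h1] using hs) 0
  simpa [h1] using h

/-! ### Gaussian integrals -/

/-- The function `exp (2πiwx - πβ²(p - x)²)`. -/
def gaussExp (β p : ℝ) (w : ℂ) (x : ℝ) : ℂ := exp (2 * π * I * w * x - π * β ^ 2 * (p - x) ^ 2)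

lemma gaussExp_eq (β p : ℝ) (w : ℂ) (x : ℝ) : gaussExp β p w x =
    exp (-(π * β ^ 2) * x ^ 2 + (2 * π * I * w + 2 * π * β ^ 2 * p) * x + -(π * β ^ 2 * p ^ 2)) := by
  rw [gaussExp]; congr 1; ring

lemma hasDerivAt_gaussExp (β p : ℝ) (w : ℂ) (x : ℝ) : HasDerivAt (gaussExp β p w)
    ((2 * π * I * w + 2 * π * β ^ 2 * (p - x)) * gaussExp β p w x) x := by
  have h1 : HasDerivAt (fun x : ℝ => (x : ℂ)) 1 x := Complex.ofRealCLM.hasDerivAt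
  have h2 := ((h1.const_mul (2 * π * I * w)).sub (((h1.const_sub (p : ℂ)).pow 2).const_mul
    (π * β ^ 2 : ℂ))).cexp
  refine h2.congr_deriv ?_
  simp only [gaussExp, Pi.sub_apply, Pi.pow_apply]
  push_cast
  ring

lemma re_neg_pi_mul_sq {β : ℝ} (hβ : 0 < β) : (-(π * β ^ 2) : ℂ).re < 0 := by
  have : (-(π * β ^ 2) : ℂ) = ((-(π * β ^ 2) : ℝ) : ℂ) := by push_cast; ring
  rw [this, ofReal_re]
  have : 0 < π * β ^ 2 := by positivity
  linarith

lemma integrable_gaussExp {β : ℝ} (hβ : 0 < β) (p : ℝ) (w : ℂ) : Integrable (gaussExp β p w) := by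
  rw [show gaussExp β p w = _ from funext (gaussExp_eq β p w)]
  exact integrable_cexp_quadratic' (re_neg_pi_mul_sq hβ) _ _

lemma integral_gaussExp {β : ℝ} (hβ : 0 < β) (p : ℝ) (w : ℂ) :
    ∫ x, gaussExp β p w x = 1 / β * exp (-(π / β ^ 2 * (w * (w - 2 * I * β ^ 2 * p)))) := by
  have hβ' : (β : ℂ) ≠ 0 := by exact_mod_cast hβ.ne'
  have hπ : (π : ℂ) ≠ 0 := by exact_mod_cast Real.pi_ne_zero
  simp only [gaussExp_eq]
  rw [integral_cexp_quadratic (re_neg_pi_mul_sq hβ), neg_neg]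
  congr 1
  · have : (π / (π * β ^ 2) : ℂ) = (((1 / β) ^ 2 : ℝ) : ℂ) := by push_cast; field_simp
    rw [this, show (1 / 2 : ℂ) = ((1 / 2 : ℝ) : ℂ) by push_cast; rfl,
      ← Complex.ofReal_cpow (by positivity), ← Real.sqrt_eq_rpow, Real.sqrt_sq (by positivity)]
    push_cast; rfl
  · congr 1
    field_simp
    ring_nf
    simp only [I_sq]
    ring

lemma norm_exp_two_pi_I_mul_real (w : ℂ) (x : ℝ) :
    ‖exp (2 * π * I * w * x)‖ = Real.exp (-(2 * π * w.im * x)) := by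
  rw [show 2 * π * I * w * x = 2 * π * I * (w * x) by ring, norm_exp_two_pi_I_mul]
  congr 1
  simp [mul_assoc]

/-- For `x ≤ p` the Gaussian tail combines with the exponential into `exp (-πβ² (p² + x²))`; for `x
> p` the exponential itself decays and `1 - E ≤ 2` suffices. -/
lemma abs_one_sub_errorE_mul_exp_le {β p : ℝ} (hβ : 0 < β) (hp : 0 < p) (x : ℝ) :
    |errorE (β * (p - x)) - 1| * Real.exp (-(2 * π * (β ^ 2 * p) * x)) ≤
      2 * Real.exp (-(2 * π * β ^ 2 * p * |x|)) := by
  rw [abs_sub_comm, abs_of_nonneg (one_sub_errorE_nonneg _)]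
  rcases le_or_gt x p with h | h
  · have h1 : 0 ≤ β * (p - x) := mul_nonneg hβ.le (by linarith)
    calc _ ≤ Real.exp (-π * (β * (p - x)) ^ 2) * Real.exp (-(2 * π * (β ^ 2 * p) * x)) := by
          gcongr; exact one_sub_errorE_le h1
      _ = Real.exp (-(π * β ^ 2 * (p ^ 2 + x ^ 2))) := by rw [← Real.exp_add]; congr 1; ring
      _ ≤ Real.exp (-(2 * π * β ^ 2 * p * |x|)) := by
          refine Real.exp_le_exp.2 (neg_le_neg ?_)
          have h2 : 2 * p * |x| ≤ p ^ 2 + x ^ 2 := by rw [← sq_abs x]; nlinarith [sq_nonneg (p - |x|)]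
          have h3 : 0 ≤ π * β ^ 2 := by positivity
          nlinarith
      _ ≤ _ := by linarith [Real.exp_pos (-(2 * π * β ^ 2 * p * |x|))]
  · have h1 : 1 - errorE (β * (p - x)) ≤ 2 := by
      have := one_sub_errorE_nonneg (-(β * (p - x)))
      rw [errorE_neg] at this
      linarith
    rw [abs_of_pos (hp.trans h), show 2 * π * (β ^ 2 * p) * x = 2 * π * β ^ 2 * p * x by ring]
    gcongr

/-- The function whose values at integers are summed by Poisson's formula. -/
def erfcExp (β p : ℝ) (w : ℂ) (x : ℝ) : ℂ :=
  (p + x) * (errorE (β * (p - x)) - 1 : ℝ) * exp (2 * π * I * w * x)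

lemma expDecay_mul_errorE {β p : ℝ} (hβ : 0 < β) (hp : 0 < p) {w : ℂ} (hw : w.im = β ^ 2 * p)
    (A B : ℂ) : ExpDecay (fun x : ℝ => (A * (p + x) + B) * ((errorE (β * (p - x)) - 1 : ℝ) : ℂ) *
      exp (2 * π * I * w * x)) := by
  constructor
  · have := continuous_errorE
    fun_prop
  · refine ⟨(‖A‖ * (p + 1) + ‖B‖) * 2, 2 * π * β ^ 2 * p, by positivity, by positivity, fun x => ?_⟩
    rw [norm_mul, norm_mul, Complex.norm_real, norm_exp_two_pi_I_mul_real, hw, Real.norm_eq_abs,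
      mul_assoc]
    have h1 : ‖A * (p + x) + B‖ ≤ (‖A‖ * (p + 1) + ‖B‖) * (1 + |x|) ^ 2 := by
      have h2 : ‖(p + x : ℂ)‖ ≤ p + |x| := by
        refine (norm_add_le _ _).trans (le_of_eq ?_)
        rw [Complex.norm_real, Complex.norm_real, Real.norm_of_nonneg hp.le, Real.norm_eq_abs]
      have h3 : p + |x| ≤ (p + 1) * (1 + |x|) ^ 2 := by
        have := abs_nonneg x
        have := mul_nonneg hp.le this
        nlinarith
      have h4 : (1 : ℝ) ≤ (1 + |x|) ^ 2 := by nlinarith [abs_nonneg x]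
      calc ‖A * (p + x) + B‖ ≤ ‖A‖ * (p + |x|) + ‖B‖ := by
            refine (norm_add_le _ _).trans ?_
            rw [norm_mul]
            gcongr
        _ ≤ ‖A‖ * ((p + 1) * (1 + |x|) ^ 2) + ‖B‖ * (1 + |x|) ^ 2 := by
            gcongr
            exact le_mul_of_one_le_right (norm_nonneg _) h4
        _ = _ := by ring
    refine (mul_le_mul h1 (abs_one_sub_errorE_mul_exp_le hβ hp x) (by positivity) (by positivity)).trans
      (le_of_eq (by ring))

lemma expDecay_erfcExp {β p : ℝ} (hβ : 0 < β) (hp : 0 < p) {w : ℂ} (hw : w.im = β ^ 2 * p) :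
    ExpDecay (erfcExp β p w) := by
  have := expDecay_mul_errorE hβ hp hw 1 0
  simp only [one_mul, add_zero] at this
  exact this

/-- Integration by parts against a primitive of `(p + x) exp (2πiwx)` reduces the integral to
Gaussians. The hypothesis on `Im w` makes the resulting exponent depend on `|w|²`, which is the
source of the rotation-invariant factor in the lattice sums. -/
lemma integral_erfcExp {β p : ℝ} (hβ : 0 < β) (hp : 0 < p) {w : ℂ} (hw : w.im = β ^ 2 * p) :
    ∫ x, erfcExp β p w x = 1 / (2 * π ^ 2 * w ^ 2) *
      (((1 + 2 * π * (‖w‖ ^ 2 / β ^ 2)) * Real.exp (-(π * (‖w‖ ^ 2 / β ^ 2))) : ℝ) : ℂ) := by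
  have hβ' : (β : ℂ) ≠ 0 := by exact_mod_cast hβ.ne'
  have hπ : (π : ℂ) ≠ 0 := by exact_mod_cast Real.pi_ne_zero
  have hw0 : w ≠ 0 := by
    rintro rfl
    have : 0 < β ^ 2 * p := by positivity
    rw [← hw] at this
    simp at this
  have h1 : ∀ x : ℝ, HasDerivAt (fun x : ℝ => (1 / (2 * π * I * w) * (p + x) + 1 / (4 * π ^ 2 * w ^ 2)) *
      ((errorE (β * (p - x)) - 1 : ℝ) : ℂ) * exp (2 * π * I * w * x))
      (erfcExp β p w x - 2 * β * (1 / (2 * π * I * w) * (p + x) + 1 / (4 * π ^ 2 * w ^ 2)) *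
        gaussExp β p w x) x := by
    intro x
    have hx : HasDerivAt (fun x : ℝ => (x : ℂ)) 1 x := Complex.ofRealCLM.hasDerivAt
    have ha := ((hx.const_add (p : ℂ)).const_mul (1 / (2 * π * I * w))).add_const
      (1 / (4 * π ^ 2 * w ^ 2))
    have hb : HasDerivAt (fun x : ℝ => ((errorE (β * (p - x)) - 1 : ℝ) : ℂ))
        ((2 * Real.exp (-π * (β * (p - x)) ^ 2) * (β * -1) : ℝ) : ℂ) x :=
      HasDerivAt.ofReal_comp (((hasDerivAt_errorE _).comp x
        (((hasDerivAt_id x).const_sub p).const_mul β)).sub_const 1)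
    have hc := (hx.const_mul (2 * π * I * w)).cexp
    refine ((ha.mul hb).mul hc).congr_deriv ?_
    have hg : gaussExp β p w x = exp (2 * π * I * w * x) * exp (-π * (β * (p - x)) ^ 2) := by
      rw [gaussExp, ← Complex.exp_add]; congr 1; ring
    rw [hg, erfcExp]
    simp only [Pi.mul_apply]
    push_cast
    generalize exp (2 * π * I * w * x) = E1
    generalize exp (-π * (β * (p - x)) ^ 2) = E2
    field_simp
    ring_nf
    simp only [I_sq]
    ring
  -- Subtracting this multiple of the Gaussian removes the linear factor in `x`, leaving a pure
  -- Gaussian to integrate.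
  set κ : ℂ := 2 * β / (2 * π * I * w) / (2 * π * β ^ 2) with hκ
  have h2 : ∀ x : ℝ, HasDerivAt (fun x : ℝ => (1 / (2 * π * I * w) * (p + x) + 1 / (4 * π ^ 2 * w ^ 2)) *
      ((errorE (β * (p - x)) - 1 : ℝ) : ℂ) * exp (2 * π * I * w * x) - κ * gaussExp β p w x)
      (erfcExp β p w x - 2 * β * ((2 * p + I * w / β ^ 2) / (2 * π * I * w) + 1 / (4 * π ^ 2 * w ^ 2)) *
        gaussExp β p w x) x := by
    intro x
    refine ((h1 x).sub ((hasDerivAt_gaussExp β p w x).const_mul κ)).congr_deriv ?_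
    rw [hκ]
    generalize gaussExp β p w x = G
    field_simp
    ring
  have hi1 := (expDecay_mul_errorE hβ hp hw (1 / (2 * π * I * w)) (1 / (4 * π ^ 2 * w ^ 2))).integrable
  have hi2 := integrable_gaussExp hβ p w
  have hi3 := (expDecay_erfcExp hβ hp hw).integrable
  have h3 := integral_eq_zero_of_hasDerivAt_of_integrable h2 (hi3.sub (hi2.const_mul _))
    (hi1.sub (hi2.const_mul _))
  rw [integral_sub hi3 (hi2.const_mul _), integral_const_mul, integral_gaussExp hβ, sub_eq_zero] at h3
  -- This is where `Im w = β² p` enters: completing the square moves `w` to its conjugate.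
  have hconj : w - 2 * I * β ^ 2 * p = conj w := by
    apply Complex.ext
    · simp [← ofReal_pow]
    · simp [← ofReal_pow, hw]; ring
  have hnorm : w * (w - 2 * I * β ^ 2 * p) = ((‖w‖ ^ 2 : ℝ) : ℂ) := by
    rw [hconj, Complex.mul_conj, Complex.normSq_eq_norm_sq]
  have h4 : (2 * p + I * w / β ^ 2) / (2 * π * I * w) =
      ((‖w‖ ^ 2 : ℝ) : ℂ) / (2 * π * β ^ 2 * w ^ 2) := by
    rw [← hnorm]
    field_simp
    ring_nf
    simp only [I_sq]
    ring
  rw [h3, hnorm, h4]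
  push_cast
  field_simp
  ring

lemma norm_inv_sq_mul_gauss_le {β : ℝ} (w : ℂ) :
    ‖(((1 + 2 * π * (‖w‖ ^ 2 / β ^ 2)) * Real.exp (-(π * (‖w‖ ^ 2 / β ^ 2))) : ℝ) : ℂ)‖ ≤ 2 := by
  rw [Complex.norm_real, Real.norm_of_nonneg (by positivity), Real.exp_neg, ← div_eq_mul_inv,
    div_le_iff₀ (Real.exp_pos _)]
  have := Real.add_one_le_exp (π * (‖w‖ ^ 2 / β ^ 2))
  linarith

/-- Poisson summation for `erfcExp`. -/
lemma tsum_erfcExp {β p : ℝ} (hβ : 0 < β) (hp : 0 < p) {w : ℂ} (hw : w.im = β ^ 2 * p) :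
    ∑' b : ℤ, erfcExp β p w b = ∑' n : ℤ, 1 / (2 * π ^ 2 * (w + n) ^ 2) *
      (((1 + 2 * π * (‖w + n‖ ^ 2 / β ^ 2)) *
        Real.exp (-(π * (‖w + n‖ ^ 2 / β ^ 2))) : ℝ) : ℂ) := by
  set F : ℤ → ℂ := fun n => 1 / (2 * π ^ 2 * (w + n) ^ 2) *
      (((1 + 2 * π * (‖w + n‖ ^ 2 / β ^ 2)) *
        Real.exp (-(π * (‖w + n‖ ^ 2 / β ^ 2))) : ℝ) : ℂ) with hF
  have hs : Summable F := by
    have h := (EisensteinSeries.linear_right_summable w 1 (k := 2) le_rfl).norm.mul_left (1 / π ^ 2)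
    refine h.of_norm_bounded fun n => ?_
    rw [hF]
    simp only
    rw [norm_mul]
    refine (mul_le_mul_of_nonneg_left (norm_inv_sq_mul_gauss_le _) (norm_nonneg _)).trans (le_of_eq ?_)
    simp only [Int.cast_one, one_mul, norm_div, norm_one, norm_mul, norm_pow, Complex.norm_real,
      Real.norm_of_nonneg Real.pi_pos.le, Complex.norm_ofNat, norm_inv]
    field_simp
    rw [norm_pow]
  -- The `n`-th Fourier coefficient replaces `w` by `w - n`, which keeps the imaginary part; the
  -- sign is undone by reflecting the sum.
  rw [(expDecay_erfcExp hβ hp hw).tsum_eq_tsum_fourier (F := fun n => F (-n)) ?_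
    ((Equiv.neg ℤ).summable_iff.2 hs)]
  · exact (Equiv.neg ℤ).tsum_eq F
  · intro n
    have hw' : (w + ((-n : ℤ) : ℂ)).im = β ^ 2 * p := by simp [hw]
    rw [hF]
    simp only
    rw [← integral_erfcExp hβ hp hw']
    refine integral_congr_ae (ae_of_all _ fun x => ?_)
    simp only [erfcExp]
    rw [mul_assoc, ← Complex.exp_add]
    congr 2
    push_cast
    ring

/-! ### The row of index zero -/

lemma abs_signErfc_mul_le {β : ℝ} (x : ℝ) :
    |signErfc (β * x)| ≤ Real.exp (π * β ^ 2) * Real.exp (-(2 * π * β ^ 2 * |x|)) := by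
  refine (abs_signErfc_le _).trans ?_
  rw [← Real.exp_add]
  refine Real.exp_le_exp.2 ?_
  have h2 : 2 * |x| ≤ 1 + x ^ 2 := by rw [← sq_abs x]; nlinarith [sq_nonneg (1 - |x|)]
  have h3 : 0 ≤ π * β ^ 2 := by positivity
  nlinarith

/-- The jump of the sign at `0` is harmless because `K` vanishes there together with its derivative.
-/
lemma hasDerivAt_mul_signErfc {β : ℝ} (hβ : 0 < β) {K K' : ℝ → ℂ} (hK : ∀ x, HasDerivAt K (K' x) x)
    (h0 : K 0 = 0) (h0' : K' 0 = 0) (x : ℝ) :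
    HasDerivAt (fun x => K x * (signErfc (β * x) : ℂ))
      (K' x * (signErfc (β * x) : ℂ) - 2 * β * (K x * (Real.exp (-π * (β * x) ^ 2) : ℝ))) x := by
  have herr : HasDerivAt (fun x : ℝ => errorE (β * x)) (2 * Real.exp (-π * (β * x) ^ 2) * β) x := by
    have := (hasDerivAt_errorE (β * x)).comp x ((hasDerivAt_id x).const_mul β)
    simpa only [mul_one] using! this
  have key : ∀ c : ℝ, (∀ᶠ y in 𝓝 x, signErfc (β * y) = c - errorE (β * y)) →
      HasDerivAt (fun x => K x * (signErfc (β * x) : ℂ))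
      (K' x * (signErfc (β * x) : ℂ) - 2 * β * (K x * (Real.exp (-π * (β * x) ^ 2) : ℝ))) x := by
    intro c hc
    have h1 : HasDerivAt (fun y => signErfc (β * y)) (-(2 * Real.exp (-π * (β * x) ^ 2) * β)) x :=
      (herr.const_sub c).congr_of_eventuallyEq hc
    refine ((hK x).mul h1.ofReal_comp).congr_deriv ?_
    push_cast
    ring
  rcases lt_trichotomy x 0 with hx | rfl | hx
  · refine key (-1) ?_
    filter_upwards [eventually_lt_nhds hx] with y hy
    rw [signErfc, Real.sign_of_neg (mul_neg_of_pos_of_neg hβ hy)]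
  · rw [h0', h0, zero_mul, zero_mul, mul_zero, sub_zero, hasDerivAt_iff_isLittleO]
    have h1 := hasDerivAt_iff_isLittleO.1 (hK 0)
    simp only [h0, h0', smul_zero, sub_zero, zero_mul] at h1 ⊢
    refine Asymptotics.IsBigO.trans_isLittleO (Asymptotics.isBigO_of_le _ fun y => ?_) h1
    rw [norm_mul, Complex.norm_real, Real.norm_eq_abs]
    refine mul_le_of_le_one_right (norm_nonneg _) ((abs_signErfc_le _).trans ?_)
    rw [Real.exp_le_one_iff]
    have : 0 ≤ π * (β * y) ^ 2 := by positivity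
    linarith
  · refine key 1 ?_
    filter_upwards [eventually_gt_nhds hx] with y hy
    rw [signErfc, Real.sign_of_pos (mul_pos hβ hy)]

lemma expDecay_mul_signErfc {β : ℝ} (hβ : 0 < β) {K K' : ℝ → ℂ} (hK : ∀ x, HasDerivAt K (K' x) x)
    (h0 : K 0 = 0) (h0' : K' 0 = 0) {C : ℝ} (hC : 0 ≤ C) (hb : ∀ x, ‖K x‖ ≤ C * (1 + |x|) ^ 2) :
    ExpDecay (fun x => K x * (signErfc (β * x) : ℂ)) := by
  constructor
  · exact continuous_iff_continuousAt.2 fun x => (hasDerivAt_mul_signErfc hβ hK h0 h0' x).continuousAt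
  · refine ⟨C * Real.exp (π * β ^ 2), 2 * π * β ^ 2, by positivity, by positivity, fun x => ?_⟩
    rw [norm_mul, Complex.norm_real, Real.norm_eq_abs]
    refine (mul_le_mul (hb x) (abs_signErfc_mul_le x) (abs_nonneg _) (by positivity)).trans
      (le_of_eq (by ring))

lemma continuous_mul_signErfc {β : ℝ} (hβ : 0 < β) :
    Continuous fun x : ℝ => ((x * signErfc (β * x) : ℝ) : ℂ) := by
  have h : ∀ x : ℝ, x * signErfc (β * x) = |x| * (1 - errorE (β * |x|)) := fun x => by
    rcases lt_trichotomy x 0 with h | rfl | h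
    · rw [abs_of_neg h, signErfc, Real.sign_of_neg (mul_neg_of_pos_of_neg hβ h), mul_neg, errorE_neg]
      ring
    · simp
    · rw [abs_of_pos h, signErfc, Real.sign_of_pos (mul_pos hβ h)]
  simp only [h]
  have := continuous_errorE
  fun_prop

lemma expDecay_id_mul_signErfc {β : ℝ} (hβ : 0 < β) (w : ℝ) :
    ExpDecay (fun x : ℝ => ((x * signErfc (β * x) : ℝ) : ℂ) * exp (2 * π * I * w * x)) := by
  constructor
  · have := continuous_mul_signErfc hβ
    fun_prop
  · refine ⟨Real.exp (π * β ^ 2), 2 * π * β ^ 2, by positivity, by positivity, fun x => ?_⟩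
    rw [norm_mul, Complex.norm_real, norm_exp_two_pi_I_mul_real, ofReal_im, Real.norm_eq_abs, abs_mul]
    simp only [mul_zero, zero_mul, neg_zero, Real.exp_zero, mul_one]
    have h1 : |x| ≤ (1 + |x|) ^ 2 := by nlinarith [abs_nonneg x]
    refine (mul_le_mul h1 (abs_signErfc_mul_le x) (abs_nonneg _) (by positivity)).trans
      (le_of_eq (by ring))

/-- Integration by parts with the primitive `K` of `x exp (2πiwx)` normalised by `K(0) = 0`. The
normalising constant contributes a Gaussian without oscillation, whose integral is the `-1`. -/
lemma integral_id_mul_signErfc {β : ℝ} (hβ : 0 < β) {w : ℝ} (hw : w ≠ 0) :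
    ∫ x : ℝ, ((x * signErfc (β * x) : ℝ) : ℂ) * exp (2 * π * I * w * x) =
      1 / (2 * π ^ 2 * (w : ℂ) ^ 2) *
        (((1 + 2 * π * (w ^ 2 / β ^ 2)) * Real.exp (-(π * (w ^ 2 / β ^ 2))) - 1 : ℝ) : ℂ) := by
  have hβ' : (β : ℂ) ≠ 0 := by exact_mod_cast hβ.ne'
  have hπ : (π : ℂ) ≠ 0 := by exact_mod_cast Real.pi_ne_zero
  have hw' : (w : ℂ) ≠ 0 := by exact_mod_cast hw
  set K : ℝ → ℂ := fun x => exp (2 * π * I * w * x) * (x / (2 * π * I * w) + 1 / (4 * π ^ 2 * w ^ 2)) -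
    1 / (4 * π ^ 2 * w ^ 2) with hKdef
  have hK : ∀ x : ℝ, HasDerivAt K ((x : ℂ) * exp (2 * π * I * w * x)) x := fun x => by
    have hx : HasDerivAt (fun x : ℝ => (x : ℂ)) 1 x := Complex.ofRealCLM.hasDerivAt
    refine (((hx.const_mul (2 * π * I * w)).cexp.mul ((hx.div_const (2 * π * I * w)).add_const
      (1 / (4 * π ^ 2 * w ^ 2) : ℂ))).sub_const (1 / (4 * π ^ 2 * w ^ 2) : ℂ)).congr_deriv ?_
    generalize exp (2 * π * I * w * x) = E1
    field_simp
    ring_nf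
    simp only [I_sq]
    ring
  have hK0 : K 0 = 0 := by simp [hKdef]
  have hK0' : ((0 : ℝ) : ℂ) * exp (2 * π * I * w * (0 : ℝ)) = 0 := by simp
  set C : ℝ := ‖(1 / (2 * π * I * w) : ℂ)‖ + 2 * ‖(1 / (4 * π ^ 2 * w ^ 2) : ℂ)‖ with hC
  have hKb : ∀ x, ‖K x‖ ≤ C * (1 + |x|) ^ 2 := fun x => by
    have h1 : ‖K x‖ ≤ |x| * ‖(1 / (2 * π * I * w) : ℂ)‖ + 2 * ‖(1 / (4 * π ^ 2 * w ^ 2) : ℂ)‖ := by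
      rw [hKdef]
      refine (norm_sub_le _ _).trans ?_
      rw [norm_mul, norm_exp_two_pi_I_mul_real, ofReal_im]
      simp only [mul_zero, zero_mul, neg_zero, Real.exp_zero, one_mul]
      have h2 := norm_add_le (x / (2 * π * I * w) : ℂ) (1 / (4 * π ^ 2 * w ^ 2))
      rw [div_eq_mul_one_div (x : ℂ), norm_mul (x : ℂ), Complex.norm_real, Real.norm_eq_abs,
        ← div_eq_mul_one_div (x : ℂ)] at h2
      linarith
    refine h1.trans ?_
    have h2 : |x| ≤ (1 + |x|) ^ 2 := by nlinarith [abs_nonneg x]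
    have h3 : 1 ≤ (1 + |x|) ^ 2 := by nlinarith [abs_nonneg x]
    rw [hC, add_mul, mul_comm |x|]
    exact add_le_add (mul_le_mul_of_nonneg_left h2 (norm_nonneg _))
      (le_mul_of_one_le_right (by positivity) h3)
  have hi1 := (expDecay_mul_signErfc hβ hK hK0 hK0' (by positivity) hKb).integrable
  have hi2 := integrable_gaussExp hβ 0 w
  have hi3 := (expDecay_id_mul_signErfc hβ w).integrable
  have hi4 := integrable_gaussExp hβ 0 0
  set κ : ℂ := 2 * β / (2 * π * I * w) / (2 * π * β ^ 2) with hκ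
  have h2 : ∀ x : ℝ, HasDerivAt (fun x => K x * (signErfc (β * x) : ℂ) - κ * gaussExp β 0 w x)
      (((x * signErfc (β * x) : ℝ) : ℂ) * exp (2 * π * I * w * x) -
        ((2 * β / (4 * π ^ 2 * w ^ 2) + 1 / (π * β)) * gaussExp β 0 w x -
          2 * β / (4 * π ^ 2 * w ^ 2) * gaussExp β 0 0 x)) x := by
    intro x
    refine ((hasDerivAt_mul_signErfc hβ hK hK0 hK0' x).sub
      ((hasDerivAt_gaussExp β 0 w x).const_mul κ)).congr_deriv ?_
    have hg0 : gaussExp β 0 0 x = exp (-π * (β * x) ^ 2) := by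
      rw [gaussExp]; congr 1; push_cast; ring
    have hg : gaussExp β 0 w x = exp (2 * π * I * w * x) * exp (-π * (β * x) ^ 2) := by
      rw [gaussExp, ← Complex.exp_add]; congr 1; push_cast; ring
    rw [hg0, hg, hκ, hKdef]
    push_cast
    generalize exp (2 * π * I * w * x) = E1
    generalize exp (-π * (β * x) ^ 2) = E2
    field_simp
    ring
  have hi5 : Integrable (fun x => (2 * β / (4 * π ^ 2 * w ^ 2) + 1 / (π * β)) * gaussExp β 0 w x -
      2 * β / (4 * π ^ 2 * w ^ 2) * gaussExp β 0 0 x) := (hi2.const_mul _).sub (hi4.const_mul _)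
  have h3 := integral_eq_zero_of_hasDerivAt_of_integrable h2 (hi3.sub hi5) (hi1.sub (hi2.const_mul _))
  rw [integral_sub hi3 hi5, sub_eq_zero,
    integral_sub (hi2.const_mul _) (hi4.const_mul _), integral_const_mul, integral_const_mul,
    integral_gaussExp hβ, integral_gaussExp hβ] at h3
  rw [h3]
  have h5 : -(π / (β : ℂ) ^ 2 * (w * (w - 2 * I * β ^ 2 * (0 : ℝ)))) = -(π * (w ^ 2 / β ^ 2)) := by
    push_cast; ring
  rw [h5]
  push_cast
  simp only [zero_mul, mul_zero, neg_zero, Complex.exp_zero]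
  field_simp
  ring

/-- The zero Fourier mode has to be computed separately, with primitive `x² / 2`; it is the origin
of the term `π / τ₂` that completes `G₂`. -/
lemma integral_id_mul_signErfc_zero {β : ℝ} (hβ : 0 < β) :
    ∫ x : ℝ, ((x * signErfc (β * x) : ℝ) : ℂ) * exp (2 * π * I * (0 : ℝ) * x) =
      1 / (2 * π * β ^ 2) := by
  have hβ' : (β : ℂ) ≠ 0 := by exact_mod_cast hβ.ne'
  have hπ : (π : ℂ) ≠ 0 := by exact_mod_cast Real.pi_ne_zero
  have hK : ∀ x : ℝ, HasDerivAt (fun x : ℝ => (x : ℂ) ^ 2 / 2) ((fun x : ℝ => (x : ℂ)) x) x := fun x => by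
    have hx : HasDerivAt (fun x : ℝ => (x : ℂ)) 1 x := Complex.ofRealCLM.hasDerivAt
    refine ((hx.pow 2).div_const 2).congr_deriv ?_
    push_cast; ring
  have hKb : ∀ x : ℝ, ‖(x : ℂ) ^ 2 / 2‖ ≤ 1 * (1 + |x|) ^ 2 := fun x => by
    rw [norm_div, norm_pow, Complex.norm_real, Real.norm_eq_abs, Complex.norm_ofNat]
    nlinarith [abs_nonneg x]
  have hi1 := (expDecay_mul_signErfc hβ hK (by simp) (by simp) one_pos.le hKb).integrable
  have hi3 := (expDecay_id_mul_signErfc hβ 0).integrable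
  have hi4 := integrable_gaussExp hβ 0 0
  have hi5 : Integrable (fun x : ℝ => (x : ℂ) * gaussExp β 0 0 x) := by
    have := integrable_mul_cexp_neg_mul_sq (b := π * β ^ 2)
      (by have := re_neg_pi_mul_sq hβ; rw [neg_re] at this; linarith)
    refine this.congr (ae_of_all _ fun x => ?_)
    simp only [gaussExp_eq]
    congr 2
    push_cast; ring
  have h2 : ∀ x : ℝ, HasDerivAt (fun x : ℝ => (x : ℂ) ^ 2 / 2 * (signErfc (β * x) : ℂ) -
      1 / (2 * π * β) * (x * gaussExp β 0 0 x))
      (((x * signErfc (β * x) : ℝ) : ℂ) * exp (2 * π * I * (0 : ℝ) * x) -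
        1 / (2 * π * β) * gaussExp β 0 0 x) x := by
    intro x
    have hx : HasDerivAt (fun x : ℝ => (x : ℂ)) 1 x := Complex.ofRealCLM.hasDerivAt
    refine ((hasDerivAt_mul_signErfc hβ hK (by simp) (by simp) x).sub
      ((hx.mul (hasDerivAt_gaussExp β 0 0 x)).const_mul _)).congr_deriv ?_
    have hg0 : gaussExp β 0 0 x = exp (-π * (β * x) ^ 2) := by
      rw [gaussExp]; congr 1; push_cast; ring
    rw [hg0]
    push_cast
    generalize exp (-π * (β * x) ^ 2) = E2
    simp only [mul_zero, zero_mul, Complex.exp_zero]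
    field_simp
    ring
  have h3 := integral_eq_zero_of_hasDerivAt_of_integrable h2
    (hi3.sub (hi4.const_mul _)) (hi1.sub (hi5.const_mul _))
  rw [integral_sub hi3 (hi4.const_mul _), sub_eq_zero, integral_const_mul, integral_gaussExp hβ] at h3
  rw [h3]
  simp only [zero_mul, mul_zero, neg_zero, Complex.exp_zero]
  field_simp

/-- Poisson summation for the row of index zero; the summand at `n = 0` on the right is `0`. -/
lemma tsum_id_mul_signErfc {β : ℝ} (hβ : 0 < β) :
    ∑' b : ℤ, ((b * signErfc (β * b) : ℝ) : ℂ) = 1 / (2 * π * β ^ 2) +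
      ∑' n : ℤ, 1 / (2 * π ^ 2 * (n : ℂ) ^ 2) *
        (((1 + 2 * π * ((n : ℝ) ^ 2 / β ^ 2)) * Real.exp (-(π * ((n : ℝ) ^ 2 / β ^ 2))) - 1 : ℝ) : ℂ) := by
  set F : ℤ → ℂ := fun n => 1 / (2 * π ^ 2 * (n : ℂ) ^ 2) *
        (((1 + 2 * π * ((n : ℝ) ^ 2 / β ^ 2)) * Real.exp (-(π * ((n : ℝ) ^ 2 / β ^ 2))) - 1 : ℝ) : ℂ)
    with hF
  have hs : Summable F := by
    have h := (EisensteinSeries.linear_right_summable 0 0 (k := 2) le_rfl).norm.mul_left (3 / π ^ 2)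
    refine h.of_norm_bounded fun n => ?_
    rw [hF]
    simp only
    rw [norm_mul]
    have h1 : ‖(((1 + 2 * π * ((n : ℝ) ^ 2 / β ^ 2)) * Real.exp (-(π * ((n : ℝ) ^ 2 / β ^ 2))) - 1 : ℝ)
        : ℂ)‖ ≤ 3 := by
      have h2 := norm_inv_sq_mul_gauss_le (β := β) (n : ℂ)
      rw [Complex.norm_intCast, sq_abs] at h2
      rw [Complex.ofReal_sub]
      refine (norm_sub_le _ _).trans ?_
      simp only [ofReal_one, norm_one]
      linarith
    refine (mul_le_mul_of_nonneg_left h1 (norm_nonneg _)).trans ?_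
    simp only [Int.cast_zero, zero_mul, zero_add, norm_div, norm_one, norm_mul, norm_pow, Complex.norm_real,
      Real.norm_of_nonneg Real.pi_pos.le, Complex.norm_ofNat, norm_inv]
    rw [norm_zpow, zpow_ofNat, one_div, mul_inv, mul_inv, div_eq_mul_inv]
    have : 0 ≤ (π ^ 2)⁻¹ * (‖(n : ℂ)‖ ^ 2)⁻¹ := by positivity
    nlinarith
  -- At `n = 0` the convention `1 / 0 = 0` makes `F 0` vanish, so the true zero mode is added as a
  -- separate summand.
  have hs1 : Summable (fun n : ℤ => if n = 0 then (1 / (2 * π * β ^ 2) : ℂ) else 0) :=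
    (hasSum_ite_eq (0 : ℤ) _).summable
  have hf := (expDecay_id_mul_signErfc hβ 0).tsum_eq_tsum_fourier
    (F := fun n => (if n = 0 then (1 / (2 * π * β ^ 2) : ℂ) else 0) + F n) ?_ (hs1.add hs)
  · rw [hs1.tsum_add hs, tsum_ite_eq] at hf
    rw [← hf]
    refine tsum_congr fun b => ?_
    simp
  · intro n
    have h1 : ∀ x : ℝ, ((x * signErfc (β * x) : ℝ) : ℂ) * exp (2 * π * I * (0 : ℝ) * x) *
        exp (-(2 * π * I * n * x)) = ((x * signErfc (β * x) : ℝ) : ℂ) *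
          exp (2 * π * I * ((-n : ℝ) : ℂ) * x) := fun x => by
      rw [mul_assoc, ← Complex.exp_add]
      congr 2
      push_cast
      ring
    simp only [h1]
    split_ifs with h
    · subst h
      rw [hF]
      have := integral_id_mul_signErfc_zero hβ
      simpa using this
    · rw [integral_id_mul_signErfc hβ (w := -n) (by simpa using h), hF]
      simp

/-! ### The Lipschitz formula of weight two -/

lemma tsum_inv_sq_of_im_pos {w : ℂ} (hw : 0 < w.im) :
    ∑' n : ℤ, ((w + n) ^ 2)⁻¹ =
      -(4 * π ^ 2) * (exp (2 * π * I * w) / (1 - exp (2 * π * I * w)) ^ 2) := by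
  have h := EisensteinSeries.qExpansion_identity (k := 1) le_rfl ⟨w, hw⟩
  have hn : ‖exp (2 * π * I * w)‖ < 1 := by
    rw [norm_exp_two_pi_I_mul, Real.exp_lt_one_iff]
    have := mul_pos Real.two_pi_pos hw
    linarith
  simp only [one_div, pow_one, Nat.factorial_one, Nat.cast_one, div_one, Nat.reduceAdd] at h
  rw [h, tsum_coe_mul_geometric_of_norm_lt_one hn]
  congr 1
  rw [mul_pow, mul_pow, I_sq]
  ring

lemma hasSum_pos_mul_exp {w : ℂ} (hw : 0 < w.im) :
    HasSum (fun b : ℤ => if 0 < b then (b : ℂ) * exp (2 * π * I * w * b) else 0)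
      (-(1 / (4 * π ^ 2)) * ∑' n : ℤ, ((w + n) ^ 2)⁻¹) := by
  have hn : ‖exp (2 * π * I * w)‖ < 1 := by
    rw [norm_exp_two_pi_I_mul, Real.exp_lt_one_iff]
    have := mul_pos Real.two_pi_pos hw
    linarith
  have hp : (π : ℂ) ≠ 0 := by exact_mod_cast Real.pi_ne_zero
  have e : -(1 / (4 * π ^ 2)) * ∑' n : ℤ, ((w + n) ^ 2)⁻¹ =
      exp (2 * π * I * w) / (1 - exp (2 * π * I * w)) ^ 2 := by
    rw [tsum_inv_sq_of_im_pos hw, ← mul_assoc]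
    field_simp
  rw [e, ← Function.Injective.hasSum_iff (g := ((↑) : ℕ → ℤ)) Nat.cast_injective]
  · refine (hasSum_coe_mul_geometric_of_norm_lt_one hn).congr_fun ?_
    intro n
    rcases Nat.eq_zero_or_pos n with rfl | h
    · simp
    · simp only [Function.comp_apply, Nat.cast_pos, h, if_true, Int.cast_natCast]
      rw [← Complex.exp_nat_mul]
      congr 2
      ring
  · intro b hb
    refine if_neg fun h => hb ⟨b.toNat, ?_⟩
    simp [h.le]

/-- The right-hand side is invariant under `w ↦ -w`, which covers the lower half plane, and real `w`
is reached as a limit from above. All three cases are needed because `z + aτ` can have any imaginary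
part. -/
lemma tsum_inv_sq_add_int {w : ℂ} (hw : ∀ n : ℤ, w ≠ n) :
    ∑' n : ℤ, ((w + n) ^ 2)⁻¹ =
      -(4 * π ^ 2) * (exp (2 * π * I * w) / (1 - exp (2 * π * I * w)) ^ 2) := by
  rcases lt_trichotomy w.im 0 with h | h | h
  · have h1 := tsum_inv_sq_of_im_pos (w := -w) (by simpa using h)
    have h2 : ∑' n : ℤ, ((-w + n) ^ 2)⁻¹ = ∑' n : ℤ, ((w + n) ^ 2)⁻¹ := by
      rw [← (Equiv.neg ℤ).tsum_eq (fun n : ℤ => ((w + n) ^ 2)⁻¹)]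
      refine tsum_congr fun n => ?_
      congr 1
      simp only [Equiv.neg_apply, Int.cast_neg]
      ring
    rw [← h2, h1, mul_neg, Complex.exp_neg]
    have hne := Complex.exp_ne_zero (2 * π * I * w)
    have h3 : exp (2 * π * I * w) ≠ 1 := by
      rw [Ne, exp_two_pi_I_mul_eq_one_iff]
      rintro ⟨n, hn⟩
      exact hw n hn
    generalize exp (2 * π * I * w) = E at *
    have h4 : 1 - E ≠ 0 := sub_ne_zero.2 (Ne.symm h3)
    have h5 : 1 - E⁻¹ ≠ 0 := by
      rw [sub_ne_zero]
      exact fun h => h3 (by rw [← inv_inv E, ← h, inv_one])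
    congr 1
    rw [div_eq_div_iff (pow_ne_zero _ h5) (pow_ne_zero _ h4)]
    field_simp
    ring
  · have hne : 1 - exp (2 * π * I * w) ≠ 0 := by
      rw [sub_ne_zero, ne_comm, Ne, exp_two_pi_I_mul_eq_one_iff]
      rintro ⟨n, hn⟩
      exact hw n hn
    have hlim : Tendsto (fun t : ℝ => w + t * I) (𝓝[>] 0) (𝓝 w) := by
      have : ContinuousAt (fun t : ℝ => w + t * I) 0 := by fun_prop
      simpa [ContinuousAt] using this.tendsto.mono_left nhdsWithin_le_nhds
    have hA : Tendsto (fun t : ℝ => ∑' n : ℤ, ((w + t * I + n) ^ 2)⁻¹) (𝓝[>] 0)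
        (𝓝 (∑' n : ℤ, ((w + n) ^ 2)⁻¹)) := by
      have hs := (EisensteinSeries.linear_right_summable w 1 (k := 2) le_rfl).norm
      simp only [Int.cast_one, one_mul, zpow_ofNat] at hs
      refine tendsto_tsum_of_dominated_convergence hs ?_ ?_
      · intro n
        have : w + n ≠ 0 := fun h => hw (-n) (by push_cast; linear_combination h)
        have h1 : Tendsto (fun t : ℝ => w + t * I + n) (𝓝[>] 0) (𝓝 (w + n)) := hlim.add_const _
        exact (h1.pow 2).inv₀ (pow_ne_zero _ this)
      · refine Eventually.of_forall fun t n => ?_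
        have : w + n ≠ 0 := fun h => hw (-n) (by push_cast; linear_combination h)
        rw [norm_inv, norm_inv, norm_pow, norm_pow]
        have h1 : ‖w + n‖ ≤ ‖w + t * I + n‖ := by
          have e1 : w + n = ((w + t * I + n).re : ℝ) := by
            apply Complex.ext <;> simp [h]
          rw [e1, Complex.norm_real, Real.norm_eq_abs]
          exact Complex.abs_re_le_norm _
        gcongr
    have hB : Tendsto (fun t : ℝ => -(4 * π ^ 2 : ℂ) * (exp (2 * π * I * (w + t * I)) /
        (1 - exp (2 * π * I * (w + t * I))) ^ 2)) (𝓝[>] 0)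
        (𝓝 (-(4 * π ^ 2) * (exp (2 * π * I * w) / (1 - exp (2 * π * I * w)) ^ 2))) := by
      have : ContinuousAt (fun v : ℂ => -(4 * π ^ 2 : ℂ) * (exp (2 * π * I * v) /
          (1 - exp (2 * π * I * v)) ^ 2)) w :=
        ContinuousAt.mul continuousAt_const (ContinuousAt.div (by fun_prop) (by fun_prop)
          (pow_ne_zero _ hne))
      exact this.tendsto.comp hlim
    refine tendsto_nhds_unique hA (hB.congr' ?_)
    filter_upwards [self_mem_nhdsWithin] with t ht
    rw [tsum_inv_sq_of_im_pos]
    simpa [h] using ht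
  · exact tsum_inv_sq_of_im_pos h

/-! ### Lattice sums -/

/-- The pair of periods `τ, 1`. -/
def upperPeriodPair {τ : ℂ} (hτ : 0 < τ.im) : PeriodPair where
  ω₁ := τ
  ω₂ := 1
  indep := by
    rw [LinearIndependent.pair_iff]
    intro s t h
    have h1 := congrArg Complex.im h
    have h2 := congrArg Complex.re h
    simp at h1 h2
    have : s = 0 := by rcases h1 with h1 | h1; exacts [h1, absurd h1 hτ.ne']
    subst this
    simpa using h2

lemma upperPeriodPair_latticeEquivProd_symm {τ : ℂ} (hτ : 0 < τ.im) (p : ℤ × ℤ) :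
    ((upperPeriodPair hτ).latticeEquivProd.symm p : ℂ) = p.1 * τ + p.2 := by
  rw [PeriodPair.latticeEquiv_symm_apply]
  simp [upperPeriodPair]

lemma summable_weierstrass {τ : ℂ} (hτ : 0 < τ.im) (z : ℂ) :
    Summable fun p : ℤ × ℤ => ((z + (p.1 * τ + p.2)) ^ 2)⁻¹ - ((p.1 * τ + p.2) ^ 2)⁻¹ := by
  have h := ((upperPeriodPair hτ).hasSum_weierstrassP (-z)).summable
  have h2 := h.comp_injective (upperPeriodPair hτ).latticeEquivProd.symm.injective
  refine h2.congr fun p => ?_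
  simp only [Function.comp_apply, upperPeriodPair_latticeEquivProd_symm, one_div]
  congr 2
  ring

lemma summable_lattice_inv_pow {τ : ℂ} (hτ : 0 < τ.im) {r : ℕ} (hr : 2 < r) :
    Summable fun p : ℤ × ℤ => (((p.1 : ℂ) * τ + p.2) ^ r)⁻¹ := by
  have h := ((upperPeriodPair hτ).hasSum_sumInvPow 0 hr).summable
  have h2 := h.comp_injective (upperPeriodPair hτ).latticeEquivProd.symm.injective
  refine h2.congr fun p => ?_
  simp only [Function.comp_apply, upperPeriodPair_latticeEquivProd_symm, sub_zero]

/-- The summand of the theta-regularised Eisenstein series of weight two. -/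
def gaussEisTerm (α : ℝ) (τ ω : ℂ) : ℂ :=
  (ω ^ 2)⁻¹ * (((1 + 2 * π * (α * ‖ω‖ ^ 2 / τ.im)) *
    Real.exp (-(π * (α * ‖ω‖ ^ 2 / τ.im))) : ℝ) : ℂ)

lemma one_add_two_mul_exp_neg_le {x : ℝ} (hx : 0 < x) : (1 + 2 * x) * Real.exp (-x) ≤ 5 / x := by
  have h := Real.quadratic_le_exp_of_nonneg hx.le
  rw [Real.exp_neg, ← div_eq_mul_inv, div_le_div_iff₀ (Real.exp_pos _) hx]
  nlinarith

/-- The bound `(1 + 2x) exp (-x) ≤ 5 / x` improves `ω⁻²` to `ω⁻⁴`, so convergence over the whole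
lattice is absolute and the sum may be reindexed by `SL(2, ℤ)`. -/
lemma summable_gaussEisTerm {α : ℝ} (hα : 0 < α) {τ : ℂ} (hτ : 0 < τ.im) :
    Summable fun p : ℤ × ℤ => gaussEisTerm α τ (p.1 * τ + p.2) := by
  have h := (summable_lattice_inv_pow hτ (r := 4) (by norm_num)).norm.mul_left (5 / (π * α / τ.im))
  refine h.of_norm_bounded fun p => ?_
  set ω : ℂ := p.1 * τ + p.2
  by_cases h0 : ω = 0
  · simp [gaussEisTerm, h0]
  have hn : 0 < ‖ω‖ := norm_pos_iff.2 h0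
  have hx : 0 < π * (α * ‖ω‖ ^ 2 / τ.im) := by positivity
  have := one_add_two_mul_exp_neg_le hx
  rw [gaussEisTerm, norm_mul, Complex.norm_real, Real.norm_of_nonneg (by positivity), norm_inv, norm_pow,
    norm_inv, norm_pow, mul_assoc 2 π]
  calc (‖ω‖ ^ 2)⁻¹ * ((1 + 2 * (π * (α * ‖ω‖ ^ 2 / τ.im))) * Real.exp (-(π * (α * ‖ω‖ ^ 2 / τ.im))))
      ≤ (‖ω‖ ^ 2)⁻¹ * (5 / (π * (α * ‖ω‖ ^ 2 / τ.im))) := by gcongr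
    _ = 5 / (π * α / τ.im) * (‖ω‖ ^ 4)⁻¹ := by field_simp

/-! ### Row sums of the completed series -/

/-- From `(da + eb)² - (da - eb)² = 4de·ab`: holomorphic series and correction carry the same power
of `q`. -/
lemma thetaExp_mul_inv {d e : ℕ} (hd : d ≠ 0) (he : e ≠ 0) (τ : ℂ) (a b : ℤ) :
    thetaExp (d * e) τ (d * a + e * b) * (thetaExp (d * e) τ (d * a - e * b))⁻¹ =
      exp (2 * π * I * (a * b) * τ) := by
  have hd' : (d : ℂ) ≠ 0 := by exact_mod_cast hd
  have he' : (e : ℂ) ≠ 0 := by exact_mod_cast he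
  rw [thetaExp, thetaExp, ← Complex.exp_neg, ← Complex.exp_add]
  congr 1
  push_cast
  field_simp
  ring

lemma completedTerm_eq {d e : ℕ} (hd : d ≠ 0) (he : e ≠ 0) (τ : ℂ) (a b : ℤ) :
    completedTerm d e τ a b =
      (((if 0 < (e * b : ℤ) * (d * a - e * b) then ((|e * b| : ℤ) : ℂ) else 0) -
        (if 0 < (d * a : ℤ) * (e * b - d * a) then ((|d * a| : ℤ) : ℂ) else 0)) -
        (1 / 2) * ((d * a + e * b) *
          (signErfc (((d * a - e * b : ℤ) : ℝ) * √(τ.im / (d * e : ℕ))) : ℝ))) *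
        exp (2 * π * I * (a * b) * τ) := by
  rw [completedTerm, divisorTerm, unaryCoeff, starTerm, ← thetaExp_mul_inv hd he]
  push_cast
  ring

lemma completedTerm_neg (d e : ℕ) (τ : ℂ) (a b : ℤ) :
    completedTerm d e τ (-a) (-b) = completedTerm d e τ a b := by
  rw [completedTerm, completedTerm, divisorTerm, divisorTerm,
    show (d : ℤ) * -a + e * -b = -(d * a + e * b) by ring,
    show (d : ℤ) * -a - e * -b = -(d * a - e * b) by ring, unaryCoeff_neg, starTerm_neg,
    show (e : ℤ) * -b = -(e * b) by ring, show (d : ℤ) * -a = -(d * a) by ring,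
    abs_neg, abs_neg, show (-((e : ℤ) * b)) * (-(d * a - e * b)) = e * b * (d * a - e * b) by ring,
    show (-((d : ℤ) * a)) * (-(e * b) - -(d * a)) = d * a * (e * b - d * a) by ring]
  push_cast
  ring_nf

/-- For `a > 0` the two sign conditions are equivalent to `1/2 (da + eb)(sgn x - 1)` plus `eb` for
`b > 0`, and the discontinuous sign cancels against the one in `signErfc`. What is left is a
continuous function suited to Poisson summation and an elementary sum over `b > 0`. -/
lemma completedTerm_of_pos {d e : ℕ} (hd : d ≠ 0) (he : e ≠ 0) {τ : ℂ} (hτ : 0 < τ.im) {a : ℤ}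
    (ha : 0 < a) (b : ℤ) :
    completedTerm d e τ a b = e / 2 * erfcExp (e * √(τ.im / (d * e : ℕ))) (d * a / e) (a * τ) b +
      e * (if 0 < b then (b : ℂ) * exp (2 * π * I * (a * τ) * b) else 0) := by
  have hd' : 0 < (d : ℤ) := by positivity
  have he' : 0 < (e : ℤ) := by positivity
  have heC : (e : ℂ) ≠ 0 := by exact_mod_cast he
  have heR : (e : ℝ) ≠ 0 := by exact_mod_cast he
  have hda : 0 < d * a := mul_pos hd' ha
  have hs : 0 < √(τ.im / (d * e : ℕ)) := by positivity
  rw [completedTerm_eq hd he, erfcExp, signErfc,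
    show (e * √(τ.im / (d * e : ℕ))) * (d * a / e - (b : ℝ)) =
      ((d * a - e * b : ℤ) : ℝ) * √(τ.im / (d * e : ℕ)) by push_cast; field_simp,
    show 2 * π * I * (a * τ) * ((b : ℝ) : ℂ) = 2 * π * I * (a * b) * τ by push_cast; ring,
    show 2 * π * I * (a * τ) * (b : ℂ) = 2 * π * I * (a * b) * τ by ring]
  generalize exp (2 * π * I * (a * b) * τ) = E
  set x := ((d * a - e * b : ℤ) : ℝ) * √(τ.im / (d * e : ℕ)) with hx
  have key : ((if 0 < (e * b : ℤ) * (d * a - e * b) then ((|e * b| : ℤ) : ℂ) else 0) -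
        (if 0 < (d * a : ℤ) * (e * b - d * a) then ((|d * a| : ℤ) : ℂ) else 0)) =
      (1 / 2) * ((d * a + e * b) * ((Real.sign x : ℝ) - 1)) + e * (if 0 < b then (b : ℂ) else 0) := by
    rcases lt_trichotomy (e * b) (d * a) with h | h | h
    · have hx0 : 0 < x := mul_pos (by exact_mod_cast sub_pos.2 h) hs
      rw [Real.sign_of_pos hx0, if_neg (c := 0 < (d * a : ℤ) * (e * b - d * a))
        (by nlinarith)]
      by_cases hb : 0 < b
      · have heb : 0 < e * b := mul_pos he' hb
        rw [if_pos (by nlinarith), if_pos hb, abs_of_pos heb]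
        push_cast; ring
      · have heb : e * b ≤ 0 := by nlinarith
        rw [if_neg (by nlinarith), if_neg hb]
        push_cast; ring
    -- On the diagonal `eb = da` both conditions fail and the sign is zero; the two terms on the
    -- right then cancel.
    · have hx0 : x = 0 := by rw [hx, ← h]; simp
      have hb : 0 < b := pos_of_mul_pos_right (h ▸ hda : 0 < e * b) he'.le
      have h' : (d : ℂ) * a = e * b := by exact_mod_cast h.symm
      rw [hx0, Real.sign_zero, h, if_pos hb, h']
      simp
      ring
    · have hx0 : x < 0 := mul_neg_of_neg_of_pos (by exact_mod_cast sub_neg.2 h) hs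
      have hb : 0 < b := pos_of_mul_pos_right (hda.trans h) he'.le
      rw [Real.sign_of_neg hx0, if_neg (by nlinarith), if_pos (by nlinarith), if_pos hb,
        abs_of_pos hda]
      push_cast; ring
  rw [key]
  split_ifs with hb <;>
  · push_cast
    field_simp
    ring

lemma completedTerm_zero_left {d e : ℕ} (hd : d ≠ 0) (he : e ≠ 0) (τ : ℂ) (b : ℤ) :
    completedTerm d e τ 0 b =
      e / 2 * ((b * signErfc ((e * √(τ.im / (d * e : ℕ))) * b) : ℝ) : ℂ) := by
  have h : ¬ 0 < (e * b : ℤ) * (d * 0 - e * b) := by nlinarith [sq_nonneg ((e : ℤ) * b)]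
  have h2 : signErfc (-((e * √(τ.im / (d * e : ℕ))) * b)) = -signErfc ((e * √(τ.im / (d * e : ℕ))) * b) := by
    rw [signErfc, signErfc, errorE_neg, Real.sign_neg]; ring
  rw [completedTerm_eq hd he, if_neg h, show ((d * 0 - e * b : ℤ) : ℝ) * √(τ.im / (d * e : ℕ)) =
    -((e * √(τ.im / (d * e : ℕ))) * b) by push_cast; ring, h2]
  simp
  ring

/-- Poisson summation applies with `β² = eτ₂ / d` and `p = da / e`, for which `Im (aτ) = β² p`. It
produces the Gaussian lattice terms, while Lipschitz's formula for the sum over `b > 0` gives `-(aτ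
+ n)⁻²`. Rows with `a < 0` follow by `(a, b) ↦ (-a, -b)`, and the zero mode of the row `a = 0`
leaves `πd / τ₂`. -/
lemma tsum_completedTerm_row {d e : ℕ} (hd : d ≠ 0) (he : e ≠ 0) {τ : ℂ} (hτ : 0 < τ.im) (a : ℤ) :
    4 * π ^ 2 * ∑' b : ℤ, completedTerm d e τ a b =
      e * ∑' n : ℤ, (gaussEisTerm (d / e) τ (a * τ + n) - ((a * τ + n) ^ 2)⁻¹) +
        if a = 0 then (π * d / τ.im : ℂ) else 0 := by
  set β : ℝ := e * √(τ.im / (d * e : ℕ)) with hβd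
  have hd' : 0 < (d : ℝ) := by positivity
  have he' : 0 < (e : ℝ) := by positivity
  have hβ : 0 < β := by positivity
  have hβ2 : β ^ 2 = e * τ.im / d := by
    rw [hβd, mul_pow, Real.sq_sqrt (by positivity)]
    push_cast
    field_simp
  have hp : (π : ℂ) ≠ 0 := by exact_mod_cast Real.pi_ne_zero
  have hratio : ∀ x : ℝ, x / β ^ 2 = d / e * x / τ.im := fun x => by
    rw [hβ2]; field_simp
  have hsr : ∀ a : ℤ, Summable fun n : ℤ => gaussEisTerm (d / e) τ (a * τ + n) := fun a =>
    (summable_gaussEisTerm (α := d / e) (by positivity) hτ).comp_injective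
      (i := fun n : ℤ => (a, n)) (fun _ _ h => (Prod.mk.inj h).2)
  have hsi : ∀ a : ℤ, Summable fun n : ℤ => (((a : ℂ) * τ + n) ^ 2)⁻¹ := fun a => by
    simpa using! EisensteinSeries.linear_right_summable τ a (k := 2) le_rfl
  have hpos : ∀ a : ℤ, 0 < a → 4 * π ^ 2 * ∑' b : ℤ, completedTerm d e τ a b =
      e * ∑' n : ℤ, (gaussEisTerm (d / e) τ (a * τ + n) - ((a * τ + n) ^ 2)⁻¹) := by
    intro a ha
    have ha' : 0 < (a : ℝ) := by exact_mod_cast ha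
    have him : ((a : ℂ) * τ).im = β ^ 2 * (d * a / e) := by
      rw [hβ2]
      simp only [mul_im, intCast_re, intCast_im, zero_mul, add_zero]
      field_simp
    have h1 := tsum_erfcExp hβ (p := d * a / e) (by positivity) him
    have h2 := hasSum_pos_mul_exp (w := (a : ℂ) * τ) (by
      simp only [mul_im, intCast_re, intCast_im, zero_mul, add_zero]; positivity)
    have hT : Summable fun b : ℤ => completedTerm d e τ a b :=
      (summable_completedTerm hd he hτ).comp_injective
        (i := fun n : ℤ => (a, n)) (fun _ _ h => (Prod.mk.inj h).2)
    have hE : Summable fun b : ℤ => (e / 2 : ℂ) * erfcExp β (d * a / e) (a * τ) b := by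
      refine (hT.sub (h2.summable.mul_left (e : ℂ))).congr fun b => ?_
      rw [completedTerm_of_pos hd he hτ ha]
      ring
    rw [tsum_congr (completedTerm_of_pos hd he hτ ha), hE.tsum_add (h2.summable.mul_left _),
      tsum_mul_left, tsum_mul_left, h2.tsum_eq, h1, (hsr a).tsum_sub (hsi a)]
    have h3 : ∑' n : ℤ, 1 / (2 * π ^ 2 * (((a : ℂ) * τ) + n) ^ 2) *
        (((1 + 2 * π * (‖(a : ℂ) * τ + n‖ ^ 2 / β ^ 2)) *
          Real.exp (-(π * (‖(a : ℂ) * τ + n‖ ^ 2 / β ^ 2))) : ℝ) : ℂ) =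
        1 / (2 * π ^ 2) * ∑' n : ℤ, gaussEisTerm (d / e) τ (a * τ + n) := by
      rw [← tsum_mul_left]
      refine tsum_congr fun n => ?_
      rw [gaussEisTerm, hratio, one_div, one_div, mul_inv, mul_assoc]
    rw [h3]
    field_simp
    ring
  rcases lt_trichotomy a 0 with ha | rfl | ha
  · have h := hpos (-a) (by omega)
    rw [if_neg ha.ne, add_zero]
    rw [← (Equiv.neg ℤ).tsum_eq fun b => completedTerm d e τ a b,
      ← (Equiv.neg ℤ).tsum_eq fun n : ℤ => gaussEisTerm (d / e) τ (a * τ + n) - ((a * τ + n) ^ 2)⁻¹]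
    simp only [Equiv.neg_apply]
    have e1 : ∀ b, completedTerm d e τ a (-b) = completedTerm d e τ (-a) b := fun b => by
      rw [← completedTerm_neg d e τ (-a) b, neg_neg]
    have e2 : ∀ n : ℤ, gaussEisTerm (d / e) τ (a * τ + (-n : ℤ)) = gaussEisTerm (d / e) τ ((-a : ℤ) * τ + n) :=
      fun n => by
        rw [show (a : ℂ) * τ + (-n : ℤ) = -((-a : ℤ) * τ + n) by push_cast; ring, gaussEisTerm, gaussEisTerm,
          norm_neg, neg_sq]
    have e3 : ∀ n : ℤ, (((a : ℂ) * τ + (-n : ℤ)) ^ 2)⁻¹ = (((-a : ℤ) * τ + n) ^ 2)⁻¹ := fun n => by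
      rw [show (a : ℂ) * τ + (-n : ℤ) = -((-a : ℤ) * τ + n) by push_cast; ring, neg_sq]
    simp only [e1, e2, e3]
    exact h
  · have h := tsum_id_mul_signErfc hβ
    rw [tsum_congr (completedTerm_zero_left hd he τ), tsum_mul_left, h, if_pos rfl]
    have h3 : ∑' n : ℤ, 1 / (2 * π ^ 2 * (n : ℂ) ^ 2) *
        (((1 + 2 * π * ((n : ℝ) ^ 2 / β ^ 2)) * Real.exp (-(π * ((n : ℝ) ^ 2 / β ^ 2))) - 1 : ℝ) : ℂ) =
        1 / (2 * π ^ 2) * ∑' n : ℤ, (gaussEisTerm (d / e) τ ((0 : ℤ) * τ + n) - (((0 : ℤ) * τ + n) ^ 2)⁻¹) := by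
      rw [← tsum_mul_left]
      refine tsum_congr fun n => ?_
      rw [gaussEisTerm, hratio]
      simp only [Int.cast_zero, zero_mul, zero_add, Complex.norm_intCast, sq_abs, one_div, mul_inv]
      push_cast
      ring
    rw [h3]
    have hτC : ((τ.im : ℝ) : ℂ) ≠ 0 := by exact_mod_cast hτ.ne'
    have hdC : (d : ℂ) ≠ 0 := by exact_mod_cast hd
    have heC : (e : ℂ) ≠ 0 := by exact_mod_cast he
    have hβC : (β : ℂ) ^ 2 = e * τ.im / d := by exact_mod_cast hβ2
    rw [hβC]
    field_simp
    ring
  · rw [if_neg ha.ne', add_zero]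
    exact hpos a ha

/-! ### The completed series as a combination of modular lattice sums -/

/-- The Weierstrass function of the lattice `ℤτ + ℤ`. -/
def weierstrassFn (τ z : ℂ) : ℂ :=
  ∑' p : ℤ × ℤ, (((z + (p.1 * τ + p.2)) ^ 2)⁻¹ - ((p.1 * τ + p.2) ^ 2)⁻¹)

/-- The Eisenstein series of weight two with a Gaussian convergence factor. -/
def gaussEis (α : ℝ) (τ : ℂ) : ℂ := ∑' p : ℤ × ℤ, gaussEisTerm α τ (p.1 * τ + p.2)

/-- The rows of the Eisenstein series of weight two. -/
def eisRow (τ : ℂ) (a : ℤ) : ℂ := ∑' n : ℤ, ((a * τ + n) ^ 2)⁻¹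

lemma summable_eisRow_terms (τ : ℂ) (a : ℤ) : Summable fun n : ℤ => (((a : ℂ) * τ + n) ^ 2)⁻¹ := by
  simpa using! EisensteinSeries.linear_right_summable τ a (k := 2) le_rfl

lemma summable_weierstrassSum {τ z : ℂ} (hτ : 0 < τ.im) (hz : ∀ m n : ℤ, z ≠ m * τ + n) :
    Summable fun n : ℤ => exp (2 * π * I * (z + n * τ)) * appellFactor τ z n ^ 2 := by
  obtain ⟨C, hC, h⟩ := exists_appellFactor_bound hτ hz
  have hs := (summable_exp_neg_mul_abs (c := 2 * π * τ.im) (by positivity)).mul_left (C * C)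
  refine hs.of_norm_bounded fun n => ?_
  rw [sq, ← mul_assoc, ← appellFactor_sub_one hz, norm_mul]
  obtain ⟨h1, h2, h3, h4⟩ := h n
  have hc : 0 < Real.exp (-(2 * π * τ.im) * |(n : ℝ)|) := Real.exp_pos _
  rcases le_total 0 (n : ℝ) with hn | hn
  · rw [abs_of_nonneg hn]
    calc ‖appellFactor τ z n - 1‖ * ‖appellFactor τ z n‖
        ≤ (C * Real.exp (-(2 * π * τ.im * n))) * C := by gcongr
      _ = _ := by ring_nf
  · rw [abs_of_nonpos hn]
    calc ‖appellFactor τ z n - 1‖ * ‖appellFactor τ z n‖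
        ≤ C * (C * Real.exp (2 * π * τ.im * n)) := by gcongr
      _ = _ := by ring_nf

lemma hasSum_weierstrassFn_row {τ z : ℂ} (hz : ∀ m n : ℤ, z ≠ m * τ + n) (a : ℤ) :
    ∑' n : ℤ, (((z + (a * τ + n)) ^ 2)⁻¹ - ((a * τ + n) ^ 2)⁻¹) =
      -(4 * π ^ 2) * (exp (2 * π * I * (z + a * τ)) * appellFactor τ z a ^ 2) - eisRow τ a := by
  have h1 : Summable fun n : ℤ => ((z + ((a : ℂ) * τ + n)) ^ 2)⁻¹ := by
    have := EisensteinSeries.linear_right_summable (z + a * τ) 1 (k := 2) le_rfl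
    refine this.congr fun n => ?_
    rw [Int.cast_one, one_mul, zpow_ofNat, add_assoc]
  rw [h1.tsum_sub (summable_eisRow_terms τ a), eisRow]
  congr 1
  have h2 := tsum_inv_sq_add_int (w := z + a * τ) fun n hn => hz (-a) n (by
    push_cast; linear_combination hn)
  simp only [← add_assoc]
  rw [h2, appellFactor, one_div, inv_pow, div_eq_mul_inv]

/-- The rows are differences of rows of the Weierstrass series and of the exponential series at one
auxiliary point off the lattice, here `1/2`; both of these are summable. -/
lemma summable_eisRow {τ : ℂ} (hτ : 0 < τ.im) : Summable (eisRow τ) := by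
  have hz : ∀ m n : ℤ, ((1 / 2 : ℝ) : ℂ) ≠ m * τ + n := by
    intro m n h
    have h1 := congrArg Complex.im h
    simp only [ofReal_im, add_im, mul_im, intCast_re, intCast_im, zero_mul, add_zero] at h1
    have hm : m = 0 := by
      rcases mul_eq_zero.1 h1.symm with h | h
      · exact_mod_cast h
      · exact absurd h hτ.ne'
    have h2 := congrArg Complex.re h
    simp only [hm, Int.cast_zero, zero_mul, zero_add, ofReal_re, intCast_re] at h2
    have : (2 : ℤ) * n = 1 := by
      have : (2 : ℝ) * n = 1 := by rw [← h2]; norm_num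
      exact_mod_cast this
    omega
  have h1 := (summable_weierstrass hτ ((1 / 2 : ℝ) : ℂ)).prod
  simp only [hasSum_weierstrassFn_row hz] at h1
  have h2 := ((summable_weierstrassSum hτ hz).mul_left (-(4 * π ^ 2 : ℂ))).sub h1
  exact h2.congr fun a => by ring

lemma weierstrassFn_eq {τ z : ℂ} (hτ : 0 < τ.im) (hz : ∀ m n : ℤ, z ≠ m * τ + n) :
    weierstrassFn τ z = -(4 * π ^ 2) * weierstrassSum τ z - ∑' a, eisRow τ a := by
  rw [weierstrassFn, (summable_weierstrass hτ z).tsum_prod]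
  simp only [hasSum_weierstrassFn_row hz]
  rw [((summable_weierstrassSum hτ hz).mul_left (-(4 * π ^ 2 : ℂ))).tsum_sub (summable_eisRow hτ),
    tsum_mul_left, weierstrassSum]

lemma tsum_eisRow {τ : ℂ} (hτ : 0 < τ.im) : ∑' a, eisRow τ a = EisensteinSeries.G2 ⟨τ, hτ⟩ := by
  have h : (fun a => EisensteinSeries.e2Summand a ⟨τ, hτ⟩) = eisRow τ := by
    funext a
    rw [EisensteinSeries.e2Summand, eisRow]
    refine tsum_congr fun n => ?_
    simp [EisensteinSeries.eisSummand]
  rw [EisensteinSeries.G2, h]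
  exact (tsum_eq_of_summable_unconditional (summable_eisRow hτ)).symm

/-- The combination of lattice sums that the completed series is equal to. -/
def latticePart (d e : ℕ) (τ z : ℂ) : ℂ :=
  ((e : ℂ) - d) * weierstrassFn τ z + e * gaussEis (d / e) τ -
    d * (∑' a, eisRow τ a - π / τ.im)

/-- The Weierstrass sum contributes `(e - d) G₂` and the rows `-e G₂`. The total `-d G₂` meets `πd /
τ₂` from the zero mode and forms precisely the modular completion of `G₂`. -/
lemma completedPart_eq {d e : ℕ} (hd : d ≠ 0) (he : e ≠ 0) {τ z : ℂ} (hτ : 0 < τ.im)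
    (hz : ∀ m n : ℤ, z ≠ m * τ + n) :
    completedPart d e τ z = 1 / (4 * π ^ 2) * latticePart d e τ z := by
  have hp : (π : ℂ) ≠ 0 := by exact_mod_cast Real.pi_ne_zero
  have hg := summable_gaussEisTerm (α := d / e) (by positivity) hτ
  have hgr : ∀ a : ℤ, Summable fun n : ℤ => gaussEisTerm (d / e) τ (a * τ + n) := fun a =>
    hg.comp_injective (i := fun n : ℤ => (a, n)) (fun _ _ h => (Prod.mk.inj h).2)
  have h1 : 4 * π ^ 2 * ∑' p : ℤ × ℤ, completedTerm d e τ p.1 p.2 =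
      e * (gaussEis (d / e) τ - ∑' a, eisRow τ a) + π * d / τ.im := by
    rw [(summable_completedTerm hd he hτ).tsum_prod, ← tsum_mul_left]
    simp only [tsum_completedTerm_row hd he hτ]
    have h2 : ∀ a : ℤ, ∑' n : ℤ, (gaussEisTerm (d / e) τ (a * τ + n) - ((a * τ + n) ^ 2)⁻¹) =
        ∑' n : ℤ, gaussEisTerm (d / e) τ (a * τ + n) - eisRow τ a := fun a =>
      (hgr a).tsum_sub (summable_eisRow_terms τ a)
    simp only [h2]
    rw [((hg.prod.sub (summable_eisRow hτ)).mul_left (e : ℂ)).tsum_add (hasSum_ite_eq (0 : ℤ) _).summable,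
      tsum_mul_left, tsum_ite_eq, hg.prod.tsum_sub (summable_eisRow hτ), gaussEis, hg.tsum_prod]
  rw [completedPart, latticePart, weierstrassFn_eq hτ hz]
  field_simp
  linear_combination h1

/-! ### Modular transformations -/

section mobius

variable (γ : SL(2, ℤ))

lemma det_eq_one : γ 0 0 * γ 1 1 - γ 0 1 * γ 1 0 = 1 := by
  have := γ.det_coe
  rwa [Matrix.det_fin_two] at this

lemma automorphyFactor_ne_zero {τ : ℂ} (hτ : 0 < τ.im) : (γ 1 0 : ℂ) * τ + γ 1 1 ≠ 0 := by
  intro h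
  have h1 := congrArg Complex.im h
  simp only [add_im, mul_im, intCast_re, intCast_im, zero_mul, add_zero, zero_im] at h1
  have hc : γ 1 0 = 0 := by
    rcases mul_eq_zero.1 h1 with h | h
    · exact_mod_cast h
    · exact absurd h hτ.ne'
  rw [hc] at h
  have hd : γ 1 1 = 0 := by simpa using h
  have := det_eq_one γ
  rw [hc, hd] at this
  omega

lemma im_mobius {τ : ℂ} (hτ : 0 < τ.im) :
    (mobius γ τ).im = τ.im / ‖(γ 1 0 : ℂ) * τ + γ 1 1‖ ^ 2 := by
  have hn := automorphyFactor_ne_zero γ hτ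
  have hd : (γ 0 0 : ℝ) * γ 1 1 - γ 0 1 * γ 1 0 = 1 := by exact_mod_cast det_eq_one γ
  rw [mobius, Complex.div_im, ← Complex.normSq_eq_norm_sq, ← sub_div]
  congr 1
  simp only [add_im, mul_im, intCast_re, intCast_im, zero_mul, add_zero, add_re, mul_re, sub_zero]
  linear_combination τ.im * hd

lemma im_mobius_pos {τ : ℂ} (hτ : 0 < τ.im) : 0 < (mobius γ τ).im := by
  rw [im_mobius γ hτ]
  have := norm_pos_iff.2 (automorphyFactor_ne_zero γ hτ)
  positivity

/-- The right action on row vectors. -/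
def rowEquiv : ℤ × ℤ ≃ ℤ × ℤ where
  toFun p := (p.1 * γ 0 0 + p.2 * γ 1 0, p.1 * γ 0 1 + p.2 * γ 1 1)
  invFun p := (p.1 * γ 1 1 - p.2 * γ 1 0, -(p.1 * γ 0 1) + p.2 * γ 0 0)
  left_inv p := by
    have := det_eq_one γ
    ext
    · linear_combination p.1 * this
    · linear_combination p.2 * this
  right_inv p := by
    have := det_eq_one γ
    ext
    · linear_combination p.1 * this
    · linear_combination p.2 * this

lemma mobius_lattice {τ : ℂ} (hτ : 0 < τ.im) (p : ℤ × ℤ) :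
    (p.1 : ℂ) * mobius γ τ + p.2 =
      ((rowEquiv γ p).1 * τ + (rowEquiv γ p).2) / ((γ 1 0 : ℂ) * τ + γ 1 1) := by
  have hn := automorphyFactor_ne_zero γ hτ
  rw [mobius, rowEquiv]
  simp only [Equiv.coe_fn_mk]
  push_cast
  rw [eq_div_iff hn, add_mul, mul_assoc, div_mul_cancel₀ _ hn]
  ring

lemma not_lattice_mobius {τ z : ℂ} (hτ : 0 < τ.im) (hz : ∀ m n : ℤ, z ≠ m * τ + n) (m n : ℤ) :
    z / ((γ 1 0 : ℂ) * τ + γ 1 1) ≠ m * mobius γ τ + n := by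
  rw [mobius_lattice γ hτ (m, n), Ne, div_left_inj' (automorphyFactor_ne_zero γ hτ)]
  exact hz _ _

lemma weierstrassFn_mobius {τ : ℂ} (hτ : 0 < τ.im) (z : ℂ) :
    weierstrassFn (mobius γ τ) (z / ((γ 1 0 : ℂ) * τ + γ 1 1)) =
      ((γ 1 0 : ℂ) * τ + γ 1 1) ^ 2 * weierstrassFn τ z := by
  rw [weierstrassFn, weierstrassFn, ← tsum_mul_left]
  refine (tsum_congr fun p => ?_).trans ((rowEquiv γ).tsum_eq _)
  rw [mobius_lattice γ hτ, ← add_div, div_pow, div_pow, inv_div, inv_div, div_eq_mul_inv, div_eq_mul_inv]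
  ring

/-- The convergence factor depends only on `|ω|² / τ₂`, which is invariant, so only `ω⁻²`
contributes an automorphy factor. -/
lemma gaussEis_mobius (α : ℝ) {τ : ℂ} (hτ : 0 < τ.im) :
    gaussEis α (mobius γ τ) = ((γ 1 0 : ℂ) * τ + γ 1 1) ^ 2 * gaussEis α τ := by
  have hn := norm_pos_iff.2 (automorphyFactor_ne_zero γ hτ)
  rw [gaussEis, gaussEis, ← tsum_mul_left]
  refine (tsum_congr fun p => ?_).trans ((rowEquiv γ).tsum_eq _)
  rw [mobius_lattice γ hτ, gaussEisTerm, gaussEisTerm, norm_div, im_mobius γ hτ, div_pow, inv_div,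
    div_eq_mul_inv, mul_assoc, div_pow]
  set ω : ℂ := (rowEquiv γ p).1 * τ + (rowEquiv γ p).2
  rw [show α * (‖ω‖ ^ 2 / ‖(γ 1 0 : ℂ) * τ + γ 1 1‖ ^ 2) / (τ.im / ‖(γ 1 0 : ℂ) * τ + γ 1 1‖ ^ 2) =
    α * ‖ω‖ ^ 2 / τ.im by field_simp]

lemma coe_smul_eq_mobius {τ : ℂ} (hτ : 0 < τ.im) :
    (γ • (⟨τ, hτ⟩ : UpperHalfPlane)) = ⟨mobius γ τ, im_mobius_pos γ hτ⟩ := by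
  apply UpperHalfPlane.ext
  rw [UpperHalfPlane.coe_specialLinearGroup_apply]
  rfl

/-- The additive anomaly of `G₂` is cancelled by the change of `π / Im τ`; both are expressed
through `cτ + d` and its conjugate. -/
lemma eis_mobius {τ : ℂ} (hτ : 0 < τ.im) :
    ∑' a, eisRow (mobius γ τ) a - π / (mobius γ τ).im =
      ((γ 1 0 : ℂ) * τ + γ 1 1) ^ 2 * (∑' a, eisRow τ a - π / τ.im) := by
  have hn := automorphyFactor_ne_zero γ hτ
  have h := congrFun (EisensteinSeries.G2_slash_action γ) ⟨τ, hτ⟩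
  rw [ModularForm.SL_slash_apply, coe_smul_eq_mobius] at h
  rw [tsum_eisRow hτ, tsum_eisRow (im_mobius_pos γ hτ), im_mobius γ hτ]
  have hτC : ((τ.im : ℝ) : ℂ) ≠ 0 := by exact_mod_cast hτ.ne'
  have hnorm : ((‖(γ 1 0 : ℂ) * τ + γ 1 1‖ : ℝ) : ℂ) ^ 2 =
      ((γ 1 0 : ℂ) * τ + γ 1 1) * ((γ 1 0 : ℂ) * τ + γ 1 1 - 2 * I * γ 1 0 * τ.im) := by
    rw [← Complex.mul_conj']
    congr 1
    apply Complex.ext <;> simp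
    ring
  push_cast
  rw [hnorm]
  change EisensteinSeries.G2 ⟨mobius γ τ, im_mobius_pos γ hτ⟩ * ((γ 1 0 : ℂ) * τ + γ 1 1) ^ (-2 : ℤ) =
    EisensteinSeries.G2 ⟨τ, hτ⟩ - (2 * π * I * γ 1 0) / ((γ 1 0 : ℂ) * τ + γ 1 1) at h
  rw [zpow_neg, zpow_ofNat, ← div_eq_mul_inv, div_eq_iff (pow_ne_zero _ hn)] at h
  rw [h]
  field_simp
  ring

lemma latticePart_mobius (d e : ℕ) {τ : ℂ} (hτ : 0 < τ.im) (z : ℂ) :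
    latticePart d e (mobius γ τ) (z / ((γ 1 0 : ℂ) * τ + γ 1 1)) =
      ((γ 1 0 : ℂ) * τ + γ 1 1) ^ 2 * latticePart d e τ z := by
  rw [latticePart, latticePart, weierstrassFn_mobius γ hτ, gaussEis_mobius γ _ hτ, eis_mobius γ hτ]
  ring

lemma eta_cube_mul_muADETilde_mobius (Y : ADE) {τ z : ℂ} (hτ : 0 < τ.im)
    (hz : ∀ m n : ℤ, z ≠ m * τ + n) :
    ModularForm.eta (mobius γ τ) ^ 3 * muADETilde Y (mobius γ τ) (z / ((γ 1 0 : ℂ) * τ + γ 1 1))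
        (z / ((γ 1 0 : ℂ) * τ + γ 1 1)) 0 =
      ((γ 1 0 : ℂ) * τ + γ 1 1) ^ 2 * (ModularForm.eta τ ^ 3 * muADETilde Y τ z z 0) := by
  rw [eta_cube_mul_muADETilde Y hτ hz,
    eta_cube_mul_muADETilde Y (im_mobius_pos γ hτ) (not_lattice_mobius γ hτ hz), Finset.mul_sum]
  refine Finset.sum_congr rfl fun d hd => ?_
  obtain ⟨h1, h2⟩ := Y.ne_zero_of_mem hd
  rw [completedPart_eq h1 h2 hτ hz,
    completedPart_eq h1 h2 (im_mobius_pos γ hτ) (not_lattice_mobius γ hτ hz), latticePart_mobius γ _ _ hτ]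
  ring

end mobius

/-! ### Periodicity in the elliptic variable -/

lemma weierstrassSum_add_lattice (τ z : ℂ) (m n : ℤ) :
    weierstrassSum τ (z + (m * τ + n)) = weierstrassSum τ z := by
  rw [weierstrassSum, weierstrassSum, ← (Equiv.addRight m).tsum_eq (fun a : ℤ =>
    exp (2 * π * I * (z + a * τ)) * appellFactor τ z a ^ 2)]
  refine tsum_congr fun a => ?_
  have h : exp (2 * π * I * (z + (m * τ + n) + a * τ)) =
      exp (2 * π * I * (z + ((Equiv.addRight m a : ℤ) : ℂ) * τ)) := by
    rw [show 2 * π * I * (z + (m * τ + n) + a * τ) =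
      2 * π * I * (z + ((Equiv.addRight m a : ℤ) : ℂ) * τ) + n * (2 * π * I) by
        simp only [Equiv.coe_addRight, Int.cast_add]; ring, Complex.exp_add,
      Complex.exp_int_mul_two_pi_mul_I, mul_one]
  rw [appellFactor, appellFactor, h]

lemma not_lattice_add {τ z : ℂ} (hz : ∀ m n : ℤ, z ≠ m * τ + n) (m n a b : ℤ) :
    z + (m * τ + n) ≠ a * τ + b := fun h =>
  hz (a - m) (b - n) (by push_cast; linear_combination h)

/-- In the closed form `z` occurs only in the Weierstrass sum, which is elliptic. -/
lemma muADETilde_add_lattice (Y : ADE) {τ z : ℂ} (hτ : 0 < τ.im) (hz : ∀ m n : ℤ, z ≠ m * τ + n)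
    (m n : ℤ) :
    ModularForm.eta τ ^ 3 * muADETilde Y τ (z + (m * τ + n)) (z + (m * τ + n)) 0 =
      ModularForm.eta τ ^ 3 * muADETilde Y τ z z 0 := by
  rw [eta_cube_mul_muADETilde Y hτ hz, eta_cube_mul_muADETilde Y hτ (not_lattice_add hz m n)]
  simp only [completedPart, weierstrassSum_add_lattice]

/-! ### Holomorphy of exponential series -/

lemma isOpen_upperHalfPlane : IsOpen {τ : ℂ | 0 < τ.im} :=
  isOpen_lt continuous_const Complex.continuous_im

/-- Above half the height of the given point every term is dominated by its size at that height.
Nonnegativity of the exponents is only asked where the coefficient is nonzero, since the divisor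
series is indexed by all of `ℤ × ℤ`. -/
lemma differentiableOn_tsum_exp {ι : Type*} (a : ι → ℂ) (c : ι → ℝ) (hc : ∀ i, a i ≠ 0 → 0 ≤ c i)
    (hs : ∀ y : ℝ, 0 < y → Summable fun i => ‖a i‖ * Real.exp (-(2 * π * (c i * y)))) :
    DifferentiableOn ℂ (fun τ : ℂ => ∑' i, a i * exp (2 * π * I * (c i * τ))) {τ | 0 < τ.im} := by
  intro τ hτ
  have hτ' : 0 < τ.im := hτ
  have ho : IsOpen {t : ℂ | τ.im / 2 < t.im} := isOpen_lt continuous_const Complex.continuous_im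
  have hd := differentiableOn_tsum_of_summable_norm (F := fun i (t : ℂ) => a i * exp (2 * π * I * (c i * t)))
    (hs (τ.im / 2) (by positivity)) (fun i => by fun_prop) ho (fun i t ht => by
      have ht' : τ.im / 2 < t.im := ht
      rw [norm_mul, norm_exp_two_pi_I_mul]
      by_cases h0 : a i = 0
      · simp [h0]
      · have := hc i h0
        have e : ((c i : ℂ) * t).im = c i * t.im := by simp
        rw [e]
        gcongr)
  exact (hd.differentiableAt (ho.mem_nhds (by simpa using hτ'))).differentiableWithinAt

lemma divisorTerm_eq_zero {d e : ℕ} (τ : ℂ) {a b : ℤ} (h : a * b ≤ 0) : divisorTerm d e τ a b = 0 := by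
  have h' : (d : ℤ) * a * (e * b) ≤ 0 := by
    rw [show (d : ℤ) * a * (e * b) = (d * e : ℕ) * (a * b) by push_cast; ring]
    exact mul_nonpos_of_nonneg_of_nonpos (by positivity) h
  rw [divisorTerm, if_neg, if_neg, sub_zero, zero_mul]
  · nlinarith [sq_nonneg ((d : ℤ) * a)]
  · nlinarith [sq_nonneg ((e : ℤ) * b)]

lemma differentiableOn_tsum_divisorTerm {d e : ℕ} (hd : d ≠ 0) (he : e ≠ 0) :
    DifferentiableOn ℂ (fun τ => ∑' p : ℤ × ℤ, divisorTerm d e τ p.1 p.2) {τ | 0 < τ.im} := by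
  have key : ∀ (τ : ℂ) (p : ℤ × ℤ), divisorTerm d e τ p.1 p.2 =
      divisorTerm d e 0 p.1 p.2 * exp (2 * π * I * (((p.1 * p.2 : ℤ) : ℝ) * τ)) := by
    intro τ p
    simp only [divisorTerm, mul_zero, Complex.exp_zero, mul_one]
    congr 2
    push_cast
    ring
  have := differentiableOn_tsum_exp (fun p : ℤ × ℤ => divisorTerm d e 0 p.1 p.2)
    (fun p => ((p.1 * p.2 : ℤ) : ℝ)) (fun p hp => by
      by_contra h
      refine hp (divisorTerm_eq_zero 0 ?_)
      exact_mod_cast (not_le.1 h).le) (fun y hy => by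
      have h := (hasSum_divisorTerm hd he (τ := y * I) (by simpa using hy)).summable.norm
      refine h.congr fun p => ?_
      rw [key, norm_mul, norm_exp_two_pi_I_mul]
      simp)
  refine this.congr fun τ _ => tsum_congr fun p => ?_
  rw [key]

/-! ### Joint holomorphy of the Weierstrass sum -/

lemma hasDerivAt_exp_mul_inv_sq {w : ℂ} (hw : 1 - exp (2 * π * I * w) ≠ 0) :
    HasDerivAt (fun w => exp (2 * π * I * w) * (1 / (1 - exp (2 * π * I * w))) ^ 2)
      (2 * π * I * (exp (2 * π * I * w) * (1 + exp (2 * π * I * w)) / (1 - exp (2 * π * I * w)) ^ 3)) w := by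
  have h1 : HasDerivAt (fun w => exp (2 * π * I * w)) (2 * π * I * exp (2 * π * I * w)) w := by
    have := ((hasDerivAt_id w).const_mul (2 * π * I)).cexp
    simpa [mul_comm] using this
  have h2 := h1.fun_mul ((((h1.const_sub 1).fun_inv hw)).fun_pow 2)
  refine (h2.congr_of_eventuallyEq (Eventually.of_forall fun w => ?_)).congr_deriv ?_
  · simp
  · generalize exp (2 * π * I * w) = E at *
    rw [Nat.add_one_sub_one, pow_one, Nat.cast_ofNat]
    field_simp
    ring

lemma norm_deriv_le_aux {x : ℂ} (hx : ‖x‖ ≤ 1 / 2) :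
    ‖x * (1 + x) / (1 - x) ^ 3‖ ≤ 12 * ‖x‖ := by
  have h1 : ‖1 + x‖ ≤ 3 / 2 := (norm_add_le _ _).trans (by rw [norm_one]; linarith)
  have h2 : 1 / 2 ≤ ‖1 - x‖ := by
    have := norm_sub_norm_le (1 : ℂ) x
    rw [norm_one] at this
    linarith
  rw [norm_div, norm_mul, norm_pow, div_le_iff₀ (by positivity)]
  have h3 : (1 / 2 : ℝ) ^ 3 ≤ ‖1 - x‖ ^ 3 := by gcongr
  calc ‖x‖ * ‖1 + x‖ ≤ ‖x‖ * (3 / 2) := by gcongr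
    _ = 12 * ‖x‖ * (1 / 2) ^ 3 := by ring
    _ ≤ _ := by gcongr

lemma norm_deriv_exp_mul_inv_sq_le {w : ℂ} (hw : 1 ≤ |w.im|) :
    ‖2 * π * I * (exp (2 * π * I * w) * (1 + exp (2 * π * I * w)) / (1 - exp (2 * π * I * w)) ^ 3)‖ ≤
      24 * π * Real.exp (-(2 * π * |w.im|)) := by
  have hsmall : Real.exp (-(2 * π * |w.im|)) ≤ 1 / 2 := by
    have h1 : 1 ≤ 2 * π * |w.im| := by nlinarith [Real.pi_gt_three]
    have h2 := Real.add_one_le_exp (2 * π * |w.im|)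
    rw [Real.exp_neg, inv_le_comm₀ (Real.exp_pos _) (by norm_num)]
    linarith
  have hn : ‖(2 * π * I : ℂ)‖ = 2 * π := by
    simp [abs_of_pos Real.pi_pos]
  rw [norm_mul, hn, show 24 * π * Real.exp (-(2 * π * |w.im|)) =
    2 * π * (12 * Real.exp (-(2 * π * |w.im|))) by ring]
  refine mul_le_mul_of_nonneg_left ?_ (by positivity)
  rcases le_total 0 w.im with h | h
  · rw [abs_of_nonneg h] at hsmall ⊢
    rw [← norm_exp_two_pi_I_mul] at hsmall ⊢
    exact norm_deriv_le_aux hsmall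
  · have hinv : ‖(exp (2 * π * I * w))⁻¹‖ = Real.exp (-(2 * π * |w.im|)) := by
      rw [norm_inv, norm_exp_two_pi_I_mul, ← Real.exp_neg, abs_of_nonpos h]
      ring_nf
    rw [← hinv] at hsmall ⊢
    have hne := Complex.exp_ne_zero (2 * π * I * w)
    set x := exp (2 * π * I * w)
    have h1 : x ≠ 1 := by
      rintro h1
      rw [h1] at hsmall
      norm_num at hsmall
    -- The expression is odd under `x ↦ x⁻¹`, which reduces the lower half plane to the case of
    -- small `x`.
    have e : x * (1 + x) / (1 - x) ^ 3 = -(x⁻¹ * (1 + x⁻¹) / (1 - x⁻¹) ^ 3) := by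
      have h2 : 1 - x ≠ 0 := sub_ne_zero.2 (Ne.symm h1)
      have h3 : 1 - x⁻¹ = -(1 - x) / x := by field_simp; ring
      rw [h3]
      field_simp
      ring
    rw [e, norm_neg]
    exact norm_deriv_le_aux hsmall

/-- Termwise differentiation in both variables. The derivative is bounded uniformly only when `z +
nτ` stays away from the real axis, so finitely many terms are treated apart. -/
lemma differentiableAt_weierstrassSum {p₀ : ℂ × ℂ} (hτ : 0 < p₀.1.im)
    (hz : ∀ m n : ℤ, p₀.2 ≠ m * p₀.1 + n) :
    DifferentiableAt ℂ (fun p : ℂ × ℂ => weierstrassSum p.1 p.2) p₀ := by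
  set U : Set (ℂ × ℂ) := {p | 0 < p.1.im ∧ ∀ m n : ℤ, p.2 ≠ m * p.1 + n} with hU
  have hUo : IsOpen U := isOpen_setOf_not_lattice
  set y := p₀.1.im / 2 with hy
  set Z := |p₀.2.im| + 1 with hZ
  set V : Set (ℂ × ℂ) := {p | y < p.1.im ∧ |p.2.im| < Z} with hV
  have hVo : IsOpen V := (isOpen_lt continuous_const (Complex.continuous_im.comp continuous_fst)).and
    (isOpen_lt (Complex.continuous_im.comp continuous_snd).abs continuous_const)
  have hy0 : 0 < y := by positivity
  obtain ⟨r, hr, hball⟩ := Metric.isOpen_iff.1 (hUo.inter hVo) p₀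
    ⟨⟨hτ, hz⟩, by simp only [hV, Set.mem_ofPred_eq, hy, hZ]; constructor <;> linarith⟩
  -- For `|n| ≥ n₀` and all nearby `(τ, z)` this forces `|Im (z + nτ)| ≥ |n| y / 2 + 1`.
  obtain ⟨n₀, hn₀⟩ := exists_nat_gt ((2 * Z + 2) / y)
  set f : ℤ → ℂ × ℂ → ℂ := fun n p => exp (2 * π * I * (p.2 + n * p.1)) * appellFactor p.1 p.2 n ^ 2
    with hf
  set L : ℤ → (ℂ × ℂ →L[ℂ] ℂ) := fun n => ContinuousLinearMap.snd ℂ ℂ ℂ + (n : ℂ) • ContinuousLinearMap.fst ℂ ℂ ℂ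
    with hL
  set D : ℂ → ℂ := fun w => 2 * π * I * (exp (2 * π * I * w) * (1 + exp (2 * π * I * w)) /
    (1 - exp (2 * π * I * w)) ^ 3) with hD
  have hfd : ∀ n, ∀ p ∈ Metric.ball p₀ r, HasFDerivAt (f n) (D (p.2 + n * p.1) • L n) p := by
    intro n p hp
    have hw := one_sub_exp_ne_zero (hball hp).1.2 n
    have h1 : HasFDerivAt (fun p : ℂ × ℂ => p.2 + n * p.1) (L n) p := by
      have h3 : HasFDerivAt (fun p : ℂ × ℂ => p.2) (ContinuousLinearMap.snd ℂ ℂ ℂ) p := hasFDerivAt_snd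
      have h4 : HasFDerivAt (fun p : ℂ × ℂ => p.1) (ContinuousLinearMap.fst ℂ ℂ ℂ) p := hasFDerivAt_fst
      exact h3.add (h4.const_mul (n : ℂ))
    exact (hasDerivAt_exp_mul_inv_sq hw).comp_hasFDerivAt p h1
  set u : ℤ → ℝ := fun n => 24 * π * (|(n : ℝ)| * Real.exp (-(π * y) * |(n : ℝ)|)) +
    24 * π * Real.exp (-(π * y) * |(n : ℝ)|) with hu
  have hus : Summable u := by
    have h1 := summable_exp_neg_mul_abs (c := π * y) (by positivity)
    have h2 := summable_exp_neg_mul_abs (c := π * y / 2) (by positivity)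
    have h3 : Summable fun n : ℤ => |(n : ℝ)| * Real.exp (-(π * y) * |(n : ℝ)|) := by
      refine Summable.of_nonneg_of_le (fun n => by positivity) (fun n => ?_) (h2.mul_left (2 / (π * y)))
      have h4 : |(n : ℝ)| ≤ 2 / (π * y) * Real.exp (π * y / 2 * |(n : ℝ)|) := by
        have := Real.add_one_le_exp (π * y / 2 * |(n : ℝ)|)
        calc |(n : ℝ)| = 2 / (π * y) * (π * y / 2 * |(n : ℝ)|) := by field_simp
          _ ≤ _ := by gcongr; linarith
      calc |(n : ℝ)| * Real.exp (-(π * y) * |(n : ℝ)|)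
          ≤ 2 / (π * y) * Real.exp (π * y / 2 * |(n : ℝ)|) * Real.exp (-(π * y) * |(n : ℝ)|) := by gcongr
        _ = _ := by rw [mul_assoc, ← Real.exp_add]; congr 2; ring
    exact (h3.mul_left _).add (h1.mul_left _)
  set g : ℤ → ℂ × ℂ → ℂ := fun n p => if |n| < n₀ then 0 else f n p with hg
  set g' : ℤ → ℂ × ℂ → (ℂ × ℂ →L[ℂ] ℂ) := fun n p =>
    if |n| < n₀ then 0 else D (p.2 + n * p.1) • L n with hg'
  have hgd : ∀ n, ∀ p ∈ Metric.ball p₀ r, HasFDerivAt (g n) (g' n p) p := by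
    intro n p hp
    by_cases h : |n| < n₀
    · simp only [hg, hg', h, if_true]
      exact hasFDerivAt_const _ _
    · simp only [hg, hg', h, if_false]
      exact hfd n p hp
  have hbd : ∀ n, ∀ p ∈ Metric.ball p₀ r, ‖g' n p‖ ≤ u n := by
    intro n p hp
    have hu0 : 0 ≤ u n := by rw [hu]; positivity
    by_cases h : |n| < n₀
    · simpa [hg', h] using hu0
    · simp only [hg', h, if_false]
      have hpV := (hball hp).2
      have h1 : (2 * Z + 2) / y < |(n : ℝ)| := hn₀.trans_le (by exact_mod_cast not_lt.1 h)
      rw [div_lt_iff₀ hy0] at h1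
      have h2 : |(n : ℝ)| * y / 2 + 1 ≤ |(p.2 + n * p.1).im| := by
        have e : (p.2 + n * p.1).im = p.2.im + n * p.1.im := by simp
        have h3 := abs_sub_abs_le_abs_sub ((n : ℝ) * p.1.im) (-p.2.im)
        rw [abs_neg, sub_neg_eq_add, abs_mul, abs_of_pos (hy0.trans hpV.1)] at h3
        have h4 : |(n : ℝ)| * y ≤ |(n : ℝ)| * p.1.im :=
          mul_le_mul_of_nonneg_left hpV.1.le (abs_nonneg _)
        rw [e, add_comm p.2.im]
        have := hpV.2
        linarith
      have hnn : 0 ≤ |(n : ℝ)| * y := by positivity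
      rw [norm_smul]
      have h5 := norm_deriv_exp_mul_inv_sq_le (w := p.2 + n * p.1) (by linarith)
      have h6 : ‖L n‖ ≤ |(n : ℝ)| + 1 := by
        refine (norm_add_le _ _).trans ?_
        rw [norm_smul, Complex.norm_intCast]
        have a1 := ContinuousLinearMap.norm_fst_le ℂ ℂ ℂ
        have a2 := ContinuousLinearMap.norm_snd_le ℂ ℂ ℂ
        nlinarith [abs_nonneg (n : ℝ)]
      have h7 : Real.exp (-(2 * π * |(p.2 + n * p.1).im|)) ≤ Real.exp (-(π * y) * |(n : ℝ)|) := by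
        refine Real.exp_le_exp.2 ?_
        nlinarith [Real.pi_pos]
      calc ‖D (p.2 + n * p.1)‖ * ‖L n‖
          ≤ (24 * π * Real.exp (-(π * y) * |(n : ℝ)|)) * (|(n : ℝ)| + 1) := by
            refine mul_le_mul (h5.trans ?_) h6 (norm_nonneg _) (by positivity)
            gcongr
        _ = u n := by rw [hu]; ring
  have hp₀ : p₀ ∈ Metric.ball p₀ r := Metric.mem_ball_self hr
  have hsf : ∀ p ∈ Metric.ball p₀ r, Summable fun n => f n p := fun p hp =>
    summable_weierstrassSum (hball hp).1.1 (hball hp).1.2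
  have hfin : ∀ p, ∑' n, (f n p - g n p) = ∑ n ∈ Finset.Ioo (-(n₀ : ℤ)) n₀, f n p := by
    intro p
    rw [tsum_eq_sum (s := Finset.Ioo (-(n₀ : ℤ)) n₀)]
    · refine Finset.sum_congr rfl fun n hn => ?_
      have : |n| < n₀ := abs_lt.2 (Finset.mem_Ioo.1 hn)
      simp [hg, this]
    · intro n hn
      have : ¬ |n| < n₀ := fun h => hn (Finset.mem_Ioo.2 (abs_lt.1 h))
      simp [hg, this]
  have hsfg : ∀ p, Summable fun n => f n p - g n p := fun p =>
    summable_of_ne_finset_zero (s := Finset.Ioo (-(n₀ : ℤ)) n₀) fun n hn => by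
      have : ¬ |n| < n₀ := fun h => hn (Finset.mem_Ioo.2 (abs_lt.1 h))
      simp [hg, this]
  have hsg : ∀ p ∈ Metric.ball p₀ r, Summable fun n => g n p := fun p hp =>
    ((hsf p hp).sub (hsfg p)).congr fun n => by ring
  have hdg := hasFDerivAt_tsum_of_isPreconnected hus Metric.isOpen_ball
    (convex_ball p₀ r).isPreconnected hgd hbd hp₀ (hsg p₀ hp₀) hp₀
  have hdf : DifferentiableAt ℂ (fun p => ∑ n ∈ Finset.Ioo (-(n₀ : ℤ)) n₀, f n p) p₀ :=
    DifferentiableAt.fun_sum fun n _ => (hfd n p₀ hp₀).differentiableAt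
  refine (hdf.add hdg.differentiableAt).congr_of_eventuallyEq ?_
  filter_upwards [Metric.ball_mem_nhds p₀ hr] with p hp
  rw [weierstrassSum, Pi.add_apply, ← hfin, ← (hsfg p).tsum_add (hsg p hp)]
  exact tsum_congr fun n => by simp [hf]

theorem differentiableOn_eta_cube_mul_muADE (Y : ADE) :
    DifferentiableOn ℂ (fun p : ℂ × ℂ => ModularForm.eta p.1 ^ 3 * muADE Y p.1 p.2 p.2 0)
      {p | 0 < p.1.im ∧ ∀ m n : ℤ, p.2 ≠ m * p.1 + n} := by
  have h : DifferentiableOn ℂ (fun p : ℂ × ℂ => ∑ d ∈ Y.divisorSet,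
      (-((((Y.coxeter / d : ℕ) : ℂ) - d) * weierstrassSum p.1 p.2) +
        ∑' q : ℤ × ℤ, divisorTerm d (Y.coxeter / d) p.1 q.1 q.2))
      {p | 0 < p.1.im ∧ ∀ m n : ℤ, p.2 ≠ m * p.1 + n} := by
    intro p hp
    refine DifferentiableAt.differentiableWithinAt ?_
    refine DifferentiableAt.fun_sum fun d hd => ?_
    obtain ⟨h1, h2⟩ := Y.ne_zero_of_mem hd
    refine DifferentiableAt.add (((differentiableAt_weierstrassSum hp.1 hp.2).const_mul _).neg) ?_
    exact ((differentiableOn_tsum_divisorTerm h1 h2).differentiableAt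
      (isOpen_upperHalfPlane.mem_nhds hp.1)).comp (f := fun p : ℂ × ℂ => p.1) p differentiableAt_fst
  exact h.congr fun p hp => eta_cube_mul_muADE Y hp.1 hp.2

/-! ### Polynomial growth -/

lemma one_le_add_one_div {y : ℝ} (hy : 0 < y) : 1 ≤ y + 1 / y := by
  have : 0 ≤ 1 / y := by positivity
  rcases le_total 1 y with h | h
  · linarith
  · have := (one_le_div hy).2 h
    linarith

lemma PolynomialGrowth.of_bound {F : ℂ → ℂ} {A B : ℝ} (hA : 0 ≤ A) (hB : 0 ≤ B) (n : ℕ)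
    (h : ∀ τ : ℂ, 0 < τ.im → ‖F τ‖ ≤ A + B * (1 / τ.im) ^ n) : PolynomialGrowth F := by
  refine ⟨A + B, n, fun τ hτ => (h τ hτ).trans ?_⟩
  have h1 := one_le_add_one_div hτ
  have h2 : (1 : ℝ) ≤ (τ.im + 1 / τ.im) ^ n := one_le_pow₀ h1
  have h3 : (1 / τ.im) ^ n ≤ (τ.im + 1 / τ.im) ^ n := by
    gcongr
    linarith
  nlinarith [mul_le_mul_of_nonneg_left h2 hA, mul_le_mul_of_nonneg_left h3 hB]

lemma PolynomialGrowth.const_mul {F : ℂ → ℂ} (hF : PolynomialGrowth F) (c : ℂ) :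
    PolynomialGrowth fun τ => c * F τ := by
  obtain ⟨C, N, h⟩ := hF
  refine ⟨‖c‖ * C, N, fun τ hτ => ?_⟩
  rw [norm_mul, mul_assoc]
  exact mul_le_mul_of_nonneg_left (h τ hτ) (norm_nonneg _)

lemma PolynomialGrowth.add {F G : ℂ → ℂ} (hF : PolynomialGrowth F) (hG : PolynomialGrowth G) :
    PolynomialGrowth fun τ => F τ + G τ := by
  obtain ⟨C, N, h⟩ := hF
  obtain ⟨C', N', h'⟩ := hG
  refine ⟨|C| + |C'|, N + N', fun τ hτ => (norm_add_le _ _).trans ?_⟩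
  have h1 := one_le_add_one_div hτ
  have h2 : (τ.im + 1 / τ.im) ^ N ≤ (τ.im + 1 / τ.im) ^ (N + N') := pow_le_pow_right₀ h1 (by omega)
  have h3 : (τ.im + 1 / τ.im) ^ N' ≤ (τ.im + 1 / τ.im) ^ (N + N') := pow_le_pow_right₀ h1 (by omega)
  rw [add_mul]
  refine add_le_add ((h τ hτ).trans ?_) ((h' τ hτ).trans ?_)
  · exact mul_le_mul (le_abs_self C) h2 (by positivity) (abs_nonneg _)
  · exact mul_le_mul (le_abs_self C') h3 (by positivity) (abs_nonneg _)

lemma PolynomialGrowth.sum {ι : Type*} (s : Finset ι) {F : ι → ℂ → ℂ}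
    (hF : ∀ i ∈ s, PolynomialGrowth (F i)) : PolynomialGrowth fun τ => ∑ i ∈ s, F i τ := by
  classical
  induction s using Finset.induction_on with
  | empty => exact ⟨0, 0, fun τ _ => by simp⟩
  | insert i s hi ih =>
    simp only [Finset.sum_insert hi]
    exact (hF i (Finset.mem_insert_self _ _)).add (ih fun j hj => hF j (Finset.mem_insert_of_mem hj))

lemma PolynomialGrowth.congr {F G : ℂ → ℂ} (hF : PolynomialGrowth F)
    (h : ∀ τ : ℂ, 0 < τ.im → G τ = F τ) : PolynomialGrowth G := by
  obtain ⟨C, N, hC⟩ := hF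
  exact ⟨C, N, fun τ hτ => by rw [h τ hτ]; exact hC τ hτ⟩

lemma exp_neg_le_two_div_sq {x : ℝ} (hx : 0 < x) : Real.exp (-x) ≤ 2 / x ^ 2 := by
  have h := Real.pow_div_factorial_le_exp x hx.le 2
  rw [Real.exp_neg, inv_le_comm₀ (Real.exp_pos _) (by positivity), inv_div]
  simpa [Nat.factorial] using h

lemma exp_neg_le_six_div_cube {x : ℝ} (hx : 0 < x) : Real.exp (-x) ≤ 6 / x ^ 3 := by
  have h := Real.pow_div_factorial_le_exp x hx.le 3
  rw [Real.exp_neg, inv_le_comm₀ (Real.exp_pos _) (by positivity), inv_div]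
  simpa [Nat.factorial] using h

lemma summable_one_div_int_sq : Summable fun n : ℤ => 1 / (n : ℝ) ^ 2 :=
  Real.summable_one_div_int_pow.2 (by norm_num)

/-! ### The unary theta functions -/

lemma differentiableOn_unaryTheta {k : ℕ} (hk : k ≠ 0) (r : ℤ) :
    DifferentiableOn ℂ (unaryTheta k r) {τ | 0 < τ.im} := by
  have h := differentiableOn_tsum_exp (fun p : ℤ => if (2 * k : ℤ) ∣ p - r then (p : ℂ) else 0)
    (fun p => (p : ℝ) ^ 2 / (4 * k)) (fun p _ => by positivity) (fun y hy => by
      have h1 := (summable_unaryCoeff hk (τ := y * I) (by simpa using hy)).norm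
      refine Summable.of_nonneg_of_le (fun p => by positivity) (fun p => ?_) h1
      rw [unaryCoeff, norm_mul, norm_thetaExp]
      have e : -(π * (y * I : ℂ).im / (2 * k)) * (p : ℝ) ^ 2 =
          -(2 * π * ((p : ℝ) ^ 2 / (4 * k) * y)) := by
        have : (k : ℝ) ≠ 0 := by exact_mod_cast hk
        simp
        field_simp
        ring
      rw [e]
      refine mul_le_mul_of_nonneg_right ?_ (Real.exp_pos _).le
      split_ifs <;> simp)
  refine h.congr fun τ _ => ?_
  rw [unaryTheta_eq_residueSum hk, residueSum]
  refine tsum_congr fun p => ?_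
  split_ifs
  · rw [unaryCoeff, thetaExp]
    congr 2
    push_cast
    ring
  · simp

lemma polynomialGrowth_unaryTheta {k : ℕ} (hk : k ≠ 0) (r : ℤ) : PolynomialGrowth (unaryTheta k r) := by
  have hkR : 0 < (k : ℝ) := by positivity
  refine PolynomialGrowth.of_bound (A := 0) (B := 8 * k ^ 2 / π ^ 2 * ∑' n : ℤ, 1 / (n : ℝ) ^ 2) le_rfl
    (mul_nonneg (by positivity) (tsum_nonneg fun n => by positivity)) 2 fun τ hτ => ?_
  rw [unaryTheta_eq_residueSum hk, residueSum, zero_add]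
  have hs := (summable_one_div_int_sq.mul_left (8 * k ^ 2 / (π ^ 2) * (1 / τ.im) ^ 2)).hasSum
  rw [tsum_mul_left] at hs
  rw [show 8 * (k : ℝ) ^ 2 / π ^ 2 * (∑' n : ℤ, 1 / (n : ℝ) ^ 2) * (1 / τ.im) ^ 2 =
    8 * k ^ 2 / (π ^ 2) * (1 / τ.im) ^ 2 * ∑' n : ℤ, 1 / (n : ℝ) ^ 2 by ring]
  refine tsum_of_norm_bounded hs fun p => ?_
  rcases eq_or_ne p 0 with rfl | hp
  · simp [unaryCoeff]
  have hpR : (p : ℝ) ≠ 0 := by exact_mod_cast hp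
  have hp2 : 0 < (p : ℝ) ^ 2 := by positivity
  have hle : |(p : ℝ)| ≤ (p : ℝ) ^ 2 := by
    rw [← sq_abs]
    have : (1 : ℝ) ≤ |(p : ℝ)| := by exact_mod_cast Int.one_le_abs hp
    nlinarith
  have h1 : ‖unaryCoeff k τ p‖ ≤ 8 * k ^ 2 / (π ^ 2) * (1 / τ.im) ^ 2 * (1 / (p : ℝ) ^ 2) := by
    rw [unaryCoeff, norm_mul, norm_thetaExp, Complex.norm_intCast, neg_mul]
    have := exp_neg_le_two_div_sq (x := π * τ.im / (2 * k) * (p : ℝ) ^ 2) (by positivity)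
    calc |(p : ℝ)| * Real.exp (-(π * τ.im / (2 * k) * (p : ℝ) ^ 2))
        ≤ (p : ℝ) ^ 2 * (2 / (π * τ.im / (2 * k) * (p : ℝ) ^ 2) ^ 2) := by gcongr
      _ = _ := by field_simp; ring
  split_ifs
  · exact h1
  · rw [norm_zero]; positivity

/-! ### Growth at torsion points -/

/-- The coefficient is at most `(d + e) ab`, and `exp (-x) ≤ 6 / x³` at `x = 2πab τ₂` supplies
`(ab)⁻³`; the summable `(ab)⁻²` remains. -/
lemma norm_divisorTerm_le {d e : ℕ} {τ : ℂ} (hτ : 0 < τ.im) (p : ℤ × ℤ) :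
    ‖divisorTerm d e τ p.1 p.2‖ ≤ (d + e) * (1 / τ.im) ^ 3 * (1 / (p.1 : ℝ) ^ 2 * (1 / (p.2 : ℝ) ^ 2)) := by
  obtain ⟨a, b⟩ := p
  simp only
  rcases le_or_gt (a * b) 0 with h | h
  · rw [divisorTerm_eq_zero τ h, norm_zero]
    positivity
  have ha : a ≠ 0 := by rintro rfl; simp at h
  have hb : b ≠ 0 := by rintro rfl; simp at h
  have haR : (a : ℝ) ≠ 0 := by exact_mod_cast ha
  have hbR : (b : ℝ) ≠ 0 := by exact_mod_cast hb
  have hab : 0 < (a : ℝ) * b := by exact_mod_cast h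
  have ha1 : (1 : ℝ) ≤ |(a : ℝ)| := by exact_mod_cast Int.one_le_abs ha
  have hb1 : (1 : ℝ) ≤ |(b : ℝ)| := by exact_mod_cast Int.one_le_abs hb
  have habs : |(a : ℝ)| * |(b : ℝ)| = a * b := by rw [← abs_mul, abs_of_pos hab]
  have h1 : ‖((if 0 < (e * b : ℤ) * (d * a - e * b) then ((|e * b| : ℤ) : ℂ) else 0) -
      (if 0 < (d * a : ℤ) * (e * b - d * a) then ((|d * a| : ℤ) : ℂ) else 0))‖ ≤ (d + e) * (a * b) := by
    have e1 : ‖((|e * b| : ℤ) : ℂ)‖ ≤ e * (a * b) := by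
      rw [Complex.norm_intCast, Int.cast_abs, abs_abs, Int.cast_mul, abs_mul, ← habs, Int.cast_natCast,
        Nat.abs_cast]
      gcongr
      exact le_mul_of_one_le_left (abs_nonneg _) ha1
    have e2 : ‖((|d * a| : ℤ) : ℂ)‖ ≤ d * (a * b) := by
      rw [Complex.norm_intCast, Int.cast_abs, abs_abs, Int.cast_mul, abs_mul, ← habs, Int.cast_natCast,
        Nat.abs_cast]
      gcongr
      exact le_mul_of_one_le_right (abs_nonneg _) hb1
    have e1' : (0 : ℝ) ≤ e * (a * b) := by positivity
    have e2' : (0 : ℝ) ≤ d * (a * b) := by positivity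
    refine (norm_sub_le _ _).trans ?_
    rw [add_mul, add_comm]
    refine add_le_add ?_ ?_
    · split_ifs
      · exact e2
      · simpa using e2'
    · split_ifs
      · exact e1
      · simpa using e1'
  have h2 : ‖exp (2 * π * I * (a * b) * τ)‖ ≤ 6 / (2 * π * (a * b * τ.im)) ^ 3 := by
    rw [mul_assoc, norm_exp_two_pi_I_mul]
    have e : ((a : ℂ) * b * τ).im = a * b * τ.im := by
      simp
    rw [e]
    exact exp_neg_le_six_div_cube (by positivity)
  rw [divisorTerm, norm_mul]
  calc _ ≤ ((d + e) * (a * b)) * (6 / (2 * π * (a * b * τ.im)) ^ 3) :=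
        mul_le_mul h1 h2 (norm_nonneg _) (by positivity)
    _ = (6 / (2 * π) ^ 3) * ((d + e) * (1 / τ.im) ^ 3 * (1 / (a : ℝ) ^ 2 * (1 / (b : ℝ) ^ 2))) := by
        field_simp
    _ ≤ _ := by
        refine mul_le_of_le_one_left (by positivity) ?_
        rw [div_le_one (by positivity)]
        calc (6 : ℝ) ≤ (2 * 3) ^ 3 := by norm_num
          _ ≤ _ := by gcongr; exact Real.pi_gt_three.le

lemma polynomialGrowth_tsum_divisorTerm (d e : ℕ) :
    PolynomialGrowth fun τ => ∑' p : ℤ × ℤ, divisorTerm d e τ p.1 p.2 := by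
  have hs : Summable fun p : ℤ × ℤ => 1 / (p.1 : ℝ) ^ 2 * (1 / (p.2 : ℝ) ^ 2) :=
    summable_one_div_int_sq.mul_of_nonneg summable_one_div_int_sq (fun n => by positivity)
      fun n => by positivity
  refine PolynomialGrowth.of_bound (A := 0)
    (B := (d + e) * ∑' p : ℤ × ℤ, 1 / (p.1 : ℝ) ^ 2 * (1 / (p.2 : ℝ) ^ 2)) le_rfl
    (mul_nonneg (by positivity) (tsum_nonneg fun n => by positivity)) 3 fun τ hτ => ?_
  rw [zero_add, mul_right_comm]
  have h := (hs.mul_left ((d + e) * (1 / τ.im) ^ 3)).hasSum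
  rw [tsum_mul_left] at h
  exact tsum_of_norm_bounded h fun p => norm_divisorTerm_le hτ p

/-- The modulus is at most `1 / (2 sinh (t/2))²` with `t = 2π Im w`, because `|1 - x| ≥ |1 - |x||`,
and `|sinh (t/2)| ≥ |t/2|`. -/
lemma norm_exp_mul_inv_sq_le {w : ℂ} (hw : w.im ≠ 0) :
    ‖exp (2 * π * I * w) * (1 / (1 - exp (2 * π * I * w))) ^ 2‖ ≤ 1 / (2 * π * w.im) ^ 2 := by
  set t := 2 * π * w.im with ht
  have ht0 : t ≠ 0 := mul_ne_zero (by positivity) hw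
  have hx : ‖exp (2 * π * I * w)‖ = Real.exp (-t) := norm_exp_two_pi_I_mul w
  have h1 : |1 - Real.exp (-t)| ≤ ‖1 - exp (2 * π * I * w)‖ := by
    have := abs_norm_sub_norm_le (1 : ℂ) (exp (2 * π * I * w))
    rwa [norm_one, hx] at this
  have h2 : t ^ 2 * Real.exp (-t) ≤ (1 - Real.exp (-t)) ^ 2 := by
    have h3 : (1 - Real.exp (-t)) ^ 2 = (2 * Real.sinh (t / 2)) ^ 2 * Real.exp (-t) := by
      have e1 : Real.exp (-t) = Real.exp (-(t / 2)) ^ 2 := by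
        rw [← Real.exp_nat_mul]; congr 1; push_cast; ring
      have e2 : Real.exp (t / 2) * Real.exp (-(t / 2)) = 1 := by
        rw [← Real.exp_add, add_neg_cancel, Real.exp_zero]
      rw [e1, Real.sinh_eq, ← mul_pow]
      congr 1
      linear_combination -e2
    rw [h3]
    refine mul_le_mul_of_nonneg_right ?_ (Real.exp_pos _).le
    have h4 := Real.self_le_sinh_iff.2 (abs_nonneg (t / 2))
    rw [← Real.abs_sinh, abs_div, abs_two] at h4
    rw [← sq_abs, ← sq_abs (2 * Real.sinh (t / 2)), abs_mul 2 (Real.sinh (t / 2)), abs_two]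
    have h5 : |t| ≤ 2 * |Real.sinh (t / 2)| := by linarith
    gcongr
  have h3 : t ^ 2 * Real.exp (-t) ≤ ‖1 - exp (2 * π * I * w)‖ ^ 2 := by
    refine h2.trans ?_
    rw [← sq_abs]
    gcongr
  have hpos : 0 < t ^ 2 := by positivity
  have h0 : 0 < ‖1 - exp (2 * π * I * w)‖ ^ 2 := lt_of_lt_of_le (by positivity) h3
  rw [norm_mul, norm_pow, norm_div, norm_one, hx, div_pow, one_pow, mul_one_div, div_le_div_iff₀ h0 hpos]
  linarith

lemma torsion_not_lattice {N : ℕ} {a b : ℤ} (hN : 0 < N) (hab : ¬((N : ℤ) ∣ a ∧ (N : ℤ) ∣ b))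
    {τ : ℂ} (hτ : 0 < τ.im) (m n : ℤ) : (a * τ + b) / N ≠ m * τ + n := by
  intro h
  have hN' : (N : ℂ) ≠ 0 := by exact_mod_cast hN.ne'
  rw [div_eq_iff hN'] at h
  have h1 := congrArg Complex.im h
  have h2 : (a : ℝ) = m * N := by
    simp at h1
    have : ((a : ℝ) - m * N) * τ.im = 0 := by linear_combination h1
    rcases mul_eq_zero.1 this with h | h
    · linarith
    · exact absurd h hτ.ne'
  have h2' : (a : ℂ) = m * N := by exact_mod_cast h2
  rw [h2'] at h
  have h3 : (b : ℂ) = n * N := by linear_combination h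
  refine hab ⟨⟨m, ?_⟩, ⟨n, ?_⟩⟩
  · rw [mul_comm]; exact_mod_cast h2'
  · rw [mul_comm]; exact_mod_cast h3

/-- At a torsion point `Im (z + nτ) = (a + nN) τ₂ / N`. At most one index has `a + nN = 0`, and its
term is constant in `τ`; the others are `O(τ₂⁻² (a + nN)⁻²)`. -/
lemma polynomialGrowth_weierstrassSum {N : ℕ} (a b : ℤ) (hN : 0 < N) :
    PolynomialGrowth fun τ => weierstrassSum τ ((a * τ + b) / N) := by
  have hN' : (N : ℂ) ≠ 0 := by exact_mod_cast hN.ne'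
  have hNR : (0 : ℝ) < N := by exact_mod_cast hN
  set Cb : ℝ := ‖exp (2 * π * I * (b / N)) * (1 / (1 - exp (2 * π * I * (b / N)))) ^ 2‖ with hCb
  have hinj : Function.Injective fun n : ℤ => a + n * N := fun m n h => by
    have h' : m * N = n * N := by simpa using h
    exact mul_right_cancel₀ (by exact_mod_cast hN.ne') h'
  have hs1 : Summable fun n : ℤ => 1 / ((a + n * N : ℤ) : ℝ) ^ 2 :=
    summable_one_div_int_sq.comp_injective hinj
  have hs2 : Summable fun n : ℤ => if a + n * N = 0 then Cb else 0 :=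
    (hasSum_ite_eq (0 : ℤ) Cb).summable.comp_injective hinj
  refine PolynomialGrowth.of_bound (A := ∑' n : ℤ, if a + n * N = 0 then Cb else 0)
    (B := N ^ 2 / (2 * π) ^ 2 * ∑' n : ℤ, 1 / ((a + n * N : ℤ) : ℝ) ^ 2)
    (tsum_nonneg fun n => by split_ifs; exacts [norm_nonneg _, le_rfl])
    (mul_nonneg (by positivity) (tsum_nonneg fun n => by positivity)) 2 fun τ hτ => ?_
  have h := hs2.hasSum.add (hs1.mul_left (N ^ 2 / (2 * π) ^ 2 * (1 / τ.im) ^ 2)).hasSum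
  rw [tsum_mul_left] at h
  rw [mul_right_comm]
  refine tsum_of_norm_bounded h fun n => ?_
  have e : (a * τ + b) / N + n * τ = (((a + n * N : ℤ) : ℂ) * τ + b) / N := by
    push_cast; field_simp; ring
  rw [appellFactor, e]
  have him : ((((a + n * N : ℤ) : ℂ) * τ + b) / N).im = (a + n * N : ℤ) * τ.im / N := by
    rw [Complex.div_natCast_im]
    simp
  rcases eq_or_ne (a + n * N) 0 with h0 | h0
  · rw [h0, if_pos rfl]
    simp [hCb]
  · rw [if_neg h0, zero_add]
    have h0' : ((a + n * N : ℤ) : ℝ) ≠ 0 := by exact_mod_cast h0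
    refine (norm_exp_mul_inv_sq_le (by rw [him]; positivity)).trans (le_of_eq ?_)
    rw [him]
    field_simp

lemma polynomialGrowth_eta_cube_mul_muADE (Y : ADE) {N : ℕ} {a b : ℤ} (hN : 0 < N)
    (hab : ¬((N : ℤ) ∣ a ∧ (N : ℤ) ∣ b)) :
    PolynomialGrowth fun τ => ModularForm.eta τ ^ 3 * muADE Y τ ((a * τ + b) / N) ((a * τ + b) / N) 0 := by
  refine (PolynomialGrowth.sum Y.divisorSet (F := fun d τ =>
    (-(((Y.coxeter / d : ℕ) : ℂ) - d)) * weierstrassSum τ ((a * τ + b) / N) +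
      ∑' q : ℤ × ℤ, divisorTerm d (Y.coxeter / d) τ q.1 q.2) fun d _ =>
      ((polynomialGrowth_weierstrassSum a b hN).const_mul _).add
        (polynomialGrowth_tsum_divisorTerm _ _)).congr fun τ hτ => ?_
  rw [eta_cube_mul_muADE Y hτ (torsion_not_lattice hN hab hτ)]
  refine Finset.sum_congr rfl fun d _ => ?_
  ring

lemma differentiableOn_eta_cube_mul_muADE_torsion (Y : ADE) {N : ℕ} {a b : ℤ} (hN : 0 < N)
    (hab : ¬((N : ℤ) ∣ a ∧ (N : ℤ) ∣ b)) :
    DifferentiableOn ℂ (fun τ => ModularForm.eta τ ^ 3 *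
      muADE Y τ ((a * τ + b) / N) ((a * τ + b) / N) 0) {τ | 0 < τ.im} := by
  have h : DifferentiableOn ℂ (fun τ : ℂ => (τ, (a * τ + b) / (N : ℂ))) {τ | 0 < τ.im} := by fun_prop
  have key : ∀ G : ℂ × ℂ → ℂ, DifferentiableOn ℂ G {p | 0 < p.1.im ∧ ∀ m n : ℤ, p.2 ≠ m * p.1 + n} →
      DifferentiableOn ℂ (fun τ => G (τ, (a * τ + b) / (N : ℂ))) {τ | 0 < τ.im} := fun G hG =>
    hG.comp h fun τ hτ => ⟨hτ, torsion_not_lattice hN hab hτ⟩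
  exact key _ (differentiableOn_eta_cube_mul_muADE Y)

/-! ### The Wirtinger derivative -/

lemma dbar_eq_of_hasFDerivAt {F : ℂ → ℂ} {F' : ℂ →L[ℝ] ℂ} {τ : ℂ} (h : HasFDerivAt F F' τ) :
    dbar F τ = (1 / 2) * (F' 1 + I * F' I) := by
  rw [dbar, h.fderiv]

lemma dbar_of_differentiableAt {F : ℂ → ℂ} {τ : ℂ} (h : DifferentiableAt ℂ F τ) : dbar F τ = 0 := by
  rw [dbar_eq_of_hasFDerivAt (h.hasDerivAt.hasFDerivAt.restrictScalars ℝ)]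
  simp only [ContinuousLinearMap.coe_restrictScalars', ContinuousLinearMap.toSpanSingleton_apply, smul_eq_mul,
    one_mul]
  linear_combination (1 / 2 * deriv F τ) * I_mul_I

lemma dbar_congr {F G : ℂ → ℂ} {τ : ℂ} (h : F =ᶠ[𝓝 τ] G) : dbar F τ = dbar G τ := by
  rw [dbar, dbar, h.fderiv_eq]

lemma dbar_sub {F G : ℂ → ℂ} {τ : ℂ} (hF : DifferentiableAt ℝ F τ) (hG : DifferentiableAt ℝ G τ) :
    dbar (fun t => F t - G t) τ = dbar F τ - dbar G τ := by
  rw [dbar_eq_of_hasFDerivAt (hF.hasFDerivAt.fun_sub hG.hasFDerivAt), dbar, dbar]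
  simp only [sub_apply]
  ring

lemma dbar_sum {ι : Type*} (s : Finset ι) {F : ι → ℂ → ℂ} {τ : ℂ}
    (hF : ∀ i ∈ s, DifferentiableAt ℝ (F i) τ) :
    dbar (fun t => ∑ i ∈ s, F i t) τ = ∑ i ∈ s, dbar (F i) τ := by
  rw [dbar_eq_of_hasFDerivAt (HasFDerivAt.fun_sum fun i hi => (hF i hi).hasFDerivAt)]
  simp only [dbar, sum_apply, Finset.mul_sum, ← Finset.sum_add_distrib]

lemma dbar_mul_left {F G : ℂ → ℂ} {τ : ℂ} (hF : DifferentiableAt ℂ F τ) (hG : DifferentiableAt ℝ G τ) :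
    dbar (fun t => F t * G t) τ = F τ * dbar G τ := by
  have h := hF.hasDerivAt.hasFDerivAt.restrictScalars ℝ
  rw [dbar_eq_of_hasFDerivAt (h.fun_mul hG.hasFDerivAt), dbar]
  simp only [add_apply, smul_apply,
    ContinuousLinearMap.coe_restrictScalars', ContinuousLinearMap.toSpanSingleton_apply, smul_eq_mul, one_mul]
  linear_combination (1 / 2 * deriv F τ * G τ) * I_mul_I

/-! ### The derivative of the Eichler integrals -/

lemma hasDerivAt_signErfc {x : ℝ} (hx : x ≠ 0) :
    HasDerivAt signErfc (-(2 * Real.exp (-π * x ^ 2))) x := by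
  have h : signErfc =ᶠ[𝓝 x] fun t => Real.sign x - errorE t := by
    rcases hx.lt_or_gt with h | h
    · filter_upwards [eventually_lt_nhds h] with t ht
      rw [signErfc, Real.sign_of_neg ht, Real.sign_of_neg h]
    · filter_upwards [eventually_gt_nhds h] with t ht
      rw [signErfc, Real.sign_of_pos ht, Real.sign_of_pos h]
  exact ((hasDerivAt_errorE x).const_sub _).congr_of_eventuallyEq h

/-- The part of the derivative of `starTerm` along the imaginary direction that is not
complex linear. -/
def starDerivIm (k : ℕ) (τ : ℂ) (p : ℤ) : ℂ :=
  (-(p * Real.exp (-(π * p ^ 2 * (τ.im / k))) / (√(τ.im / k) * k)) : ℝ) * (thetaExp k τ p)⁻¹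

/-- The complex linear part of the derivative of `starTerm`. -/
def starDerivHol (k : ℕ) (τ : ℂ) (p : ℤ) : ℂ :=
  -(2 * π * I * ((p : ℂ) ^ 2 / (4 * k))) * starTerm k τ p

/-- The derivative of `starTerm`. -/
def starDeriv (k : ℕ) (τ : ℂ) (p : ℤ) : ℂ →L[ℝ] ℂ :=
  starDerivIm k τ p • (Complex.ofRealCLM.comp Complex.imCLM) +
    starDerivHol k τ p • ContinuousLinearMap.id ℝ ℂ

variable {k : ℕ}

lemma hasFDerivAt_starTerm (hk : k ≠ 0) {τ : ℂ} (hτ : 0 < τ.im) (p : ℤ) :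
    HasFDerivAt (fun t => starTerm k t p) (starDeriv k τ p) τ := by
  have hkR : 0 < (k : ℝ) := by positivity
  rcases eq_or_ne p 0 with rfl | hp
  · have h1 : (fun t => starTerm k t 0) = fun _ => 0 := by
      funext t
      simp [starTerm, signErfc_zero]
    have h2 : starDeriv k τ 0 = 0 := by
      ext v; simp [starDeriv, starDerivIm, starDerivHol]
    rw [h1, h2]
    exact hasFDerivAt_const _ _
  have hpR : (p : ℝ) ≠ 0 := by exact_mod_cast hp
  have hs : 0 < √(τ.im / k) := by positivity
  have hy : HasDerivAt (fun y : ℝ => signErfc (p * √(y / k)))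
      (-(p * Real.exp (-(π * p ^ 2 * (τ.im / k))) / (√(τ.im / k) * k))) τ.im := by
    have h1 : HasDerivAt (fun y : ℝ => p * √(y / k)) (p * ((1 / k) / (2 * √(τ.im / k)))) τ.im :=
      (((hasDerivAt_id τ.im).div_const (k : ℝ)).sqrt (by positivity)).const_mul _
    refine ((hasDerivAt_signErfc (mul_ne_zero hpR hs.ne')).comp τ.im h1).congr_deriv ?_
    rw [mul_pow, Real.sq_sqrt (by positivity), show -π * ((p : ℝ) ^ 2 * (τ.im / k)) =
      -(π * p ^ 2 * (τ.im / k)) by ring]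
    field_simp
  have h1 : HasFDerivAt (fun t : ℂ => ((signErfc (p * √(t.im / k)) : ℝ) : ℂ))
      (((-(p * Real.exp (-(π * p ^ 2 * (τ.im / k))) / (√(τ.im / k) * k)) : ℝ) : ℂ) •
        (Complex.ofRealCLM.comp Complex.imCLM)) τ := by
    have h2 := (hy.comp_hasFDerivAt τ Complex.imCLM.hasFDerivAt)
    have h3 := Complex.ofRealCLM.hasFDerivAt.comp τ h2
    refine h3.congr_fderiv ?_
    ext; simp
  have h2 : HasDerivAt (fun t : ℂ => (thetaExp k t p)⁻¹)
      (-(2 * π * I * ((p : ℂ) ^ 2 / (4 * k))) * (thetaExp k τ p)⁻¹) τ := by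
    have e : ∀ t, (thetaExp k t p)⁻¹ = exp (-(2 * π * I * ((p : ℂ) ^ 2 / (4 * k))) * t) := fun t => by
      rw [thetaExp, ← Complex.exp_neg, neg_mul]
    simp only [e]
    have := ((hasDerivAt_id τ).const_mul (-(2 * π * I * ((p : ℂ) ^ 2 / (4 * k))))).cexp
    refine this.congr_deriv ?_
    simp only [id, mul_one]
    ring
  have h3 := h1.mul (h2.hasFDerivAt.restrictScalars ℝ)
  refine h3.congr_fderiv ?_
  ext; simp [starDeriv, starDerivIm, starDerivHol, starTerm]; ring

/-- The Gaussian from differentiating the error function converts the inverse theta exponential into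
its complex conjugate; this is why the shadow consists of conjugated unary theta functions. -/
lemma exp_mul_inv_thetaExp (k : ℕ) (τ : ℂ) (p : ℤ) :
    (Real.exp (-(π * p ^ 2 * (τ.im / k))) : ℂ) * (thetaExp k τ p)⁻¹ = conj (thetaExp k τ p) := by
  rw [thetaExp, ← Complex.exp_neg, ← Complex.exp_conj, Complex.ofReal_exp, ← Complex.exp_add]
  congr 1
  simp only [map_mul, map_div₀, map_pow, Complex.conj_I, Complex.conj_ofReal, map_ofNat, map_natCast,
    map_intCast]
  have : conj τ = τ - 2 * I * τ.im := by apply Complex.ext <;> simp; ring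
  rw [this]
  push_cast
  linear_combination -(π * (p : ℂ) ^ 2 * (τ.im / k)) * I_mul_I

lemma starDerivIm_eq (k : ℕ) (τ : ℂ) (p : ℤ) :
    starDerivIm k τ p = -(1 / (√(τ.im / k) * k : ℝ)) * conj (unaryCoeff k τ p) := by
  rw [starDerivIm, unaryCoeff, map_mul, ← exp_mul_inv_thetaExp, map_intCast]
  push_cast
  ring

lemma norm_starDeriv_le (hk : k ≠ 0) {y : ℝ} (hy : 0 < y) {τ : ℂ} (hτ : y < τ.im) (p : ℤ) :
    ‖starDeriv k τ p‖ ≤ 1 / (√(y / k) * k) * (|(p : ℝ)| ^ 1 * Real.exp (-(π * y / (2 * k)) * p ^ 2 + 0 * |(p : ℝ)|)) +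
      π / (2 * k) * (|(p : ℝ)| ^ 2 * Real.exp (-(π * y / (2 * k)) * p ^ 2 + 0 * |(p : ℝ)|)) := by
  have hkR : 0 < (k : ℝ) := by positivity
  have hexp : Real.exp (-(π * τ.im / (2 * k)) * (p : ℝ) ^ 2) ≤
      Real.exp (-(π * y / (2 * k)) * p ^ 2 + 0 * |(p : ℝ)|) := by
    rw [zero_mul, add_zero]
    gcongr
  have h1 : ‖starDerivIm k τ p‖ ≤ 1 / (√(y / k) * k) *
      (|(p : ℝ)| ^ 1 * Real.exp (-(π * y / (2 * k)) * p ^ 2 + 0 * |(p : ℝ)|)) := by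
    rw [starDerivIm_eq, norm_mul, norm_neg, norm_div, norm_one, Complex.norm_real,
      Real.norm_of_nonneg (by positivity), Complex.norm_conj, unaryCoeff, norm_mul, norm_thetaExp,
      Complex.norm_intCast, pow_one]
    gcongr
  have h2 : ‖starDerivHol k τ p‖ ≤ π / (2 * k) *
      (|(p : ℝ)| ^ 2 * Real.exp (-(π * y / (2 * k)) * p ^ 2 + 0 * |(p : ℝ)|)) := by
    rw [starDerivHol, norm_mul, norm_neg]
    have e : ‖(2 * π * I * ((p : ℂ) ^ 2 / (4 * k)) : ℂ)‖ = π / (2 * k) * |(p : ℝ)| ^ 2 := by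
      simp [abs_of_pos Real.pi_pos]
      ring
    rw [e, mul_assoc]
    gcongr
    exact (norm_starTerm_le hk (hy.trans hτ) p).trans hexp
  have h3 : ‖(Complex.ofRealCLM.comp Complex.imCLM : ℂ →L[ℝ] ℂ)‖ ≤ 1 := by
    refine ContinuousLinearMap.opNorm_le_bound _ zero_le_one fun x => ?_
    simpa using Complex.abs_im_le_norm x
  have h4 : ‖(ContinuousLinearMap.id ℝ ℂ)‖ ≤ 1 := ContinuousLinearMap.norm_id_le
  rw [starDeriv]
  refine (norm_add_le _ _).trans (add_le_add ?_ ?_)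
  · rw [norm_smul]
    exact (mul_le_of_le_one_right (norm_nonneg _) h3).trans h1
  · rw [norm_smul]
    exact (mul_le_of_le_one_right (norm_nonneg _) h4).trans h2

/-- The derivatives are summable uniformly above a fixed height. The combination `F'(1) + i F'(i)`
annihilates the complex linear part of each term and retains `i` times the derivative of the error
function in `τ₂`. -/
lemma hasFDerivAt_residueSum_starTerm (hk : k ≠ 0) (r : ℤ) {τ : ℂ} (hτ : 0 < τ.im) :
    ∃ F' : ℂ →L[ℝ] ℂ, HasFDerivAt (fun t => residueSum k (starTerm k t) r) F' τ ∧
      (1 / 2) * (F' 1 + I * F' I) =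
        -(I / (2 * (√(τ.im / k) * k : ℝ))) * conj (unaryTheta k r τ) := by
  have hkR : 0 < (k : ℝ) := by positivity
  set y := τ.im / 2 with hy
  have hy0 : 0 < y := by positivity
  have hyτ : y < τ.im := by rw [hy]; linarith
  have hc : 0 < π * y / (2 * k) := by positivity
  have hu := ((summable_pow_mul_gaussian 1 0 hc).mul_left (1 / (√(y / k) * k))).add
    ((summable_pow_mul_gaussian 2 0 hc).mul_left (π / (2 * k)))
  have hb : ∀ t : ℂ, y < t.im → ∀ p : ℤ, ‖if (2 * k : ℤ) ∣ p - r then starDeriv k t p else 0‖ ≤ _ :=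
    fun t ht p => (show _ ≤ ‖starDeriv k t p‖ by split_ifs; exacts [le_rfl, by simp]).trans
      (norm_starDeriv_le hk hy0 ht p)
  have hd := hasFDerivAt_tsum_of_isPreconnected (𝕜 := ℝ)
    (f := fun (p : ℤ) t => if (2 * k : ℤ) ∣ p - r then starTerm k t p else 0)
    (f' := fun p t => if (2 * k : ℤ) ∣ p - r then starDeriv k t p else 0) (s := {t : ℂ | y < t.im})
    (x₀ := τ) (x := τ) hu (isOpen_lt continuous_const Complex.continuous_im)
    (convex_halfSpace_im_gt y).isPreconnected
    (fun p t ht => by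
      split_ifs
      · exact hasFDerivAt_starTerm hk (hy0.trans ht) p
      · exact hasFDerivAt_const _ _) (fun p t ht => hb t ht p) hyτ
    ((summable_starTerm hk hτ).norm.of_norm_bounded fun p => by
      split_ifs
      · exact le_rfl
      · simp) hyτ
  refine ⟨_, hd, ?_⟩
  have hs : Summable fun p : ℤ => if (2 * k : ℤ) ∣ p - r then starDeriv k τ p else 0 :=
    hu.of_norm_bounded (hb τ hyτ)
  have happ : ∀ v : ℂ, (∑' p : ℤ, if (2 * k : ℤ) ∣ p - r then starDeriv k τ p else 0) v =
      ∑' p : ℤ, (if (2 * k : ℤ) ∣ p - r then starDeriv k τ p else 0) v := fun v =>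
    (ContinuousLinearMap.apply ℝ ℂ v).map_tsum hs
  have hsv : ∀ v : ℂ, Summable fun p : ℤ => (if (2 * k : ℤ) ∣ p - r then starDeriv k τ p else 0) v :=
    fun v => (ContinuousLinearMap.apply ℝ ℂ v).summable hs
  rw [happ, happ, ← tsum_mul_left, ← (hsv 1).tsum_add ((hsv I).mul_left I), ← tsum_mul_left,
    unaryTheta_eq_residueSum hk, residueSum, Complex.conj_tsum, ← tsum_mul_left]
  refine tsum_congr fun p => ?_
  split_ifs
  · simp only [starDeriv, add_apply, smul_apply, smul_eq_mul,
      ContinuousLinearMap.comp_apply, Complex.imCLM_apply, Complex.ofRealCLM_apply, Complex.one_im,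
      Complex.I_im, ContinuousLinearMap.id_apply, starDerivIm_eq]
    have hI : I * I = -1 := I_mul_I
    push_cast
    field_simp
    linear_combination (k * starDerivHol k τ p) * hI
  · simp

lemma differentiableAt_unaryThetaStar (hk : k ≠ 0) (r : ℤ) {τ : ℂ} (hτ : 0 < τ.im) :
    DifferentiableAt ℝ (unaryThetaStar k r) τ ∧
      (√(4 * π * τ.im) : ℝ) * dbar (unaryThetaStar k r) τ =
        -(2 * π * I) * conj (unaryTheta k r τ) := by
  have hkR : 0 < (k : ℝ) := by positivity
  obtain ⟨F', hF, hF'⟩ := hasFDerivAt_residueSum_starTerm hk r hτ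
  have he : unaryThetaStar k r =ᶠ[𝓝 τ]
      fun t => (√(4 * π * k) : ℝ) * residueSum k (starTerm k t) r := by
    filter_upwards [isOpen_upperHalfPlane.mem_nhds hτ] with t ht
    exact unaryThetaStar_eq_residueSum hk r ht
  have hd := (hF.differentiableAt.const_mul ((√(4 * π * k) : ℝ) : ℂ))
  refine ⟨hd.congr_of_eventuallyEq he, ?_⟩
  rw [dbar_congr he, dbar_mul_left (differentiableAt_const _) hF.differentiableAt,
    dbar_eq_of_hasFDerivAt hF, hF', ← mul_assoc, ← mul_assoc]
  congr 1
  have h1 : √(4 * π * τ.im) * √(4 * π * k) = 4 * π * (√(τ.im / k) * k) := by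
    rw [← Real.sqrt_mul (by positivity), show 4 * π * τ.im * (4 * π * k) =
      (4 * π * k) ^ 2 * (τ.im / k) by field_simp, Real.sqrt_mul (by positivity),
      Real.sqrt_sq (by positivity)]
    ring
  have h2 : (√(4 * π * τ.im) : ℂ) * (√(4 * π * k) : ℝ) = 4 * π * ((√(τ.im / k) * k : ℝ) : ℂ) := by
    exact_mod_cast h1
  have h3 : ((√(τ.im / k) * k : ℝ) : ℂ) ≠ 0 := by
    have : 0 < √(τ.im / k) * k := by positivity
    exact_mod_cast this.ne'
  rw [h2]
  generalize ((√(τ.im / k) * k : ℝ) : ℂ) = s at *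
  field_simp
  ring

theorem dbar_eta_cube_mul_muADETilde (Y : ADE) {τ z : ℂ} (hτ : 0 < τ.im)
    (hz : ∀ m n : ℤ, z ≠ m * τ + n) :
    DifferentiableAt ℝ (fun t => ModularForm.eta t ^ 3 * muADETilde Y t z z 0) τ ∧
      (√(4 * π * τ.im) : ℝ) *
          dbar (fun t => ModularForm.eta t ^ 3 * muADETilde Y t z z 0) τ =
        -2 * π * I * (-(1 / (√(16 * π * Y.coxeter) : ℝ)) *
          ∑ r : Fin (2 * Y.coxeter), ∑ r' : Fin (2 * Y.coxeter),
            Y.omega r r' * unaryTheta Y.coxeter r τ * conj (unaryTheta Y.coxeter r' τ)) := by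
  have hk := Y.coxeter_ne_zero
  have he : (fun t => ModularForm.eta t ^ 3 * muADETilde Y t z z 0) =ᶠ[𝓝 τ] fun t =>
      ModularForm.eta t ^ 3 * muADE Y t z z 0 - ∑ j : Fin (2 * Y.coxeter), ∑ j' : Fin (2 * Y.coxeter),
          (1 / (√(16 * π * Y.coxeter) : ℝ) * Y.omega j j' * unaryTheta Y.coxeter j t) *
            unaryThetaStar Y.coxeter j' t := by
    filter_upwards [isOpen_upperHalfPlane.mem_nhds hτ] with t ht
    rw [eta_cube_mul_muADETilde_eq Y ht, Finset.mul_sum]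
    congr 1
    refine Finset.sum_congr rfl fun j _ => ?_
    rw [Finset.mul_sum]
    exact Finset.sum_congr rfl fun j' _ => by ring
  have key : ∀ G : ℂ × ℂ → ℂ, DifferentiableOn ℂ G {p | 0 < p.1.im ∧ ∀ m n : ℤ, p.2 ≠ m * p.1 + n} →
      DifferentiableAt ℂ (fun t => G (t, z)) τ := fun G hG =>
    (hG.differentiableAt (x := (τ, z)) (isOpen_setOf_not_lattice.mem_nhds ⟨hτ, hz⟩)).comp τ
      (f := fun t => (t, z)) (by fun_prop)
  have hhol : DifferentiableAt ℂ (fun t => ModularForm.eta t ^ 3 * muADE Y t z z 0) τ :=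
    key _ (differentiableOn_eta_cube_mul_muADE Y)
  have hf : ∀ j j' : Fin (2 * Y.coxeter), DifferentiableAt ℂ (fun t =>
      1 / (√(16 * π * Y.coxeter) : ℝ) * Y.omega j j' * unaryTheta Y.coxeter j t) τ := fun j j' =>
    ((differentiableOn_unaryTheta hk _).differentiableAt (isOpen_upperHalfPlane.mem_nhds hτ)).const_mul _
  have hfg : ∀ j j' : Fin (2 * Y.coxeter), DifferentiableAt ℝ (fun t =>
      (1 / (√(16 * π * Y.coxeter) : ℝ) * Y.omega j j' * unaryTheta Y.coxeter j t) *
        unaryThetaStar Y.coxeter j' t) τ := fun j j' =>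
    ((hf j j').restrictScalars ℝ).mul (differentiableAt_unaryThetaStar hk _ hτ).1
  have hsum : DifferentiableAt ℝ (fun t => ∑ j : Fin (2 * Y.coxeter), ∑ j' : Fin (2 * Y.coxeter),
      (1 / (√(16 * π * Y.coxeter) : ℝ) * Y.omega j j' * unaryTheta Y.coxeter j t) *
        unaryThetaStar Y.coxeter j' t) τ :=
    DifferentiableAt.fun_sum fun j _ => DifferentiableAt.fun_sum fun j' _ => hfg j j'
  refine ⟨((hhol.restrictScalars ℝ).sub hsum).congr_of_eventuallyEq he, ?_⟩
  rw [dbar_congr he, dbar_sub (hhol.restrictScalars ℝ) hsum, dbar_of_differentiableAt hhol,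
    dbar_sum _ fun j _ => DifferentiableAt.fun_sum fun j' _ => hfg j j', zero_sub, mul_neg,
    Finset.mul_sum, Finset.mul_sum, Finset.mul_sum, ← Finset.sum_neg_distrib]
  refine Finset.sum_congr rfl fun j _ => ?_
  rw [dbar_sum _ fun j' _ => hfg j j', Finset.mul_sum, Finset.mul_sum, Finset.mul_sum,
    ← Finset.sum_neg_distrib]
  refine Finset.sum_congr rfl fun j' _ => ?_
  rw [dbar_mul_left (hf j j') (differentiableAt_unaryThetaStar hk _ hτ).1]
  linear_combination -(1 / ((√(16 * π * Y.coxeter) : ℝ) : ℂ) * Y.omega j j' *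
    unaryTheta Y.coxeter j τ) * (differentiableAt_unaryThetaStar hk (j' : ℕ) hτ).2

variable {k : ℕ}

/-! ### The finite Fourier kernel -/

/-- The additive character `m ↦ exp (-2πi m / 2k)`. -/
def fourierPhase (k : ℕ) (m : ℤ) : ℂ := exp (-(2 * π * I * ((m : ℂ) / (2 * k))))

lemma fourierPhase_add (k : ℕ) (m n : ℤ) :
    fourierPhase k (m + n) = fourierPhase k m * fourierPhase k n := by
  rw [fourierPhase, fourierPhase, fourierPhase, ← Complex.exp_add]
  congr 1
  push_cast
  ring

lemma fourierPhase_eq_one_iff (hk : k ≠ 0) (m : ℤ) : fourierPhase k m = 1 ↔ (2 * k : ℤ) ∣ m := by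
  have hk' : (2 * k : ℂ) ≠ 0 := by
    have : (k : ℂ) ≠ 0 := by exact_mod_cast hk
    simpa using this
  rw [fourierPhase, ← mul_neg, exp_two_pi_I_mul_eq_one_iff]
  constructor
  · rintro ⟨n, hn⟩
    refine ⟨-n, ?_⟩
    have : (m : ℂ) = 2 * k * (-n) := by
      rw [← hn]; field_simp
    exact_mod_cast this
  · rintro ⟨n, rfl⟩
    refine ⟨-n, ?_⟩
    push_cast
    field_simp

lemma fourierPhase_congr (hk : k ≠ 0) {m n : ℤ} (h : (2 * k : ℤ) ∣ m - n) :
    fourierPhase k m = fourierPhase k n := by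
  rw [show m = n + (m - n) by ring, fourierPhase_add, (fourierPhase_eq_one_iff hk _).2 h, mul_one]

lemma sum_fin_shift {n : ℕ} (hn : n ≠ 0) {f : ℤ → ℂ} (hf : ∀ r m : ℤ, f (r + n * m) = f r) (h : ℤ) :
    ∑ s : Fin n, f ((s : ℕ) + h) = ∑ s : Fin n, f (s : ℕ) := by
  have h1 : ∀ c : ℕ, ∑ s ∈ Finset.range n, f ((s : ℕ) + c) = ∑ s ∈ Finset.range n, f (s : ℕ) := by
    intro c
    induction c with
    | zero => simp
    | succ c ih =>
      rw [← ih]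
      have h2 := Finset.sum_range_succ (fun s : ℕ => f ((s : ℕ) + c)) n
      rw [Finset.sum_range_succ'] at h2
      have h3 : f ((n : ℕ) + c) = f ((0 : ℕ) + c) := by
        have := hf c 1
        rw [mul_one, add_comm] at this
        rw [this, Nat.cast_zero, zero_add]
      rw [h3] at h2
      have h4 := add_right_cancel h2
      rw [← h4]
      refine Finset.sum_congr rfl fun s _ => ?_
      congr 1
      push_cast
      ring
  have hn' : (n : ℤ) ≠ 0 := by exact_mod_cast hn
  obtain ⟨c, hc⟩ := Int.eq_ofNat_of_zero_le (Int.emod_nonneg h hn')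
  have h5 : ∀ s : ℕ, f (s + h) = f (s + c) := fun s => by
    rw [← hf (s + c) (h / n), ← hc, add_assoc, Int.emod_add_mul_ediv]
  rw [Fin.sum_univ_eq_sum_range (fun s : ℕ => f (s + h)), Fin.sum_univ_eq_sum_range (fun s : ℕ => f s),
    ← h1 c]
  exact Finset.sum_congr rfl fun s _ => h5 s

section commute

variable {d e : ℕ}

/-- The entries of the product of the Fourier kernel and `Ω^{(de,d)}`. -/
def fourierOmega (d e : ℕ) (r t : ℤ) : ℂ :=
  ∑ s : Fin (2 * (d * e)), fourierPhase (d * e) (r * (s : ℕ)) * omegaDiv (d * e) d (s : ℕ) t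

lemma sum_shift_two_mul (hd : d ≠ 0) (he : e ≠ 0) {f : ℤ → ℂ}
    (hf : ∀ r m : ℤ, f (r + 2 * (d * e : ℕ) * m) = f r) (h : ℤ) :
    ∑ s : Fin (2 * (d * e)), f ((s : ℕ) + h) = ∑ s : Fin (2 * (d * e)), f (s : ℕ) :=
  sum_fin_shift (n := 2 * (d * e)) (by simp [hd, he]) (fun r m => by
    rw [← hf r m]; push_cast; rfl) h

/-- Row side: translating `s` by `2 lcm(d, e)` preserves the conditions on `s` but multiplies the
phase by a nontrivial root of unity unless `gcd(d, e)` divides `r`. Column side: `s + t ∈ 2dℤ` and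
`s - t ∈ 2eℤ` already force `gcd(d, e) ∣ t`. -/
lemma fourierOmega_eq_zero (hd : d ≠ 0) (he : e ≠ 0) {r : ℤ} (hr : ¬ ((Int.gcd d e : ℕ) : ℤ) ∣ r) (t : ℤ) :
    fourierOmega d e r t = 0 ∧ fourierOmega d e t r = 0 := by
  have hk : d * e ≠ 0 := mul_ne_zero hd he
  set g := Int.gcd d e with hg
  obtain ⟨d', hd'⟩ : (g : ℤ) ∣ d := Int.gcd_dvd_left _ _
  obtain ⟨e', he'⟩ : (g : ℤ) ∣ e := Int.gcd_dvd_right _ _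
  constructor
  -- This is `2 lcm(d, e)`.
  · set h : ℤ := 2 * g * d' * e' with hh
    have h1 : (2 * d : ℤ) ∣ h := ⟨e', by rw [hh, hd']; ring⟩
    have h2 : (2 * e : ℤ) ∣ h := ⟨d', by rw [hh, he']; ring⟩
    have hne : fourierPhase (d * e) (r * h) ≠ 1 := by
      rw [Ne, fourierPhase_eq_one_iff hk]
      rintro ⟨c, hc⟩
      refine hr ⟨c, ?_⟩
      have hd0 : (d : ℤ) ≠ 0 := by exact_mod_cast hd
      have he0 : (e' : ℤ) ≠ 0 := by
        rintro rfl
        exact he (by exact_mod_cast (by rw [he', mul_zero] : (e : ℤ) = 0))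
      have : (2 * d * e' : ℤ) * r = 2 * d * e' * (g * c) := by
        rw [show (2 * d * e' : ℤ) * r = r * h by rw [hh, hd']; ring, hc]
        push_cast
        rw [he']
        ring
      exact mul_left_cancel₀ (mul_ne_zero (mul_ne_zero two_ne_zero hd0) he0) this
    set f : ℤ → ℂ := fun s => fourierPhase (d * e) (r * s) * omegaDiv (d * e) d s t with hf
    have hper : ∀ s m : ℤ, f (s + 2 * (d * e : ℕ) * m) = f s := fun s m => by
      rw [hf]
      simp only
      rw [omegaDiv_add_left hd, fourierPhase_congr hk (m := r * (s + 2 * (d * e : ℕ) * m)) (n := r * s)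
        ⟨r * m, by ring⟩]
    have hsh : ∀ s : ℤ, f (s + h) = fourierPhase (d * e) (r * h) * f s := fun s => by
      rw [hf]
      simp only
      rw [mul_add, fourierPhase_add, omegaDiv_mul hd, omegaDiv_mul hd,
        show s + h + t = s + t + h by ring, show s + h - t = s - t + h by ring,
        if_congr (and_congr (dvd_add_left h1) (dvd_add_left h2)) rfl rfl]
      ring
    have h3 := sum_shift_two_mul hd he hper h
    simp only [hsh] at h3
    rw [← Finset.mul_sum] at h3
    have h4 : (fourierPhase (d * e) (r * h) - 1) * ∑ s : Fin (2 * (d * e)), f (s : ℕ) = 0 := by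
      rw [sub_mul, h3, one_mul, sub_self]
    exact (mul_eq_zero.1 h4).resolve_left (sub_ne_zero.2 hne)
  · refine Finset.sum_eq_zero fun s _ => ?_
    rw [omegaDiv_mul hd, if_neg, mul_zero]
    rintro ⟨⟨x, hx⟩, ⟨y, hy⟩⟩
    refine hr ⟨d' * x - e' * y, ?_⟩
    have : 2 * r = 2 * (g * (d' * x - e' * y)) := by
      have h1 : 2 * r = 2 * d * x - 2 * e * y := by rw [← hx, ← hy]; ring
      rw [h1]
      linear_combination 2 * x * hd' - 2 * y * he'
    exact mul_left_cancel₀ two_ne_zero this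

/-- Away from multiples of the gcd both sides vanish. Otherwise write `r = dx + ey`, `t = du + ev`:
on the support `s ≡ du - ev` modulo `2d` and `2e`, so the phase is constantly that of `(dx + ey)(du
- ev)`, and this product is symmetric in the two pairs modulo `2de`. -/
lemma fourierOmega_comm (hd : d ≠ 0) (he : e ≠ 0) (r t : ℤ) :
    fourierOmega d e r t = fourierOmega d e t r := by
  have hk : d * e ≠ 0 := mul_ne_zero hd he
  by_cases hr : ((Int.gcd d e : ℕ) : ℤ) ∣ r
  swap
  · rw [(fourierOmega_eq_zero hd he hr t).1, (fourierOmega_eq_zero hd he hr t).2]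
  by_cases ht : ((Int.gcd d e : ℕ) : ℤ) ∣ t
  swap
  · rw [(fourierOmega_eq_zero hd he ht r).1, (fourierOmega_eq_zero hd he ht r).2]
  have hrep : ∀ r : ℤ, ((Int.gcd d e : ℕ) : ℤ) ∣ r → ∃ x y : ℤ, r = d * x + e * y := by
    rintro _ ⟨c, rfl⟩
    rw [Int.gcd_eq_gcd_ab]
    exact ⟨Int.gcdA d e * c, Int.gcdB d e * c, by ring⟩
  obtain ⟨x, y, rfl⟩ := hrep r hr
  obtain ⟨u, v, rfl⟩ := hrep t ht
  set J : ℤ → ℂ := fun m => if (2 * d : ℤ) ∣ m ∧ (2 * e : ℤ) ∣ m then 1 else 0 with hJ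
  have hJper : ∀ r m : ℤ, J (r + 2 * (d * e : ℕ) * m) = J r := fun r m => by
    rw [hJ]
    simp only
    exact if_congr (and_congr (dvd_add_left ⟨e * m, by push_cast; ring⟩)
      (dvd_add_left ⟨d * m, by push_cast; ring⟩)) rfl rfl
  have key : ∀ x y u v : ℤ, fourierOmega d e (d * x + e * y) (d * u + e * v) =
      fourierPhase (d * e) ((d * x + e * y) * (d * u - e * v)) * ∑ s : Fin (2 * (d * e)), J (s : ℕ) := by
    intro x y u v
    rw [← sum_shift_two_mul hd he hJper (-(d * u - e * v)), Finset.mul_sum]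
    refine Finset.sum_congr rfl fun s _ => ?_
    rw [omegaDiv_mul hd, hJ]
    simp only
    have e1 : (2 * d : ℤ) ∣ ((s : ℕ) : ℤ) + (d * u + e * v) ↔
        (2 * d : ℤ) ∣ ((s : ℕ) : ℤ) + -(d * u - e * v) := by
      rw [show ((s : ℕ) : ℤ) + (d * u + e * v) = ((s : ℕ) : ℤ) + -(d * u - e * v) + 2 * d * u by ring]
      exact dvd_add_left ⟨u, rfl⟩
    have e2 : (2 * e : ℤ) ∣ ((s : ℕ) : ℤ) - (d * u + e * v) ↔
        (2 * e : ℤ) ∣ ((s : ℕ) : ℤ) + -(d * u - e * v) := by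
      rw [show ((s : ℕ) : ℤ) - (d * u + e * v) = ((s : ℕ) : ℤ) + -(d * u - e * v) + 2 * e * (-v) by ring]
      exact dvd_add_left ⟨-v, rfl⟩
    rw [if_congr (and_congr e1 e2) rfl rfl]
    split_ifs with h
    · obtain ⟨⟨α, hα⟩, ⟨β, hβ⟩⟩ := h
      rw [mul_one, mul_one]
      refine fourierPhase_congr hk ⟨x * β + y * α, ?_⟩
      push_cast
      linear_combination d * x * hβ + e * y * hα
    · simp
  rw [key, key]
  congr 1
  refine fourierPhase_congr hk ⟨y * u - x * v, ?_⟩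
  push_cast
  ring

end commute

/-- The matrix `Ω^Y` indexed by `ℤ/2k`. -/
def ADE.omegaMatrix (Y : ADE) : Matrix (Fin (2 * Y.coxeter)) (Fin (2 * Y.coxeter)) ℂ :=
  Matrix.of fun r s => Y.omega (r : ℕ) (s : ℕ)

/-- The finite Fourier matrix. -/
def fourierMatrix (k : ℕ) : Matrix (Fin (2 * k)) (Fin (2 * k)) ℂ :=
  Matrix.of fun r s => fourierPhase k ((r : ℕ) * (s : ℕ))

/-- Both matrices are symmetric, so they commute as soon as their product is symmetric, which is
checked divisor by divisor. -/
lemma ADE.commute_fourierMatrix (Y : ADE) : Commute (fourierMatrix Y.coxeter) Y.omegaMatrix := by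
  have key : ∀ r t : Fin (2 * Y.coxeter), ∑ s : Fin (2 * Y.coxeter),
      fourierPhase Y.coxeter ((r : ℕ) * (s : ℕ)) * Y.omega (s : ℕ) (t : ℕ) =
      ∑ d ∈ Y.divisorSet, fourierOmega d (Y.coxeter / d) (r : ℕ) (t : ℕ) := by
    intro r t
    simp only [Y.omega_eq_sum, Finset.mul_sum]
    rw [Finset.sum_comm]
    refine Finset.sum_congr rfl fun d hd => ?_
    rw [fourierOmega, Y.mul_div_coxeter hd]
  ext r t
  rw [Matrix.mul_apply, Matrix.mul_apply]
  simp only [fourierMatrix, ADE.omegaMatrix, Matrix.of_apply]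
  rw [key]
  have h2 : ∑ s : Fin (2 * Y.coxeter), Y.omega (r : ℕ) (s : ℕ) * fourierPhase Y.coxeter ((s : ℕ) * (t : ℕ)) =
      ∑ s : Fin (2 * Y.coxeter), fourierPhase Y.coxeter ((t : ℕ) * (s : ℕ)) * Y.omega (s : ℕ) (r : ℕ) :=
    Finset.sum_congr rfl fun s _ => by rw [mul_comm, Y.omega_comm, mul_comm ((s : ℕ) : ℤ)]
  rw [h2, key]
  refine Finset.sum_congr rfl fun d hd => ?_
  obtain ⟨h1, h2⟩ := Y.ne_zero_of_mem hd
  exact fourierOmega_comm h1 h2 _ _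

/-- It is a Vandermonde matrix whose nodes are the distinct `2k`-th roots of unity. -/
lemma isUnit_fourierMatrix (hk : k ≠ 0) : IsUnit (fourierMatrix k) := by
  have h : fourierMatrix k = Matrix.vandermonde fun r : Fin (2 * k) => fourierPhase k (r : ℕ) := by
    ext r s
    rw [fourierMatrix, Matrix.of_apply, Matrix.vandermonde_apply, fourierPhase, fourierPhase,
      ← Complex.exp_nat_mul]
    congr 1
    push_cast
    ring
  rw [Matrix.isUnit_iff_isUnit_det, isUnit_iff_ne_zero, h, Matrix.det_vandermonde_ne_zero_iff]
  intro r s hrs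
  have h1 : fourierPhase k ((r : ℕ) - (s : ℕ) : ℤ) = 1 := by
    have h2 : fourierPhase k ((r : ℕ) - (s : ℕ) : ℤ) * fourierPhase k (s : ℕ) = fourierPhase k (s : ℕ) := by
      rw [← fourierPhase_add, sub_add_cancel]
      exact hrs
    exact mul_eq_right₀ (Complex.exp_ne_zero _) |>.1 h2
  rw [fourierPhase_eq_one_iff hk] at h1
  have h3 := Int.eq_zero_of_abs_lt_dvd h1 (by
    have := r.2
    have := s.2
    rw [abs_lt]
    constructor <;> omega)
  exact Fin.ext (by omega)

/-! ### Transformation of the unary theta functions under the generators -/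

lemma im_neg_one_div_pos {τ : ℂ} (hτ : 0 < τ.im) : 0 < (-1 / τ).im := by
  have h : τ ≠ 0 := fun h => by simp [h] at hτ
  rw [neg_div, one_div, neg_im, inv_im, neg_div, neg_neg]
  exact div_pos hτ (normSq_pos.2 h)

lemma sum_fourierPhase_mul_residueSum (hk : k ≠ 0) (r : ℤ) {G : ℤ → ℂ} (hG : Summable G) :
    ∑ s : Fin (2 * k), fourierPhase k (r * (s : ℕ)) * residueSum k G (s : ℕ) =
      ∑' p : ℤ, fourierPhase k (r * p) * G p := by
  have hs : ∀ s : Fin (2 * k), Summable fun p : ℤ =>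
      fourierPhase k (r * (s : ℕ)) * if (2 * k : ℤ) ∣ p - (s : ℕ) then G p else 0 := fun s =>
    (hG.norm.of_norm_bounded (f := fun p : ℤ => if (2 * k : ℤ) ∣ p - (s : ℕ) then G p else 0) fun p => by
      split_ifs
      · exact le_rfl
      · simp).mul_left _
  simp only [residueSum, ← tsum_mul_left]
  rw [← Summable.tsum_finsetSum fun s _ => hs s]
  refine tsum_congr fun p => ?_
  have h := sum_fin_ite hk (f := fun s => fourierPhase k (r * s)) (fun s m =>
    fourierPhase_congr hk ⟨r * m, by ring⟩) p
  rw [← h, Finset.sum_mul]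
  refine Finset.sum_congr rfl fun s _ => ?_
  split_ifs <;> simp

/-- The unary theta function is the derivative at `z = 0` of a Jacobi theta function, so the law
follows by differentiating the functional equation. -/
lemma unaryTheta_S (hk : k ≠ 0) (r : ℤ) {τ : ℂ} (hτ : 0 < τ.im) :
    unaryTheta k r (-1 / τ) = τ * (-I * τ / (2 * k)) ^ (1 / 2 : ℂ) *
      ∑ s : Fin (2 * k), fourierPhase k (r * (s : ℕ)) * unaryTheta k (s : ℕ) τ := by
  have hkC : (k : ℂ) ≠ 0 := by exact_mod_cast hk
  have hτ0 : τ ≠ 0 := fun h => by simp [h] at hτ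
  have hp : (2 * π * I : ℂ) ≠ 0 := Complex.two_pi_I_ne_zero
  have him : 0 < (τ / (2 * k)).im := by
    rw [show τ / (2 * k : ℂ) = τ / ((2 * k : ℕ) : ℂ) by push_cast; rfl, Complex.div_natCast_im]
    positivity
  set c : ℂ := (-I * τ / (2 * k)) ^ (1 / 2 : ℂ) with hc
  have hc0 : c ≠ 0 := by
    rw [hc, Ne, Complex.cpow_eq_zero_iff]
    rintro ⟨h, -⟩
    have : -I * τ / (2 * k) ≠ 0 := by
      simp [hτ0, hkC]
    exact this h
  -- The shift by `r / 2k` at modulus `τ / 2k` puts the phases on the untransformed side and the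
  -- residue class `r` on the transformed side. The Gaussian prefactor is stationary at `z = 0` and
  -- drops out of the derivative.
  have hG : ∀ z : ℂ, jacobiTheta₂ (z - r / (2 * k)) (τ / (2 * k)) =
      1 / c * exp (-(2 * π * I * (k * z ^ 2 / τ))) * levelTheta k r (-1 / τ) (z / τ) := by
    intro z
    rw [jacobiTheta₂_functional_equation, levelTheta_eq_jacobiTheta₂ hk, ← mul_div_assoc, ← hc,
      show (z - r / (2 * k)) / (τ / (2 * k)) = 2 * k * (z / τ) + r * (-1 / τ) by field_simp; ring,
      show -1 / (τ / (2 * k)) = 2 * k * (-1 / τ) by field_simp, mul_assoc (1 / c), mul_assoc (1 / c),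
      ← mul_assoc (exp _) (exp _), ← Complex.exp_add]
    congr 4
    field_simp
    ring
  have h1 : HasDerivAt (fun z : ℂ => jacobiTheta₂ (z - r / (2 * k)) (τ / (2 * k)))
      (jacobiTheta₂' (-(r / (2 * k))) (τ / (2 * k))) 0 := by
    have := hasDerivAt_jacobiTheta₂_fst (0 - r / (2 * k)) him
    rw [zero_sub] at this
    have h2 : HasDerivAt (fun z : ℂ => z - r / (2 * k)) 1 0 := (hasDerivAt_id 0).sub_const _
    have h3 := HasDerivAt.comp (h₂ := (jacobiTheta₂ · (τ / (2 * k)))) (0 : ℂ)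
      (by rw [zero_sub]; exact this) h2
    simpa using! h3
  have h2 : HasDerivAt (fun z : ℂ => jacobiTheta₂ (z - r / (2 * k)) (τ / (2 * k)))
      (1 / c * (2 * π * I * unaryTheta k r (-1 / τ) * (1 / τ))) 0 := by
    have e1 : HasDerivAt (fun z : ℂ => levelTheta k r (-1 / τ) (z / τ))
        (2 * π * I * unaryTheta k r (-1 / τ) * (1 / τ)) 0 := by
      have := hasDerivAt_levelTheta_zero hk r (im_neg_one_div_pos hτ)
      refine HasDerivAt.comp (h₂ := levelTheta k r (-1 / τ)) (0 : ℂ) (by rw [zero_div]; exact this)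
        ((hasDerivAt_id (0 : ℂ)).div_const τ)
    have e2 : HasDerivAt (fun z : ℂ => exp (-(2 * π * I * (k * z ^ 2 / τ)))) 0 0 := by
      have := (((((hasDerivAt_pow 2 (0 : ℂ)).const_mul (k : ℂ)).div_const τ).const_mul (2 * π * I)).fun_neg).cexp
      refine this.congr_deriv ?_
      simp
    have e3 := (e2.fun_mul e1).const_mul (1 / c)
    refine (e3.congr_of_eventuallyEq (Eventually.of_forall fun z => ?_)).congr_deriv ?_
    · rw [hG]
      ring
    · simp
  have h3 := h1.unique h2
  have h4 : jacobiTheta₂' (-(r / (2 * k))) (τ / (2 * k)) =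
      2 * π * I * ∑ s : Fin (2 * k), fourierPhase k (r * (s : ℕ)) * unaryTheta k (s : ℕ) τ := by
    simp only [unaryTheta_eq_residueSum hk]
    rw [sum_fourierPhase_mul_residueSum hk r (summable_unaryCoeff hk hτ), jacobiTheta₂', ← tsum_mul_left]
    refine tsum_congr fun n => ?_
    rw [jacobiTheta₂'_term, jacobiTheta₂_term, fourierPhase, unaryCoeff, thetaExp, mul_left_comm _ (n : ℂ),
      ← Complex.exp_add, mul_assoc]
    congr 3
    push_cast
    field_simp
    ring
  rw [h4] at h3
  generalize ∑ s : Fin (2 * k), fourierPhase k (r * (s : ℕ)) * unaryTheta k (s : ℕ) τ = A at *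
  field_simp at h3
  rw [neg_div, ← h3]
  ring

lemma unaryTheta_T (hk : k ≠ 0) (r : ℤ) (τ : ℂ) :
    unaryTheta k r (τ + 1) = exp (2 * π * I * ((r : ℂ) ^ 2 / (4 * k))) * unaryTheta k r τ := by
  have hkC : (k : ℂ) ≠ 0 := by exact_mod_cast hk
  rw [unaryTheta, unaryTheta, ← tsum_mul_left]
  refine tsum_congr fun n => ?_
  have e : 2 * π * I * (((2 * k * n + r : ℤ) : ℂ) ^ 2 / (4 * k)) * (τ + 1) =
      2 * π * I * ((r : ℂ) ^ 2 / (4 * k)) + 2 * π * I * (((2 * k * n + r : ℤ) : ℂ) ^ 2 / (4 * k)) * τ +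
        2 * π * I * ((k * n ^ 2 + n * r : ℤ) : ℂ) := by
    push_cast
    field_simp
    ring
  rw [e, Complex.exp_add, Complex.exp_add, exp_two_pi_I_mul_int]
  ring

/-! ### The Dedekind eta function -/

/-- Even and odd `m` in Jacobi's series each give `S_{2,1}`. Hence the transformation laws of `η³`
are instances of those of the unary theta functions. -/
lemma unaryTheta_two_one {τ : ℂ} (hτ : 0 < τ.im) : unaryTheta 2 1 τ = ModularForm.eta τ ^ 3 := by
  have h := tsum_mul_oddThetaCoeff hτ
  have h1 : ∑' n : ℤ, (2 * (((0 : ℕ) + (2 : ℕ) * n : ℤ) : ℂ) + 1) * oddThetaCoeff τ ((0 : ℕ) + (2 : ℕ) * n) =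
      I * unaryTheta 2 1 τ := by
    rw [unaryTheta, ← tsum_mul_left]
    refine tsum_congr fun n => ?_
    rw [Nat.cast_zero, zero_add, Nat.cast_ofNat, oddThetaCoeff, Even.neg_one_zpow (even_two_mul n), mul_one]
    push_cast
    rw [mul_left_comm]
    ring_nf
  have h2 : ∑' n : ℤ, (2 * (((1 : ℕ) + (2 : ℕ) * n : ℤ) : ℂ) + 1) * oddThetaCoeff τ ((1 : ℕ) + (2 : ℕ) * n) =
      I * unaryTheta 2 1 τ := by
    rw [unaryTheta, ← tsum_mul_left, ← (Equiv.subLeft (-1 : ℤ)).tsum_eq]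
    refine tsum_congr fun n => ?_
    rw [Nat.cast_one, add_comm (1 : ℤ), Nat.cast_ofNat, oddThetaCoeff, Odd.neg_one_zpow (odd_two_mul_add_one _)]
    simp only [Equiv.subLeft_apply]
    push_cast
    ring_nf
  have h3 := tsum_range_add_mul (N := 2) two_ne_zero
    (f := fun m => (2 * (m : ℂ) + 1) * oddThetaCoeff τ m) (by
      refine (((summable_oddThetaCoeff_mul hτ 1 0).mul_left 2).add
        (summable_oddThetaCoeff_mul hτ 0 0)).of_norm_bounded fun m => ?_
      have h4 : ‖2 * (m : ℂ) + 1‖ ≤ 2 * |(m : ℝ)| + 1 := by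
        refine (norm_add_le _ _).trans_eq ?_
        rw [norm_mul, Complex.norm_intCast, Complex.norm_ofNat, norm_one]
      rw [norm_mul, zero_mul, Real.exp_zero, pow_one, pow_zero]
      nlinarith [norm_nonneg (oddThetaCoeff τ m)])
  rw [h, Finset.sum_range_succ, Finset.sum_range_one, h1, h2] at h3
  have hI : (2 * I : ℂ) ≠ 0 := mul_ne_zero two_ne_zero I_ne_zero
  refine mul_left_cancel₀ hI ?_
  rw [← h3]
  ring

lemma ofReal_mul_cpow {a : ℝ} (ha : 0 < a) {z : ℂ} (hz : z ≠ 0) (s : ℂ) :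
    (a * z : ℂ) ^ s = (a : ℂ) ^ s * z ^ s := by
  have ha' : (a : ℂ) ≠ 0 := by exact_mod_cast ha.ne'
  rw [cpow_def_of_ne_zero (mul_ne_zero ha' hz), cpow_def_of_ne_zero ha', cpow_def_of_ne_zero hz,
    Complex.log_ofReal_mul ha hz, ← Complex.exp_add, Complex.ofReal_log ha.le, add_mul]

lemma eta_cube_T {τ : ℂ} (hτ : 0 < τ.im) :
    ModularForm.eta (τ + 1) ^ 3 = exp (π * I / 4) * ModularForm.eta τ ^ 3 := by
  rw [← unaryTheta_two_one (by simpa using hτ), ← unaryTheta_two_one hτ, unaryTheta_T two_ne_zero]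
  congr 2
  push_cast
  ring

lemma eta_cube_S {τ : ℂ} (hτ : 0 < τ.im) :
    ModularForm.eta (-1 / τ) ^ 3 = -I * τ * (-I * τ) ^ (1 / 2 : ℂ) * ModularForm.eta τ ^ 3 := by
  rw [← unaryTheta_two_one (im_neg_one_div_pos hτ), ← unaryTheta_two_one hτ, unaryTheta_S two_ne_zero 1 hτ]
  -- Modulo `4` oddness and periodicity leave a single independent function: the classes `0` and `2`
  -- vanish and the class `3` is the negative of the class `1`.
  have h0 : unaryTheta 2 0 τ = 0 := by
    have := unaryTheta_neg (k := 2) two_ne_zero 0 τ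
    rw [neg_zero] at this
    linear_combination this / 2
  have hper : ∀ r : ℤ, unaryTheta 2 (r + 4) τ = unaryTheta 2 r τ := fun r => by
    rw [unaryTheta_eq_residueSum two_ne_zero, unaryTheta_eq_residueSum two_ne_zero,
      show r + 4 = r + 2 * (2 : ℕ) * 1 by norm_num, residueSum_add]
  have h2 : unaryTheta 2 2 τ = 0 := by
    have h1 := unaryTheta_neg (k := 2) two_ne_zero 2 τ
    have h3 := hper (-2)
    norm_num at h3
    rw [← h3] at h1
    linear_combination h1 / 2
  have h3 : unaryTheta 2 3 τ = -unaryTheta 2 1 τ := by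
    have h1 := unaryTheta_neg (k := 2) two_ne_zero 1 τ
    rw [← h1, ← hper (-1)]
    norm_num
  have hsq : (-I * τ / (2 * (2 : ℕ))) ^ (1 / 2 : ℂ) = (-I * τ) ^ (1 / 2 : ℂ) / 2 := by
    have e : -I * τ / (2 * (2 : ℕ)) = ((1 / 4 : ℝ) : ℂ) * (-I * τ) := by push_cast; ring
    rw [e, ofReal_mul_cpow (by norm_num) (by simpa using fun h : τ = 0 => by simp [h] at hτ)]
    have : (((1 / 4 : ℝ) : ℂ)) ^ (1 / 2 : ℂ) = 1 / 2 := by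
      rw [show (1 / 2 : ℂ) = ((1 / 2 : ℝ) : ℂ) by push_cast; rfl, ← Complex.ofReal_cpow (by norm_num),
        ← Real.sqrt_eq_rpow, show (1 / 4 : ℝ) = (1 / 2) ^ 2 by norm_num, Real.sqrt_sq (by norm_num)]
    rw [this]
    ring
  have p1 : fourierPhase 2 1 = -I := by
    rw [fourierPhase, show -(2 * π * I * (((1 : ℤ) : ℂ) / (2 * (2 : ℕ)))) = -(π / 2 * I) by push_cast; ring,
      Complex.exp_neg, Complex.exp_pi_div_two_mul_I, Complex.inv_I]
  have p3 : fourierPhase 2 3 = I := by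
    rw [show (3 : ℤ) = 1 + (1 + 1) by norm_num, fourierPhase_add, fourierPhase_add, p1]
    linear_combination -I * I_mul_I
  rw [hsq]
  simp only [Fin.sum_univ_succ, Fin.sum_univ_zero, Nat.reduceMul, Fin.val_zero, Fin.val_succ, Nat.cast_zero,
    one_mul, zero_add, Nat.reduceAdd, Nat.cast_one, Nat.cast_ofNat, h0, h2, h3, p1, p3, mul_zero, add_zero]
  ring

/-! ### Modularity of the unary theta functions -/

lemma mobius_mul (γ₁ γ₂ : SL(2, ℤ)) {τ : ℂ} (hτ : 0 < τ.im) :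
    mobius (γ₁ * γ₂) τ = mobius γ₁ (mobius γ₂ τ) := by
  have h := mul_smul γ₁ γ₂ (⟨τ, hτ⟩ : UpperHalfPlane)
  rw [coe_smul_eq_mobius, coe_smul_eq_mobius, coe_smul_eq_mobius] at h
  exact congrArg UpperHalfPlane.coe h

lemma automorphyFactor_mul (γ₁ γ₂ : SL(2, ℤ)) {τ : ℂ} (hτ : 0 < τ.im) :
    ((γ₁ * γ₂) 1 0 : ℂ) * τ + (γ₁ * γ₂) 1 1 =
      ((γ₁ 1 0 : ℂ) * mobius γ₂ τ + γ₁ 1 1) * ((γ₂ 1 0 : ℂ) * τ + γ₂ 1 1) := by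
  have h := automorphyFactor_ne_zero γ₂ hτ
  rw [mobius, add_mul, mul_assoc, div_mul_cancel₀ _ h]
  simp only [Matrix.SpecialLinearGroup.coe_mul, Matrix.mul_apply, Fin.sum_univ_two]
  push_cast
  ring

lemma mobius_one (τ : ℂ) : mobius 1 τ = τ := by simp [mobius]

lemma mobius_S (τ : ℂ) : mobius ModularGroup.S τ = -1 / τ := by
  simp [mobius, ModularGroup.S]

lemma mobius_T (τ : ℂ) : mobius ModularGroup.T τ = τ + 1 := by
  simp [mobius, ModularGroup.T]

lemma differentiableOn_mobius (γ : SL(2, ℤ)) : DifferentiableOn ℂ (mobius γ) {τ | 0 < τ.im} := by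
  intro τ hτ
  have h := automorphyFactor_ne_zero γ hτ
  unfold mobius
  fun_prop (disch := exact h)

/-- The vector of unary theta functions. -/
def unaryVector (k : ℕ) (τ : ℂ) : Fin (2 * k) → ℂ := fun r => unaryTheta k (r : ℕ) τ

/-- The unary theta functions transform under `γ` by a matrix commuting with `Ω^Y` and a continuous
branch of `(cτ + d) ^ (3/2)`. -/
def UnaryMultiplier (Y : ADE) (γ : SL(2, ℤ)) : Prop :=
  ∃ φ : ℂ → ℂ, ContinuousOn φ {τ | 0 < τ.im} ∧
    (∀ τ : ℂ, 0 < τ.im → φ τ ^ 2 = ((γ 1 0 : ℂ) * τ + γ 1 1) ^ 3) ∧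
    ∃ M : (Matrix (Fin (2 * Y.coxeter)) (Fin (2 * Y.coxeter)) ℂ)ˣ, Commute (M : Matrix _ _ ℂ) Y.omegaMatrix ∧
      ∀ τ : ℂ, 0 < τ.im → unaryVector Y.coxeter (mobius γ τ) =
        φ τ • (M : Matrix _ _ ℂ).mulVec (unaryVector Y.coxeter τ)

variable (Y : ADE)

lemma unaryMultiplier_one : UnaryMultiplier Y 1 := by
  refine ⟨fun _ => 1, continuousOn_const, fun τ _ => ?_, 1, Commute.one_left _, fun τ _ => ?_⟩
  · simp
  · rw [mobius_one, Units.val_one, Matrix.one_mulVec, one_smul]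

variable {Y} in
lemma UnaryMultiplier.mul {γ₁ γ₂ : SL(2, ℤ)} (h₁ : UnaryMultiplier Y γ₁) (h₂ : UnaryMultiplier Y γ₂) :
    UnaryMultiplier Y (γ₁ * γ₂) := by
  obtain ⟨φ₁, c₁, s₁, M₁, k₁, e₁⟩ := h₁
  obtain ⟨φ₂, c₂, s₂, M₂, k₂, e₂⟩ := h₂
  refine ⟨fun τ => φ₁ (mobius γ₂ τ) * φ₂ τ, ?_, fun τ hτ => ?_, M₁ * M₂, ?_, fun τ hτ => ?_⟩
  · exact (c₁.comp (differentiableOn_mobius γ₂).continuousOn fun τ hτ => im_mobius_pos γ₂ hτ).mul c₂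
  · rw [mul_pow, s₁ _ (im_mobius_pos γ₂ hτ), s₂ τ hτ, automorphyFactor_mul γ₁ γ₂ hτ, mul_pow]
  · rw [Units.val_mul]
    exact k₁.mul_left k₂
  · rw [mobius_mul γ₁ γ₂ hτ, e₁ _ (im_mobius_pos γ₂ hτ), e₂ τ hτ, Matrix.mulVec_smul, smul_smul,
      Matrix.mulVec_mulVec, Units.val_mul]

variable {Y} in
lemma UnaryMultiplier.inv {γ : SL(2, ℤ)} (h : UnaryMultiplier Y γ) : UnaryMultiplier Y γ⁻¹ := by
  obtain ⟨φ, c, s, M, k, e⟩ := h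
  have hj : ∀ τ : ℂ, 0 < τ.im → ((γ 1 0 : ℂ) * mobius γ⁻¹ τ + γ 1 1) * ((γ⁻¹ 1 0 : ℂ) * τ + γ⁻¹ 1 1) = 1 :=
    fun τ hτ => by
      rw [← automorphyFactor_mul γ γ⁻¹ hτ, mul_inv_cancel]
      simp
  have hφ : ∀ τ : ℂ, 0 < τ.im → φ (mobius γ⁻¹ τ) ≠ 0 := fun τ hτ h0 => by
    have := s _ (im_mobius_pos γ⁻¹ hτ)
    rw [h0, zero_pow two_ne_zero] at this
    exact pow_ne_zero 3 (automorphyFactor_ne_zero γ (im_mobius_pos γ⁻¹ hτ)) this.symm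
  refine ⟨fun τ => (φ (mobius γ⁻¹ τ))⁻¹, ?_, fun τ hτ => ?_, M⁻¹, ?_, fun τ hτ => ?_⟩
  · exact (c.comp (differentiableOn_mobius γ⁻¹).continuousOn fun τ hτ => im_mobius_pos γ⁻¹ hτ).inv₀
      fun τ hτ => hφ τ hτ
  · rw [inv_pow, s _ (im_mobius_pos γ⁻¹ hτ), ← inv_pow, inv_eq_of_mul_eq_one_right (hj τ hτ)]
  · exact k.units_inv_left
  · have h1 := e _ (im_mobius_pos γ⁻¹ hτ)
    rw [← mobius_mul γ γ⁻¹ hτ, mul_inv_cancel, mobius_one] at h1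
    rw [h1, Matrix.mulVec_smul, smul_smul, Matrix.mulVec_mulVec, inv_mul_cancel₀ (hφ τ hτ), one_smul,
      Units.inv_mul, Matrix.one_mulVec]

/-- Where `Ω^{(de,d)}` is nonzero, `r² - s² = (r + s)(r - s)` is divisible by `4de`, so the
eigenvalues of `T` at `r` and `s` agree. -/
lemma ADE.omega_mul_exp (r s : ℤ) :
    exp (2 * π * I * ((r : ℂ) ^ 2 / (4 * Y.coxeter))) * Y.omega r s =
      Y.omega r s * exp (2 * π * I * ((s : ℂ) ^ 2 / (4 * Y.coxeter))) := by
  rw [Y.omega_eq_sum, Finset.mul_sum, Finset.sum_mul]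
  refine Finset.sum_congr rfl fun d hd => ?_
  obtain ⟨h1, h2⟩ := Y.ne_zero_of_mem hd
  rw [← Y.mul_div_coxeter hd, omegaDiv_mul h1]
  generalize Y.coxeter / d = e at *
  split_ifs with h
  · obtain ⟨⟨x, hx⟩, ⟨y, hy⟩⟩ := h
    have hdC : (d : ℂ) ≠ 0 := by exact_mod_cast h1
    have heC : (e : ℂ) ≠ 0 := by exact_mod_cast h2
    have h3 : ((r : ℂ) + s) * (r - s) = 4 * (d * e) * (x * y) := by
      have : ((r + s : ℤ) : ℂ) * ((r - s : ℤ) : ℂ) = 4 * (d * e) * (x * y) := by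
        rw [hx, hy]
        push_cast
        ring
      exact_mod_cast this
    have h4 : 2 * π * I * ((r : ℂ) ^ 2 / (4 * (d * e : ℕ))) =
        2 * π * I * ((s : ℂ) ^ 2 / (4 * (d * e : ℕ))) + 2 * π * I * ((x * y : ℤ) : ℂ) := by
      push_cast
      field_simp
      linear_combination h3
    rw [h4, Complex.exp_add, exp_two_pi_I_mul_int]
    ring
  · rw [mul_zero, zero_mul]

lemma unaryMultiplier_T : UnaryMultiplier Y ModularGroup.T := by
  have hk := Y.coxeter_ne_zero
  set D : Fin (2 * Y.coxeter) → ℂ := fun r => exp (2 * π * I * (((r : ℕ) : ℂ) ^ 2 / (4 * Y.coxeter))) with hD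
  have hu : IsUnit (Matrix.diagonal D) := by
    rw [Matrix.isUnit_diagonal, Pi.isUnit_iff]
    exact fun r => (Complex.exp_ne_zero _).isUnit
  refine ⟨fun _ => 1, continuousOn_const, fun τ _ => ?_, hu.unit, ?_, fun τ hτ => ?_⟩
  · simp [ModularGroup.T]
  · rw [IsUnit.unit_spec, commute_iff_eq]
    ext r s
    rw [Matrix.diagonal_mul, Matrix.mul_diagonal]
    simpa [hD, ADE.omegaMatrix] using Y.omega_mul_exp (r : ℕ) (s : ℕ)
  · rw [mobius_T, one_smul, IsUnit.unit_spec]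
    funext r
    rw [Matrix.mulVec_diagonal, unaryVector, unaryVector, unaryTheta_T hk]
    simp [hD]

lemma unaryMultiplier_S : UnaryMultiplier Y ModularGroup.S := by
  have hk := Y.coxeter_ne_zero
  set k := Y.coxeter with hk'
  have hkC : (k : ℂ) ≠ 0 := by exact_mod_cast hk
  -- Normalised so that `c² τ² (-iτ / 2k) = τ³`, which makes the automorphy factor a square root of
  -- `(cτ + d)³` for `S`.
  set c : ℂ := (2 * k * I) ^ (1 / 2 : ℂ) with hc
  have hsq : ∀ x : ℂ, (x ^ (1 / 2 : ℂ)) ^ 2 = x := fun x => by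
    rw [← Complex.cpow_nat_mul]
    simp
  have hc2 : c ^ 2 = 2 * k * I := hsq _
  have hc0 : c ≠ 0 := fun h => by
    rw [h, zero_pow two_ne_zero] at hc2
    simp [hkC] at hc2
  have hu : IsUnit (c⁻¹ • fourierMatrix k) := by
    rw [Matrix.isUnit_iff_isUnit_det, Matrix.det_smul]
    exact ((inv_ne_zero hc0).isUnit.pow _).mul ((Matrix.isUnit_iff_isUnit_det _).1 (isUnit_fourierMatrix hk))
  refine ⟨fun τ => c * (τ * (-I * τ / (2 * k)) ^ (1 / 2 : ℂ)), ?_, fun τ _ => ?_, hu.unit, ?_, fun τ hτ => ?_⟩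
  · refine continuousOn_const.mul (continuousOn_id.mul (ContinuousOn.cpow (by fun_prop) continuousOn_const ?_))
    intro τ hτ
    refine Or.inl ?_
    rw [show -I * τ / (2 * k) = -I * τ / ((2 * k : ℕ) : ℂ) by push_cast; rfl, Complex.div_natCast_re]
    have : 0 < τ.im := hτ
    refine div_pos (by simpa using this) (by positivity)
  · rw [mul_pow, mul_pow, hc2, hsq]
    simp only [ModularGroup.S]
    simp
    field_simp
    linear_combination -τ ^ 3 * I_mul_I
  · rw [IsUnit.unit_spec]
    exact Y.commute_fourierMatrix.smul_left _
  · rw [mobius_S, IsUnit.unit_spec]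
    funext r
    rw [unaryVector, unaryTheta_S hk _ hτ, Pi.smul_apply, Matrix.smul_mulVec, Pi.smul_apply, smul_eq_mul,
      smul_eq_mul, ← mul_assoc, mul_right_comm c, mul_inv_cancel₀ hc0, one_mul]
    rfl

lemma unaryMultiplier (γ : SL(2, ℤ)) : UnaryMultiplier Y γ := by
  have h : γ ∈ Subgroup.closure {ModularGroup.S, ModularGroup.T} := by
    rw [SpecialLinearGroup.SL2Z_generators]
    trivial
  induction h using Subgroup.closure_induction with
  | mem x hx =>
    rcases hx with rfl | rfl
    · exact unaryMultiplier_S Y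
    · exact unaryMultiplier_T Y
  | one => exact unaryMultiplier_one Y
  | mul x y _ _ hx hy => exact hx.mul hy
  | inv x _ hx => exact hx.inv

lemma continuousOn_automorphyFactor_cpow (γ : SL(2, ℤ)) (s : ℂ) :
    ContinuousOn (fun τ : ℂ => ((γ 1 0 : ℂ) * τ + γ 1 1) ^ s) {τ | 0 < τ.im} := by
  by_cases h : γ 1 0 = 0
  · simp only [h, Int.cast_zero, zero_mul, zero_add]
    exact continuousOn_const
  · refine ContinuousOn.cpow (by fun_prop) continuousOn_const fun τ hτ => Or.inr ?_
    have h1 : 0 < τ.im := hτ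
    simp [h, h1.ne']

/-- The factor built from generators and the principal power `(cτ + d) ^ (3/2)` are continuous
square roots of one nonvanishing function on the connected half plane, so they differ by a global
sign, absorbed in the matrix. No cocycle for half-integral weight has to be tracked. -/
lemma exists_unaryVector_mobius (γ : SL(2, ℤ)) :
    ∃ M : (Matrix (Fin (2 * Y.coxeter)) (Fin (2 * Y.coxeter)) ℂ)ˣ, Commute (M : Matrix _ _ ℂ) Y.omegaMatrix ∧
      ∀ τ : ℂ, 0 < τ.im → unaryVector Y.coxeter (mobius γ τ) =
        ((γ 1 0 : ℂ) * τ + γ 1 1) ^ (3 / 2 : ℂ) • (M : Matrix _ _ ℂ).mulVec (unaryVector Y.coxeter τ) := by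
  obtain ⟨φ, c, s, M, k, e⟩ := unaryMultiplier Y γ
  have hS : IsPreconnected {τ : ℂ | 0 < τ.im} := (convex_halfSpace_im_gt 0).isPreconnected
  rcases hS.eq_or_eq_neg_of_sq_eq c (continuousOn_automorphyFactor_cpow γ (3 / 2)) (fun τ hτ => by
    rw [Pi.pow_apply, Pi.pow_apply, s τ hτ, ← Complex.cpow_nat_mul]
    norm_num) (fun {τ} hτ => by
    rw [Ne, Complex.cpow_eq_zero_iff]
    exact fun h => automorphyFactor_ne_zero γ hτ h.1) with h | h
  · exact ⟨M, k, fun τ hτ => by rw [e τ hτ, h hτ]⟩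
  · refine ⟨-M, by rw [Units.val_neg]; exact k.neg_left, fun τ hτ => ?_⟩
    rw [e τ hτ, h hτ, Units.val_neg, Matrix.neg_mulVec, Pi.neg_apply, neg_smul, smul_neg]

lemma isVectorModularForm_unaryTheta (Γ : Subgroup SL(2, ℤ)) :
    IsVectorModularForm Γ (3 / 2) fun (r : Fin (2 * Y.coxeter)) τ => unaryTheta Y.coxeter r τ := by
  have hk := Y.coxeter_ne_zero
  refine ⟨fun r => differentiableOn_unaryTheta hk r, fun r => polynomialGrowth_unaryTheta hk r, fun γ _ => ?_⟩
  obtain ⟨M, -, h⟩ := exists_unaryVector_mobius Y γ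
  refine ⟨M, fun τ hτ r => ?_⟩
  have := congrFun (h τ hτ) r
  push_cast
  exact this

/-- Because the transformation matrix commutes with `Ω^Y`, the same matrix serves for the image
under `Ω^Y`, even where `Ω^Y` is singular. -/
lemma isVectorModularForm_omega_unaryTheta (Γ : Subgroup SL(2, ℤ)) (c : ℂ) :
    IsVectorModularForm Γ (3 / 2) fun (r : Fin (2 * Y.coxeter)) τ =>
      c * ∑ r' : Fin (2 * Y.coxeter), Y.omega r r' * unaryTheta Y.coxeter r' τ := by
  have hk := Y.coxeter_ne_zero
  refine ⟨fun r => ?_, fun r => ?_, fun γ _ => ?_⟩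
  · exact (DifferentiableOn.fun_sum fun s _ => (differentiableOn_unaryTheta hk _).const_mul _).const_mul c
  · exact (PolynomialGrowth.sum _ fun s _ => (polynomialGrowth_unaryTheta hk _).const_mul _).const_mul c
  obtain ⟨M, hM, h⟩ := exists_unaryVector_mobius Y γ
  have hv : ∀ (τ : ℂ) (r : Fin (2 * Y.coxeter)),
      c * ∑ r' : Fin (2 * Y.coxeter), Y.omega r r' * unaryTheta Y.coxeter r' τ =
        c * Y.omegaMatrix.mulVec (unaryVector Y.coxeter τ) r := fun τ r => rfl
  refine ⟨M, fun τ hτ r => ?_⟩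
  simp only [hv]
  rw [h τ hτ, Matrix.mulVec_smul, Matrix.mulVec_mulVec, ← hM.eq, ← Matrix.mulVec_mulVec, Pi.smul_apply,
    smul_eq_mul, Matrix.mulVec, dotProduct]
  simp only [Finset.mul_sum]
  push_cast
  refine Finset.sum_congr rfl fun s _ => ?_
  ring

/-! ### Linearity of the Eichler integral -/

section eichler
variable {k : ℕ}

lemma norm_unaryTheta_add_mul_I_le (hk : k ≠ 0) (r : ℤ) {τ : ℂ} (hτ : 0 < τ.im) {t : ℝ} (ht : 0 ≤ t) :
    ‖unaryTheta k r (τ + t * I)‖ ≤ (∑' p : ℤ, ‖unaryCoeff k τ p‖) * Real.exp (-(π / (2 * k)) * t) := by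
  have hkR : (0 : ℝ) < k := by positivity
  have hs := (summable_unaryCoeff hk hτ).norm
  rw [unaryTheta_eq_residueSum hk, residueSum, ← tsum_mul_right]
  refine tsum_of_norm_bounded (hs.mul_right _).hasSum fun p => ?_
  refine (show ‖if (2 * k : ℤ) ∣ p - r then unaryCoeff k (τ + t * I) p else 0‖ ≤
    ‖unaryCoeff k (τ + t * I) p‖ by split_ifs <;> simp).trans ?_
  rw [unaryCoeff, unaryCoeff, norm_mul, norm_mul, norm_thetaExp, norm_thetaExp, mul_assoc, ← Real.exp_add]
  rcases eq_or_ne p 0 with rfl | hp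
  · simp
  refine mul_le_mul_of_nonneg_left (Real.exp_le_exp.2 ?_) (norm_nonneg _)
  have hp2 : (1 : ℝ) ≤ (p : ℝ) ^ 2 := by
    have : (1 : ℤ) ≤ p ^ 2 := by have := sq_nonneg p; have := pow_ne_zero 2 hp; omega
    exact_mod_cast this
  have him : (τ + t * I).im = τ.im + t := by simp
  have h2 : 0 ≤ π / (2 * k) * t * ((p : ℝ) ^ 2 - 1) :=
    mul_nonneg (by positivity) (by linarith)
  rw [him]
  have : -(π * (τ.im + t) / (2 * k)) * (p : ℝ) ^ 2 =
      -(π * τ.im / (2 * k)) * (p : ℝ) ^ 2 + -(π / (2 * k)) * t - π / (2 * k) * t * ((p : ℝ) ^ 2 - 1) := by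
    field_simp
    ring
  linarith

lemma integrableOn_eichlerIntegrand_unaryTheta (hk : k ≠ 0) (r : ℤ) {τ : ℂ} (hτ : 0 < τ.im) :
    IntegrableOn (fun t : ℝ => (((√(2 * τ.im + t))⁻¹ : ℝ) : ℂ) * conj (unaryTheta k r (τ + t * I)))
      (Set.Ioi 0) := by
  have hb : 0 < π / (2 * k) := by positivity
  have h1 := ((exp_neg_integrableOn_Ioi 0 hb).const_mul
    ((√(2 * τ.im))⁻¹ * ∑' p : ℤ, ‖unaryCoeff k τ p‖))
  refine Integrable.mono' h1 ?_ ?_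
  · refine ContinuousOn.aestronglyMeasurable ?_ measurableSet_Ioi
    refine ContinuousOn.mul ?_ (Complex.continuous_conj.comp_continuousOn ?_)
    · refine Complex.continuous_ofReal.comp_continuousOn (ContinuousOn.inv₀ (by fun_prop) fun t ht => ?_)
      have : (0 : ℝ) < t := ht
      exact (Real.sqrt_pos.2 (by positivity)).ne'
    · refine (differentiableOn_unaryTheta hk r).continuousOn.comp (by fun_prop) fun t ht => ?_
      have : (0 : ℝ) < t := ht
      simp only [Set.mem_ofPred_eq, add_im, mul_im, ofReal_re, I_im, mul_one, ofReal_im, I_re, mul_zero, add_zero]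
      positivity
  · refine (ae_restrict_iff' measurableSet_Ioi).2 (Eventually.of_forall fun t ht => ?_)
    have ht' : (0 : ℝ) < t := ht
    rw [norm_mul, RCLike.norm_conj, Complex.norm_real, Real.norm_of_nonneg (by positivity), mul_assoc]
    refine mul_le_mul ?_ (norm_unaryTheta_add_mul_I_le hk r hτ ht'.le) (norm_nonneg _) (by positivity)
    exact inv_anti₀ (by positivity) (Real.sqrt_le_sqrt (by linarith))

lemma eichlerIntegral_half_sum {ι : Type*} [Fintype ι] (c : ι → ℂ) (r : ι → ℤ) (hk : k ≠ 0) {τ : ℂ}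
    (hτ : 0 < τ.im) :
    eichlerIntegral (1 / 2) (fun τ => ∑ i, c i * unaryTheta k (r i) τ) τ =
      ∑ i, conj (c i) * unaryThetaStar k (r i) τ := by
  have h1 : ∀ t : ℝ, (((√(2 * τ.im + t))⁻¹ : ℝ) : ℂ) * conj (∑ i, c i * unaryTheta k (r i) (τ + t * I)) =
      ∑ i, conj (c i) *
        ((((√(2 * τ.im + t))⁻¹ : ℝ) : ℂ) * conj (unaryTheta k (r i) (τ + t * I))) := fun t => by
    rw [map_sum, Finset.mul_sum]
    refine Finset.sum_congr rfl fun i _ => ?_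
    rw [map_mul]
    ring
  rw [eichlerIntegral_half _ hτ]
  simp only [h1]
  rw [integral_finsetSum _ fun i _ => (integrableOn_eichlerIntegrand_unaryTheta hk (r i) hτ).const_mul _,
    Finset.mul_sum]
  refine Finset.sum_congr rfl fun i _ => ?_
  rw [integral_const_mul, unaryThetaStar, eichlerIntegral_half _ hτ]
  ring

end eichler

variable (Y : ADE)

lemma ADE.conj_omega (r s : ℤ) : conj (Y.omega r s) = Y.omega r s := by
  rw [Y.omega_eq_sum, map_sum]
  refine Finset.sum_congr rfl fun d _ => ?_
  rw [omegaDiv]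
  split_ifs <;> simp

lemma eichlerIntegral_omega_unaryTheta (r : ℤ) (c : ℝ) {τ : ℂ} (hτ : 0 < τ.im) :
    eichlerIntegral (1 / 2) (fun τ => (c : ℂ) *
        ∑ r' : Fin (2 * Y.coxeter), Y.omega r r' * unaryTheta Y.coxeter r' τ) τ =
      c * ∑ r' : Fin (2 * Y.coxeter), Y.omega r r' * unaryThetaStar Y.coxeter r' τ := by
  have h := eichlerIntegral_half_sum (k := Y.coxeter)
    (fun r' : Fin (2 * Y.coxeter) => (c : ℂ) * Y.omega r (r' : ℕ)) (fun r' => ((r' : ℕ) : ℤ)) Y.coxeter_ne_zero hτ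
  simp only [mul_assoc, ← Finset.mul_sum, map_mul, Complex.conj_ofReal, Y.conj_omega] at h
  exact h

/-! ### The completed function at torsion points -/

/-- Since `γ ≡ 1` modulo `N`, the row vector `(a, b)γ` differs from `(a, b)` by a multiple of `N`,
so the torsion point moves by a lattice vector. -/
lemma torsion_mobius {N : ℕ} (hN : 0 < N) (a b : ℤ) {γ : SL(2, ℤ)} (hγ : γ ∈ CongruenceSubgroup.Gamma N) :
    ∃ m n : ℤ, ∀ τ : ℂ, 0 < τ.im → (a * mobius γ τ + b) / N =
      ((a * τ + b) / N + (m * τ + n)) / ((γ 1 0 : ℂ) * τ + γ 1 1) := by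
  have hN' : (N : ℂ) ≠ 0 := by exact_mod_cast hN.ne'
  obtain ⟨h1, h2, h3, h4⟩ := CongruenceSubgroup.Gamma_mem.1 hγ
  have h1' : (N : ℤ) ∣ γ 0 0 - 1 := by
    rw [← ZMod.intCast_eq_intCast_iff_dvd_sub]; simpa using h1.symm
  have h4' : (N : ℤ) ∣ γ 1 1 - 1 := by
    rw [← ZMod.intCast_eq_intCast_iff_dvd_sub]; simpa using h4.symm
  obtain ⟨x, hx⟩ := h1'
  obtain ⟨v, hv⟩ := h4'
  obtain ⟨y, hy⟩ := (ZMod.intCast_zmod_eq_zero_iff_dvd _ _).1 h2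
  obtain ⟨u, hu⟩ := (ZMod.intCast_zmod_eq_zero_iff_dvd _ _).1 h3
  refine ⟨a * x + b * u, a * y + b * v, fun τ hτ => ?_⟩
  have hj := automorphyFactor_ne_zero γ hτ
  have hxC : (γ 0 0 : ℂ) - 1 = N * x := by exact_mod_cast congrArg (Int.cast : ℤ → ℂ) hx
  have hvC : (γ 1 1 : ℂ) - 1 = N * v := by exact_mod_cast congrArg (Int.cast : ℤ → ℂ) hv
  have hyC : (γ 0 1 : ℂ) = N * y := by exact_mod_cast congrArg (Int.cast : ℤ → ℂ) hy
  have huC : (γ 1 0 : ℂ) = N * u := by exact_mod_cast congrArg (Int.cast : ℤ → ℂ) hu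
  rw [mobius, eq_div_iff hj, div_mul_eq_mul_div, add_mul, ← mul_div_assoc, div_mul_cancel₀ _ hj, div_eq_iff hN',
    add_mul, div_mul_cancel₀ _ hN']
  push_cast
  linear_combination a * τ * hxC + a * hyC + b * τ * huC + b * hvC

lemma eta_cube_mul_muADETilde_torsion_mobius {N : ℕ} {a b : ℤ} (hN : 0 < N)
    (hab : ¬((N : ℤ) ∣ a ∧ (N : ℤ) ∣ b)) {γ : SL(2, ℤ)} (hγ : γ ∈ CongruenceSubgroup.Gamma N) {τ : ℂ}
    (hτ : 0 < τ.im) :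
    ModularForm.eta (mobius γ τ) ^ 3 * muADETilde Y (mobius γ τ) ((a * mobius γ τ + b) / N)
        ((a * mobius γ τ + b) / N) 0 =
      ((γ 1 0 : ℂ) * τ + γ 1 1) ^ 2 *
        (ModularForm.eta τ ^ 3 * muADETilde Y τ ((a * τ + b) / N) ((a * τ + b) / N) 0) := by
  obtain ⟨m, n, h⟩ := torsion_mobius hN a b hγ
  have hz := torsion_not_lattice hN hab hτ
  rw [h τ hτ, eta_cube_mul_muADETilde_mobius γ Y hτ (not_lattice_add hz m n), muADETilde_add_lattice Y hτ hz]

lemma eta_cube_mul_muADE_add_eichlerIntegral {τ : ℂ} (hτ : 0 < τ.im) (z : ℂ) :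
    ModularForm.eta τ ^ 3 * muADE Y τ z z 0 + ∑ r : Fin (2 * Y.coxeter), unaryTheta Y.coxeter r τ *
        eichlerIntegral (1 / 2) (fun τ => -(1 / (√(16 * π * Y.coxeter) : ℝ)) *
          ∑ r' : Fin (2 * Y.coxeter), Y.omega r r' * unaryTheta Y.coxeter r' τ) τ =
      ModularForm.eta τ ^ 3 * muADETilde Y τ z z 0 := by
  rw [eta_cube_mul_muADETilde_eq Y hτ z, sub_eq_add_neg, ← neg_mul, Finset.mul_sum]
  congr 1
  refine Finset.sum_congr rfl fun r _ => ?_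
  have h := eichlerIntegral_omega_unaryTheta Y (r : ℕ) (-(1 / √(16 * π * Y.coxeter))) hτ
  push_cast at h ⊢
  rw [h, Finset.mul_sum, Finset.mul_sum, Finset.mul_sum]
  refine Finset.sum_congr rfl fun s _ => ?_
  ring

lemma isMixedMockModularForm_eta_cube_mul_muADE {N : ℕ} {a b : ℤ} (hN : 0 < N)
    (hab : ¬((N : ℤ) ∣ a ∧ (N : ℤ) ∣ b)) :
    IsMixedMockModularForm (CongruenceSubgroup.Gamma N) 2 (3 / 2)
      (fun τ => ModularForm.eta τ ^ 3 * muADE Y τ ((a * τ + b) / N) ((a * τ + b) / N) 0)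
      (fun (r : Fin (2 * Y.coxeter)) τ => unaryTheta Y.coxeter r τ)
      (fun (r : Fin (2 * Y.coxeter)) τ => -(1 / (√(16 * π * Y.coxeter) : ℝ)) *
        ∑ r' : Fin (2 * Y.coxeter), Y.omega r r' * unaryTheta Y.coxeter r' τ) where
  holomorphic := differentiableOn_eta_cube_mul_muADE_torsion Y hN hab
  growth := polynomialGrowth_eta_cube_mul_muADE Y hN hab
  modular_f := isVectorModularForm_unaryTheta Y _
  modular_g := by
    rw [show (2 - (((2 : ℤ) : ℝ) - 3 / 2) : ℝ) = 3 / 2 by norm_num]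
    exact isVectorModularForm_omega_unaryTheta Y _ _
  transform := fun γ hγ τ hτ => by
    rw [show (((2 : ℤ) : ℝ) - 3 / 2 : ℝ) = 1 / 2 by norm_num,
      eta_cube_mul_muADE_add_eichlerIntegral Y hτ,
      eta_cube_mul_muADE_add_eichlerIntegral Y (im_mobius_pos γ hτ),
      eta_cube_mul_muADETilde_torsion_mobius Y hN hab hγ hτ]
    norm_cast

/-! ### Transformation under the generators -/

variable {τ z : ℂ}

lemma eta_cube_mul_muADETilde_T (hτ : 0 < τ.im) (hz : ∀ m n : ℤ, z ≠ m * τ + n) :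
    ModularForm.eta (τ + 1) ^ 3 * muADETilde Y (τ + 1) z z 0 = ModularForm.eta τ ^ 3 * muADETilde Y τ z z 0 := by
  have h := eta_cube_mul_muADETilde_mobius ModularGroup.T Y hτ hz
  rw [mobius_T] at h
  simpa [ModularGroup.T] using h

lemma eta_cube_mul_muADETilde_S (hτ : 0 < τ.im) (hz : ∀ m n : ℤ, z ≠ m * τ + n) :
    ModularForm.eta (-1 / τ) ^ 3 * muADETilde Y (-1 / τ) (z / τ) (z / τ) 0 =
      τ ^ 2 * (ModularForm.eta τ ^ 3 * muADETilde Y τ z z 0) := by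
  have h := eta_cube_mul_muADETilde_mobius ModularGroup.S Y hτ hz
  rw [mobius_S] at h
  have e : (ModularGroup.S 1 0 : ℂ) * τ + ModularGroup.S 1 1 = τ := by simp [ModularGroup.S]
  rwa [e] at h

lemma muADETilde_T (hτ : 0 < τ.im) (hz : ∀ m n : ℤ, z ≠ m * τ + n) :
    muADETilde Y (τ + 1) z z 0 = exp (-(π * I / 4)) * muADETilde Y τ z z 0 := by
  have h := eta_cube_mul_muADETilde_T Y hτ hz
  have hη := pow_ne_zero 3 (eta_ne_zero hτ)
  rw [eta_cube_T hτ] at h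
  rw [Complex.exp_neg, eq_inv_mul_iff_mul_eq₀ (Complex.exp_ne_zero _)]
  refine mul_left_cancel₀ hη ?_
  rw [← h]
  ring

/-- With `s² = -iτ`, dividing the weight two factor `τ²` by the factor `-iτ s` of `η³` gives `-s`.
-/
lemma muADETilde_S (hτ : 0 < τ.im) (hz : ∀ m n : ℤ, z ≠ m * τ + n) :
    muADETilde Y (-1 / τ) (z / τ) (z / τ) 0 = -((-I * τ) ^ (1 / 2 : ℂ)) * muADETilde Y τ z z 0 := by
  have h := eta_cube_mul_muADETilde_S Y hτ hz
  have hη := pow_ne_zero 3 (eta_ne_zero hτ)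
  have hτ0 : τ ≠ 0 := fun h => by simp [h] at hτ
  have hs : ((-I * τ) ^ (1 / 2 : ℂ)) ^ 2 = -I * τ := by
    rw [← Complex.cpow_nat_mul]
    simp
  have hs0 : (-I * τ) ^ (1 / 2 : ℂ) ≠ 0 := fun h0 => by
    rw [h0, zero_pow two_ne_zero] at hs
    simp [hτ0] at hs
  rw [eta_cube_S hτ] at h
  generalize (-I * τ) ^ (1 / 2 : ℂ) = s at *
  refine mul_left_cancel₀ (mul_ne_zero (mul_ne_zero (mul_ne_zero (neg_ne_zero.2 I_ne_zero) hτ0) hs0) hη) ?_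
  rw [h]
  linear_combination (-I * τ * ModularForm.eta τ ^ 3 * muADETilde Y τ z z 0) * hs +
    τ ^ 2 * ModularForm.eta τ ^ 3 * muADETilde Y τ z z 0 * I_mul_I

end ADEAppell

end

open ADEAppell
theorem mainTheorem2 (Y : ADE) :
    -- the completion and its modular transformations
    (∀ τ z : ℂ, 0 < τ.im → (∀ m n : ℤ, z ≠ m * τ + n) →
      muADETilde Y τ z z 0 = muADE Y τ z z 0 -
          1 / ModularForm.eta τ ^ 3 * (1 / (√(4 * π * Y.coxeter) : ℝ)) *
            ∑ j ∈ Finset.Icc 1 (Y.coxeter - 1), ∑ j' ∈ Finset.Icc 1 (Y.coxeter - 1),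
              Y.omegaHat j j' * unaryTheta Y.coxeter j τ * unaryThetaStar Y.coxeter j' τ ∧
      muADETilde Y τ z z 0 = muADE Y τ z z 0 -
          1 / ModularForm.eta τ ^ 3 * (1 / (√(16 * π * Y.coxeter) : ℝ)) *
            ∑ j : Fin (2 * Y.coxeter), ∑ j' : Fin (2 * Y.coxeter),
              Y.omega j j' * unaryTheta Y.coxeter j τ * unaryThetaStar Y.coxeter j' τ ∧
      muADETilde Y (τ + 1) z z 0 = exp (-(π * I / 4)) * muADETilde Y τ z z 0 ∧
      muADETilde Y (-1 / τ) (z / τ) (z / τ) 0 =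
          -((-I * τ) ^ (1 / 2 : ℂ)) * muADETilde Y τ z z 0 ∧
      ModularForm.eta (τ + 1) ^ 3 * muADETilde Y (τ + 1) z z 0 =
          ModularForm.eta τ ^ 3 * muADETilde Y τ z z 0 ∧
      ModularForm.eta (-1 / τ) ^ 3 * muADETilde Y (-1 / τ) (z / τ) (z / τ) 0 =
          τ ^ 2 * (ModularForm.eta τ ^ 3 * muADETilde Y τ z z 0)) ∧
    -- holomorphy of the uncompleted function
    DifferentiableOn ℂ (fun p : ℂ × ℂ => ModularForm.eta p.1 ^ 3 * muADE Y p.1 p.2 p.2 0)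
      {p | 0 < p.1.im ∧ ∀ m n : ℤ, p.2 ≠ m * p.1 + n} ∧
    -- the shadow
    (∀ τ z : ℂ, 0 < τ.im → (∀ m n : ℤ, z ≠ m * τ + n) →
      DifferentiableAt ℝ (fun t => ModularForm.eta t ^ 3 * muADETilde Y t z z 0) τ ∧
      (√(4 * π * τ.im) : ℝ) *
          dbar (fun t => ModularForm.eta t ^ 3 * muADETilde Y t z z 0) τ =
        -2 * π * I * (-(1 / (√(16 * π * Y.coxeter) : ℝ)) *
          ∑ r : Fin (2 * Y.coxeter), ∑ r' : Fin (2 * Y.coxeter),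
            Y.omega r r' * unaryTheta Y.coxeter r τ * conj (unaryTheta Y.coxeter r' τ))) ∧
    -- at torsion points, a mixed mock modular form of weight two with that shadow
    (∀ (N : ℕ) (a b : ℤ), 0 < N → ¬((N : ℤ) ∣ a ∧ (N : ℤ) ∣ b) →
      IsMixedMockModularForm (CongruenceSubgroup.Gamma N) 2 (3 / 2)
        (fun τ => ModularForm.eta τ ^ 3 *
          muADE Y τ ((a * τ + b) / N) ((a * τ + b) / N) 0)
        (fun (r : Fin (2 * Y.coxeter)) τ => unaryTheta Y.coxeter r τ)
        (fun (r : Fin (2 * Y.coxeter)) τ => -(1 / (√(16 * π * Y.coxeter) : ℝ)) *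
          ∑ r' : Fin (2 * Y.coxeter), Y.omega r r' * unaryTheta Y.coxeter r' τ)) := by
  refine ⟨fun τ z hτ hz => ⟨muADETilde_eq Y hτ z, muADETilde_eq' Y hτ z, muADETilde_T Y hτ hz, muADETilde_S Y hτ hz,
    eta_cube_mul_muADETilde_T Y hτ hz, eta_cube_mul_muADETilde_S Y hτ hz⟩,
    differentiableOn_eta_cube_mul_muADE Y, fun τ z hτ hz => dbar_eta_cube_mul_muADETilde Y hτ hz,
    fun N a b hN hab => isMixedMockModularForm_eta_cube_mul_muADE Y hN hab⟩
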